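/- Let $n\ge 1$ and let $A\colon\mathbb{R}^n\to\mathbb{C}^{(1+n)\times(1+n)}$ be measurable, essentially bounded and strongly elliptic: there is $\lambda>0$ with $\operatorname{Re}\langle A(x)\xi,\xi\rangle\ge\lambda|\xi|^2$ for almost every $x\in\mathbb{R}^n$ and all $\xi\in\mathbb{C}^{1+n}$. Write $A=\begin{bmatrix}a&b\\c&d\end{bmatrix}$ in block form according to $\mathbb{C}^{1+n}=\mathbb{C}\times\mathbb{C}^n$, and put $$B=\begin{bmatrix}1&0\\c&d\end{bmatrix}\begin{bmatrix}a&b\\0&1\end{bmatrix}^{-1},\qquad D=\begin{bmatrix}0&\operatorname{div}_x\\-\nabla_x&0\end{bmatrix}.$$ For $p\in(1,\infty)$ let $D_p$ be the operator $D$, understood in the sense of distributions, in $L^p(\mathbb{R}^n;\mathbb{C}^{1+n})$ with maximal domain, and let $(DB)_p=D_pB$. An operator $T$ in a Banach space $X$ is called bisectorial if there is $\mu\in(0,\pi/2)$ such that its spectrum is contained in $\overline{S_\mu}$, where $S_\mu=\{z\in\mathbb{C}\setminus\{0\}:|\arg z|<\mu\text{ or }|\arg(-z)|<\mu\}$, and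 for each $\nu\in(\mu,\pi/2)$ there is $C>0$ with $\|(1+zT)^{-1}\|_{X\to X}\le C$ for all $z\in\mathbb{C}\setminus\overline{S_\nu}$. Let $I(DB)\subseteq(1,\infty)$ be the maximal open interval around $2$ such that $(DB)_p$ is bisectorial in $L^p$ for all $p\in I(DB)$, that is, the union of all open intervals $J$ with $2\in J\subseteq(1,\infty)$ such that $(DB)_q$ is bisectorial in $L^q$ for every $q\in J$. Let $p_+(DB)=\sup I(DB)\in[0,\infty]$ be its upper endpoint. For $\tau\in\mathbb{R}^*=\mathbb{R}\setminus\{0\}$ let $S_\tau=[\mathrm{i}\tau,\nabla_x]^\top$, let $W^{1,2}_\tau(\mathbb{R}^n)$ be the Sobolev space $W^{1,2}(\mathbb{R}^n)$ with the norm $\|S_\tau u\|_2$, and let $W^{-1,2}_\tau(\mathbb{R}^n)$ be its space of bounded anti-linear functionals. Let $L_\tau=S_\tau^*AS_\tau\colon W^{1,2}_\tau\to W^{-1,2}_\tau$ be the isomorphism given by $\langle L_\tau u,v\rangle=\int_{\mathbb{R}^n}AS_\tau u\cdot\overline{S_\tau v}\,dx$, and let $S_\tau^*\colon L^2(\mathbb{R}^n;\mathbb{C}^{1+n})\to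 W^{-1,2}_\tau$ be given by $\langle S_\tau^*f,v\rangle=\int_{\mathbb{R}^n}f\cdot\overline{S_\tau v}\,dx$. The operator $S_\tau L_\tau^{-1}S_\tau^*$ on $L^2(\mathbb{R}^n;\mathbb{C}^{1+n})$ is called the Hodge projector associated with $L_\tau$. The family $(S_\tau L_\tau^{-1}S_\tau^*)_{\tau\in\mathbb{R}^*}$ is called $L^p$-bounded if there is $C>0$ such that $\|S_\tau L_\tau^{-1}S_\tau^*f\|_p\le C\|f\|_p$ for all $\tau\in\mathbb{R}^*$ and all $f\in L^p\cap L^2$. Then for every $p\in(1,\infty)$ the following are equivalent: (i) $p\in I(DB)$; (ii) $(S_\tau L_\tau^{-1}S_\tau^*)_{\tau\in\mathbb{R}^*}$ is $L^p$-bounded. In particular, the set of all $p\in(1,\infty)$ for which (ii) holds is an open interval $(p_-,p_+(DB))$ with upper endpoint $p_+(DB)$, and $1\le p_-<2<p_+(DB)$. -/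

import Mathlib

open MeasureTheory
open scoped ENNReal NNReal ContDiff

noncomputable section

namespace DiracElliptic

/-- Euclidean space `ℝⁿ`. -/
abbrev Rn (n : ℕ) := EuclideanSpace ℝ (Fin n)

/-- The fibre `ℂ^{1+n}`. The coordinate `0` is the perpendicular (`t`-) coordinate, the
coordinates `i.succ` with `i : Fin n` are the parallel (`x`-) coordinates. -/
abbrev Cn1 (n : ℕ) := EuclideanSpace ℂ (Fin (n + 1))

/-- `L^p(ℝⁿ; ℂ)`. -/
abbrev LpS (n : ℕ) (p : ℝ≥0∞) := Lp ℂ p (volume : Measure (Rn n))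

/-- `L^p(ℝⁿ; ℂ^{1+n})`. -/
abbrev LpV (n : ℕ) (p : ℝ≥0∞) := Lp (Cn1 n) p (volume : Measure (Rn n))

/-! ### Distributional derivatives -/

/-- Smooth compactly supported test functions. Real-valued ones suffice to test complex-valued
locally integrable functions. -/
structure IsTest {n : ℕ} (φ : Rn n → ℝ) : Prop where
  smooth : ContDiff ℝ ∞ φ
  compact : HasCompactSupport φ

/-- The classical partial derivative `∂_i φ`. -/
def partialD {n : ℕ} (i : Fin n) (φ : Rn n → ℝ) (x : Rn n) : ℝ :=
  fderiv ℝ φ x (EuclideanSpace.single i 1)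

/-- `div F = g` in the sense of distributions, for locally integrable `F` and `g`. -/
structure HasWeakDiv {n : ℕ} (F : Fin n → Rn n → ℂ) (g : Rn n → ℂ) : Prop where
  locInt : ∀ i, LocallyIntegrable (F i) volume
  locInt' : LocallyIntegrable g volume
  eq : ∀ φ : Rn n → ℝ, IsTest φ →
    ∑ i, ∫ x, partialD i φ x • F i x = - ∫ x, φ x • g x

/-- `∂_i u = g` in the sense of distributions, for locally integrable `u` and `g`. -/
structure HasWeakPartial {n : ℕ} (i : Fin n) (u g : Rn n → ℂ) : Prop where
  locInt : LocallyIntegrable u volume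
  locInt' : LocallyIntegrable g volume
  eq : ∀ φ : Rn n → ℝ, IsTest φ →
    ∫ x, partialD i φ x • u x = - ∫ x, φ x • g x

section weak

variable {n : ℕ}

theorem IsTest.integrable {φ : Rn n → ℝ} (hφ : IsTest φ) {u : Rn n → ℂ}
    (hu : LocallyIntegrable u volume) : Integrable (fun x => φ x • u x) volume :=
  hu.integrable_smul_left_of_hasCompactSupport hφ.smooth.continuous hφ.compact

theorem IsTest.integrable_partialD {φ : Rn n → ℝ} (hφ : IsTest φ) (i : Fin n) {u : Rn n → ℂ}
    (hu : LocallyIntegrable u volume) : Integrable (fun x => partialD i φ x • u x) volume := by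
  refine hu.integrable_smul_left_of_hasCompactSupport ?_ ?_
  · have h := hφ.smooth.continuous_fderiv (by simp)
    exact h.clm_apply continuous_const
  · exact hφ.compact.fderiv_apply (𝕜 := ℝ) _

theorem HasWeakDiv.add {F F' : Fin n → Rn n → ℂ} {g g' : Rn n → ℂ} (h : HasWeakDiv F g)
    (h' : HasWeakDiv F' g') : HasWeakDiv (fun i => F i + F' i) (g + g') := by
  refine ⟨fun i => (h.locInt i).add (h'.locInt i), h.locInt'.add h'.locInt', fun φ hφ => ?_⟩
  have e1 : ∀ i, ∫ x, partialD i φ x • (F i + F' i) x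
      = (∫ x, partialD i φ x • F i x) + ∫ x, partialD i φ x • F' i x := fun i => by
    rw [← integral_add (hφ.integrable_partialD i (h.locInt i))
      (hφ.integrable_partialD i (h'.locInt i))]
    simp
  have e2 : ∫ x, φ x • (g + g') x = (∫ x, φ x • g x) + ∫ x, φ x • g' x := by
    rw [← integral_add (hφ.integrable h.locInt') (hφ.integrable h'.locInt')]
    simp
  simp only [e1, e2, Finset.sum_add_distrib, h.eq φ hφ, h'.eq φ hφ]
  ring

theorem HasWeakDiv.smul {F : Fin n → Rn n → ℂ} {g : Rn n → ℂ} (c : ℂ) (h : HasWeakDiv F g) :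
    HasWeakDiv (fun i => c • F i) (c • g) := by
  refine ⟨fun i => (h.locInt i).smul c, h.locInt'.smul c, fun φ hφ => ?_⟩
  have e : ∀ (a : Rn n → ℝ) (u : Rn n → ℂ), ∫ x, a x • (c • u) x = c * ∫ x, a x • u x := by
    intro a u
    rw [← integral_const_mul]
    congr 1
    ext x
    simp only [Pi.smul_apply, smul_eq_mul, Complex.real_smul]
    ring
  simp only [e, ← Finset.mul_sum, h.eq φ hφ]
  ring

theorem HasWeakDiv.congr {F F' : Fin n → Rn n → ℂ} {g g' : Rn n → ℂ} (h : HasWeakDiv F g)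
    (hF : ∀ i, F i =ᵐ[volume] F' i) (hg : g =ᵐ[volume] g') : HasWeakDiv F' g' := by
  refine ⟨fun i => (h.locInt i).congr (hF i), h.locInt'.congr hg, fun φ hφ => ?_⟩
  have e1 : ∀ i, ∫ x, partialD i φ x • F' i x = ∫ x, partialD i φ x • F i x := fun i =>
    integral_congr_ae (by filter_upwards [hF i] with x hx; rw [hx])
  have e2 : ∫ x, φ x • g' x = ∫ x, φ x • g x :=
    integral_congr_ae (by filter_upwards [hg] with x hx; rw [hx])
  simp only [e1, e2, h.eq φ hφ]

theorem HasWeakDiv.eq_zero {F : Fin n → Rn n → ℂ} {g : Rn n → ℂ} (h : HasWeakDiv F g)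
    (hF : ∀ i, F i =ᵐ[volume] 0) : g =ᵐ[volume] 0 := by
  refine ae_eq_zero_of_integral_contDiff_smul_eq_zero h.locInt' fun φ h1 h2 => ?_
  have h3 := (h.congr hF .rfl).eq φ ⟨h1, h2⟩
  simpa using h3

theorem hasWeakPartial_iff {i : Fin n} {u g : Rn n → ℂ} :
    HasWeakPartial i u g ↔ HasWeakDiv (Pi.single i u) g := by
  have key : ∀ φ : Rn n → ℝ, ∑ j, ∫ x, partialD j φ x • (Pi.single i u : Fin n → Rn n → ℂ) j x
      = ∫ x, partialD i φ x • u x := by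
    intro φ
    rw [Finset.sum_eq_single i]
    · simp
    · intro j _ hj
      simp [Pi.single_eq_of_ne hj]
    · simp
  constructor
  · intro h
    refine ⟨fun j => ?_, h.locInt', fun φ hφ => by rw [key, h.eq φ hφ]⟩
    by_cases hj : j = i
    · subst hj; simpa using h.locInt
    · rw [Pi.single_eq_of_ne hj]; exact locallyIntegrable_zero
  · intro h
    exact ⟨by simpa using h.locInt i, h.locInt', fun φ hφ => by rw [← key, h.eq φ hφ]⟩

theorem HasWeakPartial.add {i : Fin n} {u u' g g' : Rn n → ℂ} (h : HasWeakPartial i u g)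
    (h' : HasWeakPartial i u' g') : HasWeakPartial i (u + u') (g + g') := by
  rw [hasWeakPartial_iff] at *
  convert h.add h' using 1
  rw [Pi.single_add]
  rfl

theorem HasWeakPartial.smul {i : Fin n} {u g : Rn n → ℂ} (c : ℂ) (h : HasWeakPartial i u g) :
    HasWeakPartial i (c • u) (c • g) := by
  rw [hasWeakPartial_iff] at *
  convert h.smul c using 1
  rw [Pi.single_smul]
  rfl

theorem HasWeakPartial.congr {i : Fin n} {u u' g g' : Rn n → ℂ} (h : HasWeakPartial i u g)
    (hu : u =ᵐ[volume] u') (hg : g =ᵐ[volume] g') : HasWeakPartial i u' g' := by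
  rw [hasWeakPartial_iff] at *
  refine h.congr (fun j => ?_) hg
  by_cases hj : j = i
  · subst hj; simpa using hu
  · simp [Pi.single_eq_of_ne hj]

theorem HasWeakPartial.eq_zero {i : Fin n} {u g : Rn n → ℂ} (h : HasWeakPartial i u g)
    (hu : u =ᵐ[volume] 0) : g =ᵐ[volume] 0 := by
  have h' := hasWeakPartial_iff.1 (h.congr hu .rfl)
  exact h'.eq_zero (fun j => by simp)

theorem hasWeakDiv_zero : HasWeakDiv (0 : Fin n → Rn n → ℂ) 0 :=
  ⟨fun _ => locallyIntegrable_zero, locallyIntegrable_zero, by simp⟩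

theorem hasWeakPartial_zero (i : Fin n) : HasWeakPartial i (0 : Rn n → ℂ) 0 :=
  ⟨locallyIntegrable_zero, locallyIntegrable_zero, by simp⟩

theorem LpV_ext {p : ℝ≥0∞} {u v : LpV n p}
    (h : ∀ j, (fun x => u x j) =ᵐ[volume] fun x => v x j) : u = v := by
  refine Lp.ext ?_
  filter_upwards [ae_all_iff.2 h] with x hx
  ext j
  exact hx j

theorem LpV_zero_coord {p : ℝ≥0∞} (j : Fin (n + 1)) :
    (fun x => (0 : LpV n p) x j) =ᵐ[volume] 0 := by
  filter_upwards [Lp.coeFn_zero (Cn1 n) p (volume : Measure (Rn n))] with x hx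
  rw [hx]
  rfl

theorem LpV_add_coord {p : ℝ≥0∞} (u v : LpV n p) (j : Fin (n + 1)) :
    (fun x => (u + v) x j) =ᵐ[volume] (fun x => u x j) + fun x => v x j := by
  filter_upwards [Lp.coeFn_add u v] with x hx
  rw [hx]
  rfl

theorem LpV_smul_coord {p : ℝ≥0∞} (c : ℂ) (u : LpV n p) (j : Fin (n + 1)) :
    (fun x => (c • u) x j) =ᵐ[volume] c • fun x => u x j := by
  filter_upwards [Lp.coeFn_smul c u] with x hx
  rw [hx]
  rfl

end weak

/-! ### The Dirac operator -/

/-- The graph of the Dirac operator `D = [[0, div], [-∇, 0]]` in `L^p(ℝⁿ; ℂ^{1+n})` with maximal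
domain: the pairs `(u, g)` of `L^p`-functions with `div u_∥ = g_⊥` and `-∇ u_⊥ = g_∥` in the sense
of distributions. -/
def diracGraph (n : ℕ) (p : ℝ≥0∞) : Submodule ℂ (LpV n p × LpV n p) where
  carrier := {w | HasWeakDiv (fun i x => w.1 x i.succ) (fun x => w.2 x 0) ∧
    ∀ i : Fin n, HasWeakPartial i (-fun x => w.1 x 0) (fun x => w.2 x i.succ)}
  zero_mem' := by
    refine ⟨hasWeakDiv_zero.congr (fun i => (LpV_zero_coord _).symm) (LpV_zero_coord _).symm,
      fun i => (hasWeakPartial_zero i).congr ?_ (LpV_zero_coord _).symm⟩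
    simpa using (LpV_zero_coord (n := n) (p := p) 0).symm.neg
  add_mem' := by
    rintro w w' ⟨h1, h2⟩ ⟨h1', h2'⟩
    refine ⟨(h1.add h1').congr (fun i => (LpV_add_coord _ _ _).symm) (LpV_add_coord _ _ _).symm,
      fun i => ((h2 i).add (h2' i)).congr ?_ (LpV_add_coord _ _ _).symm⟩
    rw [← neg_add]
    exact (LpV_add_coord _ _ _).symm.neg
  smul_mem' := by
    rintro c w ⟨h1, h2⟩
    refine ⟨(h1.smul c).congr (fun i => (LpV_smul_coord _ _ _).symm) (LpV_smul_coord _ _ _).symm,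
      fun i => ((h2 i).smul c).congr ?_ (LpV_smul_coord _ _ _).symm⟩
    rw [smul_neg]
    exact (LpV_smul_coord _ _ _).symm.neg

theorem diracGraph_single_valued (n : ℕ) (p : ℝ≥0∞) (w : LpV n p × LpV n p)
    (hw : w ∈ diracGraph n p) (h0 : w.1 = 0) : w.2 = 0 := by
  obtain ⟨h1, h2⟩ := hw
  refine LpV_ext fun j => Filter.EventuallyEq.trans ?_ (LpV_zero_coord j).symm
  refine Fin.cases ?_ (fun i => ?_) j
  · exact h1.eq_zero fun i => by rw [h0]; exact LpV_zero_coord _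
  · exact (h2 i).eq_zero (by rw [h0]; simpa using (LpV_zero_coord (n := n) (p := p) 0).neg)

/-- The Dirac operator `D_p` in `L^p(ℝⁿ; ℂ^{1+n})`, with maximal domain. -/
def dirac (n : ℕ) (p : ℝ≥0∞) : LpV n p →ₗ.[ℂ] LpV n p := (diracGraph n p).toLinearPMap

theorem mem_graph_dirac {n : ℕ} {p : ℝ≥0∞} {w : LpV n p × LpV n p} :
    w ∈ (dirac n p).graph ↔ w ∈ diracGraph n p := by
  rw [dirac, Submodule.toLinearPMap_graph_eq _ (diracGraph_single_valued n p)]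

/-! ### Coefficients -/

/-- Matrix-valued coefficients on `ℝⁿ`; in block form `A = [[a, b], [c, d]]`, where `a` is the
entry with index `(0, 0)`. -/
abbrev Coeff (n : ℕ) := Rn n → Matrix (Fin (n + 1)) (Fin (n + 1)) ℂ

/-- The action of a matrix on `ℂ^{1+n}`. -/
abbrev act {n : ℕ} (M : Matrix (Fin (n + 1)) (Fin (n + 1)) ℂ) (ξ : Cn1 n) : Cn1 n :=
  Matrix.toEuclideanCLM (𝕜 := ℂ) M ξ

/-- The matrix `[[1, 0], [c, d]]`. -/
def lowerPart {n : ℕ} (M : Matrix (Fin (n + 1)) (Fin (n + 1)) ℂ) :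
    Matrix (Fin (n + 1)) (Fin (n + 1)) ℂ :=
  Matrix.of fun i j => if i = 0 then (if j = 0 then 1 else 0) else M i j

/-- The matrix `[[a, b], [0, 1]]`. -/
def upperPart {n : ℕ} (M : Matrix (Fin (n + 1)) (Fin (n + 1)) ℂ) :
    Matrix (Fin (n + 1)) (Fin (n + 1)) ℂ :=
  Matrix.of fun i j => if i = 0 then M i j else (if i = j then 1 else 0)

/-- `B = [[1, 0], [c, d]] [[a, b], [0, 1]]⁻¹`. The inverse exists wherever `a ≠ 0`, hence almost
everywhere for strongly elliptic coefficients. -/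
def coeffB {n : ℕ} (A : Coeff n) : Coeff n := fun x => lowerPart (A x) * (upperPart (A x))⁻¹

/-- The graph of `(DB)_p = D_p B`: the pairs `(u, g)` for which `B u` lies in the domain of `D_p`
and `D_p (B u) = g`. -/
def diracBGraph {n : ℕ} (A : Coeff n) (p : ℝ≥0∞) : Submodule ℂ (LpV n p × LpV n p) where
  carrier := {w | ∃ v : LpV n p, (v =ᵐ[volume] fun x => act (coeffB A x) (w.1 x)) ∧
    (v, w.2) ∈ (dirac n p).graph}
  zero_mem' := by
    refine ⟨0, ?_, (dirac n p).graph.zero_mem⟩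
    filter_upwards with x
    simp
  add_mem' := by
    rintro w w' ⟨v, h1, h2⟩ ⟨v', h1', h2'⟩
    refine ⟨v + v', ?_, (dirac n p).graph.add_mem h2 h2'⟩
    filter_upwards [h1, h1', Lp.coeFn_add v v', Lp.coeFn_add w.1 w'.1] with x e1 e2 e3 e4
    simp only [Prod.fst_add, e3, e4, Pi.add_apply, e1, e2, map_add]
  smul_mem' := by
    rintro c w ⟨v, h1, h2⟩
    refine ⟨c • v, ?_, (dirac n p).graph.smul_mem c h2⟩
    filter_upwards [h1, Lp.coeFn_smul c v, Lp.coeFn_smul c w.1] with x e1 e2 e3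
    simp only [Prod.smul_fst, e2, e3, Pi.smul_apply, e1, map_smul]

theorem diracBGraph_single_valued {n : ℕ} (A : Coeff n) (p : ℝ≥0∞) (w : LpV n p × LpV n p)
    (hw : w ∈ diracBGraph A p) (h0 : w.1 = 0) : w.2 = 0 := by
  obtain ⟨v, h1, h2⟩ := hw
  refine (dirac n p).graph_fst_eq_zero_snd h2 (Lp.ext ?_)
  rw [h0] at h1
  filter_upwards [h1] with x e1
  simp [e1]

/-- The perturbed Dirac operator `(DB)_p = D_p B` in `L^p(ℝⁿ; ℂ^{1+n})`. -/
def diracB {n : ℕ} (A : Coeff n) (p : ℝ≥0∞) : LpV n p →ₗ.[ℂ] LpV n p :=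
  (diracBGraph A p).toLinearPMap

theorem mem_graph_diracB {n : ℕ} {A : Coeff n} {p : ℝ≥0∞} {w : LpV n p × LpV n p} :
    w ∈ (diracB A p).graph ↔ w ∈ diracBGraph A p := by
  rw [diracB, Submodule.toLinearPMap_graph_eq _ (diracBGraph_single_valued A p)]

/-! ### Bisectorial operators -/

section bisectorial

variable {X : Type*} [NormedAddCommGroup X] [NormedSpace ℂ X]

/-- The bounded operator `R` is the two-sided inverse of `a + b T : dom T → X`. -/
def IsInverseOf (T : X →ₗ.[ℂ] X) (a b : ℂ) (R : X →L[ℂ] X) : Prop :=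
  (∀ f : X, ∃ u : T.domain, (u : X) = R f ∧ a • (u : X) + b • T u = f) ∧
    ∀ u : T.domain, R (a • (u : X) + b • T u) = u

/-- The spectrum of an unbounded operator `T`: all `z` such that `z - T` has no bounded inverse. -/
def spec (T : X →ₗ.[ℂ] X) : Set ℂ := {z | ¬ ∃ R : X →L[ℂ] X, IsInverseOf T z (-1) R}

/-- The open bisector of half-angle `μ` around the real axis. -/
def bisector (μ : ℝ) : Set ℂ := {z | z ≠ 0 ∧ (|z.arg| < μ ∨ |(-z).arg| < μ)}

/-- Bisectoriality: for some `μ ∈ (0, π/2)` the spectrum lies in the closed bisector of angle `μ`,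
and `(1 + z T)⁻¹` is uniformly bounded outside every larger closed bisector. -/
def IsBisectorial (T : X →ₗ.[ℂ] X) : Prop :=
  ∃ μ ∈ Set.Ioo 0 (Real.pi / 2), spec T ⊆ closure (bisector μ) ∧
    ∀ ν ∈ Set.Ioo μ (Real.pi / 2), ∃ C : ℝ, ∀ z ∉ closure (bisector ν),
      ∃ R : X →L[ℂ] X, IsInverseOf T 1 z R ∧ ‖R‖ ≤ C

end bisectorial

/-- The maximal open interval `I(DB) ⊆ (1, ∞)` around `2` such that `(DB)_p` is bisectorial in
`L^p` for all `p ∈ I(DB)`, that is, the union of all open intervals with these properties. -/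
def intervalDB {n : ℕ} (A : Coeff n) : Set ℝ≥0∞ :=
  {p | ∃ a b : ℝ≥0∞, 1 ≤ a ∧ 2 ∈ Set.Ioo a b ∧ p ∈ Set.Ioo a b ∧
    ∀ q ∈ Set.Ioo a b, ∀ _ : Fact (1 ≤ q), IsBisectorial (diracB A q)}

/-- The upper endpoint `p_+(DB) ∈ [0, ∞]` of `I(DB)`. -/
def pPlus {n : ℕ} (A : Coeff n) : ℝ≥0∞ := sSup (intervalDB A)

/-! ### The inhomogeneous gradients `S_τ` and the Hodge projectors -/

/-- The graph of `S_τ = [iτ, ∇]ᵀ` on the Sobolev space `W^{1,2}(ℝⁿ)`: the pairs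
`(u, F) ∈ L² × L²` with `F_⊥ = iτ u`, and `F_∥ = ∇ u` in the sense of distributions. -/
def gradGraph (n : ℕ) (τ : ℝ) : Submodule ℂ (LpS n 2 × LpV n 2) where
  carrier := {w | ((fun x => w.2 x 0) =ᵐ[volume] fun x => Complex.I * τ * w.1 x) ∧
    ∀ i : Fin n, HasWeakPartial i w.1 (fun x => w.2 x i.succ)}
  zero_mem' := by
    have h := Lp.coeFn_zero ℂ 2 (volume : Measure (Rn n))
    refine ⟨?_, fun i => (hasWeakPartial_zero i).congr h.symm (LpV_zero_coord _).symm⟩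
    filter_upwards [LpV_zero_coord (n := n) (p := 2) 0] with x e2
    exact e2.trans (by simp)
  add_mem' := by
    rintro w w' ⟨h1, h2⟩ ⟨h1', h2'⟩
    refine ⟨?_, fun i => ((h2 i).add (h2' i)).congr (Lp.coeFn_add _ _).symm
      (LpV_add_coord _ _ _).symm⟩
    filter_upwards [h1, h1', Lp.coeFn_add w.1 w'.1, LpV_add_coord w.2 w'.2 0] with x e1 e2 e3 e4
    refine e4.trans ?_
    simp only [Pi.add_apply, Prod.fst_add, e1, e2, e3]
    ring
  smul_mem' := by
    rintro c w ⟨h1, h2⟩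
    refine ⟨?_, fun i => ((h2 i).smul c).congr (Lp.coeFn_smul _ _).symm
      (LpV_smul_coord _ _ _).symm⟩
    filter_upwards [h1, Lp.coeFn_smul c w.1, LpV_smul_coord c w.2 0] with x e1 e2 e3
    refine e3.trans ?_
    simp only [Pi.smul_apply, Prod.smul_fst, e1, e2, smul_eq_mul]
    ring

theorem gradGraph_single_valued (n : ℕ) (τ : ℝ) (w : LpS n 2 × LpV n 2)
    (hw : w ∈ gradGraph n τ) (h0 : w.1 = 0) : w.2 = 0 := by
  obtain ⟨h1, h2⟩ := hw
  have h := Lp.coeFn_zero ℂ 2 (volume : Measure (Rn n))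
  rw [h0] at h1 h2
  refine LpV_ext fun j => Filter.EventuallyEq.trans ?_ (LpV_zero_coord j).symm
  refine Fin.cases ?_ (fun i => ?_) j
  · filter_upwards [h1] with x e1
    exact e1.trans (by simp)
  · exact (h2 i).eq_zero h

/-- The operator `S_τ`, whose domain is the Sobolev space `W^{1,2}(ℝⁿ) ⊆ L²(ℝⁿ)`. -/
def grad (n : ℕ) (τ : ℝ) : LpS n 2 →ₗ.[ℂ] LpV n 2 := (gradGraph n τ).toLinearPMap

theorem mem_graph_grad {n : ℕ} {τ : ℝ} {w : LpS n 2 × LpV n 2} :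
    w ∈ (grad n τ).graph ↔ w ∈ gradGraph n τ := by
  rw [grad, Submodule.toLinearPMap_graph_eq _ (gradGraph_single_valued n τ)]

/-- For `τ ≠ 0`, the space `W^{1,2}_τ(ℝⁿ)` with norm `‖S_τ u‖₂`: the Sobolev space
`W^{1,2}(ℝⁿ)`. -/
abbrev W12 (n : ℕ) (τ : ℝ) := (grad n τ).domain

/-- `L_τ = S_τ^* A S_τ` in its weak form: `L_τ u` is the anti-linear functional
`v ↦ ∫ A S_τ u · conj (S_τ v)` on `W^{1,2}_τ`. -/
def opL {n : ℕ} (A : Coeff n) (τ : ℝ) (u : W12 n τ) : W12 n τ → ℂ :=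
  fun v => ∫ x, inner ℂ (grad n τ v x) (act (A x) (grad n τ u x))

/-- The adjoint of `S_τ`: for `f ∈ L²`, `S_τ^* f` is the anti-linear functional
`v ↦ ∫ f · conj (S_τ v)` on `W^{1,2}_τ`. -/
def gradStar {n : ℕ} (τ : ℝ) (f : LpV n 2) : W12 n τ → ℂ :=
  fun v => ∫ x, inner ℂ (grad n τ v x) (f x)

/-- Essentially bounded measurable coefficients. -/
structure IsBoundedCoeff {n : ℕ} (A : Coeff n) : Prop where
  aesm : ∀ i j, AEStronglyMeasurable (fun x => A x i j) (volume : Measure (Rn n))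
  bdd : ∃ Λ : ℝ, ∀ᵐ x : Rn n, ∀ i j, ‖A x i j‖ ≤ Λ

/-- Strong ellipticity: `Re ⟨A(x) ξ, ξ⟩ ≥ lam |ξ|²` for almost every `x` and all `ξ ∈ ℂ^{1+n}`,
with some `lam > 0`. -/
def IsStronglyElliptic {n : ℕ} (A : Coeff n) : Prop :=
  ∃ lam : ℝ, 0 < lam ∧ ∀ᵐ x : Rn n, ∀ ξ : Cn1 n,
    lam * ‖ξ‖ ^ 2 ≤ (inner ℂ ξ (act (A x) ξ)).re

/-! ### Well-posedness of `L_τ u = S_τ^* f` -/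

section wellposed

variable {n : ℕ}

theorem LpV_memLp_coord {p : ℝ≥0∞} (F : LpV n p) (j : Fin (n + 1)) :
    MemLp (fun x => F x j) p (volume : Measure (Rn n)) :=
  (EuclideanSpace.proj j : Cn1 n →L[ℂ] ℂ).comp_memLp' (Lp.memLp F)

theorem LpV_locInt (F : LpV n 2) (j : Fin (n + 1)) :
    LocallyIntegrable (fun x => F x j) volume :=
  (LpV_memLp_coord F j).locallyIntegrable (by norm_num)

theorem continuous_pairing {ψ : Rn n → ℝ} (h1 : Continuous ψ) (h2 : HasCompactSupport ψ)
    (j : Fin (n + 1)) : Continuous fun F : LpV n 2 => ∫ x, ψ x • F x j := by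
  have hm : MemLp (fun x => (EuclideanSpace.single j (ψ x : ℂ) : Cn1 n)) 2 volume := by
    refine Continuous.memLp_of_hasCompactSupport ?_ ?_
    · refine (PiLp.continuous_toLp 2 _).comp ((continuous_single j).comp ?_)
      exact Complex.continuous_ofReal.comp h1
    · exact h2.comp_left (g := fun r : ℝ => (EuclideanSpace.single j (r : ℂ) : Cn1 n)) (by simp)
  have e : (fun F : LpV n 2 => ∫ x, ψ x • F x j) = fun F => inner ℂ (hm.toLp _) F := by
    ext F
    rw [L2.inner_def]
    refine integral_congr_ae ?_
    filter_upwards [hm.coeFn_toLp] with x hx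
    rw [hx, EuclideanSpace.inner_single_left]
    simp
  rw [e]
  exact continuous_const.inner continuous_id

/-- The range of `S_τ` in `L²`. -/
def gradRange (n : ℕ) (τ : ℝ) : Submodule ℂ (LpV n 2) :=
  (gradGraph n τ).map (LinearMap.snd ℂ _ _)

theorem grad_mem_gradRange {τ : ℝ} (u : W12 n τ) : grad n τ u ∈ gradRange n τ :=
  ⟨((u : LpS n 2), grad n τ u), mem_graph_grad.1 ((grad n τ).mem_graph u), rfl⟩

theorem exists_grad_eq {τ : ℝ} {F : LpV n 2} (hF : F ∈ gradRange n τ) :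
    ∃ u : W12 n τ, grad n τ u = F := by
  obtain ⟨⟨u, F'⟩, h, rfl⟩ := hF
  obtain ⟨y, -, h2⟩ := (LinearPMap.mem_graph_iff _).1 (mem_graph_grad.2 h)
  exact ⟨y, h2⟩

theorem grad_injective {τ : ℝ} (hτ : τ ≠ 0) : Function.Injective (grad n τ) := by
  intro u v huv
  have hu := (mem_graph_grad.1 ((grad n τ).mem_graph u)).1
  have hv := (mem_graph_grad.1 ((grad n τ).mem_graph v)).1
  refine Subtype.ext (Lp.ext ?_)
  rw [← huv] at hv
  have hI : Complex.I * (τ : ℂ) ≠ 0 := mul_ne_zero Complex.I_ne_zero (by exact_mod_cast hτ)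
  filter_upwards [hu, hv] with x e1 e2
  exact mul_left_cancel₀ hI (e1.symm.trans e2)

theorem isClosed_gradRange {τ : ℝ} (hτ : τ ≠ 0) : IsClosed (gradRange n τ : Set (LpV n 2)) := by
  have hI : Complex.I * (τ : ℂ) ≠ 0 := mul_ne_zero Complex.I_ne_zero (by exact_mod_cast hτ)
  have key : (gradRange n τ : Set (LpV n 2)) = {F | ∀ (i : Fin n) (φ : Rn n → ℝ), IsTest φ →
      (∫ x, partialD i φ x • F x 0) = -(Complex.I * τ * ∫ x, φ x • F x i.succ)} := by
    ext F
    constructor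
    · rintro ⟨⟨u, F'⟩, ⟨h1, h2⟩, rfl⟩ i φ hφ
      have h3 := (h2 i).eq φ hφ
      simp only at h1 h3
      calc (∫ x, partialD i φ x • F' x 0)
          = ∫ x, (Complex.I * τ) * (partialD i φ x • u x) := by
            refine integral_congr_ae ?_
            filter_upwards [h1] with x hx
            rw [hx]
            simp only [Complex.real_smul]
            ring
        _ = _ := by
            rw [integral_const_mul, h3]
            simp
    · intro h
      have hm : MemLp (fun x => (Complex.I * τ)⁻¹ * F x 0) 2 (volume : Measure (Rn n)) :=
        (LpV_memLp_coord F 0).const_mul _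
      refine ⟨(hm.toLp _, F), ⟨?_, fun i => ?_⟩, rfl⟩
      · filter_upwards [hm.coeFn_toLp] with x hx
        simp only [hx]
        rw [mul_inv_cancel_left₀ hI]
      · have hw : HasWeakPartial i (fun x => (Complex.I * τ)⁻¹ * F x 0) (fun x => F x i.succ) := by
          refine ⟨hm.locallyIntegrable (by norm_num), LpV_locInt F _, fun φ hφ => ?_⟩
          have e : ∀ x, partialD i φ x • ((Complex.I * (τ : ℂ))⁻¹ * F x 0)
              = (Complex.I * (τ : ℂ))⁻¹ * (partialD i φ x • F x 0) := fun x => by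
            simp only [Complex.real_smul]
            ring
          simp only [e]
          rw [integral_const_mul, h i φ hφ]
          rw [mul_neg, inv_mul_cancel_left₀ hI]
        exact hw.congr hm.coeFn_toLp.symm .rfl
  rw [key]
  simp only [Set.ofPred_forall]
  refine isClosed_iInter fun i => isClosed_iInter fun φ => isClosed_iInter fun hφ => ?_
  refine isClosed_eq (continuous_pairing ?_ ?_ 0)
    (continuous_const.mul (continuous_pairing hφ.smooth.continuous hφ.compact _)).neg
  · exact (hφ.smooth.continuous_fderiv (by simp)).clm_apply continuous_const
  · exact hφ.compact.fderiv_apply (𝕜 := ℝ) _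

/-- Multiplication by bounded coefficients is a bounded operator on `L²`. -/
theorem exists_mulCLM {A : Coeff n} (hA : IsBoundedCoeff A) :
    ∃ T : LpV n 2 →L[ℂ] LpV n 2, ∀ F : LpV n 2, T F =ᵐ[volume] fun x => act (A x) (F x) := by
  obtain ⟨Λ, hΛ⟩ := hA.bdd
  have hnorm : ∀ F : LpV n 2, ∀ᵐ x : Rn n,
      ‖act (A x) (F x)‖ ≤ ((n + 1) * ((n + 1) * Λ)) * ‖F x‖ := by
    intro F
    filter_upwards [hΛ] with x hx
    have h0 : 0 ≤ Λ := (norm_nonneg _).trans (hx 0 0)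
    have hc : ∀ i, ‖act (A x) (F x) i‖ ≤ ((n + 1) * Λ) * ‖F x‖ := fun i => by
      have : act (A x) (F x) i = ∑ j, A x i j * F x j := by
        simp [Matrix.mulVec, dotProduct]
      rw [this]
      calc ‖∑ j, A x i j * F x j‖ ≤ ∑ j : Fin (n + 1), Λ * ‖F x‖ := by
            refine norm_sum_le_of_le _ fun j _ => ?_
            rw [norm_mul]
            exact mul_le_mul (hx i j) (PiLp.norm_apply_le _ j) (norm_nonneg _) h0
        _ = _ := by simp; ring
    calc ‖act (A x) (F x)‖
        = ‖∑ i, (EuclideanSpace.single i (act (A x) (F x) i) : Cn1 n)‖ := by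
          congr 1
          ext k
          simp [Finset.sum_apply, Pi.single_apply]
      _ ≤ ∑ i : Fin (n + 1), ((n + 1) * Λ) * ‖F x‖ :=
          norm_sum_le_of_le _ fun i _ => by simpa using hc i
      _ = _ := by simp; ring
  have hmeas : ∀ F : LpV n 2, AEStronglyMeasurable (fun x => act (A x) (F x))
      (volume : Measure (Rn n)) := by
    intro F
    have : (fun x => act (A x) (F x)) =
        fun x => (WithLp.toLp 2 fun i => ∑ j, A x i j * F x j : Cn1 n) := by
      ext x i
      simp [Matrix.mulVec, dotProduct]
    rw [this]
    refine (PiLp.continuous_toLp 2 _).comp_aestronglyMeasurable ?_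
    refine (aemeasurable_pi_lambda _ fun i => ?_).aestronglyMeasurable
    refine Finset.aemeasurable_fun_sum _ fun j _ => ?_
    refine (hA.aesm i j).aemeasurable.mul ?_
    exact (LpV_memLp_coord F j).1.aemeasurable
  have hmem : ∀ F : LpV n 2, MemLp (fun x => act (A x) (F x)) 2 (volume : Measure (Rn n)) :=
    fun F => MemLp.of_le_mul (Lp.memLp F) (hmeas F) (hnorm F)
  let T : LpV n 2 →ₗ[ℂ] LpV n 2 :=
    { toFun := fun F => (hmem F).toLp _
      map_add' := fun F G => by
        refine Lp.ext ?_
        filter_upwards [(hmem (F + G)).coeFn_toLp, (hmem F).coeFn_toLp, (hmem G).coeFn_toLp,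
          Lp.coeFn_add F G, Lp.coeFn_add ((hmem F).toLp _) ((hmem G).toLp _)]
          with x e1 e2 e3 e4 e5
        rw [e1, e5, e4, Pi.add_apply, Pi.add_apply, e2, e3]
        exact (Matrix.toEuclideanCLM (𝕜 := ℂ) (A x)).map_add _ _
      map_smul' := fun c F => by
        refine Lp.ext ?_
        filter_upwards [(hmem (c • F)).coeFn_toLp, (hmem F).coeFn_toLp,
          Lp.coeFn_smul c F, Lp.coeFn_smul c ((hmem F).toLp _)]
          with x e1 e2 e3 e4
        rw [RingHom.id_apply, e1, e4, e3, Pi.smul_apply, Pi.smul_apply, e2]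
        exact (Matrix.toEuclideanCLM (𝕜 := ℂ) (A x)).map_smul _ _ }
  refine ⟨T.mkContinuous ((n + 1) * ((n + 1) * Λ)) fun F => ?_, fun F => (hmem F).coeFn_toLp⟩
  refine Lp.norm_le_mul_norm_of_ae_le_mul ?_
  filter_upwards [hnorm F, (hmem F).coeFn_toLp] with x e1 e2
  have e3 : T F x = act (A x) (F x) := e2
  rw [e3]
  exact e1

/-- The Lax-Milgram lemma on a closed subspace `K` of a Hilbert space. -/
theorem lax_milgram {H : Type*} [NormedAddCommGroup H] [InnerProductSpace ℂ H] [CompleteSpace H]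
    (K : Submodule ℂ H) (hK : IsClosed (K : Set H)) (T : H →L[ℂ] H) {lam : ℝ} (hlam : 0 < lam)
    (hT : ∀ F : H, lam * ‖F‖ ^ 2 ≤ (inner ℂ F (T F)).re) (f : H) :
    ∃! F : K, ∀ G : K, inner ℂ (G : H) (T F) = inner ℂ (G : H) f := by
  have : CompleteSpace K := hK.completeSpace_coe
  let S : K →L[ℂ] K := K.orthogonalProjectionOnto ∘L T ∘L K.subtypeL
  have hS : ∀ (F : K) (G : K), inner ℂ (G : H) (T F) = inner ℂ G (S F) := fun F G =>
    (Submodule.inner_orthogonalProjectionOnto_eq_of_mem_left G (T F)).symm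
  have hf : ∀ G : K, inner ℂ (G : H) f = inner ℂ G (K.orthogonalProjectionOnto f) := fun G =>
    (Submodule.inner_orthogonalProjectionOnto_eq_of_mem_left G f).symm
  have hunit : IsUnit S := by
    refine ContinuousLinearMap.isUnit_of_forall_le_norm_inner_map S (c := ⟨lam, hlam.le⟩) hlam ?_
    intro F
    calc ‖F‖ ^ 2 * lam = lam * ‖(F : H)‖ ^ 2 := by rw [mul_comm]; rfl
      _ ≤ (inner ℂ (F : H) (T F)).re := hT _
      _ ≤ ‖inner ℂ (F : H) (T F)‖ := Complex.re_le_norm _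
      _ = ‖inner ℂ (S F) F‖ := by rw [hS, ← inner_conj_symm, RCLike.norm_conj]
  have hbij := ContinuousLinearMap.isUnit_iff_bijective.1 hunit
  have hiff : ∀ F : K, (∀ G : K, inner ℂ (G : H) (T F) = inner ℂ (G : H) f) ↔
      S F = K.orthogonalProjectionOnto f := by
    intro F
    simp only [hS, hf]
    exact ⟨fun h => ext_inner_left ℂ h, fun h G => by rw [h]⟩
  simp only [hiff]
  exact hbij.existsUnique _

theorem coercive_of_act {A : Coeff n} {lam : ℝ}
    (hE : ∀ᵐ x : Rn n, ∀ ξ : Cn1 n, lam * ‖ξ‖ ^ 2 ≤ (inner ℂ ξ (act (A x) ξ)).re)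
    {F TF : LpV n 2} (hT : TF =ᵐ[volume] fun x => act (A x) (F x)) :
    lam * ‖F‖ ^ 2 ≤ (inner ℂ F TF).re := by
  have h1 : ‖F‖ ^ 2 = ∫ x, ‖F x‖ ^ 2 := by
    rw [← inner_self_eq_norm_sq (𝕜 := ℂ) F, L2.inner_def, ← integral_re (L2.integrable_inner F F)]
    simp only [inner_self_eq_norm_sq]
  have hint : Integrable (fun x => inner ℂ (F x) (TF x)) volume := L2.integrable_inner F TF
  have h4 : (inner ℂ F TF).re = ∫ x, (inner ℂ (F x) (TF x)).re := by
    rw [L2.inner_def]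
    exact (integral_re hint).symm
  rw [h1, h4, ← integral_const_mul]
  refine integral_mono_ae ?_ hint.re ?_
  · exact ((Lp.memLp F).integrable_norm_pow (by norm_num)).const_mul lam
  · filter_upwards [hT, hE] with x e1 e2
    simp only [e1]
    exact e2 (F x)

/-- The Lax-Milgram lemma for `L_τ`: for `τ ≠ 0` and `f ∈ L²` the equation `L_τ u = S_τ^* f` has
exactly one solution `u ∈ W^{1,2}_τ`. -/
theorem existsUnique_opL_eq_gradStar {A : Coeff n} (hA : IsBoundedCoeff A)
    (hell : IsStronglyElliptic A) {τ : ℝ} (hτ : τ ≠ 0) (f : LpV n 2) :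
    ∃! u : W12 n τ, opL A τ u = gradStar τ f := by
  obtain ⟨T, hT⟩ := exists_mulCLM hA
  obtain ⟨lam, hlam, hE⟩ := hell
  have hopL : ∀ u v : W12 n τ, opL A τ u v = inner ℂ (grad n τ v) (T (grad n τ u)) := by
    intro u v
    rw [L2.inner_def]
    refine integral_congr_ae ?_
    filter_upwards [hT (grad n τ u)] with x hx
    rw [hx]
  have hstar : ∀ v : W12 n τ, gradStar τ f v = inner ℂ (grad n τ v) f := fun v => by
    rw [L2.inner_def]
    rfl
  obtain ⟨F, hF, hF'⟩ := lax_milgram (gradRange n τ) (isClosed_gradRange hτ) T hlam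
    (fun F => coercive_of_act hE (hT F)) f
  obtain ⟨u, hu⟩ := exists_grad_eq F.2
  refine ⟨u, ?_, fun v hv => ?_⟩
  · funext v
    rw [hopL, hstar, hu]
    exact hF ⟨grad n τ v, grad_mem_gradRange v⟩
  · have h1 := hF' ⟨grad n τ v, grad_mem_gradRange v⟩ fun G => by
      obtain ⟨w, hw⟩ := exists_grad_eq G.2
      have h2 := congrFun hv w
      rw [hopL, hstar, hw] at h2
      exact h2
    exact grad_injective hτ ((congrArg Subtype.val h1).trans hu.symm)

end wellposed

/-- The Hodge projector `S_τ L_τ⁻¹ S_τ^*` on `L²(ℝⁿ; ℂ^{1+n})` for `τ ≠ 0`. By the Lax-Milgram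
lemma, see `existsUnique_opL_eq_gradStar`, the functional `S_τ^* f` has exactly one preimage under
`L_τ`. -/
def hodge {n : ℕ} (A : Coeff n) (τ : ℝ) (f : LpV n 2) : LpV n 2 :=
  grad n τ (Function.invFun (opL A τ) (gradStar τ f))

/-- `L^p`-boundedness of a family `(T τ)_{τ ∈ I}` of operators on `L²`. -/
def LpBounded {n : ℕ} (I : Set ℝ) (T : ℝ → LpV n 2 → LpV n 2) (p : ℝ≥0∞) : Prop :=
  ∃ C : ℝ≥0, ∀ τ ∈ I, ∀ f : LpV n 2, MemLp f p volume →
    eLpNorm (T τ f) p volume ≤ C * eLpNorm f p volume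

end DiracElliptic

end

set_option linter.unusedSectionVars false

noncomputable section

namespace DiracElliptic

/-! ### Bounds for operators on `L²` in the `L^p` scale -/

/-! The resolvents of `DB` on the imaginary axis and the Hodge projectors are the same family in two
notations. Put `U = [[a, b], [0, 1]]` and `u = U w`. Then `u` has the components `((A w)_⊥, w_∥)`
and `B u` has the components `(w_⊥, (A w)_∥)`. With `σ = -1/τ` the equation `(1 + iτDB) u = f`
therefore says that `w - f_∥` lies in the range of `S_σ` and that `S_σ^*(A w - f_⊥) = 0`. Hence `w =
H_σ (f_⊥ - A f_∥) + f_∥`, where `H_σ` is the Hodge projector (`mem_diracBGraph_iff_res`).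
Ellipticity makes `U` and `f ↦ f_⊥ - A f_∥` boundedly invertible multiplications, so a uniform `L^p`
bound for one family is a uniform `L^p` bound for the other (`hodge_eq_res`). By a Neumann series,
bisectoriality is the same as uniform boundedness of `(1 + iτT)⁻¹` for real `τ ≠ 0`
(`isBisectorial_iff`).

Two gaps remain between the `L²`-resolvent and a resolvent in `L^p`. If the `L²`-resolvent is
`L^p`-bounded, its extension is a right inverse because the graph of `(DB)_p` is closed. It is a
left inverse because `L² ∩ L^p` contains a core of `D_p`; this rests on the case `A = 1`, where the
Hodge projector is the orthogonal projection onto the range of `S_τ` (`exists_core`,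
`left_resolvent`). Conversely, if `(DB)_p` is bisectorial, its resolvent has to agree with that of
`L²`. Conjugation with slowly growing weights shows that solutions with data of bounded support
decay polynomially, so they lie in all spaces of smaller exponent (`memLp_of_mem_diracBGraph`). The
resolvents can then be compared in the smaller of the two spaces (`resolvent_ae_eq_res`).

This gives the equivalence for each single exponent. To obtain intervals, the set of good exponents
must be connected and open. It is connected by the Riesz–Thorin theorem (`FormBdd.interpolate`). For
openness, `H_τ f` is the solution `w` of `T w = P f`, where `P` is the orthogonal projection onto
the range of `S_τ` and `T = P A + (1 - P)`. The operator `T` is bounded on all `L^p`, and a lower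
bound of `T` at one exponent persists nearby by the Schwarz lemma applied to the analytic families
of interpolation (`exists_lowerBound_nearby`). The resulting a priori estimate becomes a bound as
soon as `H_τ f ∈ L^q` is known for enough `f`, and decay provides this for smaller exponents.
Duality with `A^*` yields the larger ones (`isOpen_hodgeSet`).

The bounds of `P` have to be uniform in `τ`. The symbol of `P` is `ζζᵀ/|ζ|²` with `ζ = (τ, -2πξ)`,
and `ζ_j/|ζ|` is an average of signs of affine functions of `ξ`. The corresponding directional
Hilbert transforms are bounded by Cotlar's identity, with constants that depend neither on the
direction nor on the shift (`hilb_opBdd`, `riesz_formBdd`). -/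

/-- The Lebesgue exponent `1 / r`. -/
def ex (r : ℝ) : ℝ≥0∞ := ENNReal.ofReal r⁻¹

theorem ex_ne_top (r : ℝ) : ex r ≠ ⊤ := ENNReal.ofReal_ne_top

theorem ex_ne_zero {r : ℝ} (hr : 0 < r) : ex r ≠ 0 := by
  simp [ex, hr]

theorem toReal_ex {r : ℝ} (hr : 0 < r) : (ex r).toReal = r⁻¹ :=
  ENNReal.toReal_ofReal (by positivity)

theorem one_le_ex {r : ℝ} (hr : 0 < r) (hr1 : r ≤ 1) : 1 ≤ ex r := by
  rw [ex, ← ENNReal.ofReal_one]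
  exact ENNReal.ofReal_le_ofReal ((one_le_inv₀ hr).2 hr1)

theorem ex_half : ex (1 / 2) = 2 := by
  norm_num [ex]

section interpolation

variable {α : Type*} [MeasurableSpace α] {μ : Measure α} {E : Type*} [NormedAddCommGroup E]
  [InnerProductSpace ℂ E]

theorem eLpNorm_ex {r : ℝ} (hr : 0 < r) (f : α → E) :
    eLpNorm f (ex r) μ = (∫⁻ x, ‖f x‖ₑ ^ r⁻¹ ∂μ) ^ r := by
  rw [eLpNorm_eq_lintegral_rpow_enorm_toReal (ex_ne_zero hr) (ex_ne_top r), toReal_ex hr]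
  simp

/-- The bilinear form of `T` is bounded on `L^{1/r} × L^{1/(1-r)}`. -/
def FormBdd (T : Lp E 2 μ → Lp E 2 μ) (r M : ℝ) : Prop :=
  ∀ f g : Lp E 2 μ, MemLp f (ex r) μ → MemLp g (ex (1 - r)) μ →
    ‖inner ℂ g (T f)‖ ≤ M * (eLpNorm f (ex r) μ).toReal * (eLpNorm g (ex (1 - r)) μ).toReal

/-- `T` is bounded in the norm of `L^{1/r}`. -/
def OpBdd (T : Lp E 2 μ → Lp E 2 μ) (r M : ℝ) : Prop :=
  ∀ f : Lp E 2 μ, MemLp f (ex r) μ → MemLp (T f) (ex r) μ ∧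
    (eLpNorm (T f) (ex r) μ).toReal ≤ M * (eLpNorm f (ex r) μ).toReal

theorem norm_inner_le_eLpNorm {r : ℝ} (h0 : 0 < r) (h1 : r < 1) (g h : Lp E 2 μ)
    (hg : MemLp g (ex (1 - r)) μ) (hh : MemLp h (ex r) μ) :
    ‖inner ℂ g h‖ ≤ (eLpNorm h (ex r) μ).toReal * (eLpNorm g (ex (1 - r)) μ).toReal := by
  have hc : (r⁻¹).HolderConjugate (1 - r)⁻¹ := by
    rw [Real.holderConjugate_iff]
    exact ⟨(one_lt_inv₀ h0).2 h1, by rw [inv_inv, inv_inv]; ring⟩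
  have key : ∫⁻ x, ‖h x‖ₑ * ‖g x‖ₑ ∂μ ≤ eLpNorm h (ex r) μ * eLpNorm g (ex (1 - r)) μ := by
    refine (ENNReal.lintegral_mul_le_Lp_mul_Lq μ hc hh.1.enorm hg.1.enorm).trans (le_of_eq ?_)
    rw [eLpNorm_ex h0, eLpNorm_ex (by linarith)]
    simp
  rw [L2.inner_def, ← ENNReal.toReal_mul]
  rw [← toReal_enorm]
  refine ENNReal.toReal_mono (ENNReal.mul_ne_top hh.2.ne hg.2.ne)
    ((enorm_integral_le_lintegral_enorm _).trans (le_trans ?_ key))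
  refine lintegral_mono fun x => ?_
  rw [← ofReal_norm, ← ofReal_norm, ← ofReal_norm,
    ← ENNReal.ofReal_mul (norm_nonneg _), mul_comm]
  exact ENNReal.ofReal_le_ofReal (norm_inner_le_norm _ _)

theorem OpBdd.formBdd {T : Lp E 2 μ → Lp E 2 μ} {r M : ℝ} (h0 : 0 < r) (h1 : r < 1)
    (h : OpBdd T r M) : FormBdd T r M := fun f g hf hg =>
  (norm_inner_le_eLpNorm h0 h1 g (T f) hg (h f hf).1).trans
    (mul_le_mul_of_nonneg_right (h f hf).2 ENNReal.toReal_nonneg)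

/-- The converse of Hölder's inequality. -/
theorem memLp_of_norm_inner_le {r K : ℝ} (h0 : 0 < r) (h1 : r < 1) (hK : 0 ≤ K) (h : Lp E 2 μ)
    (hb : ∀ g : Lp E 2 μ, MemLp g (ex (1 - r)) μ →
      ‖inner ℂ g h‖ ≤ K * (eLpNorm g (ex (1 - r)) μ).toReal) :
    MemLp h (ex r) μ ∧ (eLpNorm h (ex r) μ).toReal ≤ K := by
  have h1' : 0 < 1 - r := by linarith
  have hm : StronglyMeasurable (h : α → E) := Lp.stronglyMeasurable h
  -- On these sets `h` is bounded above and away from zero, so they have finite measure because `h ∈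
  -- L²`. They increase to `{h ≠ 0}`.
  let B : ℕ → Set α := fun N => {x | ((N : ℝ) + 1)⁻¹ ≤ ‖h x‖ ∧ ‖h x‖ ≤ N}
  have hBm : ∀ N, MeasurableSet (B N) := fun N =>
    (measurableSet_le measurable_const hm.norm.measurable).inter
      (measurableSet_le hm.norm.measurable measurable_const)
  have hBfin : ∀ N, μ (B N) < ⊤ := fun N => by
    have := (Lp.memLp h).meas_ge_lt_top (by norm_num) (by norm_num)
      (ε := ((N : ℝ≥0) + 1)⁻¹) (by positivity)
    refine lt_of_le_of_lt (measure_mono fun x hx => ?_) this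
    have := hx.1
    simp only [Set.mem_ofPred_eq, ← NNReal.coe_le_coe]
    simpa using this
  have hBdir : Directed (· ⊆ ·) B := by
    refine Monotone.directed_le fun N N' hN x hx => ⟨le_trans ?_ hx.1, hx.2.trans ?_⟩
    · have : (N : ℝ) ≤ N' := by exact_mod_cast hN
      gcongr
    · exact_mod_cast hN
  have hBU : ∀ x, h x ≠ 0 → x ∈ ⋃ N, B N := fun x hx => by
    obtain ⟨N1, hN1⟩ := exists_nat_ge ‖h x‖
    obtain ⟨N2, hN2⟩ := exists_nat_ge (‖h x‖⁻¹)
    have hp : 0 < ‖h x‖ := norm_pos_iff.2 hx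
    refine Set.mem_iUnion.2 ⟨max N1 N2, ?_, hN1.trans (by simp)⟩
    rw [inv_le_comm₀ (by positivity) hp]
    refine hN2.trans ?_
    have : (N2 : ℝ) ≤ (max N1 N2 : ℕ) := by exact_mod_cast le_max_right _ _
    linarith
  let I : ℕ → ℝ≥0∞ := fun N => ∫⁻ x in B N, ‖h x‖ₑ ^ r⁻¹ ∂μ
  have hI : ∀ N, I N ≤ ENNReal.ofReal K ^ r⁻¹ := by
    intro N
    -- The extremal test function of Hölder's inequality, cut off to `B N`: its pairing with `h` is
    -- `I N`, and its norm in the dual exponent is `I N ^ (1 - r)`. The cutoff puts it in every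
    -- `L^q`.
    let G : α → E := (B N).indicator fun x => ((‖h x‖ ^ (r⁻¹ - 2) : ℝ) : ℂ) • h x
    have hGnorm : ∀ x, ‖G x‖ₑ = (B N).indicator (fun x => ‖h x‖ₑ ^ (r⁻¹ - 1)) x := by
      intro x
      by_cases hx : x ∈ B N
      · have hp : 0 < ‖h x‖ := lt_of_lt_of_le (by positivity) hx.1
        simp only [G, Set.indicator_of_mem hx]
        rw [← ofReal_norm, ← ofReal_norm, ENNReal.ofReal_rpow_of_pos hp,
          norm_smul, Complex.norm_real, Real.norm_of_nonneg (by positivity)]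
        nth_rw 2 [← Real.rpow_one ‖h x‖]
        rw [← Real.rpow_add hp]
        ring_nf
      · simp [G, hx]
    have hGm : AEStronglyMeasurable G μ := by
      refine (StronglyMeasurable.indicator ?_ (hBm N)).aestronglyMeasurable
      refine StronglyMeasurable.smul ?_ hm
      exact (Complex.measurable_ofReal.comp (hm.norm.measurable.pow_const _)).stronglyMeasurable
    have hGb : ∃ C : ℝ, ∀ᵐ x ∂(μ.restrict (B N)), ‖G x‖ ≤ C := by
      refine ⟨max 1 (((N : ℝ) + 1) ^ |r⁻¹ - 1|), ?_⟩
      filter_upwards [ae_restrict_mem (hBm N)] with x hx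
      have hp : 0 < ‖h x‖ := lt_of_lt_of_le (by positivity) hx.1
      have e : ‖G x‖ = ‖h x‖ ^ (r⁻¹ - 1) := by
        have := hGnorm x
        rw [Set.indicator_of_mem hx, ← ofReal_norm, ← ofReal_norm,
          ENNReal.ofReal_rpow_of_pos hp] at this
        exact (ENNReal.ofReal_eq_ofReal_iff (norm_nonneg _) (by positivity)).1 this
      rw [e]
      have h3 : 0 ≤ r⁻¹ - 1 := by
        have := (one_lt_inv₀ h0).2 h1
        linarith
      rw [abs_of_nonneg h3]
      refine le_max_of_le_right (Real.rpow_le_rpow hp.le (hx.2.trans (by linarith)) h3)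
    have hGq : ∀ q : ℝ≥0∞, MemLp G q μ := fun q => by
      obtain ⟨C, hC⟩ := hGb
      have hr : MemLp G q (μ.restrict (B N)) := by
        have : IsFiniteMeasure (μ.restrict (B N)) := ⟨by simpa using hBfin N⟩
        exact MemLp.of_bound hGm.restrict C hC
      have := (memLp_indicator_iff_restrict (hBm N)).2 hr
      rwa [Set.indicator_indicator, Set.inter_self] at this
    have hIfin : I N ≠ ⊤ := by
      refine ne_top_of_le_ne_top (ENNReal.mul_ne_top (ENNReal.rpow_ne_top_of_nonneg
        (inv_pos.2 h0).le (ENNReal.natCast_ne_top N)) (hBfin N).ne) ?_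
      rw [← setLIntegral_const]
      refine setLIntegral_mono measurable_const fun x hx => ?_
      refine ENNReal.rpow_le_rpow ?_ (inv_pos.2 h0).le
      rw [← ofReal_norm, ← ENNReal.ofReal_natCast]
      exact ENNReal.ofReal_le_ofReal hx.2
    have e1 : ‖inner ℂ ((hGq 2).toLp G) h‖ = (I N).toReal := by
      have e : inner ℂ ((hGq 2).toLp G) h
          = ((∫ x, (B N).indicator (fun x => ‖h x‖ ^ r⁻¹) x ∂μ : ℝ) : ℂ) := by
        rw [L2.inner_def, ← integral_complex_ofReal]
        refine integral_congr_ae ?_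
        filter_upwards [(hGq 2).coeFn_toLp] with x hx
        rw [hx]
        by_cases hxB : x ∈ B N
        · have hp : 0 < ‖h x‖ := lt_of_lt_of_le (by positivity) hxB.1
          simp only [G, Set.indicator_of_mem hxB]
          rw [inner_smul_left, Complex.conj_ofReal, inner_self_eq_norm_sq_to_K]
          have : ‖h x‖ ^ (r⁻¹ - 2) * ‖h x‖ ^ 2 = ‖h x‖ ^ r⁻¹ := by
            rw [← Real.rpow_natCast, ← Real.rpow_add hp]
            norm_num
          rw [← this]
          push_cast
          rfl
        · simp [G, hxB]
      rw [e, Complex.norm_real, integral_eq_lintegral_of_nonneg_ae]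
      · rw [Real.norm_of_nonneg ENNReal.toReal_nonneg]
        congr 1
        simp only [I]
        rw [← lintegral_indicator (hBm N)]
        refine lintegral_congr fun x => ?_
        by_cases hxB : x ∈ B N
        · have hp : 0 < ‖h x‖ := lt_of_lt_of_le (by positivity) hxB.1
          simp only [Set.indicator_of_mem hxB]
          rw [← ofReal_norm, ENNReal.ofReal_rpow_of_pos hp]
        · simp [hxB]
      · exact Filter.Eventually.of_forall fun x =>
          Set.indicator_nonneg (fun y _ => by positivity) x
      · exact ((hm.norm.measurable.pow_const _).indicator (hBm N)).aestronglyMeasurable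
    have e2 : eLpNorm ((hGq 2).toLp G) (ex (1 - r)) μ = I N ^ (1 - r) := by
      rw [eLpNorm_congr_ae (hGq 2).coeFn_toLp, eLpNorm_ex h1']
      simp only [I]
      rw [← lintegral_indicator (hBm N)]
      congr 1
      refine lintegral_congr fun x => ?_
      rw [hGnorm]
      by_cases hx : x ∈ B N
      · simp only [Set.indicator_of_mem hx]
        rw [← ENNReal.rpow_mul]
        congr 1
        field_simp
      · simp [hx, h1']
    have e3 := hb ((hGq 2).toLp G) ((memLp_congr_ae (hGq 2).coeFn_toLp).2 (hGq _))
    rw [e1, e2, ← ENNReal.toReal_rpow] at e3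
    -- What remains is `I ≤ K I^(1 - r)`. As `I` is finite, it may be divided by `I^(1 - r)` unless
    -- `I = 0`.
    by_cases hz : I N = 0
    · simp [hz]
    have hp : 0 < (I N).toReal := ENNReal.toReal_pos hz hIfin
    have e4 : (I N).toReal ^ r ≤ K := by
      have e5 : (I N).toReal = (I N).toReal ^ r * (I N).toReal ^ (1 - r) := by
        rw [← Real.rpow_add hp]; simp
      replace e3 := e5.symm.le.trans e3
      exact le_of_mul_le_mul_right e3 (by positivity)
    rw [← ENNReal.ofReal_toReal hIfin, ENNReal.ofReal_rpow_of_nonneg hK (inv_pos.2 h0).le]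
    refine ENNReal.ofReal_le_ofReal ?_
    calc (I N).toReal = ((I N).toReal ^ r) ^ r⁻¹ := by
          rw [← Real.rpow_mul hp.le, mul_inv_cancel₀ h0.ne', Real.rpow_one]
      _ ≤ K ^ r⁻¹ := Real.rpow_le_rpow (by positivity) e4 (inv_pos.2 h0).le
  have htot : ∫⁻ x, ‖h x‖ₑ ^ r⁻¹ ∂μ ≤ ENNReal.ofReal K ^ r⁻¹ := by
    calc ∫⁻ x, ‖h x‖ₑ ^ r⁻¹ ∂μ = ∫⁻ x in ⋃ N, B N, ‖h x‖ₑ ^ r⁻¹ ∂μ := by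
          rw [← lintegral_indicator (MeasurableSet.iUnion hBm)]
          refine lintegral_congr fun x => ?_
          by_cases hx : h x = 0
          · simp only [hx, enorm_zero]
            rw [ENNReal.zero_rpow_of_pos (inv_pos.2 h0)]
            by_cases hx' : x ∈ ⋃ N, B N
            · rw [Set.indicator_of_mem hx', hx, enorm_zero,
                ENNReal.zero_rpow_of_pos (inv_pos.2 h0)]
            · rw [Set.indicator_of_notMem hx']
          · rw [Set.indicator_of_mem (hBU x hx)]
      _ = ⨆ N, I N := setLIntegral_iUnion_of_directed _ hBdir
      _ ≤ _ := iSup_le hI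
  have hle : eLpNorm h (ex r) μ ≤ ENNReal.ofReal K := by
    rw [eLpNorm_ex h0]
    refine (ENNReal.rpow_le_rpow htot h0.le).trans (le_of_eq ?_)
    rw [← ENNReal.rpow_mul, inv_mul_cancel₀ h0.ne', ENNReal.rpow_one]
  exact ⟨⟨(Lp.memLp h).1, lt_of_le_of_lt hle ENNReal.ofReal_lt_top⟩,
    ENNReal.toReal_le_of_le_ofReal hK hle⟩

theorem FormBdd.opBdd {T : Lp E 2 μ → Lp E 2 μ} {r M : ℝ} (h0 : 0 < r) (h1 : r < 1) (hM : 0 ≤ M)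
    (h : FormBdd T r M) : OpBdd T r M := fun f hf =>
  memLp_of_norm_inner_le h0 h1 (by positivity) (T f) fun g hg => h f g hf hg

end interpolation

/-! ### Analytic families, Riesz–Thorin interpolation, and stability of lower bounds -/

section interpolation

variable {α : Type*} [MeasurableSpace α] {μ : Measure α} {E : Type*} [NormedAddCommGroup E]
  [InnerProductSpace ℂ E]

/-- Simultaneous approximation by simple functions in `L^p` and `L^q`. -/
theorem exists_simpleFunc_tendsto [SecondCountableTopology E] {p q : ℝ≥0∞} (hp : p ≠ ⊤)
    (hq : q ≠ ⊤) {f : α → E} (hfp : MemLp f p μ) (hfq : MemLp f q μ) :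
    ∃ s : ℕ → SimpleFunc α E, (∀ k, MemLp (s k) p μ) ∧
      Filter.Tendsto (fun k => eLpNorm (⇑(s k) - f) p μ) Filter.atTop (nhds 0) ∧
      Filter.Tendsto (fun k => eLpNorm (⇑(s k) - f) q μ) Filter.atTop (nhds 0) := by
  borelize E
  obtain ⟨g, hg, hfg⟩ := hfp.1
  have hgp := hfp.ae_eq hfg
  have hgq := hfq.ae_eq hfg
  refine ⟨fun k => SimpleFunc.approxOn g hg.measurable (Set.range g ∪ {0}) 0 (by simp) k,
    fun k => ?_, ?_, ?_⟩
  · exact SimpleFunc.memLp_approxOn_range hg.measurable hgp k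
  · refine (SimpleFunc.tendsto_approxOn_range_Lp_eLpNorm hp hg.measurable hgp.2).congr fun k =>
      eLpNorm_congr_ae ?_
    filter_upwards [hfg] with x hx
    simp [hx]
  · refine (SimpleFunc.tendsto_approxOn_range_Lp_eLpNorm hq hg.measurable hgq.2).congr fun k =>
      eLpNorm_congr_ae ?_
    filter_upwards [hfg] with x hx
    simp [hx]

theorem tendsto_toReal_eLpNorm {q : ℝ≥0∞} (hq : 1 ≤ q) {f : α → E} (hf : MemLp f q μ)
    {s : ℕ → α → E} (hs : ∀ k, MemLp (s k) q μ)
    (h : Filter.Tendsto (fun k => eLpNorm (s k - f) q μ) Filter.atTop (nhds 0)) :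
    Filter.Tendsto (fun k => (eLpNorm (s k) q μ).toReal) Filter.atTop
      (nhds (eLpNorm f q μ).toReal) := by
  have : Fact (1 ≤ q) := ⟨hq⟩
  have h1 : Filter.Tendsto (fun k => (hs k).toLp (s k)) Filter.atTop (nhds (hf.toLp f)) := by
    rw [Lp.tendsto_Lp_iff_tendsto_eLpNorm'']
    exact h
  simpa [Lp.norm_toLp] using h1.norm

theorem tendsto_toLp_of_eLpNorm {q : ℝ≥0∞} [Fact (1 ≤ q)] (f : Lp E q μ)
    {s : ℕ → α → E} (hs : ∀ k, MemLp (s k) q μ)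
    (h : Filter.Tendsto (fun k => eLpNorm (s k - (f : α → E)) q μ) Filter.atTop (nhds 0)) :
    Filter.Tendsto (fun k => (hs k).toLp (s k)) Filter.atTop (nhds f) := by
  rw [Lp.tendsto_Lp_iff_tendsto_eLpNorm']
  refine h.congr fun k => eLpNorm_congr_ae ?_
  filter_upwards [(hs k).coeFn_toLp] with x hx
  simp [hx]

theorem SimpleFunc_memLp {s : SimpleFunc α E} {p q : ℝ≥0∞} (hp0 : p ≠ 0) (hp : p ≠ ⊤)
    (hs : MemLp s p μ) : MemLp s q μ := by
  rw [SimpleFunc.memLp_iff_finMeasSupp hp0 hp] at hs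
  exact SimpleFunc.memLp_of_finite_measure_preimage q fun y hy =>
    SimpleFunc.finMeasSupp_iff.1 hs y hy

/-- A bound of a continuous form on simple functions extends. -/
theorem formBdd_of_simpleFunc [SecondCountableTopology E] (T : Lp E 2 μ →L[ℂ] Lp E 2 μ) {r M : ℝ}
    (h0 : 0 < r) (h1 : r < 1)
    (h : ∀ (s t : SimpleFunc α E) (hs : MemLp s 2 μ) (ht : MemLp t 2 μ),
      ‖inner ℂ (ht.toLp t) (T (hs.toLp s))‖ ≤
        M * (eLpNorm s (ex r) μ).toReal * (eLpNorm t (ex (1 - r)) μ).toReal) :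
    FormBdd T r M := by
  intro f g hf hg
  obtain ⟨s, hs, hs2, hsr⟩ := exists_simpleFunc_tendsto (by norm_num) (ex_ne_top r) (Lp.memLp f) hf
  obtain ⟨t, ht, ht2, htr⟩ := exists_simpleFunc_tendsto (by norm_num) (ex_ne_top (1 - r))
    (Lp.memLp g) hg
  have hs' := fun k => SimpleFunc_memLp (q := ex r) (by norm_num) (by norm_num) (hs k)
  have ht' := fun k => SimpleFunc_memLp (q := ex (1 - r)) (by norm_num) (by norm_num) (ht k)
  refine le_of_tendsto_of_tendsto'
    (((tendsto_toLp_of_eLpNorm g ht ht2).inner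
      ((T.continuous.tendsto _).comp (tendsto_toLp_of_eLpNorm f hs hs2))).norm)
    ((tendsto_const_nhds.mul (tendsto_toReal_eLpNorm (one_le_ex h0 h1.le) hf hs' hsr)).mul
      (tendsto_toReal_eLpNorm (one_le_ex (by linarith) (by linarith)) hg ht' htr))
    fun k => h (s k) (t k) (hs k) (ht k)

/-- The vector `v` with its norm replaced by `‖v‖ ^ z`. -/
def powFun (z : ℂ) (v : E) : E := Complex.exp (z * Real.log ‖v‖) • ((‖v‖⁻¹ : ℝ) : ℂ) • v

@[simp] theorem powFun_zero (z : ℂ) : powFun z (0 : E) = 0 := by simp [powFun]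

theorem norm_powFun {z : ℂ} (hz : 0 < z.re) (v : E) : ‖powFun z v‖ = ‖v‖ ^ z.re := by
  by_cases hv : v = 0
  · simp [hv, Real.zero_rpow hz.ne']
  · have hp : 0 < ‖v‖ := norm_pos_iff.2 hv
    rw [powFun, norm_smul, norm_smul, Complex.norm_exp, Complex.norm_real,
      Real.norm_of_nonneg (by positivity), inv_mul_cancel₀ hp.ne', mul_one]
    rw [Complex.re_mul_ofReal, mul_comm, ← Real.rpow_def_of_pos hp]

theorem enorm_powFun {z : ℂ} (hz : 0 < z.re) (v : E) : ‖powFun z v‖ₑ = ‖v‖ₑ ^ z.re := by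
  rw [← ofReal_norm, norm_powFun hz, ← ofReal_norm,
    ENNReal.ofReal_rpow_of_nonneg (norm_nonneg _) hz.le]

theorem powFun_inv_powFun {a : ℝ} (ha : 0 < a) (v : E) : powFun (a : ℂ) (powFun ((a⁻¹ : ℝ) : ℂ) v) = v := by
  by_cases hv : v = 0
  · simp [hv]
  have hp : 0 < ‖v‖ := norm_pos_iff.2 hv
  have hn : ‖powFun ((a⁻¹ : ℝ) : ℂ) v‖ = ‖v‖ ^ a⁻¹ := norm_powFun (by simpa using ha) v
  rw [powFun, hn]
  rw [powFun, Real.log_rpow hp]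
  simp only [smul_smul]
  rw [show (a : ℂ) * ((a⁻¹ * Real.log ‖v‖ : ℝ) : ℂ) = (Real.log ‖v‖ : ℝ) by
    have : (a : ℂ) ≠ 0 := by exact_mod_cast ha.ne'
    push_cast
    field_simp]
  rw [← Complex.ofReal_mul, ← Complex.ofReal_exp, ← Complex.ofReal_exp, Real.exp_log hp,
    show Real.exp (a⁻¹ * Real.log ‖v‖) = ‖v‖ ^ a⁻¹ by
      rw [Real.rpow_def_of_pos hp, mul_comm], ← Complex.ofReal_mul, ← Complex.ofReal_mul]
  have hq : ‖v‖ ^ a⁻¹ ≠ 0 := by positivity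
  rw [← Complex.ofReal_mul, show ‖v‖ * ((‖v‖ ^ a⁻¹)⁻¹ * (‖v‖ ^ a⁻¹ * ‖v‖⁻¹)) = 1 by field_simp]
  simp

theorem memLp_map_powFun {s : SimpleFunc α E} (hs : MemLp s 2 μ) (z : ℂ) (q : ℝ≥0∞) :
    MemLp (s.map (powFun z)) q μ := by
  rw [SimpleFunc.memLp_iff_finMeasSupp (by norm_num) (by norm_num)] at hs
  exact SimpleFunc.memLp_of_finite_measure_preimage q fun y hy =>
    SimpleFunc.finMeasSupp_iff.1 (hs.map (powFun_zero z)) y hy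

/-- The element of `L²` given by `powFun z ∘ s`. -/
def phi {s : SimpleFunc α E} (hs : MemLp s 2 μ) (z : ℂ) : Lp E 2 μ :=
  (memLp_map_powFun hs z 2).toLp (s.map (powFun z))

theorem phi_ae {s : SimpleFunc α E} (hs : MemLp s 2 μ) (z : ℂ) :
    phi hs z =ᵐ[μ] fun x => powFun z (s x) :=
  (memLp_map_powFun hs z 2).coeFn_toLp

theorem memLp_phi {s : SimpleFunc α E} (hs : MemLp s 2 μ) (z : ℂ) (q : ℝ≥0∞) :
    MemLp (phi hs z) q μ :=
  (memLp_congr_ae (memLp_map_powFun hs z 2).coeFn_toLp).2 (memLp_map_powFun hs z q)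

/-- Only `Re z` enters the norm. If `s` has norm one in `L¹`, then `phi hs z` is a unit vector of
`L^{1/Re z}` for every `z` with `Re z > 0`, which is the normalization used in complex
interpolation. -/
theorem eLpNorm_phi {s : SimpleFunc α E} (hs : MemLp s 2 μ) {z : ℂ} (hz : 0 < z.re) :
    eLpNorm (phi hs z) (ex z.re) μ = (∫⁻ x, ‖s x‖ₑ ∂μ) ^ z.re := by
  rw [eLpNorm_congr_ae (phi_ae hs z), eLpNorm_ex hz]
  congr 1
  refine lintegral_congr fun x => ?_
  rw [enorm_powFun hz, ← ENNReal.rpow_mul, mul_inv_cancel₀ hz.ne', ENNReal.rpow_one]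

open Classical in
/-- The part of `s` on the level set of `v`, normalized. -/
def levelFun (v : E) (w : E) : E := if w = v then ((‖v‖⁻¹ : ℝ) : ℂ) • v else 0

theorem memLp_map_levelFun {s : SimpleFunc α E} (hs : MemLp s 2 μ) (v : E) :
    MemLp (s.map (levelFun v)) 2 μ := by
  rw [SimpleFunc.memLp_iff_finMeasSupp (by norm_num) (by norm_num)] at hs
  exact SimpleFunc.memLp_of_finite_measure_preimage 2 fun y hy =>
    SimpleFunc.finMeasSupp_iff.1 (hs.map (by
      by_cases h : (0 : E) = v
      · subst h; simp [levelFun]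
      · simp [levelFun, h])) y hy

/-- The variable `z` occurs only in scalar exponentials, one for each value of `s`, in front of
fixed vectors of `L²`. Analyticity in `z` and bounds on vertical strips are then evident. -/
theorem phi_eq_sum {s : SimpleFunc α E} (hs : MemLp s 2 μ) (z : ℂ) :
    phi hs z = ∑ v ∈ s.range, Complex.exp (z * Real.log ‖v‖) •
      (memLp_map_levelFun hs v).toLp (s.map (levelFun v)) := by
  refine Lp.ext ?_
  have h1 : ∀ᵐ x ∂μ, ∀ v ∈ s.range,
      (Complex.exp (z * Real.log ‖v‖) • (memLp_map_levelFun hs v).toLp (s.map (levelFun v))) x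
        = Complex.exp (z * Real.log ‖v‖) • levelFun v (s x) := by
    rw [Filter.eventually_all_finset]
    intro v _
    filter_upwards [Lp.coeFn_smul (Complex.exp (z * Real.log ‖v‖))
      ((memLp_map_levelFun hs v).toLp (s.map (levelFun v))),
      (memLp_map_levelFun hs v).coeFn_toLp] with x e1 e2
    rw [e1, Pi.smul_apply, e2]
    rfl
  filter_upwards [phi_ae hs z, h1, Lp.coeFn_finsetSum s.range fun v =>
    Complex.exp (z * Real.log ‖v‖) • (memLp_map_levelFun hs v).toLp (s.map (levelFun v))]
    with x e1 e2 e3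
  rw [e1, e3, Finset.sum_apply, Finset.sum_congr rfl e2,
    Finset.sum_eq_single_of_mem (s x) (s.mem_range_self x)]
  · simp [levelFun, powFun]
  · intro v _ hv
    simp [levelFun, hv.symm]

/-- The analytic function which interpolates the form of `T`. -/
def interpForm (T : Lp E 2 μ →L[ℂ] Lp E 2 μ) {s t : SimpleFunc α E} (hs : MemLp s 2 μ)
    (ht : MemLp t 2 μ) (z : ℂ) : ℂ :=
  inner ℂ (phi ht (1 - (starRingEnd ℂ) z)) (T (phi hs z))

/-- The conjugate of `z` in the first slot cancels against the antilinearity of the inner product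
there, which leaves a finite sum of exponentials in `z` itself. -/
theorem interpForm_eq_sum (T : Lp E 2 μ →L[ℂ] Lp E 2 μ) {s t : SimpleFunc α E} (hs : MemLp s 2 μ)
    (ht : MemLp t 2 μ) (z : ℂ) : interpForm T hs ht z = ∑ w ∈ t.range, ∑ v ∈ s.range,
      Complex.exp ((1 - z) * Real.log ‖w‖) * (Complex.exp (z * Real.log ‖v‖) *
        inner ℂ ((memLp_map_levelFun ht w).toLp (t.map (levelFun w)))
          (T ((memLp_map_levelFun hs v).toLp (s.map (levelFun v))))) := by
  rw [interpForm, phi_eq_sum, phi_eq_sum, map_sum, sum_inner]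
  refine Finset.sum_congr rfl fun w _ => ?_
  rw [inner_sum]
  refine Finset.sum_congr rfl fun v _ => ?_
  rw [map_smul, inner_smul_left, inner_smul_right, ← Complex.exp_conj]
  simp

theorem differentiable_interpForm (T : Lp E 2 μ →L[ℂ] Lp E 2 μ) {s t : SimpleFunc α E}
    (hs : MemLp s 2 μ) (ht : MemLp t 2 μ) : Differentiable ℂ (interpForm T hs ht) := by
  have : interpForm T hs ht = _ := funext fun z => interpForm_eq_sum T hs ht z
  rw [this]
  fun_prop

theorem norm_exp_mul_le {z : ℂ} (h0 : 0 ≤ z.re) (h1 : z.re ≤ 1) (L : ℝ) :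
    ‖Complex.exp (z * L)‖ ≤ Real.exp |L| := by
  rw [Complex.norm_exp, Complex.re_mul_ofReal, Real.exp_le_exp]
  calc z.re * L ≤ |z.re * L| := le_abs_self _
    _ = z.re * |L| := by rw [abs_mul, abs_of_nonneg h0]
    _ ≤ _ := mul_le_of_le_one_left (abs_nonneg _) h1

theorem norm_interpForm_line {T : Lp E 2 μ →L[ℂ] Lp E 2 μ} {r M : ℝ} (h0 : 0 < r) (h1 : r < 1)
    (hM : 0 ≤ M) (hT : FormBdd T r M) {s t : SimpleFunc α E} (hs : MemLp s 2 μ)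
    (ht : MemLp t 2 μ) (hs1 : ∫⁻ x, ‖s x‖ₑ ∂μ ≤ 1) (ht1 : ∫⁻ x, ‖t x‖ₑ ∂μ ≤ 1) {z : ℂ}
    (hz : z.re = r) : ‖interpForm T hs ht z‖ ≤ M := by
  have h := hT (phi hs z) (phi ht (1 - (starRingEnd ℂ) z)) (memLp_phi hs z _) (memLp_phi ht _ _)
  have e1 : (eLpNorm (phi hs z) (ex r) μ).toReal ≤ 1 := by
    rw [← hz, eLpNorm_phi hs (by rw [hz]; exact h0)]
    exact ENNReal.toReal_le_of_le_ofReal zero_le_one (by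
      simpa using ENNReal.rpow_le_one hs1 (by rw [hz]; exact h0.le))
  have e2 : (eLpNorm (phi ht (1 - (starRingEnd ℂ) z)) (ex (1 - r)) μ).toReal ≤ 1 := by
    have hre : (1 - (starRingEnd ℂ) z).re = 1 - r := by simp [hz]
    rw [← hre, eLpNorm_phi ht (by rw [hre]; linarith), hre]
    exact ENNReal.toReal_le_of_le_ofReal zero_le_one (by
      simpa using ENNReal.rpow_le_one ht1 (z := 1 - r) (by linarith))
  refine h.trans ?_
  rw [mul_assoc]
  exact mul_le_of_le_one_right hM (mul_le_one₀ e1 ENNReal.toReal_nonneg e2)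

theorem norm_interpForm_le {T : Lp E 2 μ →L[ℂ] Lp E 2 μ} {r₀ r₁ M : ℝ} (h0 : 0 < r₀)
    (h01 : r₀ < r₁) (h1 : r₁ < 1) (hM : 0 ≤ M) (hT0 : FormBdd T r₀ M) (hT1 : FormBdd T r₁ M)
    {s t : SimpleFunc α E} (hs : MemLp s 2 μ) (ht : MemLp t 2 μ) (hs1 : ∫⁻ x, ‖s x‖ₑ ∂μ ≤ 1)
    (ht1 : ∫⁻ x, ‖t x‖ₑ ∂μ ≤ 1) {z : ℂ} (hz0 : r₀ ≤ z.re) (hz1 : z.re ≤ r₁) :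
    ‖interpForm T hs ht z‖ ≤ M := by
  -- A finite sum of exponentials is bounded on the strip, so the growth condition holds with both
  -- growth constants equal to zero. On the two boundary lines the assumed form bounds apply to unit
  -- vectors.
  refine PhragmenLindelof.vertical_strip (differentiable_interpForm T hs ht).diffContOnCl
    ⟨0, div_pos Real.pi_pos (by linarith), 0, ?_⟩
    (fun z hz => norm_interpForm_line h0 (by linarith) hM hT0 hs ht hs1 ht1 hz)
    (fun z hz => norm_interpForm_line (by linarith) h1 hM hT1 hs ht hs1 ht1 hz) hz0 hz1
  let K : ℝ := ∑ w ∈ t.range, ∑ v ∈ s.range, Real.exp |Real.log ‖w‖| * (Real.exp |Real.log ‖v‖| *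
        ‖inner ℂ ((memLp_map_levelFun ht w).toLp (t.map (levelFun w)))
          (T ((memLp_map_levelFun hs v).toLp (s.map (levelFun v))))‖)
  refine Asymptotics.IsBigO.of_bound K (Filter.Eventually.filter_mono inf_le_right ?_)
  rw [Filter.eventually_principal]
  intro z hz
  have hz' : r₀ < z.re ∧ z.re < r₁ := hz
  simp only [zero_mul, Real.exp_zero, norm_one, mul_one]
  rw [interpForm_eq_sum]
  refine norm_sum_le_of_le _ fun w _ => norm_sum_le_of_le _ fun v _ => ?_
  rw [norm_mul, norm_mul]
  have a1 : ‖Complex.exp ((1 - z) * Real.log ‖w‖)‖ ≤ Real.exp |Real.log ‖w‖| :=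
    norm_exp_mul_le (by simp; linarith) (by simp; linarith) _
  have a2 : ‖Complex.exp (z * Real.log ‖v‖)‖ ≤ Real.exp |Real.log ‖v‖| :=
    norm_exp_mul_le (by linarith) (by linarith) _
  gcongr

/-- A simple function of norm `1` in `L^{1/r}` is `phi` of a simple function of norm `1` in
`L^1`. -/
theorem exists_phi_eq {s : SimpleFunc α E} (hs : MemLp s 2 μ) {r : ℝ} (hr : 0 < r) :
    ∃ (s' : SimpleFunc α E) (hs' : MemLp s' 2 μ), phi hs' (r : ℂ) = hs.toLp s ∧
      (∫⁻ x, ‖s' x‖ₑ ∂μ) = eLpNorm s (ex r) μ ^ r⁻¹ := by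
  refine ⟨s.map (powFun ((r⁻¹ : ℝ) : ℂ)), memLp_map_powFun hs _ 2, ?_, ?_⟩
  · refine Lp.ext ?_
    filter_upwards [phi_ae (memLp_map_powFun hs ((r⁻¹ : ℝ) : ℂ) 2) (r : ℂ), hs.coeFn_toLp]
      with x e1 e2
    rw [e1, e2, SimpleFunc.map_apply, powFun_inv_powFun hr]
  · rw [eLpNorm_ex hr, ← ENNReal.rpow_mul, mul_inv_cancel₀ hr.ne', ENNReal.rpow_one]
    refine lintegral_congr fun x => ?_
    rw [SimpleFunc.map_apply, enorm_powFun (by simpa using hr)]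
    simp

theorem eLpNorm_eq_zero_of_toReal {s : SimpleFunc α E} (hs : MemLp s 2 μ) {r : ℝ} (hr : 0 < r)
    (h : (eLpNorm s (ex r) μ).toReal = 0) : hs.toLp s = 0 := by
  have hs' : MemLp s (ex r) μ := SimpleFunc_memLp (by norm_num) (by norm_num) hs
  have h2 : eLpNorm s (ex r) μ = 0 := by
    rcases (ENNReal.toReal_eq_zero_iff _).1 h with h | h
    · exact h
    · exact absurd h hs'.2.ne
  rw [eLpNorm_eq_zero_iff hs'.1 (ex_ne_zero hr)] at h2
  refine Lp.ext ?_
  filter_upwards [hs.coeFn_toLp, h2, Lp.coeFn_zero E 2 μ] with x e1 e2 e3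
  rw [e1, e2, e3]

/-- Every simple function is a multiple of `phi` of a function of norm `1` in `L^1`. -/
theorem exists_phi_smul_eq {s : SimpleFunc α E} (hs : MemLp s 2 μ) {r : ℝ} (hr : 0 < r) :
    ∃ (s' : SimpleFunc α E) (hs' : MemLp s' 2 μ), (∫⁻ x, ‖s' x‖ₑ ∂μ) ≤ 1 ∧
      ((eLpNorm s (ex r) μ).toReal ≠ 0 → (∫⁻ x, ‖s' x‖ₑ ∂μ) = 1) ∧
      hs.toLp s = ((eLpNorm s (ex r) μ).toReal : ℂ) • phi hs' (r : ℂ) := by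
  set c := (eLpNorm s (ex r) μ).toReal with hc
  by_cases h : c = 0
  · refine ⟨0, by simp, by simp, fun h' => absurd h h', ?_⟩
    rw [h, eLpNorm_eq_zero_of_toReal hs hr h]
    simp
  have hmem : MemLp s (ex r) μ := SimpleFunc_memLp (by norm_num) (by norm_num) hs
  have hs2 : MemLp (((c⁻¹ : ℝ) : ℂ) • s) 2 μ := hs.const_smul _
  have e : ⇑(((c⁻¹ : ℝ) : ℂ) • s) = ((c⁻¹ : ℝ) : ℂ) • ⇑s := rfl
  obtain ⟨s', hs', e1, e2⟩ := exists_phi_eq (s := ((c⁻¹ : ℝ) : ℂ) • s) hs2 hr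
  have e3 : (∫⁻ x, ‖s' x‖ₑ ∂μ) = 1 := by
    rw [e2, e, eLpNorm_const_smul]
    have : ‖((c⁻¹ : ℝ) : ℂ)‖ₑ * eLpNorm s (ex r) μ = 1 := by
      rw [← ENNReal.ofReal_toReal hmem.2.ne, ← hc, ← ofReal_norm, Complex.norm_real, norm_inv,
        Real.norm_of_nonneg ENNReal.toReal_nonneg, ← ENNReal.ofReal_mul (by positivity),
        inv_mul_cancel₀ h, ENNReal.ofReal_one]
    rw [this]
    simp
  refine ⟨s', hs', e3.le, fun _ => e3, ?_⟩
  · rw [e1]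
    refine Lp.ext ?_
    filter_upwards [hs.coeFn_toLp, hs2.coeFn_toLp, Lp.coeFn_smul (c : ℂ) (hs2.toLp _)]
      with x a1 a2 a3
    rw [a1, a3, Pi.smul_apply]
    refine Eq.trans ?_ (congrArg ((c : ℂ) • ·) a2).symm
    have : (c : ℂ) ≠ 0 := by exact_mod_cast h
    simp [smul_smul, this]

/-- The Riesz-Thorin theorem, with the maximum of the two bounds. -/
theorem FormBdd.interpolate [SecondCountableTopology E] {T : Lp E 2 μ →L[ℂ] Lp E 2 μ}
    {r₀ r₁ r M : ℝ} (h0 : 0 < r₀) (h1 : r₁ < 1) (hM : 0 ≤ M) (hT0 : FormBdd T r₀ M)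
    (hT1 : FormBdd T r₁ M) (hr0 : r₀ ≤ r) (hr1 : r ≤ r₁) : FormBdd T r M := by
  -- Setting `r = r₀` aside makes the strip non-degenerate.
  rcases hr0.eq_or_lt with rfl | hr0
  · exact hT0
  refine formBdd_of_simpleFunc T (by linarith) (by linarith) fun s t hs ht => ?_
  obtain ⟨s', hs', e1, -, e2⟩ := exists_phi_smul_eq hs (r := r) (by linarith)
  obtain ⟨t', ht', e3, -, e4⟩ := exists_phi_smul_eq ht (r := 1 - r) (by linarith)
  have h := norm_interpForm_le h0 (by linarith) h1 hM hT0 hT1 hs' ht' e1 e3 (z := (r : ℂ))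
    (by simpa using hr0.le) (by simpa using hr1)
  rw [interpForm] at h
  rw [e2, e4, map_smul, inner_smul_left, inner_smul_right, norm_mul, norm_mul]
  simp only [Complex.conj_ofReal, Complex.norm_real, Real.norm_of_nonneg ENNReal.toReal_nonneg]
  have e5 : ((1 - r : ℝ) : ℂ) = 1 - (starRingEnd ℂ) (r : ℂ) := by simp
  rw [e5]
  calc _ = ‖inner ℂ (phi ht' (1 - (starRingEnd ℂ) (r : ℂ))) (T (phi hs' (r : ℂ)))‖ *
        (eLpNorm s (ex r) μ).toReal * (eLpNorm t (ex (1 - r)) μ).toReal := by ring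
    _ ≤ _ := by gcongr

/-- Stability of a lower bound in the `L^p` scale. -/
theorem exists_lowerBound_nearby {r₀ r₁ r M c : ℝ} (h0 : 0 < r₀) (h1 : r₁ < 1) (hM : 0 ≤ M)
    (hr0 : r₀ < r) (hr1 : r < r₁) (hc : 0 < c) : ∃ δ > 0, ∀ r' : ℝ, |r' - r| < δ →
    ∀ {α : Type*} [MeasurableSpace α] {μ : Measure α} {E : Type*} [NormedAddCommGroup E]
    [InnerProductSpace ℂ E] [SecondCountableTopology E] (T : Lp E 2 μ →L[ℂ] Lp E 2 μ),
    FormBdd T r₀ M → FormBdd T r₁ M →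
    (∀ f : Lp E 2 μ, MemLp f (ex r) μ → c * (eLpNorm f (ex r) μ).toReal ≤ (eLpNorm (T f) (ex r) μ).toReal) →
    ∀ f : Lp E 2 μ, MemLp f (ex r') μ →
      c / 4 * (eLpNorm f (ex r') μ).toReal ≤ (eLpNorm (T f) (ex r') μ).toReal := by
  obtain ⟨d, hd, hd0, hd1⟩ : ∃ d > 0, r₀ ≤ r - d ∧ r + d ≤ r₁ := by
    refine ⟨min (r - r₀) (r₁ - r), lt_min (by linarith) (by linarith), ?_, ?_⟩
    · linarith [min_le_left (r - r₀) (r₁ - r)]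
    · linarith [min_le_right (r - r₀) (r₁ - r)]
  -- The interpolating function maps the disc of radius `d` about `r` into a disc of radius `2 * M +
  -- 1` about its value at `r`. By the Schwarz lemma it moves by at most `c / 4` between `r` and
  -- `r'`. The summand `1` keeps the radius positive when `M = 0`.
  refine ⟨min d (d * c / (4 * (2 * M + 1))), lt_min hd (by positivity), ?_⟩
  intro r' hr' α _ μ E _ _ _ T hT0 hT1 hlow f hf
  have hrd := abs_lt.1 (hr'.trans_le (min_le_left _ _))
  have hT : FormBdd T r' M := hT0.interpolate h0 h1 hM hT1 (by linarith) (by linarith)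
  have hTr : FormBdd T r M := hT0.interpolate h0 h1 hM hT1 (by linarith) (by linarith)
  have hO := hT.opBdd (by linarith) (by linarith) hM
  have hOr := hTr.opBdd (by linarith) (by linarith) hM
  have hr'0 : 0 < r' := by linarith
  have hr'1 : r' < 1 := by linarith
  have hr00 : 0 < r := by linarith
  have hr11 : r < 1 := by linarith
  have key : ∀ (s : SimpleFunc α E) (hs : MemLp s 2 μ), (∫⁻ x, ‖s x‖ₑ ∂μ) = 1 →
      c / 4 ≤ (eLpNorm (T (phi hs (r' : ℂ))) (ex r') μ).toReal := by
    intro s hs hs1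
    have e1 : (eLpNorm (phi hs (r : ℂ)) (ex r) μ).toReal = 1 := by
      have := eLpNorm_phi hs (z := (r : ℂ)) (by simpa using hr00)
      rw [Complex.ofReal_re] at this
      rw [this, hs1]; simp
    have e2 := hlow _ (memLp_phi hs (r : ℂ) (ex r))
    rw [e1, mul_one] at e2
    -- The image of a unit vector has norm at least `c` at the exponent of `r`. By the converse of
    -- Hölder's inequality and density of simple functions, some normalized simple `t` detects more
    -- than half of it.
    obtain ⟨t, ht, ht1, hlt⟩ : ∃ (t : SimpleFunc α E) (ht : MemLp t 2 μ), (∫⁻ x, ‖t x‖ₑ ∂μ) ≤ 1 ∧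
        c / 2 < ‖interpForm T hs ht (r : ℂ)‖ := by
      by_contra! hcon
      have h3 := (memLp_of_norm_inner_le (K := c / 2) hr00 hr11 (by positivity)
        (T (phi hs (r : ℂ))) ?_).2
      · linarith
      intro g hg
      obtain ⟨t, ht, ht2, htr⟩ := exists_simpleFunc_tendsto (by norm_num) (ex_ne_top (1 - r))
        (Lp.memLp g) hg
      have ht' := fun k => SimpleFunc_memLp (q := ex (1 - r)) (by norm_num) (by norm_num) (ht k)
      refine le_of_tendsto_of_tendsto'
        (((tendsto_toLp_of_eLpNorm g ht ht2).inner tendsto_const_nhds).norm)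
        (tendsto_const_nhds.mul
          (tendsto_toReal_eLpNorm (one_le_ex (by linarith) (by linarith)) hg ht' htr)) fun k => ?_
      obtain ⟨t', ht', e3, -, e4⟩ := exists_phi_smul_eq (ht k) (r := 1 - r) (by linarith)
      have h4 := hcon t' ht' e3
      rw [e4, inner_smul_left, norm_mul, Complex.conj_ofReal, Complex.norm_real,
        Real.norm_of_nonneg ENNReal.toReal_nonneg, mul_comm]
      refine mul_le_mul_of_nonneg_right ?_ ENNReal.toReal_nonneg
      simpa [interpForm] using h4
    have h5 : dist (interpForm T hs ht (r' : ℂ)) (interpForm T hs ht (r : ℂ)) ≤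
        (2 * M + 1) / d * dist (r' : ℂ) (r : ℂ) := by
      have hb : ∀ z ∈ Metric.ball (r : ℂ) d, ‖interpForm T hs ht z‖ ≤ M := by
        intro z hz
        have h6 : |z.re - r| < d := by
          have := Complex.abs_re_le_norm (z - r)
          simp only [Complex.sub_re, Complex.ofReal_re] at this
          exact this.trans_lt (by simpa [dist_eq_norm] using hz)
        have h7 := abs_lt.1 h6
        exact norm_interpForm_le h0 (by linarith) h1 hM hT0 hT1 hs ht hs1.le ht1 (by linarith)
          (by linarith)
      refine Complex.dist_le_div_mul_dist_of_mapsTo_ball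
        (differentiable_interpForm T hs ht).differentiableOn (fun z hz => ?_) ?_
      · rw [Metric.mem_closedBall, dist_eq_norm]
        refine (norm_sub_le _ _).trans ?_
        linarith [hb z hz, hb r (Metric.mem_ball_self hd)]
      · rw [Metric.mem_ball, dist_eq_norm, ← Complex.ofReal_sub, Complex.norm_real]
        exact abs_lt.2 hrd
    have h8 : (2 * M + 1) / d * dist (r' : ℂ) (r : ℂ) ≤ c / 4 := by
      rw [dist_eq_norm, ← Complex.ofReal_sub, Complex.norm_real, Real.norm_eq_abs]
      calc (2 * M + 1) / d * |r' - r| ≤ (2 * M + 1) / d * (d * c / (4 * (2 * M + 1))) := by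
            gcongr
            exact (hr'.trans_le (min_le_right _ _)).le
        _ = c / 4 := by field_simp
    have h9 : c / 4 ≤ ‖interpForm T hs ht (r' : ℂ)‖ := by
      have := norm_sub_norm_le (interpForm T hs ht (r : ℂ)) (interpForm T hs ht (r' : ℂ))
      rw [dist_comm, dist_eq_norm] at h5
      linarith
    have h10 := norm_inner_le_eLpNorm hr'0 hr'1 (phi ht (1 - (starRingEnd ℂ) (r' : ℂ)))
      (T (phi hs (r' : ℂ))) (memLp_phi _ _ _) (hO _ (memLp_phi hs _ _)).1
    have h11 : (eLpNorm (phi ht (1 - (starRingEnd ℂ) (r' : ℂ))) (ex (1 - r')) μ).toReal ≤ 1 := by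
      have hre : (1 - (starRingEnd ℂ) (r' : ℂ)).re = 1 - r' := by simp
      rw [← hre, eLpNorm_phi ht (by rw [hre]; linarith), hre]
      exact ENNReal.toReal_le_of_le_ofReal zero_le_one (by
        simpa using ENNReal.rpow_le_one ht1 (z := 1 - r') (by linarith))
    exact h9.trans (h10.trans (mul_le_of_le_one_right ENNReal.toReal_nonneg h11))
  have key2 : ∀ (s : SimpleFunc α E) (hs : MemLp s 2 μ),
      c / 4 * (eLpNorm s (ex r') μ).toReal ≤ (eLpNorm (T (hs.toLp s)) (ex r') μ).toReal := by
    intro s hs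
    by_cases hz : (eLpNorm s (ex r') μ).toReal = 0
    · rw [hz, mul_zero]; exact ENNReal.toReal_nonneg
    obtain ⟨s', hs', -, e1, e2⟩ := exists_phi_smul_eq hs hr'0
    have h1 := key s' hs' (e1 hz)
    rw [e2, map_smul, eLpNorm_congr_ae (Lp.coeFn_smul _ _), eLpNorm_const_smul, ENNReal.toReal_mul,
      toReal_enorm, Complex.norm_real, Real.norm_of_nonneg ENNReal.toReal_nonneg, mul_comm]
    exact mul_le_mul_of_nonneg_left h1 ENNReal.toReal_nonneg
  obtain ⟨s, hs, hs2, hsr⟩ := exists_simpleFunc_tendsto (by norm_num) (ex_ne_top r')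
    (Lp.memLp f) hf
  have hs' := fun k => SimpleFunc_memLp (q := ex r') (by norm_num) (by norm_num) (hs k)
  refine le_of_tendsto_of_tendsto' (tendsto_const_nhds.mul
    (tendsto_toReal_eLpNorm (one_le_ex hr'0 hr'1.le) hf hs' hsr)) ?_ fun k => key2 (s k) (hs k)
  have hLp : ∀ k, MemLp ((hs k).toLp (s k)) (ex r') μ := fun k =>
    (memLp_congr_ae (hs k).coeFn_toLp).2 (hs' k)
  -- By interpolation `T` is bounded in the norm of `L^{1/r'}` as well, so both sides pass to the
  -- limit along the simple functions.
  refine tendsto_toReal_eLpNorm (one_le_ex hr'0 hr'1.le) (hO f hf).1 (fun k => (hO _ (hLp k)).1) ?_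
  have hsub : ∀ k, MemLp ((hs k).toLp (s k) - f : Lp E 2 μ) (ex r') μ := fun k =>
    (memLp_congr_ae (Lp.coeFn_sub _ _)).2 ((hLp k).sub hf)
  have e1 : ∀ k, eLpNorm (⇑(T ((hs k).toLp (s k))) - ⇑(T f)) (ex r') μ ≤
      ENNReal.ofReal M * eLpNorm (⇑(s k) - ⇑f) (ex r') μ := by
    intro k
    have h2 := hO _ (hsub k)
    rw [map_sub] at h2
    rw [eLpNorm_congr_ae (Lp.coeFn_sub _ _).symm]
    have e2 : eLpNorm (((hs k).toLp (s k) - f : Lp E 2 μ)) (ex r') μ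
        = eLpNorm (⇑(s k) - ⇑f) (ex r') μ := by
      refine eLpNorm_congr_ae ?_
      filter_upwards [Lp.coeFn_sub ((hs k).toLp (s k)) f, (hs k).coeFn_toLp] with x a1 a2
      rw [a1, Pi.sub_apply, a2, Pi.sub_apply]
    rw [← e2, ← ENNReal.ofReal_toReal h2.1.2.ne, ← ENNReal.ofReal_toReal (hsub k).2.ne,
      ← ENNReal.ofReal_mul hM]
    exact ENNReal.ofReal_le_ofReal h2.2
  refine tendsto_of_tendsto_of_tendsto_of_le_of_le tendsto_const_nhds ?_ (fun _ => zero_le) e1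
  have := ENNReal.Tendsto.const_mul (a := ENNReal.ofReal M) hsr (Or.inr ENNReal.ofReal_ne_top)
  rwa [mul_zero] at this

end interpolation

/-! ### Bounded functions in different Lebesgue spaces -/

section bounded

variable {α : Type*} [MeasurableSpace α] {μ : Measure α} {E : Type*} [NormedAddCommGroup E]

/-- A bounded function in `L^p` lies in `L^q` for `q ≥ p`. -/
theorem memLp_of_ae_bound {p q : ℝ≥0∞} (hp0 : p ≠ 0) (hpq : p ≤ q) (hq : q ≠ ⊤) {f : α → E}
    (hf : MemLp f p μ) {K : ℝ} (hK : ∀ᵐ x ∂μ, ‖f x‖ ≤ K) : MemLp f q μ := by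
  have hp : p ≠ ⊤ := ne_top_of_le_ne_top hq hpq
  have hq0 : q ≠ 0 := (lt_of_lt_of_le (pos_iff_ne_zero.2 hp0) hpq).ne'
  have hpt : 0 < p.toReal := ENNReal.toReal_pos hp0 hp
  have hpq' : p.toReal ≤ q.toReal := ENNReal.toReal_mono hq hpq
  refine ⟨hf.1, ?_⟩
  rw [eLpNorm_lt_top_iff_lintegral_rpow_enorm_lt_top hq0 hq]
  have hfin := (eLpNorm_lt_top_iff_lintegral_rpow_enorm_lt_top hp0 hp).1 hf.2
  have hle : ∫⁻ x, ‖f x‖ₑ ^ q.toReal ∂μ ≤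
      ENNReal.ofReal K ^ (q.toReal - p.toReal) * ∫⁻ x, ‖f x‖ₑ ^ p.toReal ∂μ := by
    rw [← lintegral_const_mul'' _ (hf.1.enorm.pow_const _)]
    refine lintegral_mono_ae ?_
    filter_upwards [hK] with x hx
    have e : ‖f x‖ₑ ^ q.toReal = ‖f x‖ₑ ^ (q.toReal - p.toReal) * ‖f x‖ₑ ^ p.toReal := by
      rw [← ENNReal.rpow_add_of_nonneg _ _ (by linarith) hpt.le]
      simp
    rw [e]
    gcongr
    rw [← ofReal_norm]
    exact ENNReal.ofReal_le_ofReal hx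
  exact hle.trans_lt (ENNReal.mul_lt_top (ENNReal.rpow_lt_top_of_nonneg (by linarith)
    ENNReal.ofReal_ne_top) hfin)

theorem eLpNorm_le_of_ae_bound {p : ℝ≥0∞} (hp1 : 1 ≤ p) (hp : p ≠ ⊤) {f : α → E}
    (hf : AEStronglyMeasurable f μ) {K : ℝ} (hK : ∀ᵐ x ∂μ, ‖f x‖ ≤ K) :
    eLpNorm f p μ ≤ (ENNReal.ofReal K ^ (p.toReal - 1) * eLpNorm f 1 μ) ^ (1 / p.toReal) := by
  have hp0 : p ≠ 0 := (lt_of_lt_of_le zero_lt_one hp1).ne'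
  have hpt : 1 ≤ p.toReal := by simpa using ENNReal.toReal_mono hp hp1
  rw [eLpNorm_eq_lintegral_rpow_enorm_toReal hp0 hp, eLpNorm_one_eq_lintegral_enorm]
  gcongr
  rw [← lintegral_const_mul'' _ hf.enorm]
  refine lintegral_mono_ae ?_
  filter_upwards [hK] with x hx
  have e : ‖f x‖ₑ ^ p.toReal = ‖f x‖ₑ ^ (p.toReal - 1) * ‖f x‖ₑ := by
    conv_rhs => rw [← ENNReal.rpow_one (‖f x‖ₑ), ← ENNReal.rpow_mul, one_mul,
      ← ENNReal.rpow_add_of_nonneg _ _ (by linarith) zero_le_one]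
    simp
  rw [e]
  gcongr
  rw [← ofReal_norm]
  exact ENNReal.ofReal_le_ofReal hx

end bounded

/-! ### Fourier multipliers on `L²` -/

section multiplier

open FourierTransform SchwartzMap

variable {V : Type*} [NormedAddCommGroup V] [InnerProductSpace ℝ V] [FiniteDimensional ℝ V]
  [MeasurableSpace V] [BorelSpace V]

/-- The `L²`-transform is compatible with the one on tempered distributions. This formula carries
distributional identities to the Fourier side and back. -/
theorem integral_schwartz_mul_fourier (χ : 𝓢(V, ℂ)) (f : Lp ℂ 2 (volume : Measure V)) :
    ∫ x, χ x * (𝓕 f : Lp ℂ 2 (volume : Measure V)) x = ∫ ξ, (𝓕 χ) ξ * f ξ := by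
  have h := congrArg (fun S : TemperedDistribution V ℂ => S χ)
    (Lp.fourier_toTemperedDistribution_eq f)
  simp only [TemperedDistribution.fourier_apply, Lp.toTemperedDistribution_apply, smul_eq_mul] at h
  exact h.symm

/-- The Fourier transforms on `L¹` and `L²` agree. -/
theorem fourier_toLp_ae {h : V → ℂ} (h1 : Integrable h) (h2 : MemLp h 2) :
    (𝓕 (h2.toLp h) : Lp ℂ 2 (volume : Measure V)) =ᵐ[volume] 𝓕 h := by
  refine ae_eq_of_integral_contDiff_smul_eq
    ((Lp.memLp (𝓕 (h2.toLp h))).locallyIntegrable (by norm_num)) ?_ fun g hg hgc => ?_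
  · exact (VectorFourier.fourierIntegral_continuous Real.continuous_fourierChar
      (by exact continuous_inner) h1).locallyIntegrable
  · have hc : HasCompactSupport fun x => (g x : ℂ) := hgc.comp_left (g := Complex.ofReal) (by simp)
    have hs : ContDiff ℝ ∞ fun x => (g x : ℂ) := Complex.ofRealCLM.contDiff.comp hg
    let χ : 𝓢(V, ℂ) := hc.toSchwartzMap hs
    have hχ : ∀ x, χ x = g x := fun x => rfl
    have e1 := integral_schwartz_mul_fourier χ (h2.toLp h)
    have e2 : ∫ ξ, (𝓕 χ) ξ * (h2.toLp h) ξ = ∫ ξ, (𝓕 χ) ξ * h ξ := by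
      refine integral_congr_ae ?_
      filter_upwards [h2.coeFn_toLp] with x hx
      rw [hx]
    have e3 : ∫ ξ, (𝓕 χ) ξ * h ξ = ∫ x, χ x * 𝓕 h x := by
      have := VectorFourier.integral_fourierIntegral_smul_eq_flip (μ := volume) (ν := volume)
        (L := innerₗ V) (e := Real.fourierChar) (f := χ) (g := h) Real.continuous_fourierChar
        (by exact continuous_inner) χ.integrable h1
      simp only [smul_eq_mul, flip_innerₗ] at this
      exact this
    simp only [Complex.real_smul]
    simp only [← hχ]
    rw [e1, e2, e3]

/-- Multiplication by an essentially bounded function on `L²`. -/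
def mulL {m : V → ℂ} (hm : MemLp m ⊤ volume) :
    Lp ℂ 2 (volume : Measure V) →L[ℂ] Lp ℂ 2 (volume : Measure V) :=
  (ContinuousLinearMap.mul ℂ ℂ).holderL volume ⊤ 2 2 (hm.toLp m)

theorem mulL_ae {m : V → ℂ} (hm : MemLp m ⊤ volume) (f : Lp ℂ 2 (volume : Measure V)) :
    mulL hm f =ᵐ[volume] fun x => m x * f x := by
  filter_upwards [(ContinuousLinearMap.mul ℂ ℂ).coeFn_holder (r := 2) (hm.toLp m) f,
    hm.coeFn_toLp] with x e1 e2
  simp only [mulL, ContinuousLinearMap.holderL_apply_apply]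
  rw [e1, e2]
  simp

/-- The Fourier multiplier `𝓕 m 𝓕⁻¹` on `L²`. -/
def mult {m : V → ℂ} (hm : MemLp m ⊤ volume) :
    Lp ℂ 2 (volume : Measure V) →L[ℂ] Lp ℂ 2 (volume : Measure V) :=
  (Lp.fourierTransformₗᵢ V ℂ).toContinuousLinearEquiv.toContinuousLinearMap ∘L mulL hm ∘L
    (Lp.fourierTransformₗᵢ V ℂ).symm.toContinuousLinearEquiv.toContinuousLinearMap

theorem mult_apply {m : V → ℂ} (hm : MemLp m ⊤ volume) (f : Lp ℂ 2 (volume : Measure V)) :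
    mult hm f = 𝓕 (mulL hm (𝓕⁻ f)) := rfl

theorem fourierInv_mult_ae {m : V → ℂ} (hm : MemLp m ⊤ volume)
    (f : Lp ℂ 2 (volume : Measure V)) :
    (𝓕⁻ (mult hm f) : Lp ℂ 2 (volume : Measure V)) =ᵐ[volume]
      fun x => m x * (𝓕⁻ f : Lp ℂ 2 (volume : Measure V)) x := by
  rw [mult_apply, fourierInv_fourier_eq]
  exact mulL_ae hm _

theorem inner_fourierInv_eq (f g : Lp ℂ 2 (volume : Measure V)) :
    inner ℂ (𝓕⁻ f : Lp ℂ 2 (volume : Measure V)) (𝓕⁻ g : Lp ℂ 2 (volume : Measure V))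
      = inner ℂ f g :=
  (Lp.fourierTransformₗᵢ V ℂ).symm.inner_map_map f g

theorem inner_mult {m : V → ℂ} (hm : MemLp m ⊤ volume) (f g : Lp ℂ 2 (volume : Measure V)) :
    inner ℂ g (mult hm f) = ∫ ξ, m ξ * inner ℂ ((𝓕⁻ g : Lp ℂ 2 (volume : Measure V)) ξ)
      ((𝓕⁻ f : Lp ℂ 2 (volume : Measure V)) ξ) := by
  rw [← inner_fourierInv_eq, L2.inner_def]
  refine integral_congr_ae ?_
  filter_upwards [fourierInv_mult_ae hm f] with x hx
  rw [hx]
  simp only [RCLike.inner_apply]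
  ring

theorem norm_mult_le {m : V → ℂ} (hm : MemLp m ⊤ volume) {C : ℝ} (hC : ∀ x, ‖m x‖ ≤ C)
    (f : Lp ℂ 2 (volume : Measure V)) : ‖mult hm f‖ ≤ C * ‖f‖ := by
  have e1 : ‖mult hm f‖ = ‖mulL hm (𝓕⁻ f)‖ := (Lp.fourierTransformₗᵢ V ℂ).norm_map _
  have e2 : ‖(𝓕⁻ f : Lp ℂ 2 (volume : Measure V))‖ = ‖f‖ :=
    (Lp.fourierTransformₗᵢ V ℂ).symm.norm_map _
  rw [e1, ← e2]
  refine Lp.norm_le_mul_norm_of_ae_le_mul ?_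
  filter_upwards [mulL_ae hm (𝓕⁻ f)] with x hx
  rw [hx, norm_mul]
  exact mul_le_mul_of_nonneg_right (hC x) (norm_nonneg _)

/-- Multipliers with real symbol are self-adjoint. -/
theorem inner_mult_comm {m : V → ℂ} (hm : MemLp m ⊤ volume)
    (hr : ∀ x, (starRingEnd ℂ) (m x) = m x) (f g : Lp ℂ 2 (volume : Measure V)) :
    inner ℂ g (mult hm f) = inner ℂ (mult hm g) f := by
  rw [← inner_conj_symm (mult hm g), inner_mult, inner_mult, ← integral_conj]
  refine integral_congr_ae (Filter.Eventually.of_forall fun x => ?_)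
  simp only [map_mul, hr, inner_conj_symm]

/-- Two signs. -/
def sg (x : ℝ) : ℝ := if 0 ≤ x then 1 else -1

/-- For equal signs the sum has the common sign, and for opposite signs both sides vanish. With the
value `1` at `0` there is no exceptional point. This is the algebraic core of Cotlar's identity. -/
theorem sg_identity (a b : ℝ) : sg a * sg b + 1 = sg (a + b) * (sg a + sg b) := by
  unfold sg
  split_ifs <;> linarith

theorem norm_sg (x : ℝ) : ‖((sg x : ℝ) : ℂ)‖ = 1 := by
  unfold sg; split_ifs <;> simp

theorem measurable_sg : Measurable sg :=
  Measurable.ite measurableSet_Ici measurable_const measurable_const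

/-- The symbol `sgn(⟨θ, ξ⟩ + s)`. -/
def sgSymbol (θ : V) (s : ℝ) (ξ : V) : ℂ := (sg (inner ℝ θ ξ + s) : ℝ)

theorem measurable_sgSymbol (θ : V) (s : ℝ) : Measurable (sgSymbol θ s) := by
  refine Complex.measurable_ofReal.comp (measurable_sg.comp ?_)
  fun_prop

theorem memLp_sgSymbol (θ : V) (s : ℝ) : MemLp (sgSymbol θ s) ⊤ volume :=
  memLp_top_of_bound (measurable_sgSymbol θ s).aestronglyMeasurable 1
    (Filter.Eventually.of_forall fun _ => (norm_sg _).le)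

/-- A directional Hilbert transform. -/
def hilb (θ : V) (s : ℝ) : Lp ℂ 2 (volume : Measure V) →L[ℂ] Lp ℂ 2 (volume : Measure V) :=
  mult (memLp_sgSymbol θ s)

open Convolution in
/-- The algebraic identity of Cotlar for symbols. -/
theorem sgSymbol_convolution {ψ : V → ℂ} (hψ : Integrable ψ) {K : ℝ} (hK : ∀ x, ‖ψ x‖ ≤ K)
    (θ : V) (s : ℝ) (ξ : V) :
    ((sgSymbol θ s * ψ) ⋆[ContinuousLinearMap.mul ℂ ℂ] (sgSymbol θ s * ψ)) ξ +
      (ψ ⋆[ContinuousLinearMap.mul ℂ ℂ] ψ) ξ =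
    sgSymbol θ (2 * s) ξ * (((sgSymbol θ s * ψ) ⋆[ContinuousLinearMap.mul ℂ ℂ] ψ) ξ +
      (ψ ⋆[ContinuousLinearMap.mul ℂ ℂ] (sgSymbol θ s * ψ)) ξ) := by
  have hmψ : Integrable (sgSymbol θ s * ψ) := by
    refine hψ.mono ((measurable_sgSymbol θ s).aestronglyMeasurable.mul hψ.1) ?_
    refine Filter.Eventually.of_forall fun x => ?_
    simp only [Pi.mul_apply, norm_mul]
    rw [sgSymbol, norm_sg, one_mul]
  have hmK : ∀ x, ‖(sgSymbol θ s * ψ) x‖ ≤ K := fun x => by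
    simp only [Pi.mul_apply, norm_mul]
    rw [sgSymbol, norm_sg, one_mul]
    exact hK x
  have hint : ∀ u v : V → ℂ, Integrable u → Integrable v → (∀ x, ‖v x‖ ≤ K) →
      Integrable fun t => u t * v (ξ - t) := fun u v hu hv hb =>
    hu.mul_bdd (c := K) ((hv.comp_sub_left ξ).1) (Filter.Eventually.of_forall fun t => hb _)
  simp only [MeasureTheory.convolution, ContinuousLinearMap.mul_apply']
  rw [← integral_add (hint _ _ hmψ hmψ hmK) (hint _ _ hψ hψ hK),
    ← integral_add (hint _ _ hmψ hψ hK) (hint _ _ hψ hmψ hmK), ← integral_const_mul]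
  refine integral_congr_ae (Filter.Eventually.of_forall fun t => ?_)
  have h := sg_identity (inner ℝ θ t + s) (inner ℝ θ (ξ - t) + s)
  -- Both factors of the convolution contribute the shift `s`, so the outer sign carries `2 * s`.
  -- The bounds below are therefore proved for all shifts at once.
  have e : inner ℝ θ t + s + (inner ℝ θ (ξ - t) + s) = inner ℝ θ ξ + 2 * s := by
    rw [inner_sub_right]; ring
  rw [e] at h
  have h' : sgSymbol θ s t * sgSymbol θ s (ξ - t) + 1 =
      sgSymbol θ (2 * s) ξ * (sgSymbol θ s t + sgSymbol θ s (ξ - t)) := by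
    simp only [sgSymbol]
    exact_mod_cast h
  simp only [Pi.mul_apply]
  linear_combination (ψ t * ψ (ξ - t)) * h'

open Convolution in
theorem memLp_two_convolution {u v : V → ℂ} (hu : Integrable u) (hv : Integrable v) {K : ℝ}
    (hK : ∀ x, ‖v x‖ ≤ K) : Integrable (u ⋆[ContinuousLinearMap.mul ℂ ℂ] v) ∧
      MemLp (u ⋆[ContinuousLinearMap.mul ℂ ℂ] v) 2 := by
  have h1 : Integrable (u ⋆[ContinuousLinearMap.mul ℂ ℂ] v) := hu.integrable_convolution _ hv
  refine ⟨h1, ?_⟩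
  have hb : ∀ x, ‖(u ⋆[ContinuousLinearMap.mul ℂ ℂ] v) x‖ ≤ (∫ t, ‖u t‖) * K := by
    intro x
    simp only [MeasureTheory.convolution, ContinuousLinearMap.mul_apply']
    refine (norm_integral_le_integral_norm _).trans ?_
    rw [← integral_mul_const]
    refine integral_mono_of_nonneg (Filter.Eventually.of_forall fun t => norm_nonneg _)
      (hu.norm.mul_const K) (Filter.Eventually.of_forall fun t => ?_)
    simp only [norm_mul]
    exact mul_le_mul_of_nonneg_left (hK _) (norm_nonneg _)
  exact memLp_of_ae_bound (by norm_num) (by norm_num) (by norm_num) (memLp_one_iff_integrable.2 h1)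
    (Filter.Eventually.of_forall hb)

end multiplier

/-! ### Approximation by test functions in two Lebesgue norms at once -/

section smoothApprox

variable {V : Type*} [NormedAddCommGroup V] [InnerProductSpace ℝ V] [FiniteDimensional ℝ V]
  [MeasurableSpace V] [BorelSpace V]

/-- Approximation in `L¹` followed by truncation at height `K`. For functions bounded by `2 * K`,
smallness in `L¹` forces smallness in every `L^p` with finite `p`, so a single approximant serves
both norms. -/
theorem exists_continuous_approx {p q : ℝ≥0∞} (hp1 : 1 ≤ p) (hp : p ≠ ⊤) (hq1 : 1 ≤ q) (hq : q ≠ ⊤)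
    {f : V → ℂ} (hf : MemLp f 1 (volume : Measure V)) {K : ℝ} (hK : ∀ x, ‖f x‖ ≤ K) {ε : ℝ≥0∞}
    (hε : 0 < ε) : ∃ g : V → ℂ, Continuous g ∧ HasCompactSupport g ∧
      eLpNorm (g - f) p volume < ε ∧ eLpNorm (g - f) q volume < ε := by
  wlog hK0 : 0 < K generalizing K
  · exact this (K := max K 1) (fun x => (hK x).trans (le_max_left _ _)) (by positivity)
  have hsmall : ∀ p : ℝ≥0∞, 1 ≤ p → p ≠ ⊤ → Filter.Tendsto (fun η : ℝ≥0∞ =>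
      (ENNReal.ofReal (2 * K) ^ (p.toReal - 1) * (2 * η)) ^ (1 / p.toReal)) (nhds 0) (nhds 0) := by
    intro p hp1 hp
    have hpt : 1 ≤ p.toReal := by simpa using ENNReal.toReal_mono hp hp1
    have h1 : Filter.Tendsto (fun η : ℝ≥0∞ => ENNReal.ofReal (2 * K) ^ (p.toReal - 1) * (2 * η))
        (nhds 0) (nhds 0) := by
      have := ENNReal.Tendsto.const_mul (a := ENNReal.ofReal (2 * K) ^ (p.toReal - 1))
        (ENNReal.Tendsto.const_mul (a := 2) (Filter.tendsto_id (x := nhds (0 : ℝ≥0∞)))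
          (Or.inr (by norm_num)))
        (Or.inr (ENNReal.rpow_ne_top_of_nonneg (by linarith) ENNReal.ofReal_ne_top))
      simpa using this
    have h2 := ((ENNReal.continuous_rpow_const (y := 1 / p.toReal)).tendsto 0).comp h1
    rw [ENNReal.zero_rpow_of_pos (by positivity)] at h2
    exact h2
  obtain ⟨η, ⟨hη1, hη2⟩, hη⟩ : ∃ η : ℝ≥0∞, ((ENNReal.ofReal (2 * K) ^ (p.toReal - 1) * (2 * η)) ^
      (1 / p.toReal) < ε ∧ (ENNReal.ofReal (2 * K) ^ (q.toReal - 1) * (2 * η)) ^ (1 / q.toReal) < ε)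
      ∧ 0 < η := by
    have h1 := (((hsmall p hp1 hp).eventually (gt_mem_nhds hε)).and
      ((hsmall q hq1 hq).eventually (gt_mem_nhds hε))).filter_mono
        (nhdsWithin_le_nhds (s := Set.Ioi (0 : ℝ≥0∞)))
    obtain ⟨η, h2, h3⟩ := (h1.and self_mem_nhdsWithin).exists
    exact ⟨η, h2, h3⟩
  obtain ⟨g, hgc, hg1, hgcont, hgm⟩ := hf.exists_hasCompactSupport_eLpNorm_sub_le (by norm_num) hη.ne'
  -- Radial retraction onto the ball of radius `K`. It moves `v` by no more than the distance of `v`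
  -- to any point of this ball, so the `L¹`-error at most doubles.
  let cl : ℂ → ℂ := fun v => ((K / max K ‖v‖ : ℝ) : ℂ) * v
  have hcl : Continuous cl := by
    refine (Complex.continuous_ofReal.comp (continuous_const.div (by fun_prop) fun v => ?_)).mul
      continuous_id
    exact (lt_max_of_lt_left hK0).ne'
  have hcl0 : cl 0 = 0 := by simp [cl]
  have hclK : ∀ v, ‖cl v‖ ≤ K := fun v => by
    have : 0 < max K ‖v‖ := lt_max_of_lt_left hK0
    simp only [cl]
    rw [norm_mul, Complex.norm_real, Real.norm_of_nonneg (by positivity), div_mul_eq_mul_div,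
      div_le_iff₀ this]
    exact mul_le_mul_of_nonneg_left (le_max_right _ _) hK0.le
  have hcld : ∀ v w : ℂ, ‖w‖ ≤ K → ‖cl v - v‖ ≤ ‖v - w‖ := fun v w hw => by
    rcases le_total ‖v‖ K with h | h
    · have : cl v = v := by simp [cl, max_eq_left h, hK0.ne']
      simp [this]
    · have hv : 0 < ‖v‖ := hK0.trans_le h
      have : cl v - v = ((K / ‖v‖ - 1 : ℝ) : ℂ) * v := by simp [cl, max_eq_right h, sub_mul]
      rw [this, norm_mul, Complex.norm_real, Real.norm_eq_abs, abs_sub_comm,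
        abs_of_nonneg (by rw [sub_nonneg, div_le_one hv]; exact h), sub_mul,
        div_mul_cancel₀ _ hv.ne', one_mul]
      linarith [norm_sub_norm_le v w]
  have hgm' : AEStronglyMeasurable (cl ∘ g - f) volume :=
    (hcl.comp hgcont).aestronglyMeasurable.sub hf.1
  have hb : ∀ᵐ x, ‖(cl ∘ g - f) x‖ ≤ 2 * K := Filter.Eventually.of_forall fun x => by
    refine (norm_sub_le _ _).trans ?_
    have := hclK (g x)
    simp only [Function.comp_apply]
    linarith [hK x]
  have h1 : eLpNorm (cl ∘ g - f) 1 volume ≤ 2 * η := by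
    calc eLpNorm (cl ∘ g - f) 1 volume ≤ eLpNorm ((2 : ℂ) • (f - g)) 1 volume := by
          refine eLpNorm_mono fun x => ?_
          have a1 := hcld (g x) (f x) (hK x)
          have a2 : ‖g x - f x‖ = ‖f x - g x‖ := norm_sub_rev _ _
          have a3 : (cl ∘ g - f) x = (cl (g x) - g x) + (g x - f x) := by simp
          rw [a3, Pi.smul_apply, norm_smul, Pi.sub_apply]
          refine (norm_add_le _ _).trans ?_
          simp only [Complex.norm_ofNat]
          linarith
      _ = 2 * eLpNorm (f - g) 1 volume := by
          rw [eLpNorm_const_smul]; simp [enorm_eq_nnnorm]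
      _ ≤ _ := by gcongr
  refine ⟨cl ∘ g, hcl.comp hgcont, hgc.comp_left hcl0, ?_, ?_⟩
  · refine (eLpNorm_le_of_ae_bound hp1 hp hgm' hb).trans_lt (lt_of_le_of_lt ?_ hη1)
    gcongr
  · refine (eLpNorm_le_of_ae_bound hq1 hq hgm' hb).trans_lt (lt_of_le_of_lt ?_ hη2)
    gcongr

/-- Uniform approximation without enlarging the support: the support has finite measure, so a small
uniform error is small in each `L^p`. -/
theorem exists_smooth_approx_of_continuous {p q : ℝ≥0∞} (hp : p ≠ ⊤) (hq : q ≠ ⊤)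
    {f : V → ℂ} (hf : Continuous f) (hfc : HasCompactSupport f) {ε : ℝ≥0∞}
    (hε : 0 < ε) : ∃ g : V → ℂ, ContDiff ℝ ∞ g ∧ HasCompactSupport g ∧
      eLpNorm (g - f) p volume < ε ∧ eLpNorm (g - f) q volume < ε := by
  have hsmall : ∀ p : ℝ≥0∞, p ≠ ⊤ → Filter.Tendsto (fun c : ℝ => ENNReal.ofReal c *
      (volume (tsupport f)) ^ (1 / p.toReal)) (nhds 0) (nhds 0) := by
    intro p hp
    have h1 := ENNReal.Tendsto.mul_const (b := (volume (tsupport f)) ^ (1 / p.toReal))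
      (ENNReal.continuous_ofReal.tendsto 0)
      (Or.inr (ENNReal.rpow_ne_top_of_nonneg (by positivity) hfc.measure_lt_top.ne))
    simpa using h1
  obtain ⟨c, ⟨hc1, hc2⟩, hc⟩ := ((((hsmall p hp).eventually (gt_mem_nhds hε)).and
      ((hsmall q hq).eventually (gt_mem_nhds hε))).filter_mono
        (nhdsWithin_le_nhds (s := Set.Ioi (0 : ℝ))) |>.and self_mem_nhdsWithin).exists
  have hc : 0 < c := hc
  obtain ⟨g, hg₁, hg₂, hg₃⟩ := hf.exists_contDiff_approx ⊤ (ε := fun _ ↦ c) (by fun_prop)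
    (by intro; positivity)
  refine ⟨g, hg₁, hfc.mono hg₃, ?_, ?_⟩
  · exact (eLpNorm_sub_le_of_dist_bdd _ hp hfc.measurableSet hc.le (fun x => (hg₂ x).le)
      (hg₃.trans (subset_tsupport f)) (subset_tsupport f)).trans_lt hc1
  · exact (eLpNorm_sub_le_of_dist_bdd _ hq hfc.measurableSet hc.le (fun x => (hg₂ x).le)
      (hg₃.trans (subset_tsupport f)) (subset_tsupport f)).trans_lt hc2

/-- Simultaneous approximation by test functions in `L^p` and `L^q`. -/
theorem exists_smooth_tendsto {p q : ℝ≥0∞} (hp1 : 1 ≤ p) (hp : p ≠ ⊤) (hq1 : 1 ≤ q) (hq : q ≠ ⊤)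
    {f : V → ℂ} (hfp : MemLp f p volume) (hfq : MemLp f q volume) :
    ∃ s : ℕ → V → ℂ, (∀ k, ContDiff ℝ ∞ (s k)) ∧ (∀ k, HasCompactSupport (s k)) ∧
      Filter.Tendsto (fun k => eLpNorm (s k - f) p volume) Filter.atTop (nhds 0) ∧
      Filter.Tendsto (fun k => eLpNorm (s k - f) q volume) Filter.atTop (nhds 0) := by
  obtain ⟨t, ht, htp, htq⟩ := exists_simpleFunc_tendsto hp hq hfp hfq
  have hex : ∀ k : ℕ, ∃ g : V → ℂ, ContDiff ℝ ∞ g ∧ HasCompactSupport g ∧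
      eLpNorm (g - ⇑(t k)) p volume ≤ (k : ℝ≥0∞)⁻¹ + (k : ℝ≥0∞)⁻¹ ∧
      eLpNorm (g - ⇑(t k)) q volume ≤ (k : ℝ≥0∞)⁻¹ + (k : ℝ≥0∞)⁻¹ := by
    intro k
    -- In `ℝ≥0∞` the inverse of `0` is `⊤`, so `k = 0` needs no separate treatment.
    have hk : (0 : ℝ≥0∞) < (k : ℝ≥0∞)⁻¹ := by simp
    have h1 : MemLp (t k) 1 (volume : Measure V) :=
      SimpleFunc_memLp (lt_of_lt_of_le zero_lt_one hp1).ne' hp (ht k)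
    obtain ⟨K, hK⟩ := (t k).exists_forall_norm_le
    obtain ⟨g, g1, g2, g3, g4⟩ := exists_continuous_approx hp1 hp hq1 hq h1 hK hk
    obtain ⟨g', g1', g2', g3', g4'⟩ := exists_smooth_approx_of_continuous hp hq g1 g2 hk
    have e : g' - ⇑(t k) = (g' - g) + (g - ⇑(t k)) := by simp
    refine ⟨g', g1', g2', ?_, ?_⟩
    · rw [e]
      exact (eLpNorm_add_le (g1'.continuous.sub g1).aestronglyMeasurable
        (g1.aestronglyMeasurable.sub h1.1) hp1).trans (add_le_add g3'.le g3.le)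
    · rw [e]
      exact (eLpNorm_add_le (g1'.continuous.sub g1).aestronglyMeasurable
        (g1.aestronglyMeasurable.sub h1.1) hq1).trans (add_le_add g4'.le g4.le)
  choose g g1 g2 g3 g4 using hex
  have hlim : ∀ r : ℝ≥0∞, 1 ≤ r →
      Filter.Tendsto (fun k => eLpNorm (⇑(t k) - f) r volume) Filter.atTop (nhds 0) →
      (∀ k : ℕ, eLpNorm (g k - ⇑(t k)) r volume ≤ (k : ℝ≥0∞)⁻¹ + (k : ℝ≥0∞)⁻¹) →
      Filter.Tendsto (fun k => eLpNorm (g k - f) r volume) Filter.atTop (nhds 0) := by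
    intro r hr h1 h2
    have h3 : Filter.Tendsto (fun k : ℕ => ((k : ℝ≥0∞)⁻¹ + (k : ℝ≥0∞)⁻¹) +
        eLpNorm (⇑(t k) - f) r volume) Filter.atTop (nhds 0) := by
      have := ((ENNReal.tendsto_inv_nat_nhds_zero.add ENNReal.tendsto_inv_nat_nhds_zero).add h1)
      simpa using this
    refine tendsto_of_tendsto_of_tendsto_of_le_of_le tendsto_const_nhds h3 (fun _ => zero_le)
      fun k => ?_
    have e : g k - f = (g k - ⇑(t k)) + (⇑(t k) - f) := by simp
    simp only
    rw [e]
    exact (eLpNorm_add_le ((g1 k).continuous.aestronglyMeasurable.sub (ht k).1)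
      ((ht k).1.sub hfp.1) hr).trans (add_le_add (h2 k) le_rfl)
  exact ⟨g, g1, g2, hlim p hp1 htp g3, hlim q hq1 htq g4⟩

end smoothApprox

/-! ### Bounds of directional Hilbert transforms by Cotlar's identity -/

section cotlar

open FourierTransform SchwartzMap

variable {V : Type*} [NormedAddCommGroup V] [InnerProductSpace ℝ V] [FiniteDimensional ℝ V]
  [MeasurableSpace V] [BorelSpace V]

open Convolution in
/-- Cotlar's identity `(H f)² + f² = 2 H (f H f)`. -/
theorem hilb_cotlar (θ : V) (s : ℝ) (f : 𝓢(V, ℂ)) : ∃ (g : V → ℂ) (h : Lp ℂ 2 (volume : Measure V)),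
    (hilb θ s (f.toLp 2) =ᵐ[volume] g) ∧ (∃ K : ℝ, ∀ x, ‖g x‖ ≤ K) ∧
    (h =ᵐ[volume] fun x => 2 * (f x * g x)) ∧
    (hilb θ (2 * s) h =ᵐ[volume] fun x => g x * g x + f x * f x) := by
  -- Under `𝓕` products become convolutions of `ψ` and `m * ψ`. The latter is not smooth, but it is
  -- integrable and bounded, so all four convolutions lie in `L¹ ∩ L²` and the identity for symbols
  -- can be applied pointwise.
  let ψ : 𝓢(V, ℂ) := 𝓕⁻ f
  have hψ : 𝓕 ψ = f := by simp [ψ]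
  have hψ' : ∀ x, 𝓕 (ψ : V → ℂ) x = f x := fun x => by
    rw [← SchwartzMap.fourier_coe, hψ]
  set m := sgSymbol θ s with hm
  obtain ⟨K, hK⟩ : ∃ K : ℝ, ∀ x, ‖ψ x‖ ≤ K := by
    obtain ⟨K, -, hK⟩ := ψ.decay 0 0
    exact ⟨K, fun x => by simpa using hK x⟩
  have hi : Integrable ψ := ψ.integrable
  have hmb : ∀ x, ‖(m * ⇑ψ) x‖ ≤ ‖ψ x‖ := fun x => by
    simp only [Pi.mul_apply, norm_mul]
    rw [hm, sgSymbol, norm_sg, one_mul]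
  have hmm : AEStronglyMeasurable (m * ⇑ψ) volume :=
    (measurable_sgSymbol θ s).aestronglyMeasurable.mul hi.1
  have hmi : Integrable (m * ⇑ψ) := hi.mono hmm (Filter.Eventually.of_forall hmb)
  have hm2 : MemLp (m * ⇑ψ) 2 := (ψ.memLp 2).mono hmm (Filter.Eventually.of_forall hmb)
  have hmK : ∀ x, ‖(m * ⇑ψ) x‖ ≤ K := fun x => (hmb x).trans (hK x)
  let g : V → ℂ := 𝓕 (m * ⇑ψ)
  have hg : hilb θ s (f.toLp 2) =ᵐ[volume] g := by
    have e : hilb θ s (f.toLp 2) = 𝓕 (hm2.toLp (m * ⇑ψ)) := by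
      rw [hilb, mult_apply, SchwartzMap.toLp_fourierInv_eq]
      congr 1
      refine Lp.ext ?_
      filter_upwards [mulL_ae (memLp_sgSymbol θ s) ((𝓕⁻ f).toLp 2), hm2.coeFn_toLp,
        (𝓕⁻ f).coeFn_toLp 2 volume] with x e1 e2 e3
      rw [e1, e2, e3]
      rfl
    rw [e]
    exact fourier_toLp_ae hmi hm2
  obtain ⟨w1, w2⟩ := memLp_two_convolution hmi hmi hmK
  obtain ⟨x1, x2⟩ := memLp_two_convolution hi hi hK
  obtain ⟨y1, y2⟩ := memLp_two_convolution hmi hi hK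
  obtain ⟨z1, z2⟩ := memLp_two_convolution hi hmi hmK
  have hw := fourier_toLp_ae w1 w2
  have hx := fourier_toLp_ae x1 x2
  have hy := fourier_toLp_ae y1 y2
  have hz := fourier_toLp_ae z1 z2
  let h : Lp ℂ 2 (volume : Measure V) := 𝓕 (y2.toLp _ + z2.toLp _)
  refine ⟨g, h, hg, ⟨∫ x, ‖(m * ⇑ψ) x‖, fun x => ?_⟩, ?_, ?_⟩
  · exact VectorFourier.norm_fourierIntegral_le_integral_norm _ _ _ _ _
  · have e : h = 𝓕 (y2.toLp _) + 𝓕 (z2.toLp _) := FourierAdd.fourier_add _ _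
    rw [e]
    filter_upwards [Lp.coeFn_add (𝓕 (y2.toLp _)) (𝓕 (z2.toLp _)), hy, hz] with x a1 a2 a3
    rw [a1, Pi.add_apply, a2, a3, Real.fourier_mul_convolution_eq hmi hi,
      Real.fourier_mul_convolution_eq hi hmi, hψ']
    simp only [g]
    ring
  · have e : hilb θ (2 * s) h = 𝓕 (w2.toLp _) + 𝓕 (x2.toLp _) := by
      rw [hilb, mult_apply, fourierInv_fourier_eq, ← FourierAdd.fourier_add]
      congr 1
      refine Lp.ext ?_
      filter_upwards [mulL_ae (memLp_sgSymbol θ (2 * s)) (y2.toLp _ + z2.toLp _),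
        Lp.coeFn_add (y2.toLp _) (z2.toLp _), Lp.coeFn_add (w2.toLp _) (x2.toLp _),
        y2.coeFn_toLp, z2.coeFn_toLp, w2.coeFn_toLp, x2.coeFn_toLp] with x a1 a2 a3 a4 a5 a6 a7
      rw [a1, a2, a3, Pi.add_apply, Pi.add_apply, a4, a5, a6, a7,
        sgSymbol_convolution hi hK θ s x]
    rw [e]
    filter_upwards [Lp.coeFn_add (𝓕 (w2.toLp _)) (𝓕 (x2.toLp _)), hw, hx] with x a1 a2 a3
    rw [a1, Pi.add_apply, a2, a3, Real.fourier_mul_convolution_eq hmi hmi,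
      Real.fourier_mul_convolution_eq hi hi, hψ']

theorem eLpNorm_mul_ex_le {α : Type*} [MeasurableSpace α] {μ : Measure α} {r : ℝ} (hr : 0 < r)
    {u v : α → ℂ} (hu : AEStronglyMeasurable u μ) (hv : AEStronglyMeasurable v μ) :
    eLpNorm (fun x => u x * v x) (ex r) μ ≤
      eLpNorm u (ex (r / 2)) μ * eLpNorm v (ex (r / 2)) μ := by
  have : ENNReal.HolderTriple (ex (r / 2)) (ex (r / 2)) (ex r) := by
    refine ⟨?_⟩
    rw [ex, ex, ← ENNReal.ofReal_inv_of_pos (by positivity), ← ENNReal.ofReal_inv_of_pos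
      (by positivity), ← ENNReal.ofReal_add (by positivity) (by positivity)]
    congr 1
    field_simp
    ring
  have h := eLpNorm_smul_le_mul_eLpNorm (p := ex (r / 2)) (q := ex (r / 2)) (r := ex r) hv hu
  have e : (fun x => u x * v x) = u • v := rfl
  rw [e]
  exact h

theorem eLpNorm_mul_self_ex {α : Type*} [MeasurableSpace α] {μ : Measure α} {r : ℝ} (hr : 0 < r)
    (u : α → ℂ) : eLpNorm (fun x => u x * u x) (ex r) μ = eLpNorm u (ex (r / 2)) μ ^ 2 := by
  rw [eLpNorm_ex hr, eLpNorm_ex (by positivity), ← ENNReal.rpow_natCast, ← ENNReal.rpow_mul]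
  congr 1
  · refine lintegral_congr fun x => ?_
    rw [enorm_mul, ← sq, ← ENNReal.rpow_natCast, ← ENNReal.rpow_mul]
    congr 1
    field_simp
    norm_num
  · push_cast; ring

/-- Cotlar's identity doubles the exponent. With `x` and `y` the norms of `Hf` and `f` in `L^{2/r}`,
the bound in `L^{1/r}` gives `x² ≤ 2C x y + y²`, hence `x ≤ (2C + 1) y`. That `x` is finite is known
beforehand: `Hf` lies in `L²`, is bounded, and `2 / r ≥ 2`. -/
theorem hilb_schwartz_bound {r C : ℝ} (hr : 0 < r) (hr1 : r ≤ 1 / 2) (hC : 0 ≤ C)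
    (hH : ∀ (θ : V) (s : ℝ), OpBdd (hilb θ s) r C) (θ : V) (s : ℝ) (f : 𝓢(V, ℂ)) :
    MemLp (hilb θ s (f.toLp 2)) (ex (r / 2)) volume ∧
    (eLpNorm (hilb θ s (f.toLp 2)) (ex (r / 2)) volume).toReal ≤
      (2 * C + 1) * (eLpNorm f (ex (r / 2)) volume).toReal := by
  obtain ⟨g, h, hg, ⟨K, hK⟩, hh, hHh⟩ := hilb_cotlar θ s f
  have h2le : ∀ ρ : ℝ, 0 < ρ → ρ ≤ 1 / 2 → 2 ≤ ex ρ := by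
    intro ρ h0 h1
    rw [← ex_half]
    exact ENNReal.ofReal_le_ofReal (inv_anti₀ h0 h1)
  have hg2 : MemLp g 2 volume := (memLp_congr_ae hg).1 (Lp.memLp _)
  have hgq : MemLp g (ex (r / 2)) volume := memLp_of_ae_bound (by norm_num)
    (h2le _ (by positivity) (by linarith)) (ex_ne_top _) hg2 (Filter.Eventually.of_forall hK)
  have hfq : MemLp f (ex (r / 2)) volume := f.memLp _ _
  refine ⟨(memLp_congr_ae hg).2 hgq, ?_⟩
  rw [eLpNorm_congr_ae hg]
  have hhr : eLpNorm h (ex r) volume ≤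
      2 * (eLpNorm f (ex (r / 2)) volume * eLpNorm g (ex (r / 2)) volume) := by
    rw [eLpNorm_congr_ae hh]
    calc eLpNorm (fun x => 2 * (f x * g x)) (ex r) volume
        = 2 * eLpNorm (fun x => f x * g x) (ex r) volume := by
          have := eLpNorm_const_smul (2 : ℂ) (fun x => f x * g x) (ex r) (volume : Measure V)
          rw [show ‖(2 : ℂ)‖ₑ = 2 by simp [enorm_eq_nnnorm]] at this
          exact this
      _ ≤ _ := by
          gcongr
          exact eLpNorm_mul_ex_le hr hfq.1 hgq.1
  have hhm : MemLp h (ex r) volume := ⟨(Lp.memLp h).1, hhr.trans_lt (ENNReal.mul_lt_top (by simp)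
    (ENNReal.mul_lt_top hfq.2 hgq.2))⟩
  obtain ⟨-, hb⟩ := hH θ (2 * s) h hhm
  rw [eLpNorm_congr_ae hHh] at hb
  have hsum : eLpNorm (fun x => g x * g x) (ex r) volume ≤
      eLpNorm (fun x => g x * g x + f x * f x) (ex r) volume +
        eLpNorm (fun x => f x * f x) (ex r) volume := by
    have e : (fun x => g x * g x) = (fun x => g x * g x + f x * f x) - fun x => f x * f x := by
      ext x; simp
    calc _ = eLpNorm ((fun x => g x * g x + f x * f x) - fun x => f x * f x) (ex r) volume := by
          rw [← e]
      _ ≤ _ := eLpNorm_sub_le ((hgq.1.mul hgq.1).add (hfq.1.mul hfq.1)) (hfq.1.mul hfq.1)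
          (one_le_ex hr (by linarith))
  rw [eLpNorm_mul_self_ex hr, eLpNorm_mul_self_ex hr] at hsum
  set x := (eLpNorm g (ex (r / 2)) volume).toReal with hx
  set y := (eLpNorm f (ex (r / 2)) volume).toReal with hy
  have hx0 : 0 ≤ x := ENNReal.toReal_nonneg
  have hy0 : 0 ≤ y := ENNReal.toReal_nonneg
  have hhr' : (eLpNorm h (ex r) volume).toReal ≤ 2 * (y * x) := by
    have := ENNReal.toReal_mono (ENNReal.mul_ne_top (by simp)
      (ENNReal.mul_ne_top hfq.2.ne hgq.2.ne)) hhr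
    simpa [ENNReal.toReal_mul] using this
  have hfin : eLpNorm (fun x => g x * g x + f x * f x) (ex r) volume ≠ ⊤ := by
    rw [← eLpNorm_congr_ae hHh]
    exact (hH θ (2 * s) h hhm).1.2.ne
  have hsum' : x ^ 2 ≤ C * (2 * (y * x)) + y ^ 2 := by
    have h1 := ENNReal.toReal_mono (ENNReal.add_ne_top.2 ⟨hfin, ENNReal.pow_ne_top hfq.2.ne⟩) hsum
    rw [ENNReal.toReal_add hfin (ENNReal.pow_ne_top hfq.2.ne), ENNReal.toReal_pow,
      ENNReal.toReal_pow] at h1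
    refine h1.trans ?_
    gcongr
    exact hb.trans (mul_le_mul_of_nonneg_left hhr' hC)
  -- If `x > (2C + 1) y`, then also `x > y`, and `x²` exceeds `2C x y + y²`.
  by_contra! hcon
  have h3 : y < x := lt_of_le_of_lt (by nlinarith) hcon
  nlinarith [mul_nonneg hC hy0]

/-- `L^p` bounds of the directional Hilbert transforms, uniformly in the direction. -/
theorem hilb_opBdd_half {r C : ℝ} (hr : 0 < r) (hr1 : r ≤ 1 / 2) (hC : 0 ≤ C)
    (hH : ∀ (θ : V) (s : ℝ), OpBdd (hilb θ s) r C) (θ : V) (s : ℝ) :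
    OpBdd (hilb θ s) (r / 2) (2 * C + 1) := by
  refine FormBdd.opBdd (by positivity) (by linarith) (by positivity) fun f g hf hg => ?_
  obtain ⟨u, u1, u2, u3, u4⟩ := exists_smooth_tendsto (by norm_num) (by norm_num)
    (one_le_ex (by positivity) (by linarith)) (ex_ne_top (r / 2)) (Lp.memLp f) hf
  let U : ℕ → 𝓢(V, ℂ) := fun k => (u2 k).toSchwartzMap (u1 k)
  have hU : ∀ k, ⇑(U k) = u k := fun k => rfl
  have hU2 : ∀ k, MemLp (u k) 2 (volume : Measure V) := fun k => by
    rw [← hU k]; exact (U k).memLp 2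
  have hUr : ∀ k, MemLp (u k) (ex (r / 2)) (volume : Measure V) := fun k => by
    rw [← hU k]; exact (U k).memLp _
  have l1 := tendsto_toLp_of_eLpNorm f hU2 u3
  have l2 := tendsto_toReal_eLpNorm (one_le_ex (by positivity) (by linarith)) hf hUr u4
  refine le_of_tendsto_of_tendsto' ((tendsto_const_nhds.inner
    (((hilb θ s).continuous.tendsto _).comp l1)).norm)
    ((tendsto_const_nhds.mul l2).mul tendsto_const_nhds) fun k => ?_
  obtain ⟨b1, b2⟩ := hilb_schwartz_bound hr hr1 hC hH θ s (U k)
  refine (norm_inner_le_eLpNorm (by positivity) (by linarith) g _ hg b1).trans ?_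
  exact mul_le_mul_of_nonneg_right b2 ENNReal.toReal_nonneg

/-- Induction on the exponents `2, 4, 8, …`. It starts from `L²`, where the symbol has modulus one,
and every doubling preserves uniformity in direction and shift. -/
theorem hilb_opBdd (k : ℕ) : ∃ C : ℝ, 0 ≤ C ∧ ∀ (θ : V) (s : ℝ),
    OpBdd (hilb θ s) ((1 / 2) ^ (k + 1)) C := by
  induction k with
  | zero =>
    refine ⟨1, zero_le_one, fun θ s f _ => ?_⟩
    simp only [zero_add, pow_one, ex_half]
    exact ⟨Lp.memLp _, norm_mult_le (memLp_sgSymbol θ s) (fun x => (norm_sg _).le) f⟩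
  | succ k ih =>
    obtain ⟨C, hC, h⟩ := ih
    refine ⟨2 * C + 1, by positivity, fun θ s => ?_⟩
    have := hilb_opBdd_half (by positivity) (by
      rw [pow_succ]
      have : ((1 : ℝ) / 2) ^ k ≤ 1 := pow_le_one₀ (by norm_num) (by norm_num)
      linarith) hC h θ s
    rw [pow_succ _ (k + 1)]
    convert this using 1
    ring

end cotlar

/-! ### Inhomogeneous Riesz transforms -/

section average

variable {W : Type*} [NormedAddCommGroup W] [InnerProductSpace ℝ W] [FiniteDimensional ℝ W]
  [MeasurableSpace W] [BorelSpace W]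

theorem setIntegral_ball_comp_isometry (L : W ≃ₗᵢ[ℝ] W) (f : W → ℝ) :
    ∫ om in Metric.ball (0 : W) 1, f (L om) = ∫ om in Metric.ball (0 : W) 1, f om := by
  have h := L.measurePreserving.setIntegral_preimage_emb L.toHomeomorph.measurableEmbedding f
    (Metric.ball (0 : W) 1)
  rw [← h]
  congr 2
  ext om
  simp

theorem integrableOn_ball_of_bound {f : W → ℝ} (hf : Measurable f) {K : ℝ}
    (hK : ∀ om ∈ Metric.ball (0 : W) 1, ‖f om‖ ≤ K) : IntegrableOn f (Metric.ball (0 : W) 1) :=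
  Measure.integrableOn_of_bounded (M := K) measure_ball_lt_top.ne hf.aestronglyMeasurable
    (by filter_upwards [ae_restrict_mem measurableSet_ball] with om hom using hK om hom)

theorem abs_sg (x : ℝ) : |sg x| = 1 := by
  unfold sg; split_ifs <;> simp

theorem mul_sg_self (x : ℝ) : x * sg x = |x| := by
  unfold sg
  split_ifs with h
  · simp [abs_of_nonneg h]
  · rw [abs_of_neg (not_le.1 h)]; ring

theorem norm_inner_mul_sg_le (w ζ : W) {om : W} (hom : om ∈ Metric.ball (0 : W) 1) :
    ‖inner ℝ om w * sg (inner ℝ om ζ)‖ ≤ ‖w‖ := by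
  rw [norm_mul, Real.norm_eq_abs (sg _), abs_sg, mul_one]
  refine (norm_inner_le_norm _ _).trans ?_
  rw [mem_ball_zero_iff] at hom
  exact mul_le_of_le_one_left (norm_nonneg _) hom.le

theorem integrableOn_inner_mul_sg (w ζ : W) :
    IntegrableOn (fun om => inner ℝ om w * sg (inner ℝ om ζ)) (Metric.ball (0 : W) 1) := by
  refine integrableOn_ball_of_bound ?_ (fun om hom => norm_inner_mul_sg_le w ζ hom)
  exact (by fun_prop : Measurable fun om : W => inner ℝ om w).mul
    (measurable_sg.comp (by fun_prop))

/-- The average of `om sgn⟨om, ζ⟩` over the unit ball points in the direction of `ζ`. -/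
theorem exists_average_sg (e : W) (he : ‖e‖ = 1) : ∃ c : ℝ, 0 < c ∧ ∀ w ζ : W, ζ ≠ 0 →
    ∫ om in Metric.ball (0 : W) 1, inner ℝ om w * sg (inner ℝ om ζ) =
      c * (inner ℝ ζ w / ‖ζ‖) := by
  let c : ℝ := ∫ om in Metric.ball (0 : W) 1, |inner ℝ om e|
  have hci : IntegrableOn (fun om => |inner ℝ om e|) (Metric.ball (0 : W) 1) := by
    have := integrableOn_inner_mul_sg e e
    simpa only [mul_sg_self] using this
  refine ⟨c, ?_, fun w ζ hζ => ?_⟩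
  · refine (integral_pos_iff_support_of_nonneg (fun om => abs_nonneg _) hci).2 ?_
    have hopen : IsOpen ({om : W | 0 < |inner ℝ om e|} ∩ Metric.ball 0 1) :=
      (isOpen_lt continuous_const (by fun_prop)).inter Metric.isOpen_ball
    have hne : ({om : W | 0 < |inner ℝ om e|} ∩ Metric.ball 0 1).Nonempty := by
      refine ⟨(1 / 2 : ℝ) • e, ?_, ?_⟩
      · simp only [Set.mem_ofPred_eq]
        rw [inner_smul_left, real_inner_self_eq_norm_sq, he]
        norm_num
      · rw [mem_ball_zero_iff, norm_smul, he]; norm_num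
    have hpos := hopen.measure_pos volume hne
    rw [Measure.restrict_apply' measurableSet_ball]
    refine hpos.trans_le (measure_mono (Set.inter_subset_inter_left _ fun om hom => ?_))
    exact (show 0 < |inner ℝ om e| from hom).ne'
  · have hζn : 0 < ‖ζ‖ := norm_pos_iff.2 hζ
    have hpar : ∫ om in Metric.ball (0 : W) 1, inner ℝ om ζ * sg (inner ℝ om ζ) = ‖ζ‖ * c := by
      simp only [mul_sg_self]
      have hn : ‖‖ζ‖⁻¹ • ζ‖ = ‖e‖ := by
        rw [norm_smul, norm_inv, norm_norm, inv_mul_cancel₀ hζn.ne', he]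
      -- A reflection takes `ζ / ‖ζ‖` to `e` and preserves the ball, so the integral depends on `ζ`
      -- only through `‖ζ‖`.
      have hr := Submodule.reflection_sub hn
      set L := (Submodule.span ℝ {‖ζ‖⁻¹ • ζ - e})ᗮ.reflection with hL
      have h1 := setIntegral_ball_comp_isometry L (fun om => |inner ℝ om e|)
      simp only [c]
      rw [← h1, ← integral_const_mul]
      refine integral_congr_ae (Filter.Eventually.of_forall fun om => ?_)
      simp only
      rw [← hr, L.inner_map_map, inner_smul_right, abs_mul, abs_of_pos (inv_pos.2 hζn),
        mul_inv_cancel_left₀ hζn.ne']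
    -- The reflection in the hyperplane orthogonal to `v` fixes `ζ`, preserves the ball and changes
    -- the sign of the integrand.
    have hperp : ∀ v : W, inner ℝ ζ v = 0 →
        ∫ om in Metric.ball (0 : W) 1, inner ℝ om v * sg (inner ℝ om ζ) = 0 := by
      intro v hv
      set L := (Submodule.span ℝ {v})ᗮ.reflection with hL
      have hLv : L v = -v := Submodule.reflection_orthogonalComplement_singleton_eq_neg v
      have hLζ : L ζ = ζ := by
        refine Submodule.reflection_mem_subspace_eq_self ?_
        rw [Submodule.mem_orthogonal_singleton_iff_inner_right, real_inner_comm]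
        exact hv
      have h1 := setIntegral_ball_comp_isometry L (fun om => inner ℝ om v * sg (inner ℝ om ζ))
      have e1 : ∀ om, inner ℝ (L om) v = - inner ℝ om v := fun om => by
        rw [← L.inner_map_map om v, hLv, inner_neg_right, neg_neg]
      have e2 : ∀ om, inner ℝ (L om) ζ = inner ℝ om ζ := fun om => by
        conv_lhs => rw [← hLζ]
        rw [L.inner_map_map]
      simp only [e1, e2, neg_mul, integral_neg] at h1
      linarith
    set a : ℝ := inner ℝ ζ w / ‖ζ‖ ^ 2 with ha
    have hv : inner ℝ ζ (w - a • ζ) = 0 := by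
      rw [inner_sub_right, inner_smul_right, real_inner_self_eq_norm_sq, ha]
      field_simp
      ring
    have hdec : ∀ om : W, inner ℝ om w * sg (inner ℝ om ζ) =
        inner ℝ om (w - a • ζ) * sg (inner ℝ om ζ) + a * (inner ℝ om ζ * sg (inner ℝ om ζ)) := by
      intro om
      rw [inner_sub_right, inner_smul_right]
      ring
    simp only [hdec]
    rw [integral_add (integrableOn_inner_mul_sg _ _)
      ((integrableOn_inner_mul_sg _ _).const_mul a), hperp _ hv, integral_const_mul, hpar, ha]
    field_simp
    ring

end average

/-! ### Method of rotations, uniformly in `τ` -/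

section riesz

variable {n : ℕ}

/-- The frequency vector `(τ, -2πξ)`. -/
def zeta (n : ℕ) (τ : ℝ) (ξ : Rn n) : EuclideanSpace ℝ (Fin (n + 1)) :=
  -- Multipliers here act between `𝓕⁻` and `𝓕`, so `∂_i` has the symbol `-2πi ξ_i`, and `S_τ`
  -- becomes multiplication by `iζ`.
  WithLp.toLp 2 (Fin.cons τ fun i => -(2 * Real.pi) * ξ i)

@[simp] theorem zeta_zero (τ : ℝ) (ξ : Rn n) : zeta n τ ξ 0 = τ := rfl

@[simp] theorem zeta_succ (τ : ℝ) (ξ : Rn n) (i : Fin n) :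
    zeta n τ ξ i.succ = -(2 * Real.pi) * ξ i := rfl

theorem zeta_ne_zero {τ : ℝ} (hτ : τ ≠ 0) (ξ : Rn n) : zeta n τ ξ ≠ 0 := fun h =>
  hτ (by simpa using congrArg (fun v : EuclideanSpace ℝ (Fin (n + 1)) => v 0) h)

theorem continuous_zeta (τ : ℝ) : Continuous (zeta n τ) := by
  refine (PiLp.continuous_toLp 2 _).comp (continuous_pi fun j => ?_)
  refine Fin.cases ?_ (fun i => ?_) j
  · exact continuous_const
  · simp only [Fin.cons_succ]
    fun_prop

/-- For a fixed direction `om` this is an affine function of `ξ` with constant term `om 0 * τ`. The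
parameter `τ` thus only affects the shift of the Hilbert transform, on which its bounds do not
depend. -/
theorem inner_zeta (τ : ℝ) (ξ : Rn n) (om : EuclideanSpace ℝ (Fin (n + 1))) :
    inner ℝ om (zeta n τ ξ) =
      inner ℝ (WithLp.toLp 2 (fun i => -(2 * Real.pi) * om i.succ) : Rn n) ξ + om 0 * τ := by
  simp only [PiLp.inner_apply, Fin.sum_univ_succ, zeta_zero, zeta_succ]
  simp only [RCLike.inner_apply, conj_trivial]
  rw [add_comm, mul_comm τ]
  congr 1
  refine Finset.sum_congr rfl fun i _ => ?_
  ring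

/-- The symbol `ζ_j / |ζ|`. -/
def rieszSymbol (n : ℕ) (τ : ℝ) (j : Fin (n + 1)) (ξ : Rn n) : ℂ :=
  ((zeta n τ ξ j / ‖zeta n τ ξ‖ : ℝ) : ℂ)

theorem continuous_rieszSymbol {τ : ℝ} (hτ : τ ≠ 0) (j : Fin (n + 1)) :
    Continuous (rieszSymbol n τ j) := by
  refine Complex.continuous_ofReal.comp (Continuous.div ?_ (continuous_zeta τ).norm
    fun ξ => (norm_pos_iff.2 (zeta_ne_zero hτ ξ)).ne')
  exact (EuclideanSpace.proj j).continuous.comp (continuous_zeta τ)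

theorem norm_rieszSymbol_le (τ : ℝ) (j : Fin (n + 1)) (ξ : Rn n) : ‖rieszSymbol n τ j ξ‖ ≤ 1 := by
  rw [rieszSymbol, Complex.norm_real, norm_div, norm_norm]
  exact div_le_one_of_le₀ (PiLp.norm_apply_le _ j) (norm_nonneg _)

theorem memLp_rieszSymbol {τ : ℝ} (hτ : τ ≠ 0) (j : Fin (n + 1)) :
    MemLp (rieszSymbol n τ j) ⊤ volume :=
  memLp_top_of_bound (continuous_rieszSymbol hτ j).aestronglyMeasurable 1
    (Filter.Eventually.of_forall fun ξ => norm_rieszSymbol_le τ j ξ)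

/-- The inhomogeneous Riesz transforms. -/
def riesz (n : ℕ) {τ : ℝ} (hτ : τ ≠ 0) (j : Fin (n + 1)) : LpS n 2 →L[ℂ] LpS n 2 :=
  mult (memLp_rieszSymbol hτ j)

-- The symbol `ζ_j / |ζ|` is a multiple of the average over the unit ball of `om_j sgn⟨om, ζ⟩`. By
-- Fubini's theorem the form of the Riesz transform is the same average of forms of directional
-- Hilbert transforms, whose bounds are uniform in direction and shift.
open FourierTransform in
theorem riesz_formBdd_pow (n k : ℕ) : ∃ C : ℝ, 0 ≤ C ∧ ∀ {τ : ℝ} (hτ : τ ≠ 0) (j : Fin (n + 1)),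
    FormBdd (riesz n hτ j) ((1 / 2) ^ (k + 1)) C := by
  obtain ⟨C, hC, hH⟩ := hilb_opBdd (V := Rn n) k
  obtain ⟨c, hc, hav⟩ := exists_average_sg (W := EuclideanSpace ℝ (Fin (n + 1)))
    (EuclideanSpace.single 0 1) (by simp)
  set B := Metric.ball (0 : EuclideanSpace ℝ (Fin (n + 1))) 1 with hB
  have hr0 : (0 : ℝ) < (1 / 2) ^ (k + 1) := by positivity
  have hr1 : ((1 : ℝ) / 2) ^ (k + 1) < 1 := pow_lt_one₀ (by norm_num) (by norm_num) (by simp)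
  refine ⟨c⁻¹ * (volume.real B * C), by positivity, fun {τ} hτ j f g hf hg => ?_⟩
  set P : ℝ := (eLpNorm f (ex ((1 / 2) ^ (k + 1))) volume).toReal *
    (eLpNorm g (ex (1 - (1 / 2) ^ (k + 1))) volume).toReal with hP
  have hP0 : 0 ≤ P := by positivity
  let q : Rn n → ℂ := fun ξ => inner ℂ ((𝓕⁻ g : LpS n 2) ξ) ((𝓕⁻ f : LpS n 2) ξ)
  have hq : Integrable q := L2.integrable_inner _ _
  let e : EuclideanSpace ℝ (Fin (n + 1)) := EuclideanSpace.single j 1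
  let S : EuclideanSpace ℝ (Fin (n + 1)) → Rn n → ℝ := fun om ξ =>
    inner ℝ om e * sg (inner ℝ om (zeta n τ ξ))
  have hsym : ∀ ξ, rieszSymbol n τ j ξ = ((c⁻¹ * ∫ om in B, S om ξ : ℝ) : ℂ) := by
    intro ξ
    rw [rieszSymbol, hav e (zeta n τ ξ) (zeta_ne_zero hτ ξ), inv_mul_cancel_left₀ hc.ne']
    simp [e, EuclideanSpace.inner_single_right]
  have hSmeas : Measurable fun p : EuclideanSpace ℝ (Fin (n + 1)) × Rn n => S p.1 p.2 := by
    have hz : Continuous fun p : EuclideanSpace ℝ (Fin (n + 1)) × Rn n => zeta n τ p.2 :=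
      (continuous_zeta τ).comp continuous_snd
    exact (by fun_prop : Measurable fun p : EuclideanSpace ℝ (Fin (n + 1)) × Rn n =>
      inner ℝ p.1 e).mul (measurable_sg.comp (continuous_fst.inner hz).measurable)
  have hS1 : ∀ om ∈ B, ∀ ξ, ‖S om ξ‖ ≤ 1 := fun om hom ξ => by
    have := norm_inner_mul_sg_le e (zeta n τ ξ) hom
    exact this.trans (by simp [e])
  have hFub : Integrable (fun p : Rn n × EuclideanSpace ℝ (Fin (n + 1)) =>
      ((S p.2 p.1 : ℝ) : ℂ) * q p.1) (volume.prod (volume.restrict B)) := by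
    have : IsFiniteMeasure (volume.restrict B) := ⟨by simpa using measure_ball_lt_top⟩
    have h1 : Integrable (fun p : Rn n × EuclideanSpace ℝ (Fin (n + 1)) => q p.1)
      (volume.prod (volume.restrict B)) := hq.comp_fst _
    refine h1.bdd_mul (c := 1) ?_ ?_
    · exact (Complex.measurable_ofReal.comp (hSmeas.comp measurable_swap)).aestronglyMeasurable
    · have h2 : ∀ᵐ p ∂((volume : Measure (Rn n)).prod (volume.restrict B)), p.2 ∈ B :=
        Measure.quasiMeasurePreserving_snd.ae (ae_restrict_mem measurableSet_ball)
      filter_upwards [h2] with p hp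
      rw [Complex.norm_real]
      exact hS1 _ hp _
  have hformula : inner ℂ g (riesz n hτ j f) =
      ((c⁻¹ : ℝ) : ℂ) * ∫ om in B, ((inner ℝ om e : ℝ) : ℂ) *
        inner ℂ g (hilb (WithLp.toLp 2 (fun i => -(2 * Real.pi) * om i.succ) : Rn n) (om 0 * τ) f) := by
    rw [riesz, inner_mult]
    have e1 : ∀ ξ, rieszSymbol n τ j ξ * q ξ =
        ((c⁻¹ : ℝ) : ℂ) * ∫ om in B, ((S om ξ : ℝ) : ℂ) * q ξ := fun ξ => by
      rw [hsym, integral_mul_const, Complex.ofReal_mul, ← integral_complex_ofReal]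
      ring
    simp only [q] at e1
    simp only [e1]
    rw [integral_const_mul]
    congr 1
    rw [integral_integral_swap hFub]
    refine integral_congr_ae (Filter.Eventually.of_forall fun om => ?_)
    simp only
    rw [hilb, inner_mult, ← integral_const_mul]
    refine integral_congr_ae (Filter.Eventually.of_forall fun ξ => ?_)
    simp only [S, sgSymbol, inner_zeta]
    push_cast
    ring
  rw [hformula, norm_mul, Complex.norm_real, Real.norm_of_nonneg (by positivity)]
  have hbd : ∀ om ∈ B, ‖((inner ℝ om e : ℝ) : ℂ) *
        inner ℂ g (hilb (WithLp.toLp 2 (fun i => -(2 * Real.pi) * om i.succ) : Rn n) (om 0 * τ) f)‖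
      ≤ C * P := by
    intro om hom
    have h1 := ((hH (WithLp.toLp 2 (fun i => -(2 * Real.pi) * om i.succ) : Rn n)
      (om 0 * τ)).formBdd hr0 hr1) f g hf hg
    rw [norm_mul, Complex.norm_real]
    have h2 : ‖(inner ℝ om e : ℝ)‖ ≤ 1 := by
      refine (norm_inner_le_norm _ _).trans ?_
      rw [hB, mem_ball_zero_iff] at hom
      simpa [e] using hom.le
    rw [mul_assoc] at h1
    calc _ ≤ 1 * (C * P) := mul_le_mul h2 h1 (norm_nonneg _) zero_le_one
      _ = _ := one_mul _
  have := norm_setIntegral_le_of_norm_le_const (μ := volume) (s := B) measure_ball_lt_top hbd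
  calc _ ≤ c⁻¹ * (C * P * volume.real B) := by gcongr
    _ = _ := by rw [hP]; ring

/-- The Riesz transforms are bounded on `L^p` for `1 < p < ∞`, uniformly in `τ`. -/
theorem riesz_formBdd (n : ℕ) {r : ℝ} (h0 : 0 < r) (h1 : r < 1) : ∃ C : ℝ, 0 ≤ C ∧
    ∀ {τ : ℝ} (hτ : τ ≠ 0) (j : Fin (n + 1)), FormBdd (riesz n hτ j) r C := by
  -- With this `k`, the exponent `r` lies between `(1/2)^(k+1)` and its dual `1 - (1/2)^(k+1)`.
  obtain ⟨k, hk⟩ := exists_pow_lt_of_lt_one (lt_min h0 (sub_pos.2 h1))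
    (by norm_num : (1 / 2 : ℝ) < 1)
  obtain ⟨hk1, hk2⟩ := lt_min_iff.1 hk
  obtain ⟨C, hC, h⟩ := riesz_formBdd_pow n k
  have hle : ((1 : ℝ) / 2) ^ (k + 1) ≤ (1 / 2) ^ k :=
    pow_le_pow_of_le_one (by norm_num) (by norm_num) (by simp)
  have hp : (0 : ℝ) < (1 / 2) ^ (k + 1) := by positivity
  refine ⟨C, hC, fun {τ} hτ j => ?_⟩
  -- The symbol is real, so the operator is self-adjoint and has the same bound at the dual
  -- exponent.
  have hdual : FormBdd (riesz n hτ j) (1 - (1 / 2) ^ (k + 1)) C := by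
    intro f g hf hg
    rw [sub_sub_cancel] at hg ⊢
    have := h hτ j g f hg hf
    have e : inner ℂ g (riesz n hτ j f) = inner ℂ (riesz n hτ j g) f :=
      inner_mult_comm (memLp_rieszSymbol hτ j) (fun _ => Complex.conj_ofReal _) f g
    rw [e, ← inner_conj_symm, RCLike.norm_conj, mul_right_comm]
    exact this
  exact FormBdd.interpolate hp (by linarith) hC (h hτ j) hdual (by linarith) (by linarith)

end riesz

/-! ### Cutoff functions and extension of the class of test functions -/

section cutoff

variable {n : ℕ}

theorem exists_cutoff (n : ℕ) : ∃ C : ℝ, 0 ≤ C ∧ ∃ ρ : ℕ → Rn n → ℝ, ∀ N, IsTest (ρ N) ∧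
    (∀ x, 0 ≤ ρ N x) ∧ (∀ x, ρ N x ≤ 1) ∧ (∀ x, ‖x‖ ≤ N → ρ N x = 1) ∧
    ∀ i x, |partialD i (ρ N) x| ≤ C / (N + 1) := by
  let f : ContDiffBump (0 : Rn n) := ⟨1, 2, by norm_num, by norm_num⟩
  have hf : ContDiff ℝ ∞ f := f.contDiff
  obtain ⟨C, hC⟩ := (hf.continuous_fderiv (by simp)).bounded_above_of_compact_support
    (f.hasCompactSupport.fderiv (𝕜 := ℝ))
  have hC0 : 0 ≤ C := (norm_nonneg _).trans (hC 0)
  refine ⟨C, hC0, fun N x => f ((N + 1 : ℝ)⁻¹ • x), fun N => ?_⟩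
  have hN : (0 : ℝ) < N + 1 := by positivity
  refine ⟨⟨hf.comp (contDiff_const_smul _), ?_⟩, fun x => f.nonneg, fun x => f.le_one,
    fun x hx => ?_, fun i x => ?_⟩
  · exact f.hasCompactSupport.comp_smul (inv_ne_zero hN.ne')
  · refine f.one_of_mem_closedBall ?_
    rw [mem_closedBall_zero_iff, norm_smul, norm_inv, Real.norm_of_nonneg hN.le]
    change _ ≤ (1 : ℝ)
    rw [inv_mul_le_iff₀ hN]
    linarith
  · have hd : DifferentiableAt ℝ f ((N + 1 : ℝ)⁻¹ • x) := hf.differentiable (by simp) _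
    have h1 : HasFDerivAt (fun y : Rn n => f ((N + 1 : ℝ)⁻¹ • y))
        ((fderiv ℝ f ((N + 1 : ℝ)⁻¹ • x)).comp ((N + 1 : ℝ)⁻¹ • ContinuousLinearMap.id ℝ (Rn n))) x :=
      hd.hasFDerivAt.comp x (((hasFDerivAt_id (𝕜 := ℝ) x).const_smul ((N + 1 : ℝ)⁻¹)))
    rw [partialD, h1.fderiv]
    simp only [ContinuousLinearMap.comp_apply, smul_apply,
      ContinuousLinearMap.id_apply, map_smul, smul_eq_mul, abs_mul, abs_inv, abs_of_pos hN]
    rw [div_eq_inv_mul]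
    gcongr
    have := (fderiv ℝ f ((N + 1 : ℝ)⁻¹ • x)).le_opNorm (EuclideanSpace.single i 1)
    rw [PiLp.norm_single, norm_one, mul_one] at this
    exact this.trans (hC _)

theorem partialD_mul {f g : Rn n → ℝ} {x : Rn n} (hf : DifferentiableAt ℝ f x)
    (hg : DifferentiableAt ℝ g x) (i : Fin n) :
    partialD i (fun y => f y * g y) x = f x * partialD i g x + g x * partialD i f x := by
  simp only [partialD, fderiv_fun_mul hf hg, add_apply,
    smul_apply, smul_eq_mul]

theorem IsTest.mul_left {φ h : Rn n → ℝ} (hφ : IsTest φ) (hh : ContDiff ℝ ∞ h) :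
    IsTest (fun x => h x * φ x) :=
  ⟨hh.mul hφ.smooth, hφ.compact.mul_left⟩

theorem continuous_partialD {φ : Rn n → ℝ} (hφ : ContDiff ℝ ∞ φ) (i : Fin n) :
    Continuous (partialD i φ) :=
  (hφ.continuous_fderiv (by simp)).clm_apply continuous_const

/-- A distributional identity holds for smooth test functions without compact support, as long as
all integrals exist. -/
theorem tested_of_integrable {K : Fin n → Rn n → ℂ} {K0 : Rn n → ℂ}
    (hK : ∀ φ : Rn n → ℝ, IsTest φ →
      (∑ i, ∫ x, partialD i φ x • K i x) + ∫ x, φ x • K0 x = 0)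
    (hKl : ∀ i, LocallyIntegrable (K i) volume) (hK0 : LocallyIntegrable K0 volume)
    {h : Rn n → ℝ} (hh : ContDiff ℝ ∞ h)
    (h1 : ∀ i, Integrable fun x => partialD i h x • K i x) (h2 : ∀ i, Integrable fun x => h x • K i x)
    (h3 : Integrable fun x => h x • K0 x) :
    (∑ i, ∫ x, partialD i h x • K i x) + ∫ x, h x • K0 x = 0 := by
  -- The product rule for `h * ρ N` leaves the error `h ∂ρ_N`, of size at most `C / (N + 1)` times
  -- `h`. It vanishes in the limit because `h • K i` is integrable.
  obtain ⟨C, hC, ρ, hρ⟩ := exists_cutoff n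
  have hev : ∀ x : Rn n, ∀ᶠ N : ℕ in Filter.atTop, ρ N x = 1 := fun x => by
    filter_upwards [Filter.eventually_ge_atTop ⌈‖x‖⌉₊] with N hN
    exact (hρ N).2.2.2.1 x ((Nat.le_ceil _).trans (by exact_mod_cast hN))
  have hρ1 : ∀ x : Rn n, Filter.Tendsto (fun N => ρ N x) Filter.atTop (nhds 1) := fun x =>
    tendsto_const_nhds.congr' ((hev x).mono fun N hN => hN.symm)
  have hdρ : ∀ i (x : Rn n), Filter.Tendsto (fun N => partialD i (ρ N) x) Filter.atTop (nhds 0) :=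
    fun i x => by
      refine squeeze_zero_norm (fun N => (hρ N).2.2.2.2 i x) ?_
      have := (tendsto_one_div_add_atTop_nhds_zero_nat (𝕜 := ℝ)).const_mul C
      simpa [div_eq_mul_inv] using this
  have hpd : ∀ N i x, partialD i (fun y => h y * ρ N y) x
      = h x * partialD i (ρ N) x + ρ N x * partialD i h x := fun N i x =>
    partialD_mul (hh.differentiable (by simp) x) ((hρ N).1.smooth.differentiable (by simp) x) i
  have hz : ∀ N, (∑ i, ∫ x, partialD i (fun y => h y * ρ N y) x • K i x)
      + ∫ x, (h x * ρ N x) • K0 x = 0 := fun N => hK _ ((hρ N).1.mul_left hh)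
  have hlim : Filter.Tendsto (fun N => (∑ i, ∫ x, partialD i (fun y => h y * ρ N y) x • K i x)
      + ∫ x, (h x * ρ N x) • K0 x) Filter.atTop
      (nhds ((∑ i, ∫ x, partialD i h x • K i x) + ∫ x, h x • K0 x)) := by
    refine Filter.Tendsto.add (tendsto_finsetSum _ fun i _ => ?_) ?_
    · refine tendsto_integral_of_dominated_convergence
        (fun x => C * ‖h x • K i x‖ + ‖partialD i h x • K i x‖) (fun N => ?_)
        (((h2 i).norm.const_mul C).add (h1 i).norm) (fun N => ?_) ?_
      · exact (((hρ N).1.mul_left hh).integrable_partialD i (hKl i)).1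
      · refine Filter.Eventually.of_forall fun x => ?_
        rw [hpd, add_smul]
        refine (norm_add_le _ _).trans (add_le_add ?_ ?_)
        · rw [mul_comm, mul_smul, norm_smul]
          gcongr
          refine ((hρ N).2.2.2.2 i x).trans (div_le_self hC ?_)
          simp
        · rw [mul_smul, norm_smul, Real.norm_of_nonneg ((hρ N).2.1 x)]
          exact mul_le_of_le_one_left (norm_nonneg _) ((hρ N).2.2.1 x)
      · refine Filter.Eventually.of_forall fun x => ?_
        simp only [hpd]
        have := (((hdρ i x).const_mul (h x)).add ((hρ1 x).mul_const (partialD i h x))).smul_const (K i x)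
        simpa using this
    · refine tendsto_integral_of_dominated_convergence (fun x => ‖h x • K0 x‖) (fun N => ?_)
        h3.norm (fun N => ?_) ?_
      · exact (((hρ N).1.mul_left hh).integrable hK0).1
      · refine Filter.Eventually.of_forall fun x => ?_
        rw [mul_comm, mul_smul, norm_smul, Real.norm_of_nonneg ((hρ N).2.1 x)]
        exact mul_le_of_le_one_left (norm_nonneg _) ((hρ N).2.2.1 x)
      · refine Filter.Eventually.of_forall fun x => ?_
        have := (((hρ1 x).const_mul (h x))).smul_const (K0 x)
        simpa using this
  exact tendsto_nhds_unique hlim (by simp only [hz]; exact tendsto_const_nhds)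

end cutoff

/-! ### Distributional identities on the Fourier side -/

section fourier

open FourierTransform SchwartzMap

variable {n : ℕ}

theorem integrable_clm_schwartz_smul (χ : 𝓢(Rn n, ℂ)) (L : ℂ →L[ℝ] ℝ) {p : ℝ≥0∞} (hp : 1 ≤ p)
    {K : Rn n → ℂ} (hK : MemLp K p volume) : Integrable fun x => L (χ x) • K x := by
  have := ENNReal.HolderConjugate.conjExponent hp
  have h : MemLp (fun x => L (χ x)) p.conjExponent (volume : Measure (Rn n)) :=
    L.comp_memLp' (χ.memLp _ volume)
  have := ENNReal.HolderConjugate.symm (p := p) (q := p.conjExponent)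
  exact memLp_one_iff_integrable.1 (hK.smul h)

theorem partialD_comp_schwartz (χ : 𝓢(Rn n, ℂ)) (L : ℂ →L[ℝ] ℝ) (i : Fin n) (x : Rn n) :
    partialD i (fun y => L (χ y)) x
      = L ((LineDeriv.lineDerivOp (EuclideanSpace.single i (1 : ℝ)) χ : 𝓢(Rn n, ℂ)) x) := by
  have h := L.hasFDerivAt.comp x (χ.differentiableAt (x := x)).hasFDerivAt
  rw [partialD]
  erw [h.fderiv]
  rfl

/-- A distributional identity between `L^p`-functions can be tested with Schwartz functions. -/
theorem tested_schwartz {p : ℝ≥0∞} (hp : 1 ≤ p) {K : Fin n → Rn n → ℂ} {K0 : Rn n → ℂ}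
    (hKm : ∀ i, MemLp (K i) p volume) (hK0m : MemLp K0 p volume)
    (hK : ∀ φ : Rn n → ℝ, IsTest φ →
      (∑ i, ∫ x, partialD i φ x • K i x) + ∫ x, φ x • K0 x = 0) (χ : 𝓢(Rn n, ℂ)) :
    (∑ i, ∫ x, (LineDeriv.lineDerivOp (EuclideanSpace.single i (1 : ℝ)) χ : 𝓢(Rn n, ℂ)) x * K i x)
      + ∫ x, χ x * K0 x = 0 := by
  -- Test functions are real-valued, so the real and the imaginary part of `χ` are tested separately
  -- and recombined at the end.
  have main : ∀ L : ℂ →L[ℝ] ℝ, (∑ i, ∫ x, L ((LineDeriv.lineDerivOp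
      (EuclideanSpace.single i (1 : ℝ)) χ : 𝓢(Rn n, ℂ)) x) • K i x) + ∫ x, L (χ x) • K0 x = 0 := by
    intro L
    have := tested_of_integrable hK (fun i => (hKm i).locallyIntegrable hp)
      (hK0m.locallyIntegrable hp) (h := fun x => L (χ x))
      (L.contDiff.comp χ.smooth') (fun i => ?_) (fun i => ?_) ?_
    · simpa only [partialD_comp_schwartz] using this
    · simp only [partialD_comp_schwartz]
      exact integrable_clm_schwartz_smul _ L hp (hKm i)
    · exact integrable_clm_schwartz_smul _ L hp (hKm i)
    · exact integrable_clm_schwartz_smul _ L hp hK0m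
  have split : ∀ (ψ : 𝓢(Rn n, ℂ)) (F : Rn n → ℂ), MemLp F p volume → ∫ x, ψ x * F x
      = (∫ x, Complex.reCLM (ψ x) • F x) + Complex.I * ∫ x, Complex.imCLM (ψ x) • F x := by
    intro ψ F hF
    rw [← integral_const_mul, ← integral_add (integrable_clm_schwartz_smul _ _ hp hF)
      ((integrable_clm_schwartz_smul _ _ hp hF).const_mul _)]
    refine integral_congr_ae (Filter.Eventually.of_forall fun x => ?_)
    simp only [Complex.reCLM_apply, Complex.imCLM_apply, Complex.real_smul]
    conv_lhs => rw [← Complex.re_add_im (ψ x)]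
    ring
  simp only [split _ _ (hKm _), split _ _ hK0m, Finset.sum_add_distrib, ← Finset.mul_sum]
  linear_combination main Complex.reCLM + Complex.I * main Complex.imCLM

theorem fourier_partial_apply (χ : 𝓢(Rn n, ℂ)) (i : Fin n) (ξ : Rn n) :
    (𝓕 (LineDeriv.lineDerivOp (EuclideanSpace.single i (1 : ℝ)) χ : 𝓢(Rn n, ℂ))) ξ
      = 2 * Real.pi * Complex.I * ξ i * (𝓕 χ) ξ := by
  have hinn : (fun x : Rn n => inner ℝ x (EuclideanSpace.single i (1 : ℝ))).HasTemperateGrowth :=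
    ((innerSL ℝ).flip _).hasTemperateGrowth
  rw [SchwartzMap.fourier_lineDerivOp_eq, smul_apply,
    SchwartzMap.smulLeftCLM_apply_apply hinn, EuclideanSpace.inner_single_right]
  simp
  ring

/-- Fourier side of a distributional identity. -/
theorem fourierInv_of_tested {K : Fin n → LpS n 2} {K0 : LpS n 2}
    (hK : ∀ φ : Rn n → ℝ, IsTest φ →
      (∑ i, ∫ x, partialD i φ x • K i x) + ∫ x, φ x • K0 x = 0) :
    ∀ᵐ ξ : Rn n, (∑ i, 2 * Real.pi * Complex.I * ξ i * (𝓕⁻ (K i) : LpS n 2) ξ)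
      + (𝓕⁻ K0 : LpS n 2) ξ = 0 := by
  have hcoord : ∀ i : Fin n, Continuous fun ξ : Rn n => (2 * Real.pi * Complex.I * ξ i : ℂ) :=
    fun i => by fun_prop
  have hloc : ∀ F : LpS n 2, LocallyIntegrable F volume := fun F =>
    (Lp.memLp F).locallyIntegrable (by norm_num)
  have hloc' : ∀ i, LocallyIntegrable (fun ξ : Rn n => 2 * Real.pi * Complex.I * ξ i *
      (𝓕⁻ (K i) : LpS n 2) ξ) volume := fun i => by
    rw [← locallyIntegrableOn_univ]
    exact (hloc _).locallyIntegrableOn _ |>.continuousOn_mul (hcoord i).continuousOn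
      isOpen_univ.isLocallyClosed
  refine ae_eq_zero_of_integral_contDiff_smul_eq_zero
    ((locallyIntegrable_finsetSum _ fun i _ => hloc' i).add (hloc _)) fun g hg hgc => ?_
  have hgc' : HasCompactSupport fun x => (g x : ℂ) :=
    hgc.comp_left (g := fun r : ℝ => (r : ℂ)) (by simp)
  let ψ : 𝓢(Rn n, ℂ) := hgc'.toSchwartzMap (Complex.ofRealCLM.contDiff.comp hg)
  have hψ : ∀ x, ψ x = g x := fun x => rfl
  have hsmul : ∀ {u : Rn n → ℂ}, LocallyIntegrable u volume → Integrable fun x => g x • u x :=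
    fun hu => (IsTest.mk hg hgc).integrable hu
  -- The function `𝓕⁻ ψ` is no longer compactly supported, which is why the identity is needed for
  -- Schwartz functions.
  have h := tested_schwartz (by norm_num) (fun i => Lp.memLp (K i)) (Lp.memLp K0) hK (𝓕⁻ ψ)
  have e : ∀ (χ : 𝓢(Rn n, ℂ)) (F : LpS n 2), ∫ x, χ x * F x
      = ∫ ξ, (𝓕 χ) ξ * (𝓕⁻ F : LpS n 2) ξ := fun χ F => by
    rw [← integral_schwartz_mul_fourier, fourier_fourierInv_eq]
  simp only [e, fourier_partial_apply, fourier_fourierInv_eq, hψ] at h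
  have hint : ∀ i, Integrable fun ξ : Rn n => 2 * Real.pi * Complex.I * ξ i * g ξ *
      (𝓕⁻ (K i) : LpS n 2) ξ := fun i => by
    refine (hsmul (hloc' i)).congr (Filter.Eventually.of_forall fun ξ => ?_)
    simp only [Complex.real_smul]
    ring
  have hint0 : Integrable fun ξ => (g ξ : ℂ) * (𝓕⁻ K0 : LpS n 2) ξ := hsmul (hloc _)
  rw [← h, ← integral_finsetSum _ fun i _ => hint i,
    ← integral_add (integrable_finsetSum _ fun i _ => hint i) hint0]
  refine integral_congr_ae (Filter.Eventually.of_forall fun ξ => ?_)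
  simp only [smul_add, Finset.smul_sum, Complex.real_smul]
  congr 1
  refine Finset.sum_congr rfl fun i _ => ?_
  ring

/-- The distributional identity from its Fourier side. -/
theorem tested_of_fourierInv {K : Fin n → LpS n 2} {K0 : LpS n 2}
    (hK : ∀ᵐ ξ : Rn n, (∑ i, 2 * Real.pi * Complex.I * ξ i * (𝓕⁻ (K i) : LpS n 2) ξ)
      + (𝓕⁻ K0 : LpS n 2) ξ = 0) {φ : Rn n → ℝ} (hφ : IsTest φ) :
    (∑ i, ∫ x, partialD i φ x • K i x) + ∫ x, φ x • K0 x = 0 := by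
  have hc : HasCompactSupport fun x => (φ x : ℂ) :=
    hφ.compact.comp_left (g := fun r : ℝ => (r : ℂ)) (by simp)
  let χ : 𝓢(Rn n, ℂ) := hc.toSchwartzMap (Complex.ofRealCLM.contDiff.comp hφ.smooth)
  have hχ : ∀ x, χ x = φ x := fun x => rfl
  have hd : ∀ i x, (LineDeriv.lineDerivOp (EuclideanSpace.single i (1 : ℝ)) χ : 𝓢(Rn n, ℂ)) x
      = partialD i φ x := fun i x => by
    have h := Complex.ofRealCLM.hasFDerivAt.comp x
      (hφ.smooth.differentiable (by simp) x).hasFDerivAt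
    have h2 : HasFDerivAt χ (Complex.ofRealCLM.comp (fderiv ℝ φ x)) x := h
    rw [SchwartzMap.lineDerivOp_apply_eq_fderiv, h2.fderiv]
    rfl
  have e : ∀ (η : 𝓢(Rn n, ℂ)) (F : LpS n 2), ∫ x, η x * F x
      = ∫ ξ, (𝓕 η) ξ * (𝓕⁻ F : LpS n 2) ξ := fun η F => by
    rw [← integral_schwartz_mul_fourier, fourier_fourierInv_eq]
  have hi : ∀ (η : 𝓢(Rn n, ℂ)) (F : LpS n 2), Integrable fun x => η x * F x := fun η F =>
    memLp_one_iff_integrable.1 ((Lp.memLp F).mul (η.memLp 2 volume))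
  have e1 : ∀ i, ∫ x, partialD i φ x • K i x = ∫ ξ,
      (𝓕 (LineDeriv.lineDerivOp (EuclideanSpace.single i (1 : ℝ)) χ : 𝓢(Rn n, ℂ))) ξ *
        (𝓕⁻ (K i) : LpS n 2) ξ := fun i => by
    rw [← e]
    simp only [hd, Complex.real_smul]
  have e2 : ∫ x, φ x • K0 x = ∫ ξ, (𝓕 χ) ξ * (𝓕⁻ K0 : LpS n 2) ξ := by
    rw [← e]
    simp only [hχ, Complex.real_smul]
  simp only [e1, e2]
  rw [← integral_finsetSum _ fun i _ => hi _ _,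
    ← integral_add (integrable_finsetSum _ fun i _ => hi _ _) (hi _ _)]
  refine integral_eq_zero_of_ae ?_
  filter_upwards [hK] with ξ hξ
  simp only [fourier_partial_apply, Pi.zero_apply]
  have : (𝓕 χ) ξ * ((∑ i, 2 * Real.pi * Complex.I * ξ i * (𝓕⁻ (K i) : LpS n 2) ξ)
      + (𝓕⁻ K0 : LpS n 2) ξ) = 0 := by rw [hξ, mul_zero]
  rw [← this, mul_add, Finset.mul_sum]
  congr 1
  refine Finset.sum_congr rfl fun i _ => ?_
  ring

end fourier

/-! ### The orthogonal projection onto the range of `S_τ` -/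

section proj

open FourierTransform

variable {n : ℕ}

/-- The `j`-th component of a vector-valued function. -/
def comp (n : ℕ) (j : Fin (n + 1)) : LpV n 2 →L[ℂ] LpS n 2 :=
  (EuclideanSpace.proj j : Cn1 n →L[ℂ] ℂ).compLpL 2 volume

theorem comp_ae (j : Fin (n + 1)) (F : LpV n 2) : comp n j F =ᵐ[volume] fun x => F x j :=
  (EuclideanSpace.proj j : Cn1 n →L[ℂ] ℂ).coeFn_compLp F

/-- The vector-valued function with a single non-zero component. -/
def emb (n : ℕ) (j : Fin (n + 1)) : LpS n 2 →L[ℂ] LpV n 2 :=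
  (ContinuousLinearMap.toSpanSingleton ℂ (EuclideanSpace.single j 1 : Cn1 n)).compLpL 2 volume

theorem emb_ae (j : Fin (n + 1)) (f : LpS n 2) :
    emb n j f =ᵐ[volume] fun x => f x • EuclideanSpace.single j (1 : ℂ) :=
  (ContinuousLinearMap.toSpanSingleton ℂ (EuclideanSpace.single j 1 : Cn1 n)).coeFn_compLp f

theorem comp_emb (j k : Fin (n + 1)) (f : LpS n 2) :
    comp n j (emb n k f) = if j = k then f else 0 := by
  refine Lp.ext ?_
  filter_upwards [comp_ae j (emb n k f), emb_ae k f, Lp.coeFn_zero ℂ 2 (volume : Measure (Rn n))]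
    with x e1 e2 e3
  rw [e1, e2]
  split_ifs with h
  · simp [h]
  · rw [e3]; simp [h]

theorem LpV_ext_comp {F G : LpV n 2} (h : ∀ j, comp n j F = comp n j G) : F = G :=
  LpV_ext fun j => by
    filter_upwards [comp_ae j F, comp_ae j G] with x e1 e2
    rw [← e1, ← e2, h]

theorem inner_eq_sum_comp (F G : LpV n 2) :
    inner ℂ F G = ∑ j, inner ℂ (comp n j F) (comp n j G) := by
  simp only [L2.inner_def]
  rw [← integral_finsetSum _ fun j _ => L2.integrable_inner _ _]
  refine integral_congr_ae ?_
  filter_upwards [ae_all_iff.2 fun j => comp_ae j F, ae_all_iff.2 fun j => comp_ae j G] with x e1 e2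
  rw [PiLp.inner_apply]
  exact Finset.sum_congr rfl fun j _ => by rw [e1, e2]

/-- As `τ ≠ 0`, the potential is determined by the perpendicular component as `F_⊥ / (iτ)`. What
remains is a compatibility condition on `F` alone. -/
theorem mem_gradRange_iff {τ : ℝ} (hτ : τ ≠ 0) (F : LpV n 2) : F ∈ gradRange n τ ↔
    ∀ (i : Fin n) (φ : Rn n → ℝ), IsTest φ →
      (∫ x, partialD i φ x • F x 0) = -(Complex.I * τ * ∫ x, φ x • F x i.succ) := by
  have hI : Complex.I * (τ : ℂ) ≠ 0 := mul_ne_zero Complex.I_ne_zero (by exact_mod_cast hτ)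
  constructor
  · rintro ⟨⟨u, F'⟩, ⟨h1, h2⟩, rfl⟩ i φ hφ
    have h3 := (h2 i).eq φ hφ
    simp only at h1 h3
    calc (∫ x, partialD i φ x • F' x 0)
        = ∫ x, (Complex.I * τ) * (partialD i φ x • u x) := by
          refine integral_congr_ae ?_
          filter_upwards [h1] with x hx
          rw [hx]
          simp only [Complex.real_smul]
          ring
      _ = _ := by
          rw [integral_const_mul, h3]
          simp
  · intro h
    have hm : MemLp (fun x => (Complex.I * τ)⁻¹ * F x 0) 2 (volume : Measure (Rn n)) :=
      (LpV_memLp_coord F 0).const_mul _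
    refine ⟨(hm.toLp _, F), ⟨?_, fun i => ?_⟩, rfl⟩
    · filter_upwards [hm.coeFn_toLp] with x hx
      simp only [hx]
      rw [mul_inv_cancel_left₀ hI]
    · have hw : HasWeakPartial i (fun x => (Complex.I * τ)⁻¹ * F x 0) (fun x => F x i.succ) := by
        refine ⟨hm.locallyIntegrable (by norm_num), LpV_locInt F _, fun φ hφ => ?_⟩
        have e : ∀ x, partialD i φ x • ((Complex.I * (τ : ℂ))⁻¹ * F x 0)
            = (Complex.I * (τ : ℂ))⁻¹ * (partialD i φ x • F x 0) := fun x => by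
          simp only [Complex.real_smul]
          ring
        simp only [e]
        rw [integral_const_mul, h i φ hφ]
        rw [mul_neg, inv_mul_cancel_left₀ hI]
      exact hw.congr hm.coeFn_toLp.symm .rfl

theorem fourierInv_smul_ae (c : ℂ) (f : LpS n 2) :
    (𝓕⁻ (c • f) : LpS n 2) =ᵐ[volume] fun ξ => c * (𝓕⁻ f : LpS n 2) ξ := by
  have h : (𝓕⁻ (c • f) : LpS n 2) = c • 𝓕⁻ f :=
    (Lp.fourierTransformₗᵢ (Rn n) ℂ).symm.map_smul c f
  rw [h]
  exact Lp.coeFn_smul _ _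

theorem fourierInv_ext {f g : LpS n 2} (h : (𝓕⁻ f : LpS n 2) =ᵐ[volume] (𝓕⁻ g : LpS n 2)) :
    f = g :=
  (Lp.fourierTransformₗᵢ (Rn n) ℂ).symm.injective (Lp.ext h)

theorem fourierInv_zero_ae : (𝓕⁻ (0 : LpS n 2) : LpS n 2) =ᵐ[volume] 0 := by
  have h : (𝓕⁻ (0 : LpS n 2) : LpS n 2) = 0 := (Lp.fourierTransformₗᵢ (Rn n) ℂ).symm.map_zero
  rw [h]
  exact Lp.coeFn_zero _ _ _

theorem fourierInv_sum_ae {ι : Type*} (s : Finset ι) (f : ι → LpS n 2) :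
    (𝓕⁻ (∑ i ∈ s, f i) : LpS n 2) =ᵐ[volume] fun ξ => ∑ i ∈ s, (𝓕⁻ (f i) : LpS n 2) ξ := by
  have h : (𝓕⁻ (∑ i ∈ s, f i) : LpS n 2) = ∑ i ∈ s, 𝓕⁻ (f i) :=
    map_sum (Lp.fourierTransformₗᵢ (Rn n) ℂ).symm.toLinearEquiv f s
  rw [h]
  exact Lp.coeFn_fun_finsetSum _ _

/-- Fourier side of the range of `S_τ`. -/
theorem mem_gradRange_iff_fourier {τ : ℝ} (hτ : τ ≠ 0) (F : LpV n 2) : F ∈ gradRange n τ ↔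
    ∀ i : Fin n, ∀ᵐ ξ : Rn n, (τ : ℂ) * (𝓕⁻ (comp n i.succ F) : LpS n 2) ξ
      = (zeta n τ ξ i.succ : ℂ) * (𝓕⁻ (comp n 0 F) : LpS n 2) ξ := by
  rw [mem_gradRange_iff hτ]
  refine forall_congr' fun i => ?_
  let K : Fin n → LpS n 2 := Pi.single i (comp n 0 F)
  let K0 : LpS n 2 := (Complex.I * (τ : ℂ)) • comp n i.succ F
  have hKz : ∀ j, j ≠ i → K j = 0 := fun j hj => by simp [K, Pi.single_eq_of_ne hj]
  have hKi : K i = comp n 0 F := by simp [K]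
  have e1 : ∀ φ : Rn n → ℝ, (∑ j, ∫ x, partialD j φ x • K j x) + ∫ x, φ x • K0 x
      = (∫ x, partialD i φ x • F x 0) + Complex.I * τ * ∫ x, φ x • F x i.succ := by
    intro φ
    rw [Finset.sum_eq_single i, hKi, ← integral_const_mul]
    · congr 1
      · refine integral_congr_ae ?_
        filter_upwards [comp_ae 0 F] with x hx
        rw [hx]
      · refine integral_congr_ae ?_
        filter_upwards [comp_ae i.succ F, Lp.coeFn_smul (Complex.I * (τ : ℂ)) (comp n i.succ F)]
          with x hx hx'
        simp only [K0]
        rw [hx', Pi.smul_apply, hx]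
        simp only [smul_eq_mul, Complex.real_smul]
        ring
    · intro j _ hj
      refine integral_eq_zero_of_ae ?_
      filter_upwards [Lp.coeFn_zero ℂ 2 (volume : Measure (Rn n))] with x hx
      rw [hKz j hj, hx]
      simp
    · simp
  have e2 : (∀ φ : Rn n → ℝ, IsTest φ →
      (∫ x, partialD i φ x • F x 0) = -(Complex.I * τ * ∫ x, φ x • F x i.succ)) ↔
      ∀ φ : Rn n → ℝ, IsTest φ →
        (∑ j, ∫ x, partialD j φ x • K j x) + ∫ x, φ x • K0 x = 0 := by
    simp only [e1, eq_neg_iff_add_eq_zero]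
  have e3 : ∀ᵐ ξ : Rn n, (∑ j, 2 * Real.pi * Complex.I * ξ j * (𝓕⁻ (K j) : LpS n 2) ξ)
      + (𝓕⁻ K0 : LpS n 2) ξ = Complex.I * ((τ : ℂ) * (𝓕⁻ (comp n i.succ F) : LpS n 2) ξ
      - (zeta n τ ξ i.succ : ℂ) * (𝓕⁻ (comp n 0 F) : LpS n 2) ξ) := by
    filter_upwards [fourierInv_smul_ae (Complex.I * (τ : ℂ)) (comp n i.succ F),
      fourierInv_zero_ae (n := n)] with ξ h1 h2
    rw [Finset.sum_eq_single i, hKi, h1, zeta_succ]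
    · push_cast; ring
    · intro j _ hj
      rw [hKz j hj, h2]
      simp
    · simp
  rw [e2]
  constructor
  · intro h
    filter_upwards [fourierInv_of_tested h, e3] with ξ h1 h2
    rw [h2] at h1
    exact sub_eq_zero.1 ((mul_eq_zero.1 h1).resolve_left Complex.I_ne_zero)
  · intro h φ hφ
    refine tested_of_fourierInv ?_ hφ
    filter_upwards [h, e3] with ξ h1 h2
    rw [h2, h1, sub_self, mul_zero]

/-- Fourier side of the kernel of `S_τ^*`. -/
theorem tested_iff_fourier {τ : ℝ} (F : LpV n 2) :
    (∀ φ : Rn n → ℝ, IsTest φ → (∑ i, ∫ x, partialD i φ x • F x (Fin.succ i))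
      = Complex.I * τ * ∫ x, φ x • F x 0) ↔
    ∀ᵐ ξ : Rn n, ∑ k, (zeta n τ ξ k : ℂ) * (𝓕⁻ (comp n k F) : LpS n 2) ξ = 0 := by
  let K : Fin n → LpS n 2 := fun i => comp n i.succ F
  let K0 : LpS n 2 := (-(Complex.I * (τ : ℂ))) • comp n 0 F
  have e1 : ∀ φ : Rn n → ℝ, (∑ j, ∫ x, partialD j φ x • K j x) + ∫ x, φ x • K0 x
      = (∑ i, ∫ x, partialD i φ x • F x (Fin.succ i)) - Complex.I * τ * ∫ x, φ x • F x 0 := by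
    intro φ
    rw [sub_eq_add_neg, ← neg_mul, ← integral_const_mul]
    congr 1
    · refine Finset.sum_congr rfl fun i _ => integral_congr_ae ?_
      filter_upwards [comp_ae i.succ F] with x hx
      simp only [K]
      rw [hx]
    · refine integral_congr_ae ?_
      filter_upwards [comp_ae 0 F, Lp.coeFn_smul (-(Complex.I * (τ : ℂ))) (comp n 0 F)]
        with x hx hx'
      simp only [K0]
      rw [hx', Pi.smul_apply, hx]
      simp only [smul_eq_mul, Complex.real_smul]
      ring
  have e3 : ∀ᵐ ξ : Rn n, (∑ j, 2 * Real.pi * Complex.I * ξ j * (𝓕⁻ (K j) : LpS n 2) ξ)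
      + (𝓕⁻ K0 : LpS n 2) ξ = -Complex.I * ∑ k, (zeta n τ ξ k : ℂ) *
        (𝓕⁻ (comp n k F) : LpS n 2) ξ := by
    filter_upwards [fourierInv_smul_ae (-(Complex.I * (τ : ℂ))) (comp n 0 F)] with ξ h1
    rw [h1, Fin.sum_univ_succ, mul_add, Finset.mul_sum, add_comm]
    congr 1
    · simp; ring
    · refine Finset.sum_congr rfl fun i _ => ?_
      simp only [zeta_succ, K]
      push_cast
      ring
  have e2 : (∀ φ : Rn n → ℝ, IsTest φ → (∑ i, ∫ x, partialD i φ x • F x (Fin.succ i))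
      = Complex.I * τ * ∫ x, φ x • F x 0) ↔ ∀ φ : Rn n → ℝ, IsTest φ →
        (∑ j, ∫ x, partialD j φ x • K j x) + ∫ x, φ x • K0 x = 0 := by
    simp only [e1, sub_eq_zero]
  rw [e2]
  constructor
  · intro h
    filter_upwards [fourierInv_of_tested h, e3] with ξ h1 h2
    rw [h2] at h1
    exact (mul_eq_zero.1 h1).resolve_left (neg_ne_zero.2 Complex.I_ne_zero)
  · intro h φ hφ
    refine tested_of_fourierInv ?_ hφ
    filter_upwards [h, e3] with ξ h1 h2
    rw [h2, h1, mul_zero]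

/-- The sum of the Riesz transforms of the components. -/
def rieszSum (n : ℕ) {τ : ℝ} (hτ : τ ≠ 0) : LpV n 2 →L[ℂ] LpS n 2 :=
  ∑ k, riesz n hτ k ∘L comp n k

theorem fourierInv_rieszSum_ae {τ : ℝ} (hτ : τ ≠ 0) (F : LpV n 2) :
    (𝓕⁻ (rieszSum n hτ F) : LpS n 2) =ᵐ[volume]
      fun ξ => ∑ k, rieszSymbol n τ k ξ * (𝓕⁻ (comp n k F) : LpS n 2) ξ := by
  have h1 : rieszSum n hτ F = ∑ k, riesz n hτ k (comp n k F) := by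
    simp [rieszSum, sum_apply]
  rw [h1]
  filter_upwards [fourierInv_sum_ae Finset.univ fun k => riesz n hτ k (comp n k F),
    ae_all_iff.2 fun k => fourierInv_mult_ae (memLp_rieszSymbol hτ k) (comp n k F)] with ξ e1 e2
  rw [e1]
  exact Finset.sum_congr rfl fun k _ => e2 k

/-- The orthogonal projection onto the range of `S_τ`. -/
def gradProj (n : ℕ) {τ : ℝ} (hτ : τ ≠ 0) : LpV n 2 →L[ℂ] LpV n 2 :=
  ∑ j, emb n j ∘L riesz n hτ j ∘L rieszSum n hτ

theorem comp_gradProj {τ : ℝ} (hτ : τ ≠ 0) (j : Fin (n + 1)) (F : LpV n 2) :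
    comp n j (gradProj n hτ F) = riesz n hτ j (rieszSum n hτ F) := by
  simp [gradProj, sum_apply, map_sum, comp_emb]

theorem fourierInv_comp_gradProj_ae {τ : ℝ} (hτ : τ ≠ 0) (j : Fin (n + 1)) (F : LpV n 2) :
    (𝓕⁻ (comp n j (gradProj n hτ F)) : LpS n 2) =ᵐ[volume]
      fun ξ => rieszSymbol n τ j ξ * (𝓕⁻ (rieszSum n hτ F) : LpS n 2) ξ := by
  rw [comp_gradProj]
  exact fourierInv_mult_ae (memLp_rieszSymbol hτ j) _

/-- On the Fourier side the operator is `ζζᵀ/|ζ|²`. Membership in the range of `S_τ` means that the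
transform is parallel to `ζ`, the factor being read off from the component `ζ_0 = τ ≠ 0`. -/
theorem gradProj_mem {τ : ℝ} (hτ : τ ≠ 0) (F : LpV n 2) : gradProj n hτ F ∈ gradRange n τ := by
  rw [mem_gradRange_iff_fourier hτ]
  intro i
  filter_upwards [fourierInv_comp_gradProj_ae hτ i.succ F, fourierInv_comp_gradProj_ae hτ 0 F]
    with ξ e1 e2
  rw [e1, e2]
  simp only [rieszSymbol, zeta_zero]
  push_cast
  ring

theorem gradProj_of_mem {τ : ℝ} (hτ : τ ≠ 0) {F : LpV n 2} (hF : F ∈ gradRange n τ) :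
    gradProj n hτ F = F := by
  rw [mem_gradRange_iff_fourier hτ] at hF
  refine LpV_ext_comp fun j => fourierInv_ext ?_
  have hτ' : (τ : ℂ) ≠ 0 := by exact_mod_cast hτ
  filter_upwards [fourierInv_comp_gradProj_ae hτ j F, fourierInv_rieszSum_ae hτ F,
    ae_all_iff.2 hF] with ξ e1 e2 e3
  have hz : ‖zeta n τ ξ‖ ≠ 0 := norm_ne_zero_iff.2 (zeta_ne_zero hτ ξ)
  have hz' : (‖zeta n τ ξ‖ : ℂ) ≠ 0 := by exact_mod_cast hz
  -- The transform of an element of the range is a scalar function times `ζ`, and `ζζᵀ/|ζ|²`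
  -- reproduces such vectors.
  have e4 : ∀ k, (𝓕⁻ (comp n k F) : LpS n 2) ξ
      = (zeta n τ ξ k : ℂ) * ((𝓕⁻ (comp n 0 F) : LpS n 2) ξ / τ) := fun k => by
    refine Fin.cases ?_ (fun i => ?_) k
    · simp only [zeta_zero]; field_simp
    · rw [mul_div_assoc', ← e3 i, mul_div_cancel_left₀ _ hτ']
  have hsq : ∑ k, ((zeta n τ ξ k : ℝ) : ℂ) * (zeta n τ ξ k : ℝ) = (‖zeta n τ ξ‖ : ℂ) ^ 2 := by
    have := EuclideanSpace.real_norm_sq_eq (zeta n τ ξ)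
    rw [← Complex.ofReal_pow, this]
    push_cast
    exact Finset.sum_congr rfl fun k _ => by ring
  rw [e1, e2, e4 j]
  have e5 : ∀ k, rieszSymbol n τ k ξ * (𝓕⁻ (comp n k F) : LpS n 2) ξ
      = (((zeta n τ ξ k : ℝ) : ℂ) * (zeta n τ ξ k : ℝ)) *
        ((𝓕⁻ (comp n 0 F) : LpS n 2) ξ / τ / ‖zeta n τ ξ‖) := fun k => by
    rw [e4 k, rieszSymbol]
    push_cast
    ring
  simp only [e5]
  rw [← Finset.sum_mul, hsq, rieszSymbol]
  push_cast
  field_simp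

/-- Both sides say that the transform of `F` is orthogonal to `ζ` at almost every frequency. The
right-hand side is the equation `S_τ^* F = 0`, tested with compactly supported functions only; this
is the form in which it appears in the Dirac system. -/
theorem gradProj_eq_zero_iff {τ : ℝ} (hτ : τ ≠ 0) (F : LpV n 2) : gradProj n hτ F = 0 ↔
    ∀ φ : Rn n → ℝ, IsTest φ → (∑ i, ∫ x, partialD i φ x • F x (Fin.succ i))
      = Complex.I * τ * ∫ x, φ x • F x 0 := by
  have hz' : ∀ ξ : Rn n, (‖zeta n τ ξ‖ : ℂ) ≠ 0 := fun ξ => by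
    exact_mod_cast norm_ne_zero_iff.2 (zeta_ne_zero hτ ξ)
  have hsum : ∀ ξ : Rn n, ∑ k, rieszSymbol n τ k ξ * (𝓕⁻ (comp n k F) : LpS n 2) ξ
      = (∑ k, (zeta n τ ξ k : ℂ) * (𝓕⁻ (comp n k F) : LpS n 2) ξ) / ‖zeta n τ ξ‖ := fun ξ => by
    rw [Finset.sum_div]
    refine Finset.sum_congr rfl fun k _ => ?_
    rw [rieszSymbol]
    push_cast
    ring
  rw [tested_iff_fourier]
  constructor
  · intro h
    have h0 : comp n 0 (gradProj n hτ F) = 0 := by rw [h, map_zero]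
    have := fourierInv_comp_gradProj_ae hτ 0 F
    rw [h0] at this
    filter_upwards [this, fourierInv_zero_ae (n := n), fourierInv_rieszSum_ae hτ F] with ξ e1 e2 e3
    rw [e2, e3, hsum] at e1
    have hτ' : (τ : ℂ) ≠ 0 := by exact_mod_cast hτ
    simpa [rieszSymbol, hτ, zeta_ne_zero hτ ξ] using e1.symm
  · intro h
    refine LpV_ext_comp fun j => fourierInv_ext ?_
    rw [map_zero]
    filter_upwards [fourierInv_comp_gradProj_ae hτ j F, fourierInv_zero_ae (n := n),
      fourierInv_rieszSum_ae hτ F, h] with ξ e1 e2 e3 e4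
    rw [e1, e2, e3, hsum, e4]
    simp

theorem inner_riesz {τ : ℝ} (hτ : τ ≠ 0) (j : Fin (n + 1)) (f g : LpS n 2) :
    inner ℂ g (riesz n hτ j f) = inner ℂ (riesz n hτ j g) f :=
  inner_mult_comm (memLp_rieszSymbol hτ j) (fun _ => Complex.conj_ofReal _) f g

/-- The projection has the form `R^* R` with `R` the operator `rieszSum`, because each Riesz
transform is self-adjoint. -/
theorem inner_gradProj_eq {τ : ℝ} (hτ : τ ≠ 0) (F G : LpV n 2) :
    inner ℂ G (gradProj n hτ F) = inner ℂ (rieszSum n hτ G) (rieszSum n hτ F) := by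
  rw [inner_eq_sum_comp]
  simp only [comp_gradProj, inner_riesz]
  rw [← sum_inner]
  congr 1
  simp [rieszSum, sum_apply]

theorem inner_gradProj {τ : ℝ} (hτ : τ ≠ 0) (F G : LpV n 2) :
    inner ℂ G (gradProj n hτ F) = inner ℂ (gradProj n hτ G) F := by
  rw [inner_gradProj_eq, ← inner_conj_symm (gradProj n hτ G), inner_gradProj_eq, inner_conj_symm]

theorem gradProj_eq_zero_iff_orthogonal {τ : ℝ} (hτ : τ ≠ 0) (F : LpV n 2) :
    gradProj n hτ F = 0 ↔ ∀ G ∈ gradRange n τ, inner ℂ G F = 0 := by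
  constructor
  · intro h G hG
    rw [← gradProj_of_mem hτ hG, ← inner_gradProj, h, inner_zero_right]
  · intro h
    rw [← inner_self_eq_zero (𝕜 := ℂ), inner_gradProj, gradProj_of_mem hτ (gradProj_mem hτ F)]
    exact h _ (gradProj_mem hτ F)

theorem memLp_comp {p : ℝ≥0∞} {F : LpV n 2} (hF : MemLp F p volume) (j : Fin (n + 1)) :
    MemLp (comp n j F) p volume ∧ eLpNorm (comp n j F) p volume ≤ eLpNorm F p volume := by
  have hle : ∀ᵐ x, ‖comp n j F x‖ ≤ ‖F x‖ := by
    filter_upwards [comp_ae j F] with x hx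
    rw [hx]
    exact PiLp.norm_apply_le _ j
  exact ⟨hF.of_le (Lp.memLp _).1 hle, eLpNorm_mono_ae hle⟩

/-- The orthogonal projections onto the range of `S_τ` are bounded on `L^p` for `1 < p < ∞`,
uniformly in `τ`. -/
theorem gradProj_formBdd (n : ℕ) {r : ℝ} (h0 : 0 < r) (h1 : r < 1) : ∃ C : ℝ, 0 ≤ C ∧
    ∀ {τ : ℝ} (hτ : τ ≠ 0), FormBdd (gradProj n hτ) r C := by
  obtain ⟨C, hC, hR⟩ := riesz_formBdd n h0 h1
  refine ⟨∑ j : Fin (n + 1), ∑ k : Fin (n + 1), C * C, by positivity, fun {τ} hτ => ?_⟩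
  intro F G hF hG
  have e : inner ℂ G (gradProj n hτ F) = ∑ j, ∑ k,
      inner ℂ (comp n j G) (riesz n hτ j (riesz n hτ k (comp n k F))) := by
    rw [inner_eq_sum_comp]
    simp only [comp_gradProj, rieszSum, sum_apply, map_sum, inner_sum,
      ContinuousLinearMap.comp_apply]
  rw [e, Finset.sum_mul, Finset.sum_mul]
  refine norm_sum_le_of_le _ fun j _ => ?_
  rw [Finset.sum_mul, Finset.sum_mul]
  refine norm_sum_le_of_le _ fun k _ => ?_
  obtain ⟨a1, a2⟩ := memLp_comp hF k
  obtain ⟨b1, b2⟩ := memLp_comp hG j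
  obtain ⟨c1, c2⟩ := (hR hτ k).opBdd h0 h1 hC _ a1
  have a2' := ENNReal.toReal_mono hF.eLpNorm_ne_top a2
  have b2' := ENNReal.toReal_mono hG.eLpNorm_ne_top b2
  calc _ ≤ C * _ * _ := hR hτ j _ _ c1 b1
    _ ≤ C * (C * (eLpNorm F (ex r) volume).toReal) * (eLpNorm G (ex (1 - r)) volume).toReal := by
        gcongr
        exact c2.trans (by gcongr)
    _ = _ := by ring

end proj

/-! ### Multiplication by bounded coefficients -/

section coeff

variable {n : ℕ}

theorem act_apply (M : Matrix (Fin (n + 1)) (Fin (n + 1)) ℂ) (ξ : Cn1 n) (i : Fin (n + 1)) :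
    act M ξ i = ∑ j, M i j * ξ j := by
  simp [Matrix.mulVec, dotProduct]

theorem act_mul (M N : Matrix (Fin (n + 1)) (Fin (n + 1)) ℂ) (ξ : Cn1 n) :
    act (M * N) ξ = act M (act N ξ) := by
  simp only [act, map_mul, mul_apply_eq_comp]

theorem act_one (ξ : Cn1 n) : act (1 : Matrix (Fin (n + 1)) (Fin (n + 1)) ℂ) ξ = ξ := by
  simp only [act, map_one, one_apply_eq_self]

theorem act_add (M N : Matrix (Fin (n + 1)) (Fin (n + 1)) ℂ) (ξ : Cn1 n) :
    act (M + N) ξ = act M ξ + act N ξ := by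
  simp only [act, map_add, add_apply]

theorem act_sub (M N : Matrix (Fin (n + 1)) (Fin (n + 1)) ℂ) (ξ : Cn1 n) :
    act (M - N) ξ = act M ξ - act N ξ := by
  simp only [act, map_sub, sub_apply]

theorem act_conjTranspose (M : Matrix (Fin (n + 1)) (Fin (n + 1)) ℂ) (ξ η : Cn1 n) :
    inner ℂ (act M.conjTranspose ξ) η = inner ℂ ξ (act M η) := by
  have h : Matrix.toEuclideanCLM (𝕜 := ℂ) M.conjTranspose
      = ContinuousLinearMap.adjoint (Matrix.toEuclideanCLM (𝕜 := ℂ) M) := by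
    rw [← Matrix.star_eq_conjTranspose, map_star]
    rfl
  rw [act, h, ContinuousLinearMap.adjoint_inner_left]

theorem IsBoundedCoeff.exists_norm_act_le {M : Coeff n} (hM : IsBoundedCoeff M) :
    ∃ K : ℝ, 0 ≤ K ∧ ∀ᵐ x : Rn n, ∀ ξ : Cn1 n, ‖act (M x) ξ‖ ≤ K * ‖ξ‖ := by
  obtain ⟨Λ, hΛ⟩ := hM.bdd
  refine ⟨(n + 1) * ((n + 1) * |Λ|), by positivity, ?_⟩
  filter_upwards [hΛ] with x hx ξ
  have hc : ∀ i, ‖act (M x) ξ i‖ ≤ ((n + 1) * |Λ|) * ‖ξ‖ := fun i => by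
    rw [act_apply]
    calc ‖∑ j, M x i j * ξ j‖ ≤ ∑ j : Fin (n + 1), |Λ| * ‖ξ‖ := by
          refine norm_sum_le_of_le _ fun j _ => ?_
          rw [norm_mul]
          exact mul_le_mul ((hx i j).trans (le_abs_self _)) (PiLp.norm_apply_le _ j)
            (norm_nonneg _) (abs_nonneg _)
      _ = _ := by simp; ring
  calc ‖act (M x) ξ‖ = ‖∑ i, (EuclideanSpace.single i (act (M x) ξ i) : Cn1 n)‖ := by
        congr 1
        ext k
        simp [Finset.sum_apply, Pi.single_apply]
    _ ≤ ∑ i : Fin (n + 1), ((n + 1) * |Λ|) * ‖ξ‖ :=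
        norm_sum_le_of_le _ fun i _ => by simpa using hc i
    _ = _ := by simp; ring

theorem IsBoundedCoeff.of_norm_act_le {M : Coeff n}
    (h : ∀ i j, AEStronglyMeasurable (fun x => M x i j) (volume : Measure (Rn n))) {K : ℝ}
    (hK : ∀ᵐ x : Rn n, ∀ ξ : Cn1 n, ‖act (M x) ξ‖ ≤ K * ‖ξ‖) : IsBoundedCoeff M := by
  refine ⟨h, K, ?_⟩
  filter_upwards [hK] with x hx i j
  have h1 : act (M x) (EuclideanSpace.single j 1) i = M x i j := by
    rw [act_apply, Finset.sum_eq_single j] <;> simp +contextual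
  rw [← h1]
  refine (PiLp.norm_apply_le _ i).trans ((hx _).trans ?_)
  simp

theorem IsBoundedCoeff.aestronglyMeasurable_act {M : Coeff n} (hM : IsBoundedCoeff M)
    {F : Rn n → Cn1 n} (hF : AEStronglyMeasurable F volume) :
    AEStronglyMeasurable (fun x => act (M x) (F x)) volume := by
  have : (fun x => act (M x) (F x)) =
      fun x => (WithLp.toLp 2 fun i => ∑ j, M x i j * F x j : Cn1 n) := by
    ext x i
    simp [Matrix.mulVec, dotProduct]
  rw [this]
  refine (PiLp.continuous_toLp 2 _).comp_aestronglyMeasurable ?_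
  refine (aemeasurable_pi_lambda _ fun i => ?_).aestronglyMeasurable
  refine Finset.aemeasurable_fun_sum _ fun j _ => ?_
  refine (hM.aesm i j).aemeasurable.mul ?_
  exact ((EuclideanSpace.proj j : Cn1 n →L[ℂ] ℂ).continuous.comp_aestronglyMeasurable hF).aemeasurable

theorem IsBoundedCoeff.memLp_act {M : Coeff n} (hM : IsBoundedCoeff M) {p : ℝ≥0∞}
    {F : Rn n → Cn1 n} (hF : MemLp F p volume) : MemLp (fun x => act (M x) (F x)) p volume := by
  obtain ⟨K, -, hK⟩ := hM.exists_norm_act_le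
  exact MemLp.of_le_mul hF (hM.aestronglyMeasurable_act hF.1) (hK.mono fun x hx => hx _)

theorem IsBoundedCoeff.exists_mulOp {M : Coeff n} (hM : IsBoundedCoeff M) (p : ℝ≥0∞)
    [Fact (1 ≤ p)] : ∃ T : LpV n p →L[ℂ] LpV n p,
      ∀ F : LpV n p, T F =ᵐ[volume] fun x => act (M x) (F x) := by
  obtain ⟨K, hK0, hK⟩ := hM.exists_norm_act_le
  have hmem : ∀ F : LpV n p, MemLp (fun x => act (M x) (F x)) p (volume : Measure (Rn n)) :=
    fun F => hM.memLp_act (Lp.memLp F)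
  let T : LpV n p →ₗ[ℂ] LpV n p :=
    { toFun := fun F => (hmem F).toLp _
      map_add' := fun F G => by
        refine Lp.ext ?_
        filter_upwards [(hmem (F + G)).coeFn_toLp, (hmem F).coeFn_toLp, (hmem G).coeFn_toLp,
          Lp.coeFn_add F G, Lp.coeFn_add ((hmem F).toLp _) ((hmem G).toLp _)]
          with x e1 e2 e3 e4 e5
        rw [e1, e5, e4, Pi.add_apply, Pi.add_apply, e2, e3]
        exact (Matrix.toEuclideanCLM (𝕜 := ℂ) (M x)).map_add _ _
      map_smul' := fun c F => by
        refine Lp.ext ?_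
        filter_upwards [(hmem (c • F)).coeFn_toLp, (hmem F).coeFn_toLp,
          Lp.coeFn_smul c F, Lp.coeFn_smul c ((hmem F).toLp _)]
          with x e1 e2 e3 e4
        rw [RingHom.id_apply, e1, e4, e3, Pi.smul_apply, Pi.smul_apply, e2]
        exact (Matrix.toEuclideanCLM (𝕜 := ℂ) (M x)).map_smul _ _ }
  refine ⟨T.mkContinuous K fun F => ?_, fun F => (hmem F).coeFn_toLp⟩
  refine Lp.norm_le_mul_norm_of_ae_le_mul ?_
  filter_upwards [hK, (hmem F).coeFn_toLp] with x e1 e2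
  have e3 : T F x = act (M x) (F x) := e2
  rw [e3]
  exact e1 _

/-- Multiplication by bounded coefficients as an operator on `L^p`. -/
def mulOp {M : Coeff n} (hM : IsBoundedCoeff M) (p : ℝ≥0∞) [Fact (1 ≤ p)] :
    LpV n p →L[ℂ] LpV n p := (hM.exists_mulOp p).choose

theorem mulOp_ae {M : Coeff n} (hM : IsBoundedCoeff M) {p : ℝ≥0∞} [Fact (1 ≤ p)] (F : LpV n p) :
    mulOp hM p F =ᵐ[volume] fun x => act (M x) (F x) := (hM.exists_mulOp p).choose_spec F

theorem mulOp_mulOp_eq {M N : Coeff n} (hM : IsBoundedCoeff M) (hN : IsBoundedCoeff N) {p : ℝ≥0∞}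
    [Fact (1 ≤ p)] (h : ∀ᵐ x : Rn n, M x * N x = 1) (F : LpV n p) :
    mulOp hM p (mulOp hN p F) = F := by
  refine Lp.ext ?_
  filter_upwards [mulOp_ae hM (mulOp hN p F), mulOp_ae hN F, h] with x e1 e2 e3
  rw [e1, e2, ← act_mul, e3, act_one]

/-- The `L^p`-bound of a multiplication operator on `L²`. -/
theorem exists_eLpNorm_mulOp_le {M : Coeff n} (hM : IsBoundedCoeff M) : ∃ K : ℝ, 0 ≤ K ∧
    ∀ (p q : ℝ≥0∞) (_ : Fact (1 ≤ p)) (F : LpV n p), MemLp F q volume →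
      MemLp (mulOp hM p F) q volume ∧
      (eLpNorm (mulOp hM p F) q volume).toReal ≤ K * (eLpNorm F q volume).toReal := by
  obtain ⟨K, hK0, hK⟩ := hM.exists_norm_act_le
  refine ⟨K, hK0, fun p q _ F hF => ?_⟩
  have hle : ∀ᵐ x, ‖mulOp hM p F x‖ ≤ K * ‖F x‖ := by
    filter_upwards [mulOp_ae hM F, hK] with x e1 e2
    rw [e1]
    exact e2 _
  refine ⟨hF.of_le_mul (Lp.memLp _).1 hle, ?_⟩
  have h1 := ENNReal.toReal_mono (ENNReal.mul_ne_top ENNReal.ofReal_ne_top hF.eLpNorm_ne_top)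
    (eLpNorm_le_mul_eLpNorm_of_ae_le_mul hle q)
  rwa [ENNReal.toReal_mul, ENNReal.toReal_ofReal hK0] at h1

theorem IsBoundedCoeff.const (M : Matrix (Fin (n + 1)) (Fin (n + 1)) ℂ) :
    IsBoundedCoeff (fun _ : Rn n => M) :=
  IsBoundedCoeff.of_norm_act_le (K := ‖Matrix.toEuclideanCLM (𝕜 := ℂ) M‖)
    (fun _ _ => aestronglyMeasurable_const)
    (Filter.Eventually.of_forall fun _ ξ => ContinuousLinearMap.le_opNorm _ ξ)

theorem IsBoundedCoeff.add {M N : Coeff n} (hM : IsBoundedCoeff M) (hN : IsBoundedCoeff N) :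
    IsBoundedCoeff (fun x => M x + N x) := by
  obtain ⟨K, -, hK⟩ := hM.exists_norm_act_le
  obtain ⟨L, -, hL⟩ := hN.exists_norm_act_le
  refine IsBoundedCoeff.of_norm_act_le (K := K + L) (fun i j => (hM.aesm i j).add (hN.aesm i j)) ?_
  filter_upwards [hK, hL] with x h1 h2 ξ
  rw [act_add, add_mul]
  exact (norm_add_le _ _).trans (add_le_add (h1 ξ) (h2 ξ))

theorem IsBoundedCoeff.sub {M N : Coeff n} (hM : IsBoundedCoeff M) (hN : IsBoundedCoeff N) :
    IsBoundedCoeff (fun x => M x - N x) := by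
  obtain ⟨K, -, hK⟩ := hM.exists_norm_act_le
  obtain ⟨L, -, hL⟩ := hN.exists_norm_act_le
  refine IsBoundedCoeff.of_norm_act_le (K := K + L) (fun i j => (hM.aesm i j).sub (hN.aesm i j)) ?_
  filter_upwards [hK, hL] with x h1 h2 ξ
  rw [act_sub, add_mul]
  exact (norm_sub_le _ _).trans (add_le_add (h1 ξ) (h2 ξ))

theorem IsBoundedCoeff.mul {M N : Coeff n} (hM : IsBoundedCoeff M) (hN : IsBoundedCoeff N) :
    IsBoundedCoeff (fun x => M x * N x) := by
  obtain ⟨K, hK0, hK⟩ := hM.exists_norm_act_le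
  obtain ⟨L, -, hL⟩ := hN.exists_norm_act_le
  refine IsBoundedCoeff.of_norm_act_le (K := K * L) (fun i j => ?_) ?_
  · simp only [Matrix.mul_apply]
    exact Finset.aestronglyMeasurable_fun_sum _ fun k _ => (hM.aesm i k).mul (hN.aesm k j)
  · filter_upwards [hK, hL] with x h1 h2 ξ
    rw [act_mul, mul_assoc]
    exact (h1 _).trans (mul_le_mul_of_nonneg_left (h2 ξ) hK0)

theorem IsBoundedCoeff.conjTranspose {M : Coeff n} (hM : IsBoundedCoeff M) :
    IsBoundedCoeff (fun x => (M x).conjTranspose) := by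
  obtain ⟨Λ, hΛ⟩ := hM.bdd
  refine ⟨fun i j => ?_, Λ, hΛ.mono fun x hx i j => ?_⟩
  · simp only [Matrix.conjTranspose_apply]
    exact Complex.continuous_conj.comp_aestronglyMeasurable (hM.aesm j i)
  · simpa using hx j i

/-- In finite dimension a lower bound gives injectivity, and injectivity gives invertibility. -/
theorem isUnit_of_act_lower {M : Matrix (Fin (n + 1)) (Fin (n + 1)) ℂ} {c : ℝ} (hc : 0 < c)
    (h : ∀ ξ : Cn1 n, c * ‖ξ‖ ≤ ‖act M ξ‖) : IsUnit M := by
  rw [← Matrix.mulVec_injective_iff_isUnit]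
  intro v w hvw
  have h1 := h (WithLp.toLp 2 (v - w))
  have h2 : act M (WithLp.toLp 2 (v - w)) = 0 := by
    ext i
    have := congrFun hvw i
    simp [this]
  rw [h2, norm_zero] at h1
  have h3 : ‖(WithLp.toLp 2 (v - w) : Cn1 n)‖ = 0 :=
    le_antisymm (by nlinarith) (norm_nonneg _)
  have h4 := norm_eq_zero.1 h3
  funext i
  have := congrArg (fun u : Cn1 n => u i) h4
  simpa [sub_eq_zero] using this

theorem IsBoundedCoeff.inv {M : Coeff n} (hM : IsBoundedCoeff M) {c : ℝ} (hc : 0 < c)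
    (h : ∀ᵐ x : Rn n, ∀ ξ : Cn1 n, c * ‖ξ‖ ≤ ‖act (M x) ξ‖) :
    IsBoundedCoeff (fun x => (M x)⁻¹) ∧ (∀ᵐ x : Rn n, M x * (M x)⁻¹ = 1) ∧
      ∀ᵐ x : Rn n, (M x)⁻¹ * M x = 1 := by
  have hu : ∀ᵐ x : Rn n, IsUnit (M x).det := h.mono fun x hx =>
    (Matrix.isUnit_iff_isUnit_det _).1 (isUnit_of_act_lower hc hx)
  have h1 : ∀ᵐ x : Rn n, M x * (M x)⁻¹ = 1 := hu.mono fun x hx => Matrix.mul_nonsing_inv _ hx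
  have h2 : ∀ᵐ x : Rn n, (M x)⁻¹ * M x = 1 := hu.mono fun x hx => Matrix.nonsing_inv_mul _ hx
  refine ⟨IsBoundedCoeff.of_norm_act_le (K := c⁻¹) (fun i j => ?_) ?_, h1, h2⟩
  · have hMm : AEMeasurable (fun x => (fun i j => M x i j : Fin (n + 1) → Fin (n + 1) → ℂ))
        (volume : Measure (Rn n)) :=
      aemeasurable_pi_lambda _ fun i => aemeasurable_pi_lambda _ fun j => (hM.aesm i j).aemeasurable
    have hdet : AEMeasurable (fun x => (M x).det) (volume : Measure (Rn n)) := by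
      have hcont : Continuous fun N : Fin (n + 1) → Fin (n + 1) → ℂ => (Matrix.of N).det :=
        Continuous.matrix_det continuous_id
      exact hcont.measurable.comp_aemeasurable hMm
    have hadj : AEMeasurable (fun x => (M x).adjugate i j) (volume : Measure (Rn n)) := by
      have hcont : Continuous fun N : Fin (n + 1) → Fin (n + 1) → ℂ => (Matrix.of N).adjugate i j :=
        (Continuous.matrix_adjugate continuous_id).matrix_elem i j
      exact hcont.measurable.comp_aemeasurable hMm
    -- Cramer's formula, which gives measurability of the inverse.
    have e : (fun x => (M x)⁻¹ i j) = fun x => (M x).det⁻¹ * (M x).adjugate i j := by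
      ext x
      rw [Matrix.inv_def, Matrix.smul_apply, smul_eq_mul, Ring.inverse_eq_inv']
    rw [e]
    exact (hdet.inv.mul hadj).aestronglyMeasurable
  · filter_upwards [h, h1] with x e1 e2 ξ
    have := e1 (act ((M x)⁻¹) ξ)
    rw [← act_mul, e2, act_one] at this
    rwa [le_inv_mul_iff₀ hc]

/-- The projection onto the perpendicular component. -/
def e0 (n : ℕ) : Matrix (Fin (n + 1)) (Fin (n + 1)) ℂ :=
  Matrix.diagonal fun j => if j = 0 then 1 else 0

/-- The projection onto the parallel components. -/
def e1 (n : ℕ) : Matrix (Fin (n + 1)) (Fin (n + 1)) ℂ :=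
  Matrix.diagonal fun j => if j = 0 then 0 else 1

theorem act_e0_apply (ξ : Cn1 n) (j : Fin (n + 1)) : act (e0 n) ξ j = if j = 0 then ξ j else 0 := by
  simp [e0, Matrix.mulVec_diagonal]

theorem act_e1_apply (ξ : Cn1 n) (j : Fin (n + 1)) : act (e1 n) ξ j = if j = 0 then 0 else ξ j := by
  simp [e1, Matrix.mulVec_diagonal]

theorem norm_act_e0_le (ξ : Cn1 n) : ‖act (e0 n) ξ‖ ≤ ‖ξ‖ := by
  rw [EuclideanSpace.norm_eq, EuclideanSpace.norm_eq]
  refine Real.sqrt_le_sqrt (Finset.sum_le_sum fun j _ => ?_)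
  rw [act_e0_apply]
  split_ifs <;> simp

theorem norm_act_e1_le (ξ : Cn1 n) : ‖act (e1 n) ξ‖ ≤ ‖ξ‖ := by
  rw [EuclideanSpace.norm_eq, EuclideanSpace.norm_eq]
  refine Real.sqrt_le_sqrt (Finset.sum_le_sum fun j _ => ?_)
  rw [act_e1_apply]
  split_ifs <;> simp

theorem e0_add_e1 (ξ : Cn1 n) : act (e0 n) ξ + act (e1 n) ξ = ξ := by
  ext j
  rw [PiLp.add_apply, act_e0_apply, act_e1_apply]
  split_ifs <;> simp

theorem act_upperPart_apply (M : Matrix (Fin (n + 1)) (Fin (n + 1)) ℂ) (ξ : Cn1 n)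
    (j : Fin (n + 1)) : act (upperPart M) ξ j = if j = 0 then act M ξ j else ξ j := by
  rw [act_apply, act_apply]
  split_ifs with h <;> simp [upperPart, h]

theorem act_lowerPart_apply (M : Matrix (Fin (n + 1)) (Fin (n + 1)) ℂ) (ξ : Cn1 n)
    (j : Fin (n + 1)) : act (lowerPart M) ξ j = if j = 0 then ξ j else act M ξ j := by
  rw [act_apply, act_apply]
  split_ifs with h <;> simp [lowerPart, h]

theorem act_upperPart (M : Matrix (Fin (n + 1)) (Fin (n + 1)) ℂ) (ξ : Cn1 n) :
    act (upperPart M) ξ = act (e0 n) (act M ξ) + act (e1 n) ξ := by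
  ext j
  rw [PiLp.add_apply, act_upperPart_apply, act_e0_apply, act_e1_apply]
  split_ifs <;> simp

theorem act_lowerPart (M : Matrix (Fin (n + 1)) (Fin (n + 1)) ℂ) (ξ : Cn1 n) :
    act (lowerPart M) ξ = act (e0 n) ξ + act (e1 n) (act M ξ) := by
  ext j
  rw [PiLp.add_apply, act_lowerPart_apply, act_e0_apply, act_e1_apply]
  split_ifs <;> simp

theorem act_e0_e0_add_e1 (ξ η : Cn1 n) :
    act (e0 n) (act (e0 n) ξ + act (e1 n) η) = act (e0 n) ξ := by
  ext j
  simp only [act_e0_apply, PiLp.add_apply, act_e1_apply]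
  split_ifs <;> simp

theorem act_e1_e0_add_e1 (ξ η : Cn1 n) :
    act (e1 n) (act (e0 n) ξ + act (e1 n) η) = act (e1 n) η := by
  ext j
  simp only [act_e0_apply, PiLp.add_apply, act_e1_apply]
  split_ifs <;> simp

theorem inner_eq_e0_add_e1 (ξ η : Cn1 n) : inner ℂ ξ η =
    inner ℂ (act (e0 n) ξ) (act (e0 n) η) + inner ℂ (act (e1 n) ξ) (act (e1 n) η) := by
  simp only [PiLp.inner_apply, ← Finset.sum_add_distrib]
  refine Finset.sum_congr rfl fun j _ => ?_
  simp only [act_e0_apply, act_e1_apply]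
  split_ifs <;> simp

/-! ### Lower bounds for the block matrices -/

section elliptic

variable {M : Matrix (Fin (n + 1)) (Fin (n + 1)) ℂ} {lam K : ℝ}

/-- Ellipticity split along the two blocks. Each of the matrices treated below controls one factor
in each of the two products. -/
theorem elliptic_le (h : ∀ ξ : Cn1 n, lam * ‖ξ‖ ^ 2 ≤ (inner ℂ ξ (act M ξ)).re) (ξ : Cn1 n) :
    lam * ‖ξ‖ ^ 2 ≤ ‖act (e0 n) ξ‖ * ‖act (e0 n) (act M ξ)‖ +
      ‖act (e1 n) ξ‖ * ‖act (e1 n) (act M ξ)‖ := by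
  refine (h ξ).trans ((Complex.re_le_norm _).trans ?_)
  rw [inner_eq_e0_add_e1]
  exact (norm_add_le _ _).trans (add_le_add (norm_inner_le_norm _ _) (norm_inner_le_norm _ _))

theorem le_of_mul_sq_le {a b c : ℝ} (ha : 0 ≤ a) (hb : 0 ≤ b) (h : c * a ^ 2 ≤ b * a) :
    c * a ≤ b := by
  rcases ha.eq_or_lt with rfl | ha
  · simpa using hb
  · nlinarith

/-- The components of the image are `(Mξ)_⊥` and `ξ_∥`. In `elliptic_le` they account for one factor
of each product; the other factors are at most `‖ξ‖` and `K ‖ξ‖`, whence the constant `1 + K`. -/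
theorem act_upperPart_lower (hK0 : 0 ≤ K) (hK : ∀ ξ : Cn1 n, ‖act M ξ‖ ≤ K * ‖ξ‖)
    (h : ∀ ξ : Cn1 n, lam * ‖ξ‖ ^ 2 ≤ (inner ℂ ξ (act M ξ)).re) (ξ : Cn1 n) :
    lam / (1 + K) * ‖ξ‖ ≤ ‖act (upperPart M) ξ‖ := by
  have h0 : ‖act (e0 n) (act M ξ)‖ ≤ ‖act (upperPart M) ξ‖ := by
    rw [act_upperPart]
    simpa only [act_e0_e0_add_e1] using
      norm_act_e0_le (act (e0 n) (act M ξ) + act (e1 n) ξ)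
  have h1 : ‖act (e1 n) ξ‖ ≤ ‖act (upperPart M) ξ‖ := by
    rw [act_upperPart]
    simpa only [act_e1_e0_add_e1] using
      norm_act_e1_le (act (e0 n) (act M ξ) + act (e1 n) ξ)
  rw [div_mul_eq_mul_div, div_le_iff₀ (by positivity)]
  refine le_of_mul_sq_le (norm_nonneg _) (by positivity) ((elliptic_le h ξ).trans ?_)
  calc _ ≤ ‖ξ‖ * ‖act (upperPart M) ξ‖ + ‖act (upperPart M) ξ‖ * (K * ‖ξ‖) := by
        gcongr
        · exact norm_act_e0_le _
        · exact (norm_act_e1_le _).trans (hK ξ)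
    _ = _ := by ring

/-- Here the components of the image are `ξ_⊥` and `(Mξ)_∥`, the complementary pair of factors in
`elliptic_le`. -/
theorem act_lowerPart_lower (hK0 : 0 ≤ K) (hK : ∀ ξ : Cn1 n, ‖act M ξ‖ ≤ K * ‖ξ‖)
    (h : ∀ ξ : Cn1 n, lam * ‖ξ‖ ^ 2 ≤ (inner ℂ ξ (act M ξ)).re) (ξ : Cn1 n) :
    lam / (1 + K) * ‖ξ‖ ≤ ‖act (lowerPart M) ξ‖ := by
  have h0 : ‖act (e0 n) ξ‖ ≤ ‖act (lowerPart M) ξ‖ := by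
    rw [act_lowerPart]
    simpa only [act_e0_e0_add_e1] using
      norm_act_e0_le (act (e0 n) ξ + act (e1 n) (act M ξ))
  have h1 : ‖act (e1 n) (act M ξ)‖ ≤ ‖act (lowerPart M) ξ‖ := by
    rw [act_lowerPart]
    simpa only [act_e1_e0_add_e1] using
      norm_act_e1_le (act (e0 n) ξ + act (e1 n) (act M ξ))
  rw [div_mul_eq_mul_div, div_le_iff₀ (by positivity)]
  refine le_of_mul_sq_le (norm_nonneg _) (by positivity) ((elliptic_le h ξ).trans ?_)
  calc _ ≤ ‖act (lowerPart M) ξ‖ * (K * ‖ξ‖) + ‖ξ‖ * ‖act (lowerPart M) ξ‖ := by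
        gcongr
        · exact (norm_act_e0_le _).trans (hK ξ)
        · exact norm_act_e1_le _
    _ = _ := by ring

/-- This matrix sends the right-hand side of the resolvent equation to the argument of the Hodge
projector, so its inverse is needed to recover the projector from the resolvent. With `m` the norm
of the image, ellipticity tested with `ξ_∥` gives `‖ξ_∥‖ ≤ m / lam`, and then `‖ξ_⊥‖ ≤ m + K m /
lam`. -/
theorem act_e0_sub_mul_e1_lower (hlam : 0 < lam) (hK0 : 0 ≤ K)
    (hK : ∀ ξ : Cn1 n, ‖act M ξ‖ ≤ K * ‖ξ‖)
    (h : ∀ ξ : Cn1 n, lam * ‖ξ‖ ^ 2 ≤ (inner ℂ ξ (act M ξ)).re) (ξ : Cn1 n) :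
    (1 + (1 + K) / lam)⁻¹ * ‖ξ‖ ≤ ‖act (e0 n - M * e1 n) ξ‖ := by
  set ζ := act (e1 n) ξ with hζ
  set m := ‖act (e0 n - M * e1 n) ξ‖ with hm
  have e : act (e0 n - M * e1 n) ξ = act (e0 n) ξ - act M ζ := by rw [act_sub, act_mul]
  have hζ0 : act (e0 n) ζ = 0 := by
    ext j; simp only [hζ, act_e0_apply, act_e1_apply]; split_ifs <;> simp
  have hζ1 : act (e1 n) (act M ζ) = -act (e1 n) (act (e0 n - M * e1 n) ξ) := by
    rw [e]
    ext j
    simp only [PiLp.neg_apply, act_e1_apply, PiLp.sub_apply, act_e0_apply]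
    split_ifs <;> simp
  have h1 : lam * ‖ζ‖ ≤ m := by
    refine le_of_mul_sq_le (norm_nonneg _) (norm_nonneg _) ((elliptic_le h ζ).trans ?_)
    rw [hζ0, norm_zero, zero_mul, zero_add, hζ1, norm_neg, mul_comm]
    gcongr
    · exact norm_act_e1_le _
    · exact norm_act_e1_le _
  have h1' : ‖ζ‖ ≤ m / lam := by rw [le_div_iff₀ hlam]; linarith
  have h2 : ‖act (e0 n) ξ‖ ≤ m + K * ‖ζ‖ := by
    have : act (e0 n) ξ = act (e0 n - M * e1 n) ξ + act M ζ := by rw [e]; abel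
    rw [this]
    exact (norm_add_le _ _).trans (add_le_add le_rfl (hK ζ))
  rw [inv_mul_le_iff₀ (by positivity)]
  calc ‖ξ‖ = ‖act (e0 n) ξ + ζ‖ := by rw [hζ, e0_add_e1]
    _ ≤ ‖act (e0 n) ξ‖ + ‖ζ‖ := norm_add_le _ _
    _ ≤ m + K * (m / lam) + m / lam := by
        refine add_le_add (h2.trans ?_) h1'
        gcongr
    _ = _ := by field_simp; ring

end elliptic

/-- The coefficients and their block transforms, with bounded inverses. -/
structure IsGoodCoeff (M : Coeff n) : Prop where
  bdd : IsBoundedCoeff M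
  inv_bdd : IsBoundedCoeff fun x => (M x)⁻¹
  mul_inv : ∀ᵐ x : Rn n, M x * (M x)⁻¹ = 1
  inv_mul : ∀ᵐ x : Rn n, (M x)⁻¹ * M x = 1

theorem IsGoodCoeff.of_lower {M : Coeff n} (hM : IsBoundedCoeff M) {c : ℝ} (hc : 0 < c)
    (h : ∀ᵐ x : Rn n, ∀ ξ : Cn1 n, c * ‖ξ‖ ≤ ‖act (M x) ξ‖) : IsGoodCoeff M :=
  ⟨hM, (hM.inv hc h).1, (hM.inv hc h).2.1, (hM.inv hc h).2.2⟩

variable {A : Coeff n}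

theorem isGoodCoeff_upperPart (hA : IsBoundedCoeff A) (hell : IsStronglyElliptic A) :
    IsGoodCoeff fun x => upperPart (A x) := by
  obtain ⟨lam, hlam, hE⟩ := hell
  obtain ⟨K, hK0, hK⟩ := hA.exists_norm_act_le
  refine IsGoodCoeff.of_lower (c := lam / (1 + K)) ?_ (by positivity) ?_
  · have := ((IsBoundedCoeff.const (e0 n)).mul hA).add (IsBoundedCoeff.const (e1 n))
    convert this using 2 with x
    ext i j
    simp only [upperPart, e0, e1, Matrix.of_apply, Matrix.add_apply, Matrix.diagonal_mul,
      Matrix.diagonal_apply]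
    split_ifs <;> simp_all
  · filter_upwards [hE, hK] with x h1 h2
    exact act_upperPart_lower hK0 h2 h1

theorem isGoodCoeff_lowerPart (hA : IsBoundedCoeff A) (hell : IsStronglyElliptic A) :
    IsGoodCoeff fun x => lowerPart (A x) := by
  obtain ⟨lam, hlam, hE⟩ := hell
  obtain ⟨K, hK0, hK⟩ := hA.exists_norm_act_le
  refine IsGoodCoeff.of_lower (c := lam / (1 + K)) ?_ (by positivity) ?_
  · have := (IsBoundedCoeff.const (e0 n)).add ((IsBoundedCoeff.const (e1 n)).mul hA)
    convert this using 2 with x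
    ext i j
    simp only [lowerPart, e0, e1, Matrix.of_apply, Matrix.add_apply, Matrix.diagonal_mul,
      Matrix.diagonal_apply]
    split_ifs <;> simp_all
  · filter_upwards [hE, hK] with x h1 h2
    exact act_lowerPart_lower hK0 h2 h1

theorem isGoodCoeff_e0_sub_mul_e1 (hA : IsBoundedCoeff A) (hell : IsStronglyElliptic A) :
    IsGoodCoeff fun x => e0 n - A x * e1 n := by
  obtain ⟨lam, hlam, hE⟩ := hell
  obtain ⟨K, hK0, hK⟩ := hA.exists_norm_act_le
  refine IsGoodCoeff.of_lower (c := (1 + (1 + K) / lam)⁻¹) ?_ (by positivity) ?_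
  · exact (IsBoundedCoeff.const (e0 n)).sub (hA.mul (IsBoundedCoeff.const (e1 n)))
  · filter_upwards [hE, hK] with x h1 h2
    exact act_e0_sub_mul_e1_lower hlam hK0 h2 h1

theorem isBoundedCoeff_coeffB (hA : IsBoundedCoeff A) (hell : IsStronglyElliptic A) :
    IsBoundedCoeff (coeffB A) :=
  (isGoodCoeff_lowerPart hA hell).bdd.mul (isGoodCoeff_upperPart hA hell).inv_bdd

/-- The pointwise inverse of `B`. -/
def coeffBInv (A : Coeff n) : Coeff n := fun x => upperPart (A x) * (lowerPart (A x))⁻¹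

theorem isBoundedCoeff_coeffBInv (hA : IsBoundedCoeff A) (hell : IsStronglyElliptic A) :
    IsBoundedCoeff (coeffBInv A) :=
  (isGoodCoeff_upperPart hA hell).bdd.mul (isGoodCoeff_lowerPart hA hell).inv_bdd

theorem coeffB_mul_inv (hA : IsBoundedCoeff A) (hell : IsStronglyElliptic A) :
    ∀ᵐ x : Rn n, coeffB A x * coeffBInv A x = 1 := by
  filter_upwards [(isGoodCoeff_lowerPart hA hell).mul_inv, (isGoodCoeff_upperPart hA hell).inv_mul]
    with x h1 h2
  rw [coeffB, coeffBInv, Matrix.mul_assoc, ← Matrix.mul_assoc _ (upperPart (A x)), h2,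
    Matrix.one_mul, h1]

theorem isStronglyElliptic_conjTranspose (hell : IsStronglyElliptic A) :
    IsStronglyElliptic fun x => (A x).conjTranspose := by
  obtain ⟨lam, hlam, hE⟩ := hell
  refine ⟨lam, hlam, hE.mono fun x hx ξ => (hx ξ).trans (le_of_eq ?_)⟩
  rw [← act_conjTranspose, ← inner_conj_symm]
  rfl

end coeff

/-! ### Properties of the Hodge projectors -/

/-! ### Sums and compositions of bounded operators -/

section opBdd

variable {α : Type*} [MeasurableSpace α] {μ : Measure α} {E : Type*} [NormedAddCommGroup E]
  [InnerProductSpace ℂ E] {S T : Lp E 2 μ → Lp E 2 μ} {r M N : ℝ}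

theorem OpBdd.id : OpBdd (fun f : Lp E 2 μ => f) r 1 := fun f hf => ⟨hf, by simp⟩

theorem OpBdd.comp (hM : 0 ≤ M) (hS : OpBdd S r M) (hT : OpBdd T r N) :
    OpBdd (fun f => S (T f)) r (M * N) := fun f hf => by
  obtain ⟨h1, h2⟩ := hT f hf
  obtain ⟨h3, h4⟩ := hS _ h1
  refine ⟨h3, h4.trans ?_⟩
  rw [mul_assoc]
  exact mul_le_mul_of_nonneg_left h2 hM

theorem OpBdd.add (h0 : 0 < r) (h1 : r ≤ 1) (hS : OpBdd S r M) (hT : OpBdd T r N) :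
    OpBdd (fun f => S f + T f) r (M + N) := fun f hf => by
  obtain ⟨a1, a2⟩ := hS f hf
  obtain ⟨b1, b2⟩ := hT f hf
  refine ⟨(a1.add b1).ae_eq (Lp.coeFn_add _ _).symm, ?_⟩
  rw [eLpNorm_congr_ae (Lp.coeFn_add _ _), add_mul]
  refine (ENNReal.toReal_mono (ENNReal.add_ne_top.2 ⟨a1.eLpNorm_ne_top, b1.eLpNorm_ne_top⟩)
    (eLpNorm_add_le a1.1 b1.1 (one_le_ex h0 h1))).trans ?_
  rw [ENNReal.toReal_add a1.eLpNorm_ne_top b1.eLpNorm_ne_top]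
  exact add_le_add a2 b2

theorem OpBdd.sub (h0 : 0 < r) (h1 : r ≤ 1) (hS : OpBdd S r M) (hT : OpBdd T r N) :
    OpBdd (fun f => S f - T f) r (M + N) := fun f hf => by
  obtain ⟨a1, a2⟩ := hS f hf
  obtain ⟨b1, b2⟩ := hT f hf
  refine ⟨(a1.sub b1).ae_eq (Lp.coeFn_sub _ _).symm, ?_⟩
  rw [eLpNorm_congr_ae (Lp.coeFn_sub _ _), add_mul]
  refine (ENNReal.toReal_mono (ENNReal.add_ne_top.2 ⟨a1.eLpNorm_ne_top, b1.eLpNorm_ne_top⟩)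
    (eLpNorm_sub_le a1.1 b1.1 (one_le_ex h0 h1))).trans ?_
  rw [ENNReal.toReal_add a1.eLpNorm_ne_top b1.eLpNorm_ne_top]
  exact add_le_add a2 b2

theorem OpBdd.mono (hMN : M ≤ N) (hS : OpBdd S r M) : OpBdd S r N := fun f hf =>
  ⟨(hS f hf).1, (hS f hf).2.trans (by gcongr)⟩

end opBdd

/-! ### Weak formulation, duality and a priori estimates -/

section hodge

variable {n : ℕ} {A : Coeff n}

theorem mulOp_opBdd {M : Coeff n} (hM : IsBoundedCoeff M) : ∃ K : ℝ, 0 ≤ K ∧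
    ∀ r, OpBdd (mulOp hM 2) r K := by
  obtain ⟨K, hK, h⟩ := exists_eLpNorm_mulOp_le hM
  exact ⟨K, hK, fun r f hf => h 2 (ex r) _ f hf⟩

theorem opL_eq (hA : IsBoundedCoeff A) {τ : ℝ} (u v : W12 n τ) :
    opL A τ u v = inner ℂ (grad n τ v) (mulOp hA 2 (grad n τ u)) := by
  rw [L2.inner_def]
  refine integral_congr_ae ?_
  filter_upwards [mulOp_ae hA (grad n τ u)] with x hx
  rw [hx]

theorem gradStar_eq {τ : ℝ} (f : LpV n 2) (v : W12 n τ) :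
    gradStar τ f v = inner ℂ (grad n τ v) f := by
  rw [L2.inner_def]
  rfl

theorem hodge_mem (A : Coeff n) (τ : ℝ) (f : LpV n 2) : hodge A τ f ∈ gradRange n τ :=
  grad_mem_gradRange _

theorem inner_mulOp_hodge (hA : IsBoundedCoeff A) (hell : IsStronglyElliptic A) {τ : ℝ}
    (hτ : τ ≠ 0) (f : LpV n 2) {G : LpV n 2} (hG : G ∈ gradRange n τ) :
    inner ℂ G (mulOp hA 2 (hodge A τ f)) = inner ℂ G f := by
  obtain ⟨u, hu, -⟩ := existsUnique_opL_eq_gradStar hA hell hτ f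
  have h := Function.invFun_eq ⟨u, hu⟩
  obtain ⟨v, rfl⟩ := exists_grad_eq hG
  have h1 := congrFun h v
  rwa [opL_eq hA, gradStar_eq] at h1

theorem gradProj_mulOp_hodge (hA : IsBoundedCoeff A) (hell : IsStronglyElliptic A) {τ : ℝ}
    (hτ : τ ≠ 0) (f : LpV n 2) : gradProj n hτ (mulOp hA 2 (hodge A τ f)) = gradProj n hτ f := by
  rw [← sub_eq_zero, ← map_sub, gradProj_eq_zero_iff_orthogonal]
  intro G hG
  rw [inner_sub_right, inner_mulOp_hodge hA hell hτ f hG, sub_self]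

theorem exists_coercive (hA : IsBoundedCoeff A) (hell : IsStronglyElliptic A) : ∃ lam : ℝ,
    0 < lam ∧ ∀ F : LpV n 2, lam * ‖F‖ ^ 2 ≤ (inner ℂ F (mulOp hA 2 F)).re := by
  obtain ⟨lam, hlam, hE⟩ := hell
  exact ⟨lam, hlam, fun F => coercive_of_act hE (mulOp_ae hA F)⟩

/-- Uniqueness by coercivity: the difference `d` of two solutions lies in the range of `S_τ` while
`A d` is orthogonal to that range, so `⟨d, A d⟩ = 0`. -/
theorem eq_hodge_of (hA : IsBoundedCoeff A) (hell : IsStronglyElliptic A) {τ : ℝ}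
    (hτ : τ ≠ 0) {f w : LpV n 2} (hw : w ∈ gradRange n τ)
    (h : gradProj n hτ (mulOp hA 2 w) = gradProj n hτ f) : w = hodge A τ f := by
  obtain ⟨lam, hlam, hE⟩ := exists_coercive hA hell
  have hd : w - hodge A τ f ∈ gradRange n τ := (gradRange n τ).sub_mem hw (hodge_mem A τ f)
  have h0 : gradProj n hτ (mulOp hA 2 (w - hodge A τ f)) = 0 := by
    rw [map_sub, map_sub, h, gradProj_mulOp_hodge hA hell hτ, sub_self]
  have h1 := hE (w - hodge A τ f)
  rw [(gradProj_eq_zero_iff_orthogonal hτ _).1 h0 _ hd, Complex.zero_re] at h1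
  have h2 : ‖w - hodge A τ f‖ ^ 2 = 0 := le_antisymm (by nlinarith) (by positivity)
  exact sub_eq_zero.1 (norm_eq_zero.1 (pow_eq_zero_iff two_ne_zero |>.1 h2))

theorem hodge_add (hA : IsBoundedCoeff A) (hell : IsStronglyElliptic A) {τ : ℝ}
    (hτ : τ ≠ 0) (f g : LpV n 2) : hodge A τ (f + g) = hodge A τ f + hodge A τ g := by
  refine (eq_hodge_of hA hell hτ ((gradRange n τ).add_mem (hodge_mem A τ f) (hodge_mem A τ g))
    ?_).symm
  simp only [map_add, gradProj_mulOp_hodge hA hell hτ]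

theorem hodge_smul (hA : IsBoundedCoeff A) (hell : IsStronglyElliptic A) {τ : ℝ}
    (hτ : τ ≠ 0) (c : ℂ) (f : LpV n 2) : hodge A τ (c • f) = c • hodge A τ f := by
  refine (eq_hodge_of hA hell hτ ((gradRange n τ).smul_mem c (hodge_mem A τ f)) ?_).symm
  simp only [map_smul, gradProj_mulOp_hodge hA hell hτ]

/-- The Hodge projectors are bounded on `L²`, uniformly in `τ`. -/
theorem exists_norm_hodge_le (hA : IsBoundedCoeff A) (hell : IsStronglyElliptic A) :
    ∃ C : ℝ, 0 ≤ C ∧ ∀ τ : ℝ, τ ≠ 0 → ∀ f : LpV n 2, ‖hodge A τ f‖ ≤ C * ‖f‖ := by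
  obtain ⟨lam, hlam, hE⟩ := exists_coercive hA hell
  refine ⟨lam⁻¹, by positivity, fun τ hτ f => ?_⟩
  rw [le_inv_mul_iff₀ hlam]
  refine le_of_mul_sq_le (norm_nonneg _) (norm_nonneg _) ((hE _).trans ?_)
  rw [inner_mulOp_hodge hA hell hτ f (hodge_mem A τ f), mul_comm]
  exact (Complex.re_le_norm _).trans (norm_inner_le_norm _ _)

/-- The Hodge projector as a bounded operator on `L²`. -/
def hodgeL (hA : IsBoundedCoeff A) (hell : IsStronglyElliptic A) {τ : ℝ} (hτ : τ ≠ 0) :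
    LpV n 2 →L[ℂ] LpV n 2 :=
  LinearMap.mkContinuous
    { toFun := hodge A τ
      map_add' := hodge_add hA hell hτ
      map_smul' := hodge_smul hA hell hτ }
    (exists_norm_hodge_le hA hell).choose
    ((exists_norm_hodge_le hA hell).choose_spec.2 τ hτ)

theorem inner_mulOp_conjTranspose (hA : IsBoundedCoeff A) (F G : LpV n 2) :
    inner ℂ (mulOp hA.conjTranspose 2 F) G = inner ℂ F (mulOp hA 2 G) := by
  simp only [L2.inner_def]
  refine integral_congr_ae ?_
  filter_upwards [mulOp_ae hA.conjTranspose F, mulOp_ae hA G] with x h1 h2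
  rw [h1, h2, act_conjTranspose]

/-- The adjoint of a Hodge projector is the Hodge projector for the adjoint coefficients. -/
theorem inner_hodge (hA : IsBoundedCoeff A) (hell : IsStronglyElliptic A) {τ : ℝ} (hτ : τ ≠ 0)
    (f g : LpV n 2) :
    inner ℂ g (hodge A τ f) = inner ℂ (hodge (fun x => (A x).conjTranspose) τ g) f := by
  rw [← inner_mulOp_hodge hA hell hτ f (hodge_mem _ τ g), ← inner_mulOp_conjTranspose,
    ← inner_conj_symm (mulOp _ _ _), inner_mulOp_hodge hA.conjTranspose
      (isStronglyElliptic_conjTranspose hell) hτ g (hodge_mem A τ f), inner_conj_symm]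

/-- Passing to the adjoint exchanges the two arguments of the form, and with them the exponents of
`r` and `1 - r`. -/
theorem hodge_formBdd_conjTranspose (hA : IsBoundedCoeff A) (hell : IsStronglyElliptic A) {τ : ℝ}
    (hτ : τ ≠ 0) {r M : ℝ} (h : FormBdd (hodge A τ) r M) :
    FormBdd (hodge (fun x => (A x).conjTranspose) τ) (1 - r) M := by
  intro f g hf hg
  rw [sub_sub_cancel] at hg ⊢
  rw [← inner_conj_symm, ← inner_hodge hA hell hτ, RCLike.norm_conj, mul_right_comm]
  exact h g f hg hf

/-- A priori bounds for the Hodge projectors persist for exponents close to one where they are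
bounded. -/
theorem exists_apriori_hodge (hA : IsBoundedCoeff A) (hell : IsStronglyElliptic A) {r M : ℝ}
    (h0 : 0 < r) (h1 : r < 1) (hM : 0 ≤ M) (hP : ∀ τ : ℝ, τ ≠ 0 → OpBdd (hodge A τ) r M) :
    ∃ δ > 0, ∀ r', |r' - r| < δ → ∃ C : ℝ, 0 ≤ C ∧ ∀ τ : ℝ, τ ≠ 0 → ∀ f : LpV n 2,
      MemLp f (ex r') volume → MemLp (hodge A τ f) (ex r') volume →
      (eLpNorm (hodge A τ f) (ex r') volume).toReal ≤ C * (eLpNorm f (ex r') volume).toReal := by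
  obtain ⟨K, hK, hmul⟩ := mulOp_opBdd hA
  have hQ : ∀ {s : ℝ}, 0 < s → s < 1 → ∃ C : ℝ, 0 ≤ C ∧
      ∀ {τ : ℝ} (hτ : τ ≠ 0), OpBdd (gradProj n hτ) s C := fun hs0 hs1 => by
    obtain ⟨C, hC, h⟩ := gradProj_formBdd n hs0 hs1
    exact ⟨C, hC, fun hτ => (h hτ).opBdd hs0 hs1 hC⟩
  -- With `P` the orthogonal projection, the projector satisfies `P A w = P f` for `w` in the range
  -- of `P`. Adding `1 - P` extends `P A` from that range to an operator on the whole space which is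
  -- bounded on every `L^p`, uniformly in `τ`, so that the stability of lower bounds applies to it.
  let T : ∀ {τ : ℝ}, τ ≠ 0 → LpV n 2 →L[ℂ] LpV n 2 := fun hτ =>
    gradProj n hτ ∘L mulOp hA 2 + (ContinuousLinearMap.id ℂ _ - gradProj n hτ)
  have hTa : ∀ {τ : ℝ} (hτ : τ ≠ 0) (f : LpV n 2),
      T hτ f = gradProj n hτ (mulOp hA 2 f) + (f - gradProj n hτ f) := fun hτ f => rfl
  have hT : ∀ {s : ℝ}, 0 < s → s < 1 → ∃ C : ℝ, 0 ≤ C ∧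
      ∀ {τ : ℝ} (hτ : τ ≠ 0), OpBdd (T hτ) s C := fun {s} hs0 hs1 => by
    obtain ⟨C, hC, h⟩ := hQ hs0 hs1
    exact ⟨C * K + (1 + C), by positivity, fun hτ =>
      (OpBdd.comp hC (h hτ) (hmul s)).add hs0 hs1.le (OpBdd.id.sub hs0 hs1.le (h hτ))⟩
  -- Any two exponents on either side of `r` would do; these stay inside `(0, 1)`.
  obtain ⟨C0, hC0, hT0⟩ := hT (s := r / 2) (by positivity) (by linarith)
  obtain ⟨C1, hC1, hT1⟩ := hT (s := (1 + r) / 2) (by positivity) (by linarith)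
  obtain ⟨CQ, hCQ, hQr⟩ := hQ h0 h1
  have hlow : ∃ c > 0, ∀ {τ : ℝ} (hτ : τ ≠ 0), ∀ f : LpV n 2, MemLp f (ex r) volume →
      c * (eLpNorm f (ex r) volume).toReal ≤ (eLpNorm (T hτ f) (ex r) volume).toReal := by
    -- The bound of the explicit left inverse `g ↦ H(g - A(g - P g)) + (g - P g)` of `T`, where `H`
    -- is the Hodge projector. Applying `1 - P` to `T f` returns `f - P f`; removing the
    -- contribution of this part from `P T f` leaves `P A P f`, from which `H` recovers `P f`.
    set L : ℝ := M * (1 + K * (1 + CQ)) + (1 + CQ) with hL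
    have hLp : 0 < L := by positivity
    refine ⟨L⁻¹, by positivity, fun {τ} hτ f hf => ?_⟩
    rw [inv_mul_le_iff₀ hLp]
    obtain ⟨CT, -, hTr⟩ := hT h0 h1
    have hid := OpBdd.id (μ := (volume : Measure (Rn n))) (E := Cn1 n) (r := r)
    have hS : OpBdd (fun g : LpV n 2 => hodge A τ (g - mulOp hA 2 (g - gradProj n hτ g))
        + (g - gradProj n hτ g)) r L :=
      (OpBdd.comp hM (hP τ hτ) (hid.sub h0 h1.le (OpBdd.comp hK (hmul r)
        (hid.sub h0 h1.le (hQr hτ))))).add h0 h1.le (hid.sub h0 h1.le (hQr hτ))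
    have hQQ : ∀ g, gradProj n hτ (gradProj n hτ g) = gradProj n hτ g := fun g =>
      gradProj_of_mem hτ (gradProj_mem hτ g)
    have e1 : T hτ f - gradProj n hτ (T hτ f) = f - gradProj n hτ f := by
      rw [hTa, map_add, map_sub, hQQ, hQQ]
      abel
    have e2 : gradProj n hτ f = hodge A τ (T hτ f - mulOp hA 2 (f - gradProj n hτ f)) := by
      refine eq_hodge_of hA hell hτ (gradProj_mem hτ f) ?_
      rw [hTa]
      simp only [map_add, map_sub, hQQ]
      abel
    have e3 : f = hodge A τ (T hτ f - mulOp hA 2 (T hτ f - gradProj n hτ (T hτ f)))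
        + (T hτ f - gradProj n hτ (T hτ f)) := by
      rw [e1, ← e2]
      abel
    have := (hS (T hτ f) (hTr hτ f hf).1).2
    beta_reduce at this
    rwa [← e3] at this
  obtain ⟨c, hc, hlow⟩ := hlow
  set B := max C0 C1 with hB
  obtain ⟨δ, hδ, hnear⟩ := exists_lowerBound_nearby (r₀ := r / 2) (r₁ := (1 + r) / 2) (M := B)
    (c := c) (r := r) (by positivity) (by linarith) (hC0.trans (le_max_left _ _)) (by linarith)
    (by linarith) hc
  refine ⟨min δ (min r (1 - r)), by simp [hδ, h0, h1], fun r' hr' => ?_⟩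
  obtain ⟨hr1, hr2⟩ := lt_min_iff.1 hr'
  obtain ⟨hr2, hr3⟩ := lt_min_iff.1 hr2
  have hr'0 : 0 < r' := by linarith [(abs_lt.1 hr2).1]
  have hr'1 : r' < 1 := by linarith [(abs_lt.1 hr3).2]
  obtain ⟨C, hC, hQ'⟩ := hQ hr'0 hr'1
  refine ⟨4 / c * C, by positivity, fun τ hτ f hf hw => ?_⟩
  have := hnear r' hr1 (T hτ)
    (((hT0 hτ).mono (le_max_left C0 C1)).formBdd (by positivity) (by linarith))
    (((hT1 hτ).mono (le_max_right C0 C1)).formBdd (by positivity) (by linarith))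
    (fun f hf => hlow hτ f hf) (hodge A τ f) hw
  -- On the range of `P` the summand `1 - P` vanishes, and `P A` turns the Hodge projector into `P`.
  -- The lower bound of `T` at `hodge A τ f` is thus the estimate wanted, as soon as this function
  -- lies in `L^{1/r'}`.
  have e : T hτ (hodge A τ f) = gradProj n hτ f := by
    rw [hTa, gradProj_mulOp_hodge hA hell, gradProj_of_mem hτ (hodge_mem A τ f)]
    abel
  rw [e] at this
  have h2 := this.trans (hQ' hτ f hf).2
  rw [div_mul_eq_mul_div, div_mul_eq_mul_div, le_div_iff₀ hc]
  linarith

end hodge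

/-! ### Hodge projectors and resolvents of the perturbed Dirac operator -/

section resolvent

variable {n : ℕ} {A : Coeff n}

theorem LpV_locallyIntegrable_coord {p : ℝ≥0∞} [h : Fact (1 ≤ p)] (F : LpV n p)
    (j : Fin (n + 1)) : LocallyIntegrable (fun x => F x j) volume :=
  (LpV_memLp_coord F j).locallyIntegrable h.out

theorem mem_diracGraph_iff {p : ℝ≥0∞} [Fact (1 ≤ p)] (v g : LpV n p) :
    (v, g) ∈ diracGraph n p ↔ (∀ φ : Rn n → ℝ, IsTest φ →
      (∑ i : Fin n, ∫ x, partialD i φ x • v x i.succ) = -∫ x, φ x • g x 0) ∧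
      ∀ (i : Fin n) (φ : Rn n → ℝ), IsTest φ →
        ∫ x, partialD i φ x • v x 0 = ∫ x, φ x • g x i.succ := by
  constructor
  · rintro ⟨h1, h2⟩
    refine ⟨h1.eq, fun i φ hφ => ?_⟩
    have := (h2 i).eq φ hφ
    simpa [integral_neg] using this
  · rintro ⟨h1, h2⟩
    refine ⟨⟨fun i => LpV_locallyIntegrable_coord v _, LpV_locallyIntegrable_coord g _, h1⟩,
      fun i => ⟨(LpV_locallyIntegrable_coord v _).neg, LpV_locallyIntegrable_coord g _,
        fun φ hφ => ?_⟩⟩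
    simpa [integral_neg] using h2 i φ hφ

theorem mem_diracBGraph_iff {p : ℝ≥0∞} [Fact (1 ≤ p)] (hB : IsBoundedCoeff (coeffB A))
    (u g : LpV n p) : (u, g) ∈ diracBGraph A p ↔ (mulOp hB p u, g) ∈ diracGraph n p := by
  constructor
  · rintro ⟨v, h1, h2⟩
    have : mulOp hB p u = v := Lp.ext (by
      filter_upwards [h1, mulOp_ae hB u] with x a b
      rw [a, b])
    rw [this]
    exact mem_graph_dirac.1 h2
  · intro h
    exact ⟨_, mulOp_ae hB u, mem_graph_dirac.2 h⟩

/-- Multiplication by the constant matrix `[[1, 0], [0, 0]]`. -/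
def opE0 (n : ℕ) (p : ℝ≥0∞) [Fact (1 ≤ p)] : LpV n p →L[ℂ] LpV n p :=
  mulOp (IsBoundedCoeff.const (e0 n)) p

/-- Multiplication by the constant matrix `[[0, 0], [0, 1]]`. -/
def opE1 (n : ℕ) (p : ℝ≥0∞) [Fact (1 ≤ p)] : LpV n p →L[ℂ] LpV n p :=
  mulOp (IsBoundedCoeff.const (e1 n)) p

theorem opE0_coord {p : ℝ≥0∞} [Fact (1 ≤ p)] (F : LpV n p) (j : Fin (n + 1)) :
    (fun x => opE0 n p F x j) =ᵐ[volume] fun x => if j = 0 then F x j else 0 := by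
  filter_upwards [mulOp_ae (IsBoundedCoeff.const (e0 n)) F] with x hx
  rw [opE0, hx, act_e0_apply]

theorem opE1_coord {p : ℝ≥0∞} [Fact (1 ≤ p)] (F : LpV n p) (j : Fin (n + 1)) :
    (fun x => opE1 n p F x j) =ᵐ[volume] fun x => if j = 0 then 0 else F x j := by
  filter_upwards [mulOp_ae (IsBoundedCoeff.const (e1 n)) F] with x hx
  rw [opE1, hx, act_e1_apply]

theorem LpV_sub_coord {p : ℝ≥0∞} (u v : LpV n p) (j : Fin (n + 1)) :
    (fun x => (u - v) x j) =ᵐ[volume] fun x => u x j - v x j := by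
  filter_upwards [Lp.coeFn_sub u v] with x hx
  rw [hx]
  rfl

/-- The equation `(1 + iτDB) u = f` in terms of the gradients `S_σ` with `σ = -1/τ`. -/
theorem mem_diracBGraph_iff_gradRange (hA : IsBoundedCoeff A) (hell : IsStronglyElliptic A)
    {τ : ℝ} (hτ : τ ≠ 0) (w f : LpV n 2) :
    (mulOp (isGoodCoeff_upperPart hA hell).bdd 2 w, (Complex.I * τ)⁻¹ •
      (f - mulOp (isGoodCoeff_upperPart hA hell).bdd 2 w)) ∈ diracBGraph A 2 ↔
    w - opE1 n 2 f ∈ gradRange n (-τ⁻¹) ∧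
      gradProj n (neg_ne_zero.2 (inv_ne_zero hτ)) (mulOp hA 2 w - opE0 n 2 f) = 0 := by
  have hτ' : (τ : ℂ) ≠ 0 := by exact_mod_cast hτ
  set U := mulOp (isGoodCoeff_upperPart hA hell).bdd 2 w with hU
  have hUc : ∀ j, (fun x => U x j) =ᵐ[volume] fun x => if j = 0 then mulOp hA 2 w x j else w x j :=
    fun j => by
      filter_upwards [mulOp_ae (isGoodCoeff_upperPart hA hell).bdd w, mulOp_ae hA w] with x h1 h2
      rw [hU, h1, act_upperPart_apply, h2]
  -- The factor `upperPart⁻¹` of `B` cancels against `U`: while `U` has the components `((A w)_⊥,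
  -- w_∥)`, applying `B` to it gives `(w_⊥, (A w)_∥)`.
  have hBU : ∀ j, (fun x => mulOp (isBoundedCoeff_coeffB hA hell) 2 U x j) =ᵐ[volume]
      fun x => if j = 0 then w x j else mulOp hA 2 w x j := fun j => by
    filter_upwards [mulOp_ae (isBoundedCoeff_coeffB hA hell) U,
      mulOp_ae (isGoodCoeff_upperPart hA hell).bdd w, mulOp_ae hA w,
      (isGoodCoeff_upperPart hA hell).inv_mul] with x h1 h2 h3 h4
    rw [h1, hU, h2, coeffB, act_mul, ← act_mul (upperPart (A x))⁻¹, h4, act_one,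
      act_lowerPart_apply, h3]
  -- This identity is the source of the parameter `-1/τ`.
  have hI : (Complex.I * (τ : ℂ))⁻¹ = Complex.I * ((-τ⁻¹ : ℝ) : ℂ) := by
    rw [mul_inv, Complex.inv_I]
    push_cast
    ring
  have hg : ∀ j, (fun x => ((Complex.I * (τ : ℂ))⁻¹ • (f - U)) x j) =ᵐ[volume]
      fun x => Complex.I * ((-τ⁻¹ : ℝ) : ℂ) * (f x j - U x j) := fun j => by
    filter_upwards [LpV_smul_coord (Complex.I * (τ : ℂ))⁻¹ (f - U) j, LpV_sub_coord f U j]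
      with x h1 h2
    rw [h1, Pi.smul_apply, h2, hI, smul_eq_mul]
  rw [mem_diracBGraph_iff (isBoundedCoeff_coeffB hA hell), mem_diracGraph_iff,
    mem_gradRange_iff (neg_ne_zero.2 (inv_ne_zero hτ)), gradProj_eq_zero_iff, and_comm]
  -- The parallel components of the Dirac equation form the range condition, and the perpendicular
  -- component forms the kernel condition.
  refine and_congr (forall_congr' fun i => forall_congr' fun φ => forall_congr' fun hφ => ?_)
    (forall_congr' fun φ => forall_congr' fun hφ => ?_)
  · have a1 : ∫ x, partialD i φ x • mulOp (isBoundedCoeff_coeffB hA hell) 2 U x 0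
        = ∫ x, partialD i φ x • (w - opE1 n 2 f) x 0 := by
      refine integral_congr_ae ?_
      filter_upwards [hBU 0, LpV_sub_coord w (opE1 n 2 f) 0, opE1_coord f 0] with x h1 h2 h3
      rw [h1, h2, h3]
      simp
    have a2 : ∫ x, φ x • ((Complex.I * (τ : ℂ))⁻¹ • (f - U)) x i.succ
        = -(Complex.I * ((-τ⁻¹ : ℝ) : ℂ) * ∫ x, φ x • (w - opE1 n 2 f) x i.succ) := by
      rw [← integral_const_mul, ← integral_neg]
      refine integral_congr_ae ?_
      filter_upwards [hg i.succ, LpV_sub_coord w (opE1 n 2 f) i.succ, opE1_coord f i.succ,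
        hUc i.succ] with x h1 h2 h3 h4
      rw [h1, h2, h3, h4]
      simp only [Fin.succ_ne_zero, if_false, Complex.real_smul]
      ring
    rw [a1, a2]
  · have a1 : (∑ i : Fin n, ∫ x, partialD i φ x • mulOp (isBoundedCoeff_coeffB hA hell) 2 U x i.succ)
        = ∑ i : Fin n, ∫ x, partialD i φ x • (mulOp hA 2 w - opE0 n 2 f) x i.succ := by
      refine Finset.sum_congr rfl fun i _ => integral_congr_ae ?_
      filter_upwards [hBU i.succ, LpV_sub_coord (mulOp hA 2 w) (opE0 n 2 f) i.succ,
        opE0_coord f i.succ] with x h1 h2 h3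
      rw [h1, h2, h3]
      simp
    have a2 : -∫ x, φ x • ((Complex.I * (τ : ℂ))⁻¹ • (f - U)) x 0
        = Complex.I * ((-τ⁻¹ : ℝ) : ℂ) * ∫ x, φ x • (mulOp hA 2 w - opE0 n 2 f) x 0 := by
      rw [← integral_const_mul, ← integral_neg]
      refine integral_congr_ae ?_
      filter_upwards [hg 0, LpV_sub_coord (mulOp hA 2 w) (opE0 n 2 f) 0, opE0_coord f 0,
        hUc 0] with x h1 h2 h3 h4
      rw [h1, h2, h3, h4]
      simp only [if_true, Complex.real_smul]
      ring
    rw [a1, a2]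

/-- The resolvent `(1 + iτDB)⁻¹` on `L²`, in terms of the Hodge projector. -/
def res (hA : IsBoundedCoeff A) (hell : IsStronglyElliptic A) {τ : ℝ} (hτ : τ ≠ 0) :
    LpV n 2 →L[ℂ] LpV n 2 :=
  mulOp (isGoodCoeff_upperPart hA hell).bdd 2 ∘L
    (hodgeL hA hell (neg_ne_zero.2 (inv_ne_zero hτ)) ∘L
      (opE0 n 2 - mulOp hA 2 ∘L opE1 n 2) + opE1 n 2)

theorem res_apply (hA : IsBoundedCoeff A) (hell : IsStronglyElliptic A) {τ : ℝ} (hτ : τ ≠ 0)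
    (f : LpV n 2) : res hA hell hτ f = mulOp (isGoodCoeff_upperPart hA hell).bdd 2
      (hodge A (-τ⁻¹) (opE0 n 2 f - mulOp hA 2 (opE1 n 2 f)) + opE1 n 2 f) := rfl

/-- Since `upperPart` is invertible, every `u` has the form `U w`. The function `w - f_∥` lies in
the range of `S_{-1/τ}`, and its image under `A` has the same projection as `f_⊥ - A f_∥`. This is
the characterization of a Hodge projector. -/
theorem mem_diracBGraph_iff_res (hA : IsBoundedCoeff A) (hell : IsStronglyElliptic A)
    {τ : ℝ} (hτ : τ ≠ 0) (u f : LpV n 2) :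
    (u, (Complex.I * τ)⁻¹ • (f - u)) ∈ diracBGraph A 2 ↔ u = res hA hell hτ f := by
  have hg := isGoodCoeff_upperPart hA hell
  obtain ⟨w, rfl⟩ : ∃ w, mulOp hg.bdd 2 w = u :=
    ⟨mulOp hg.inv_bdd 2 u, mulOp_mulOp_eq hg.bdd hg.inv_bdd hg.mul_inv u⟩
  have hinj : Function.Injective (mulOp hg.bdd 2 : LpV n 2 → LpV n 2) :=
    Function.LeftInverse.injective fun w => mulOp_mulOp_eq hg.inv_bdd hg.bdd hg.inv_mul w
  have hσ : -τ⁻¹ ≠ 0 := neg_ne_zero.2 (inv_ne_zero hτ)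
  rw [mem_diracBGraph_iff_gradRange hA hell hτ, res_apply, hinj.eq_iff, ← sub_eq_iff_eq_add]
  constructor
  · rintro ⟨h1, h2⟩
    refine eq_hodge_of hA hell hσ h1 ?_
    rw [← sub_eq_zero, ← map_sub, ← h2, map_sub (mulOp hA 2)]
    congr 1
    abel
  · intro h
    refine ⟨h ▸ hodge_mem _ _ _, ?_⟩
    have h1 := gradProj_mulOp_hodge hA hell hσ (opE0 n 2 f - mulOp hA 2 (opE1 n 2 f))
    rw [← h, ← sub_eq_zero, ← map_sub] at h1
    rw [← h1, map_sub (mulOp hA 2)]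
    congr 1
    abel

/-- The resolvent formula solved for the Hodge projector. The map `f ↦ f_⊥ - A f_∥` is
multiplication by `e0 n - A x * e1 n`, which is boundedly invertible, so every `g` arises as an
argument of the projector. -/
theorem hodge_eq_res (hA : IsBoundedCoeff A) (hell : IsStronglyElliptic A) {τ : ℝ} (hτ : τ ≠ 0)
    (g : LpV n 2) : hodge A (-τ⁻¹) g = mulOp (isGoodCoeff_upperPart hA hell).inv_bdd 2
      (res hA hell hτ (mulOp (isGoodCoeff_e0_sub_mul_e1 hA hell).inv_bdd 2 g)) -
        opE1 n 2 (mulOp (isGoodCoeff_e0_sub_mul_e1 hA hell).inv_bdd 2 g) := by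
  have hg := isGoodCoeff_upperPart hA hell
  have hM := isGoodCoeff_e0_sub_mul_e1 hA hell
  set h := mulOp hM.inv_bdd 2 g with hh
  have e : opE0 n 2 h - mulOp hA 2 (opE1 n 2 h) = g := by
    rw [← mulOp_mulOp_eq hM.bdd hM.inv_bdd hM.mul_inv g, ← hh]
    refine Lp.ext ?_
    filter_upwards [Lp.coeFn_sub (opE0 n 2 h) (mulOp hA 2 (opE1 n 2 h)), mulOp_ae hM.bdd h,
      mulOp_ae (IsBoundedCoeff.const (e0 n)) h, mulOp_ae hA (opE1 n 2 h),
      mulOp_ae (IsBoundedCoeff.const (e1 n)) h] with x h1 h2 h3 h4 h5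
    rw [h1, h2, Pi.sub_apply, opE0, h3, h4, opE1, h5, act_sub, act_mul]
  rw [res_apply, e, mulOp_mulOp_eq hg.inv_bdd hg.bdd hg.inv_mul, add_sub_cancel_right]

theorem res_opBdd_of_hodge (hA : IsBoundedCoeff A) (hell : IsStronglyElliptic A) {r M : ℝ}
    (h0 : 0 < r) (h1 : r ≤ 1) (hM : 0 ≤ M) (h : ∀ τ : ℝ, τ ≠ 0 → OpBdd (hodge A τ) r M) :
    ∃ C : ℝ, 0 ≤ C ∧ ∀ {τ : ℝ} (hτ : τ ≠ 0), OpBdd (res hA hell hτ) r C := by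
  obtain ⟨K, hK, hmul⟩ := mulOp_opBdd hA
  obtain ⟨K0, hK0, hmul0⟩ := mulOp_opBdd (IsBoundedCoeff.const (n := n) (e0 n))
  obtain ⟨K1, hK1, hmul1⟩ := mulOp_opBdd (IsBoundedCoeff.const (n := n) (e1 n))
  obtain ⟨KU, hKU, hmulU⟩ := mulOp_opBdd (isGoodCoeff_upperPart hA hell).bdd
  refine ⟨KU * (M * (K0 + K * K1) + K1), by positivity, fun {τ} hτ => ?_⟩
  exact OpBdd.comp (S := mulOp (isGoodCoeff_upperPart hA hell).bdd 2)
    (T := fun f => hodge A (-τ⁻¹) (opE0 n 2 f - mulOp hA 2 (opE1 n 2 f)) + opE1 n 2 f)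
    hKU (hmulU r) ((OpBdd.comp hM (h _ (neg_ne_zero.2 (inv_ne_zero hτ)))
    ((hmul0 r).sub h0 h1 (OpBdd.comp hK (hmul r) (hmul1 r)))).add h0 h1 (hmul1 r))

theorem hodge_opBdd_of_res (hA : IsBoundedCoeff A) (hell : IsStronglyElliptic A) {r C : ℝ}
    (h0 : 0 < r) (h1 : r ≤ 1) (hC : 0 ≤ C)
    (h : ∀ {τ : ℝ} (hτ : τ ≠ 0), OpBdd (res hA hell hτ) r C) :
    ∃ M : ℝ, 0 ≤ M ∧ ∀ τ : ℝ, τ ≠ 0 → OpBdd (hodge A τ) r M := by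
  obtain ⟨K1, hK1, hmul1⟩ := mulOp_opBdd (IsBoundedCoeff.const (n := n) (e1 n))
  obtain ⟨KU, hKU, hmulU⟩ := mulOp_opBdd (isGoodCoeff_upperPart hA hell).inv_bdd
  obtain ⟨KM, hKM, hmulM⟩ := mulOp_opBdd (isGoodCoeff_e0_sub_mul_e1 hA hell).inv_bdd
  refine ⟨KU * (C * KM) + K1 * KM, by positivity, fun σ hσ => ?_⟩
  have hτ : -σ⁻¹ ≠ 0 := neg_ne_zero.2 (inv_ne_zero hσ)
  have e : hodge A σ = fun g => mulOp (isGoodCoeff_upperPart hA hell).inv_bdd 2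
      (res hA hell hτ (mulOp (isGoodCoeff_e0_sub_mul_e1 hA hell).inv_bdd 2 g)) -
        opE1 n 2 (mulOp (isGoodCoeff_e0_sub_mul_e1 hA hell).inv_bdd 2 g) := by
    ext1 g
    rw [← hodge_eq_res hA hell hτ g]
    simp
  rw [e]
  exact (OpBdd.comp hKU (hmulU r) (OpBdd.comp hC (h hτ) (hmulM r))).sub h0 h1
    (OpBdd.comp hK1 (hmul1 r) (hmulM r))

end resolvent

/-! ### The Dirac operator in `L^p` -/

section core

variable {n : ℕ} {A : Coeff n}

-- The operator `1 - (2π)⁻² Δ` is the Fourier multiplier with symbol `1 + ‖ξ‖²`, whose reciprocal is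
-- smooth and of temperate growth. The factor `(2π)⁻²` removes the constant of the Fourier
-- transform.
open FourierTransform SchwartzMap in
theorem exists_schwartz_sub_laplacian (ψ : 𝓢(Rn n, ℂ)) : ∃ χ : 𝓢(Rn n, ℂ), ∀ x,
    ψ x = χ x - (((2 * Real.pi)⁻¹ ^ 2 : ℝ) : ℂ) * ∑ i : Fin n,
      (LineDeriv.lineDerivOp (EuclideanSpace.single i (1 : ℝ))
        (LineDeriv.lineDerivOp (EuclideanSpace.single i (1 : ℝ)) χ : 𝓢(Rn n, ℂ)) : 𝓢(Rn n, ℂ)) x := by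
  have h1 : (fun x : Rn n => (1 + ‖x‖ ^ 2) ^ (-1 : ℝ)).HasTemperateGrowth := by fun_prop
  have h2 : (fun x : Rn n => ‖x‖ ^ 2).HasTemperateGrowth := by fun_prop
  let χ : 𝓢(Rn n, ℂ) := fourierMultiplierCLM ℂ (fun x : Rn n => (1 + ‖x‖ ^ 2) ^ (-1 : ℝ)) ψ
  have hχ : χ - ((2 * Real.pi)⁻¹ ^ 2 : ℝ) • Laplacian.laplacian χ = ψ := by
    have e1 : -(2 * Real.pi) ^ 2 * (2 * Real.pi)⁻¹ ^ 2 = (-1 : ℝ) := by field_simp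
    rw [laplacian_eq_fourierMultiplierCLM, smul_smul, mul_comm, e1, neg_one_smul, sub_neg_eq_add]
    simp only [χ]
    rw [fourierMultiplierCLM_fourierMultiplierCLM_apply h2 h1]
    have e2 : ∀ g : 𝓢(Rn n, ℂ), fourierMultiplierCLM ℂ (fun _ : Rn n => (1 : ℝ)) g = g := fun g => by
      rw [fourierMultiplierCLM_const]; simp
    conv_rhs => rw [← e2 ψ]
    simp only [fourierMultiplierCLM_apply, ← FourierTransform.fourierInv_add]
    congr 1
    ext x
    rw [add_apply, smulLeftCLM_apply_apply h1, smulLeftCLM_apply_apply (h2.mul h1),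
      smulLeftCLM_apply_apply (by fun_prop), ← add_smul]
    congr 1
    simp only [Pi.mul_apply, Real.rpow_neg_one]
    have : (1 + ‖x‖ ^ 2) ≠ 0 := by positivity
    field_simp
  refine ⟨χ, fun x => ?_⟩
  conv_lhs => rw [← hχ]
  rw [laplacian_eq_sum (EuclideanSpace.basisFun (Fin n) ℝ)]
  simp [Complex.real_smul]

theorem partial_isTest {φ : Rn n → ℝ} (hφ : IsTest φ) (i : Fin n) : IsTest (partialD i φ) := by
  refine ⟨?_, hφ.compact.fderiv_apply (𝕜 := ℝ) _⟩
  exact (hφ.smooth.fderiv_right (m := ∞) (by simp)).clm_apply contDiff_const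

open FourierTransform SchwartzMap in
/-- The operator `1 + iτD` is injective on `L^p` for `τ = 1 / (2π)`. -/
theorem eq_zero_of_mem_diracGraph {p : ℝ≥0∞} [hp : Fact (1 ≤ p)] (v : LpV n p)
    (h : (v, -(Complex.I * ((2 * Real.pi)⁻¹ : ℝ))⁻¹ • v) ∈ diracGraph n p) : v = 0 := by
  set t : ℝ := (2 * Real.pi)⁻¹ with ht
  have ht0 : (t : ℂ) ≠ 0 := by
    rw [ht]; exact_mod_cast inv_ne_zero (by positivity)
  set c : ℂ := -(Complex.I * t)⁻¹ with hc
  -- This relation matches the square of the Dirac operator with `1 - t² Δ`.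
  have hct : (t : ℂ) ^ 2 * c ^ 2 = -1 := by
    rw [hc, neg_sq, inv_pow, mul_pow, Complex.I_sq]
    field_simp
  rw [mem_diracGraph_iff] at h
  obtain ⟨h1, h2⟩ := h
  have hg : ∀ j, (fun x => (c • v) x j) =ᵐ[volume] fun x => c * v x j := fun j => by
    filter_upwards [LpV_smul_coord c v j] with x hx
    rw [hx]
    rfl
  have hm := fun j => LpV_memLp_coord v j
  have k1 : ∀ χ : 𝓢(Rn n, ℂ), (∑ i : Fin n, ∫ x, (LineDeriv.lineDerivOp
      (EuclideanSpace.single i (1 : ℝ)) χ : 𝓢(Rn n, ℂ)) x * v x i.succ)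
      + ∫ x, χ x * (c * v x 0) = 0 := by
    refine tested_schwartz hp.out (fun i => hm i.succ) ((hm 0).const_mul c) fun φ hφ => ?_
    rw [h1 φ hφ, neg_add_eq_zero]
    refine integral_congr_ae ?_
    filter_upwards [hg 0] with x hx
    rw [hx]
  have k2 : ∀ (i : Fin n) (χ : 𝓢(Rn n, ℂ)), ∫ x, (LineDeriv.lineDerivOp
      (EuclideanSpace.single i (1 : ℝ)) χ : 𝓢(Rn n, ℂ)) x * v x 0
      = ∫ x, χ x * (c * v x i.succ) := by
    intro i χ
    have hz : MemLp (0 : Rn n → ℂ) p volume := MemLp.zero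
    have := tested_schwartz (K := Pi.single i fun x => v x 0) (K0 := fun x => -(c * v x i.succ))
      hp.out (fun j => ?_) ((hm i.succ).const_mul c).neg (fun φ hφ => ?_) χ
    · rw [Finset.sum_eq_single i] at this
      · simp only [Pi.single_eq_same, mul_neg, integral_neg] at this
        exact sub_eq_zero.1 (by rw [sub_eq_add_neg]; exact this)
      · intro j _ hj
        simp [Pi.single_eq_of_ne hj]
      · simp
    · by_cases hj : j = i
      · subst hj; simpa using hm 0
      · rw [Pi.single_eq_of_ne hj]; exact hz
    · rw [Finset.sum_eq_single i]
      · simp only [Pi.single_eq_same, smul_neg, integral_neg]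
        rw [h2 i φ hφ, ← sub_eq_add_neg, sub_eq_zero]
        refine integral_congr_ae ?_
        filter_upwards [hg i.succ] with x hx
        rw [hx]
      · intro j _ hj
        simp [Pi.single_eq_of_ne hj]
      · simp
  have hint : ∀ (χ : 𝓢(Rn n, ℂ)) (j : Fin (n + 1)), Integrable fun x => χ x * v x j := by
    intro χ j
    have := ENNReal.HolderConjugate.conjExponent hp.out
    have := ENNReal.HolderConjugate.symm (p := p) (q := p.conjExponent)
    exact memLp_one_iff_integrable.1 ((hm j).mul (χ.memLp p.conjExponent volume))
  -- Using the first-order system twice gives `∫ Δχ v_⊥ = -c² ∫ χ v_⊥`, so `v_⊥` annihilates every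
  -- `χ - t² Δχ`. By the preceding lemma these exhaust the Schwartz functions.
  have hv0 : (fun x => v x 0) =ᵐ[volume] 0 := by
    refine ae_eq_zero_of_integral_contDiff_smul_eq_zero (LpV_locallyIntegrable_coord v 0)
      fun g hg1 hg2 => ?_
    have hgc : HasCompactSupport fun x => (g x : ℂ) :=
      hg2.comp_left (g := fun r : ℝ => (r : ℂ)) (by simp)
    let ψ : 𝓢(Rn n, ℂ) := hgc.toSchwartzMap (Complex.ofRealCLM.contDiff.comp hg1)
    obtain ⟨χ, hχ⟩ := exists_schwartz_sub_laplacian ψ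
    have hψ : ∀ x, g x • v x 0 = χ x * v x 0 - ((t ^ 2 : ℝ) : ℂ) * ∑ i : Fin n,
      (LineDeriv.lineDerivOp (EuclideanSpace.single i (1 : ℝ))
        (LineDeriv.lineDerivOp (EuclideanSpace.single i (1 : ℝ)) χ : 𝓢(Rn n, ℂ)) : 𝓢(Rn n, ℂ)) x
          * v x 0 := fun x => by
      have : (g x : ℂ) = ψ x := rfl
      rw [Complex.real_smul, this, hχ x, sub_mul, mul_assoc, Finset.sum_mul]
    have hL : ∑ i : Fin n, ∫ x, (LineDeriv.lineDerivOp (EuclideanSpace.single i (1 : ℝ))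
        (LineDeriv.lineDerivOp (EuclideanSpace.single i (1 : ℝ)) χ : 𝓢(Rn n, ℂ)) : 𝓢(Rn n, ℂ)) x
          * v x 0 = -c ^ 2 * ∫ x, χ x * v x 0 := by
      simp only [k2]
      have e : ∀ (η : 𝓢(Rn n, ℂ)) (j : Fin (n + 1)), ∫ x, η x * (c * v x j)
          = c * ∫ x, η x * v x j := fun η j => by
        rw [← integral_const_mul]
        exact integral_congr_ae (Filter.Eventually.of_forall fun x => by simp only; ring)
      have := k1 χ
      simp only [e] at this ⊢
      rw [← Finset.mul_sum]
      linear_combination c * this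
    simp only [hψ]
    rw [integral_sub (hint χ 0) ((integrable_finsetSum _ fun i _ => hint _ 0).const_mul _),
      integral_const_mul, integral_finsetSum _ fun i _ => hint _ 0, hL]
    push_cast
    linear_combination (∫ x, χ x * v x 0) * hct
  refine LpV_ext fun j => Filter.EventuallyEq.trans ?_ (LpV_zero_coord j).symm
  refine Fin.cases hv0 (fun i => ?_) j
  refine ae_eq_zero_of_integral_contDiff_smul_eq_zero (LpV_locallyIntegrable_coord v _)
    fun g hg1 hg2 => ?_
  have h3 := h2 i g ⟨hg1, hg2⟩
  have e1 : ∫ x, partialD i g x • v x 0 = 0 := by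
    refine integral_eq_zero_of_ae ?_
    filter_upwards [hv0] with x hx
    simp [hx]
  have e2 : ∫ x, g x • (c • v) x i.succ = c * ∫ x, g x • v x i.succ := by
    rw [← integral_const_mul]
    refine integral_congr_ae ?_
    filter_upwards [hg i.succ] with x hx
    rw [hx, Complex.real_smul, Complex.real_smul]
    ring
  rw [e1, e2] at h3
  have hc0 : c ≠ 0 := fun h0 => by simp [h0] at hct
  exact (mul_eq_zero.1 h3.symm).resolve_left hc0

/-- Hölder's inequality with a fixed compactly supported factor. It makes each distributional
identity a closed condition in `L^p`, so that the graphs are closed. -/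
theorem continuous_pairing_Lp {p : ℝ≥0∞} [hp : Fact (1 ≤ p)] {ψ : Rn n → ℝ} (h1 : Continuous ψ)
    (h2 : HasCompactSupport ψ) (j : Fin (n + 1)) :
    Continuous fun F : LpV n p => ∫ x, ψ x • F x j := by
  have := ENNReal.HolderConjugate.conjExponent hp.out
  have := ENNReal.HolderConjugate.symm (p := p) (q := p.conjExponent)
  have : Fact (1 ≤ p.conjExponent) := ⟨ENNReal.HolderConjugate.one_le _ p⟩
  have hm : MemLp (fun x => (ψ x : ℂ)) p.conjExponent (volume : Measure (Rn n)) :=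
    (Complex.continuous_ofReal.comp h1).memLp_of_hasCompactSupport
      (h2.comp_left (g := fun r : ℝ => (r : ℂ)) (by simp))
  let L : LpV n p →L[ℂ] Lp ℂ 1 (volume : Measure (Rn n)) :=
    (ContinuousLinearMap.mul ℂ ℂ).holderL volume p.conjExponent p 1 (hm.toLp _) ∘L
      (EuclideanSpace.proj j : Cn1 n →L[ℂ] ℂ).compLpL p volume
  have e : (fun F : LpV n p => ∫ x, ψ x • F x j) = fun F => ∫ x, L F x := by
    ext F
    refine integral_congr_ae ?_
    filter_upwards [(ContinuousLinearMap.mul ℂ ℂ).coeFn_holder (r := 1) (hm.toLp _)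
      ((EuclideanSpace.proj j : Cn1 n →L[ℂ] ℂ).compLpL p volume F), hm.coeFn_toLp,
      (EuclideanSpace.proj j : Cn1 n →L[ℂ] ℂ).coeFn_compLp F] with x e1 e2 e3
    simp only [L, ContinuousLinearMap.comp_apply, ContinuousLinearMap.holderL_apply_apply]
    rw [e1, e2]
    have e4 : ((EuclideanSpace.proj j : Cn1 n →L[ℂ] ℂ).compLpL p volume F) x = F x j := e3
    rw [e4]
    simp
  rw [e]
  exact continuous_integral.comp L.continuous

theorem isClosed_diracGraph (n : ℕ) (p : ℝ≥0∞) [Fact (1 ≤ p)] :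
    IsClosed (diracGraph n p : Set (LpV n p × LpV n p)) := by
  have e : (diracGraph n p : Set (LpV n p × LpV n p)) = {w | (∀ φ : Rn n → ℝ, IsTest φ →
      (∑ i : Fin n, ∫ x, partialD i φ x • w.1 x i.succ) = -∫ x, φ x • w.2 x 0) ∧
      ∀ (i : Fin n) (φ : Rn n → ℝ), IsTest φ →
        ∫ x, partialD i φ x • w.1 x 0 = ∫ x, φ x • w.2 x i.succ} := by
    ext w
    exact mem_diracGraph_iff w.1 w.2
  have hc : ∀ {φ : Rn n → ℝ} (hφ : IsTest φ) (j : Fin (n + 1)),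
      Continuous fun F : LpV n p => ∫ x, φ x • F x j := fun hφ j =>
    continuous_pairing_Lp hφ.smooth.continuous hφ.compact j
  rw [e]
  simp only [Set.ofPred_and, Set.ofPred_forall]
  refine IsClosed.inter ?_ ?_
  · refine isClosed_iInter fun φ => isClosed_iInter fun hφ => isClosed_eq ?_ ?_
    · exact continuous_finsetSum _ fun i _ => (hc (partial_isTest hφ i) _).comp continuous_fst
    · exact ((hc hφ _).comp continuous_snd).neg
  · refine isClosed_iInter fun i => isClosed_iInter fun φ => isClosed_iInter fun hφ =>
      isClosed_eq ?_ ?_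
    · exact (hc (partial_isTest hφ i) _).comp continuous_fst
    · exact (hc hφ _).comp continuous_snd

theorem isClosed_diracBGraph (hB : IsBoundedCoeff (coeffB A)) (p : ℝ≥0∞) [Fact (1 ≤ p)] :
    IsClosed (diracBGraph A p : Set (LpV n p × LpV n p)) := by
  have e : (diracBGraph A p : Set (LpV n p × LpV n p)) =
      (fun w : LpV n p × LpV n p => (mulOp hB p w.1, w.2)) ⁻¹' diracGraph n p := by
    ext w
    exact mem_diracBGraph_iff hB w.1 w.2
  rw [e]
  exact (isClosed_diracGraph n p).preimage (by fun_prop)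

/-- Membership in the graph of `D` only depends on the functions, not on the exponents. -/
theorem mem_diracGraph_congr {p q : ℝ≥0∞} [Fact (1 ≤ p)] [Fact (1 ≤ q)] {v g : LpV n p}
    {v' g' : LpV n q} (hv : v =ᵐ[volume] v') (hg : g =ᵐ[volume] g') :
    (v, g) ∈ diracGraph n p ↔ (v', g') ∈ diracGraph n q := by
  have e1 : ∀ (ψ : Rn n → ℝ) j, ∫ x, ψ x • v x j = ∫ x, ψ x • v' x j := fun ψ j =>
    integral_congr_ae (by filter_upwards [hv] with x hx; rw [hx])
  have e2 : ∀ (ψ : Rn n → ℝ) j, ∫ x, ψ x • g x j = ∫ x, ψ x • g' x j := fun ψ j =>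
    integral_congr_ae (by filter_upwards [hg] with x hx; rw [hx])
  simp only [mem_diracGraph_iff, e1, e2]

theorem mem_diracBGraph_congr (hB : IsBoundedCoeff (coeffB A)) {p q : ℝ≥0∞} [Fact (1 ≤ p)]
    [Fact (1 ≤ q)] {u g : LpV n p} {u' g' : LpV n q} (hu : u =ᵐ[volume] u')
    (hg : g =ᵐ[volume] g') : (u, g) ∈ diracBGraph A p ↔ (u', g') ∈ diracBGraph A q := by
  rw [mem_diracBGraph_iff hB, mem_diracBGraph_iff hB]
  refine mem_diracGraph_congr ?_ hg
  filter_upwards [mulOp_ae hB u, mulOp_ae hB u', hu] with x h1 h2 h3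
  rw [h1, h2, h3]

end core

/-! ### Bisectorial operators and resolvents on the imaginary axis -/

section bisector

theorem tan_abs_arg {z : ℂ} (hz : 0 < z.re) : Real.tan |z.arg| = |z.im| / z.re := by
  have h : |Real.tan z.arg| = |z.im| / z.re := by
    rw [Complex.tan_arg, abs_div, abs_of_pos hz]
  rcases abs_cases z.arg with ⟨h1, h2⟩ | ⟨h1, h2⟩
  · rw [h1, ← h, Complex.tan_arg, abs_of_nonneg]
    exact div_nonneg (Complex.arg_nonneg_iff.1 h2) hz.le
  · rw [h1, Real.tan_neg, ← h, Complex.tan_arg, abs_of_nonpos]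
    exact div_nonpos_of_nonpos_of_nonneg (Complex.arg_neg_iff.1 h2).le hz.le

theorem abs_arg_lt_of_re_pos {z : ℂ} {t : ℝ} (hz : 0 < z.re) (h : |z.im| < t * z.re) :
    |z.arg| < Real.arctan t := by
  have h1 : |z.arg| < Real.pi / 2 := Complex.abs_arg_lt_pi_div_two_iff.2 (Or.inl hz)
  rw [← Real.arctan_tan (by linarith [abs_nonneg z.arg, Real.pi_pos]) h1, tan_abs_arg hz]
  exact Real.arctan_strictMono ((div_lt_iff₀ hz).2 h)

/-- Bisectors are compared with the cones `|Im z| < t |Re z|`, in which the Neumann series is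
controlled. -/
theorem mem_bisector_arctan {z : ℂ} {t : ℝ} (h : |z.im| < t * |z.re|) :
    z ∈ bisector (Real.arctan t) := by
  have hre : z.re ≠ 0 := fun h0 => by
    rw [h0, abs_zero, mul_zero] at h
    exact absurd h (not_lt.2 (abs_nonneg _))
  refine ⟨fun h0 => hre (by rw [h0, Complex.zero_re]), ?_⟩
  rcases lt_or_gt_of_ne hre with h0 | h0
  · right
    refine abs_arg_lt_of_re_pos (by simpa using h0) ?_
    rwa [Complex.neg_im, abs_neg, Complex.neg_re, ← abs_of_neg h0]
  · left
    refine abs_arg_lt_of_re_pos h0 ?_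
    rwa [abs_of_pos h0] at h

/-- The open bisector omits the origin, but its closure contains it, so points outside the closure
are nonzero. -/
theorem zero_mem_closure_bisector {ν : ℝ} (hν : 0 < ν) : (0 : ℂ) ∈ closure (bisector ν) := by
  refine mem_closure_of_tendsto (f := fun k : ℕ => ((1 / ((k : ℝ) + 1) : ℝ) : ℂ))
    (b := Filter.atTop) ?_ (Filter.Eventually.of_forall fun k => ?_)
  · have := (Complex.continuous_ofReal.tendsto 0).comp
      (tendsto_one_div_add_atTop_nhds_zero_nat (𝕜 := ℝ))
    rwa [Complex.ofReal_zero] at this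
  · have h : (0 : ℝ) < 1 / ((k : ℝ) + 1) := by positivity
    refine ⟨by exact_mod_cast h.ne', Or.inl ?_⟩
    rw [Complex.arg_ofReal_of_nonneg h.le, abs_zero]
    exact hν

theorem of_notMem_closure_bisector {z : ℂ} {t : ℝ} (ht : 0 < t)
    (hz : z ∉ closure (bisector (Real.arctan t))) : z.im ≠ 0 ∧ t * |z.re| ≤ |z.im| := by
  have h1 : t * |z.re| ≤ |z.im| := not_lt.1 fun h => hz (subset_closure (mem_bisector_arctan h))
  refine ⟨fun h0 => hz ?_, h1⟩
  rw [h0, abs_zero] at h1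
  have h2 : |z.re| = 0 := le_antisymm (by nlinarith [abs_nonneg z.re]) (abs_nonneg _)
  have h3 : z = 0 := Complex.ext (abs_eq_zero.1 h2) h0
  rw [h3]
  exact zero_mem_closure_bisector (Real.arctan_pos.2 ht)

/-- The bisector lies in the closed cone `|Im z| ≤ tan ν |Re z|`, which meets the imaginary axis
only at the origin. -/
theorem I_mul_notMem_closure_bisector {ν τ : ℝ} (hν : ν ∈ Set.Ioo 0 (Real.pi / 2)) (hτ : τ ≠ 0) :
    Complex.I * τ ∉ closure (bisector ν) := by
  have hsub : bisector ν ⊆ {z : ℂ | |z.im| ≤ Real.tan ν * |z.re|} := by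
    have key : ∀ z : ℂ, z ≠ 0 → |z.arg| < ν → |z.im| ≤ Real.tan ν * |z.re| := by
      intro z hz h
      have hre : 0 < z.re :=
        (Complex.abs_arg_lt_pi_div_two_iff.1 (h.trans hν.2)).resolve_right hz
      have h1 : Real.tan |z.arg| < Real.tan ν := Real.tan_lt_tan_of_nonneg_of_lt_pi_div_two
        (abs_nonneg _) hν.2 h
      rw [tan_abs_arg hre, div_lt_iff₀ hre] at h1
      rw [abs_of_pos hre]
      exact h1.le
    rintro z ⟨hz, h | h⟩
    · exact key z hz h
    · simpa using key (-z) (neg_ne_zero.2 hz) h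
  have hcl : IsClosed {z : ℂ | |z.im| ≤ Real.tan ν * |z.re|} :=
    isClosed_le (by fun_prop) (by fun_prop)
  intro h
  have := closure_minimal hsub hcl h
  simp at this
  exact hτ this

variable {X : Type*} [NormedAddCommGroup X] [NormedSpace ℂ X]

/-- Formulated with the graph, being an inverse involves no elements of a domain. In this form it
survives limits in a closed graph and can be transported between different `L^p`. -/
theorem isInverseOf_iff_graph {T : X →ₗ.[ℂ] X} {a b : ℂ} (hb : b ≠ 0) {R : X →L[ℂ] X} :
    IsInverseOf T a b R ↔ (∀ f, (R f, b⁻¹ • (f - a • R f)) ∈ T.graph) ∧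
      ∀ u g, (u, g) ∈ T.graph → R (a • u + b • g) = u := by
  constructor
  · rintro ⟨h1, h2⟩
    refine ⟨fun f => ?_, fun u g hug => ?_⟩
    · obtain ⟨u, hu, hf⟩ := h1 f
      have h3 := T.mem_graph u
      rw [← hu]
      have : b⁻¹ • (f - a • (u : X)) = T u := by
        rw [← hf, add_sub_cancel_left, inv_smul_smul₀ hb]
      rwa [this]
    · obtain ⟨y, h3, h4⟩ := (LinearPMap.mem_graph_iff _).1 hug
      simp only at h3 h4
      rw [← h3, ← h4]
      exact h2 y
  · rintro ⟨h1, h2⟩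
    refine ⟨fun f => ?_, fun u => h2 _ _ (T.mem_graph u)⟩
    obtain ⟨y, h3, h4⟩ := (LinearPMap.mem_graph_iff _).1 (h1 f)
    refine ⟨y, h3, ?_⟩
    rw [h4, h3, smul_inv_smul₀ hb]
    abel

/-- Perturbation off the imaginary axis. Put `w = i Im z`, `z = (1 + κ) w` and `R = (1 + wT)⁻¹`.
Then `(1 + zT) R = 1 - κ (R - 1)`, and the cone condition says that the perturbation has norm at
most `1 / 2`. Hence `(1 + zT)⁻¹ = R V⁻¹` with `V` this operator and `‖V⁻¹‖ ≤ 2`. -/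
theorem exists_isInverseOf_of_axis [CompleteSpace X] {T : X →ₗ.[ℂ] X} {C : ℝ} (hC : 0 ≤ C)
    (hT : ∀ τ : ℝ, τ ≠ 0 → ∃ R : X →L[ℂ] X, IsInverseOf T 1 (Complex.I * τ) R ∧ ‖R‖ ≤ C)
    {z : ℂ} (hz : z.im ≠ 0) (hz' : 2 * (1 + C) * |z.re| ≤ |z.im|) :
    ∃ R : X →L[ℂ] X, IsInverseOf T 1 z R ∧ ‖R‖ ≤ C * 2 := by
  obtain ⟨R, hR, hRC⟩ := hT z.im hz
  set w : ℂ := Complex.I * z.im with hw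
  have hw0 : w ≠ 0 := mul_ne_zero Complex.I_ne_zero (by exact_mod_cast hz)
  set κ : ℂ := z.re / w with hκ
  have hzw : z = (1 + κ) * w := by
    rw [hκ, add_mul, one_mul, div_mul_cancel₀ _ hw0, hw, mul_comm, add_comm]
    exact (Complex.re_add_im z).symm
  have hz0 : z ≠ 0 := fun h => hz (by rw [h, Complex.zero_im])
  have hκ1 : 1 + κ ≠ 0 := fun h => hz0 (by rw [hzw, h, zero_mul])
  have hκn : ‖κ‖ * (1 + C) ≤ 1 / 2 := by
    rw [hκ, norm_div, hw, norm_mul, Complex.norm_I, one_mul, Complex.norm_real, Complex.norm_real,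
      Real.norm_eq_abs, Real.norm_eq_abs, div_mul_eq_mul_div, div_le_iff₀ (abs_pos.2 hz)]
    linarith
  obtain ⟨h1, h2⟩ := (isInverseOf_iff_graph hw0).1 hR
  simp only [one_smul] at h1 h2
  let N : X →L[ℂ] X := κ • (R - 1)
  have hN : ‖N‖ ≤ 1 / 2 := by
    refine le_trans ?_ hκn
    rw [norm_smul]
    gcongr
    refine (norm_sub_le _ _).trans ?_
    have : ‖(1 : X →L[ℂ] X)‖ ≤ 1 := ContinuousLinearMap.norm_id_le
    linarith
  have hN1 : ‖N‖ < 1 := hN.trans_lt (by norm_num)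
  let V : (X →L[ℂ] X)ˣ := Units.oneSub N hN1
  have hV : ∀ x, (V : X →L[ℂ] X) x = x - κ • (R x - x) := fun x => rfl
  have hVinv : ‖((V⁻¹ : (X →L[ℂ] X)ˣ) : X →L[ℂ] X)‖ ≤ 2 := by
    refine ContinuousLinearMap.opNorm_le_bound _ (by norm_num) fun x => ?_
    set y := ((V⁻¹ : (X →L[ℂ] X)ˣ) : X →L[ℂ] X) x with hy
    have hVy : (V : X →L[ℂ] X) y = x := by
      rw [hy, ← mul_apply_eq_comp, Units.mul_inv, one_apply_eq_self]
    have e : y = x + N y := by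
      have : (V : X →L[ℂ] X) y = y - N y := rfl
      rw [← hVy, this]; abel
    have h3 : ‖y‖ ≤ ‖x‖ + 1 / 2 * ‖y‖ := by
      calc ‖y‖ = ‖x + N y‖ := by rw [← e]
        _ ≤ ‖x‖ + ‖N y‖ := norm_add_le _ _
        _ ≤ ‖x‖ + 1 / 2 * ‖y‖ := by
            gcongr
            exact (N.le_opNorm y).trans (by gcongr)
    linarith
  refine ⟨R ∘L ((V⁻¹ : (X →L[ℂ] X)ˣ) : X →L[ℂ] X), ?_, ?_⟩
  · rw [isInverseOf_iff_graph hz0]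
    simp only [one_smul]
    refine ⟨fun f => ?_, fun u g hug => ?_⟩
    · set y := ((V⁻¹ : (X →L[ℂ] X)ˣ) : X →L[ℂ] X) f with hy
      have hVy : f = y - κ • (R y - y) := by
        rw [← hV, hy, ← mul_apply_eq_comp, Units.mul_inv, one_apply_eq_self]
      have h3 := h1 y
      rw [ContinuousLinearMap.comp_apply, ← hy]
      convert h3 using 2
      have e : f - R y = (1 + κ) • (y - R y) := by
        conv_lhs => rw [hVy]
        rw [add_smul, one_smul, smul_sub, smul_sub]
        abel
      rw [e, smul_smul, hzw]
      congr 1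
      field_simp
    · have h3 := h2 u g hug
      have h4 : u + z • g = (V : X →L[ℂ] X) (u + w • g) := by
        rw [hV, h3, hzw, add_mul, add_smul, one_mul, mul_smul κ w, sub_add_cancel_left, smul_neg,
          sub_neg_eq_add, add_assoc]
      have h5 : ((V⁻¹ : (X →L[ℂ] X)ˣ) : X →L[ℂ] X) ((V : X →L[ℂ] X) (u + w • g)) = u + w • g := by
        rw [← mul_apply_eq_comp, Units.inv_mul, one_apply_eq_self]
      rw [ContinuousLinearMap.comp_apply, h4, h5, h3]
  · refine (ContinuousLinearMap.opNorm_comp_le _ _).trans ?_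
    gcongr

theorem isInverseOf_neg_inv {T : X →ₗ.[ℂ] X} {z : ℂ} (hz : z ≠ 0) {R : X →L[ℂ] X}
    (h : IsInverseOf T 1 (-z⁻¹) R) : IsInverseOf T z (-1) (z⁻¹ • R) := by
  rw [isInverseOf_iff_graph (by simpa using hz)] at h
  rw [isInverseOf_iff_graph (by simp)]
  obtain ⟨h1, h2⟩ := h
  refine ⟨fun f => ?_, fun u g hug => ?_⟩
  · have := h1 (z⁻¹ • f)
    rw [one_smul, map_smul] at this
    rw [smul_apply]
    convert this using 2
    rw [smul_inv_smul₀ hz, ← smul_sub, smul_smul, neg_inv, inv_inv, neg_mul, mul_inv_cancel₀ hz,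
      inv_neg_one]
  · have := h2 u g hug
    rw [smul_apply, ← map_smul, smul_add, smul_smul, smul_smul, inv_mul_cancel₀ hz]
    rw [mul_neg_one]
    exact this

/-- An operator is bisectorial if and only if `(1 + iτT)⁻¹` is bounded, uniformly in `τ ≠ 0`. -/
theorem isBisectorial_iff [CompleteSpace X] {T : X →ₗ.[ℂ] X} : IsBisectorial T ↔ ∃ C : ℝ,
    ∀ τ : ℝ, τ ≠ 0 → ∃ R : X →L[ℂ] X, IsInverseOf T 1 (Complex.I * τ) R ∧ ‖R‖ ≤ C := by
  constructor
  · rintro ⟨μ, hμ, -, h⟩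
    obtain ⟨ν, hν⟩ := exists_between hμ.2
    obtain ⟨C, hC⟩ := h ν hν
    exact ⟨C, fun τ hτ => hC _ (I_mul_notMem_closure_bisector ⟨hμ.1.trans hν.1, hν.2⟩ hτ)⟩
  · rintro ⟨C, hC⟩
    have hC0 : 0 ≤ C := by
      obtain ⟨R, -, hR⟩ := hC 1 one_ne_zero
      exact (norm_nonneg _).trans hR
    have ht : 0 < 2 * (1 + C) := by positivity
    have key : ∀ z : ℂ, z ∉ closure (bisector (Real.arctan (2 * (1 + C)))) →
        ∃ R : X →L[ℂ] X, IsInverseOf T 1 z R ∧ ‖R‖ ≤ C * 2 := fun z hz =>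
      exists_isInverseOf_of_axis hC0 hC (of_notMem_closure_bisector ht hz).1
        (of_notMem_closure_bisector ht hz).2
    -- The angle is that of the complement of the cone on which the Neumann series converges.
    refine ⟨Real.arctan (2 * (1 + C)), ⟨Real.arctan_pos.2 ht, Real.arctan_lt_pi_div_two _⟩,
      fun z hz => ?_, fun ν hν => ⟨C * 2, fun z hz => key z (mt (fun h => ?_) hz)⟩⟩
    · by_contra hzc
      obtain ⟨h1, h2⟩ := of_notMem_closure_bisector ht hzc
      have hz0 : z ≠ 0 := fun h => h1 (by rw [h, Complex.zero_im])
      have hn : 0 < Complex.normSq z := Complex.normSq_pos.2 hz0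
      -- Here `z - T = z (1 - z⁻¹ T)`, and the cone condition is invariant under `z ↦ -z⁻¹`.
      obtain ⟨R, hR, -⟩ := exists_isInverseOf_of_axis hC0 hC (z := -z⁻¹)
        (by rw [Complex.neg_im, Complex.inv_im]; simp [h1, hn.ne'])
        (by
          rw [Complex.neg_im, Complex.inv_im, Complex.neg_re, Complex.inv_re, abs_neg, abs_neg,
            abs_div, abs_div, abs_neg, ← mul_div_assoc]
          gcongr)
      exact hz ⟨_, isInverseOf_neg_inv hz0 hR⟩
    · have hsub : bisector (Real.arctan (2 * (1 + C))) ⊆ bisector ν := fun w hw =>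
        ⟨hw.1, hw.2.imp (fun a => a.trans hν.1) (fun a => a.trans hν.1)⟩
      exact closure_mono hsub h

end bisector

/-! ### Extension of the resolvents to `L^p` -/

section extension

variable {n : ℕ} {A : Coeff n}

theorem exists_tendsto_toLp {q : ℝ≥0∞} [hq : Fact (1 ≤ q)] (hq' : q ≠ ⊤) (f : LpV n q) :
    ∃ (s : ℕ → LpV n 2) (hs : ∀ k, MemLp (s k) q volume),
      Filter.Tendsto (fun k => (hs k).toLp (s k)) Filter.atTop (nhds f) := by
  obtain ⟨s, hs, h1, -⟩ := exists_simpleFunc_tendsto hq' hq' (Lp.memLp f) (Lp.memLp f)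
  have hq0 : q ≠ 0 := (zero_lt_one.trans_le hq.out).ne'
  have hs2 : ∀ k, MemLp (s k) 2 (volume : Measure (Rn n)) := fun k => SimpleFunc_memLp hq0 hq' (hs k)
  refine ⟨fun k => (hs2 k).toLp (s k), fun k => (hs k).ae_eq (hs2 k).coeFn_toLp.symm, ?_⟩
  have := tendsto_toLp_of_eLpNorm f hs h1
  refine this.congr fun k => ?_
  exact MemLp.toLp_congr _ _ (hs2 k).coeFn_toLp.symm

/-- The functions in `L² ∩ L^q`. -/
def interLp (n : ℕ) (q : ℝ≥0∞) : Submodule ℂ (LpV n 2) where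
  carrier := {f | MemLp f q volume}
  zero_mem' := MemLp.zero.ae_eq (Lp.coeFn_zero _ _ _).symm
  add_mem' := fun hf hg => (MemLp.add hf hg).ae_eq (Lp.coeFn_add _ _).symm
  smul_mem' := fun c _ hf => (MemLp.const_smul hf c).ae_eq (Lp.coeFn_smul _ _).symm

/-- A linear map from `L² ∩ L^q` to `L^q` induced by a linear map on `L²`. -/
def interMap {q : ℝ≥0∞} [Fact (1 ≤ q)] (T : LpV n 2 →ₗ[ℂ] LpV n 2)
    (hT : ∀ f : LpV n 2, MemLp f q volume → MemLp (T f) q volume) : interLp n q →ₗ[ℂ] LpV n q where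
  toFun f := (hT f f.2).toLp _
  map_add' f g := by
    refine Lp.ext ?_
    filter_upwards [(hT _ (f + g).2).coeFn_toLp, (hT _ f.2).coeFn_toLp, (hT _ g.2).coeFn_toLp,
      Lp.coeFn_add ((hT _ f.2).toLp _) ((hT _ g.2).toLp _), Lp.coeFn_add (T f) (T g)]
      with x e1 e2 e3 e4 e5
    rw [e1, e4, Pi.add_apply, e2, e3, Submodule.coe_add, map_add, e5, Pi.add_apply]
  map_smul' c f := by
    refine Lp.ext ?_
    filter_upwards [(hT _ (c • f).2).coeFn_toLp, (hT _ f.2).coeFn_toLp,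
      Lp.coeFn_smul c ((hT _ f.2).toLp _), Lp.coeFn_smul c (T f)] with x e1 e2 e3 e4
    rw [e1, RingHom.id_apply, e3, Pi.smul_apply, e2, Submodule.coe_smul, map_smul, e4,
      Pi.smul_apply]

/-- Extension by continuity from `L² ∩ L^q`, which is dense in `L^q` since it contains the simple
functions of `L^q`. -/
theorem exists_extension {r C : ℝ} [Fact (1 ≤ ex r)] (hC : 0 ≤ C)
    {T : LpV n 2 →L[ℂ] LpV n 2} (hT : OpBdd T r C) :
    ∃ R : LpV n (ex r) →L[ℂ] LpV n (ex r), ‖R‖ ≤ C ∧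
      ∀ (f : LpV n 2) (hf : MemLp f (ex r) volume), R (hf.toLp f) =ᵐ[volume] T f := by
  let e : interLp n (ex r) →ₗ[ℂ] LpV n (ex r) := interMap LinearMap.id fun f hf => hf
  let g : interLp n (ex r) →ₗ[ℂ] LpV n (ex r) := interMap T.toLinearMap fun f hf => (hT f hf).1
  have hdense : DenseRange e := by
    intro f
    obtain ⟨s, hs, h⟩ := exists_tendsto_toLp (ex_ne_top r) f
    exact mem_closure_of_tendsto h (Filter.Eventually.of_forall fun k => ⟨⟨s k, hs k⟩, rfl⟩)
  have hnorm : ∀ f, ‖g f‖ ≤ C * ‖e f‖ := by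
    intro f
    have h1 : ‖g f‖ = (eLpNorm (T f) (ex r) volume).toReal :=
      Lp.norm_toLp _ (hT f f.2).1
    have h2 : ‖e f‖ = (eLpNorm (f : LpV n 2) (ex r) volume).toReal := Lp.norm_toLp _ f.2
    rw [h1, h2]
    exact (hT f f.2).2
  refine ⟨g.extendOfNorm e, LinearMap.opNorm_extendOfNorm_le hdense hC hnorm, fun f hf => ?_⟩
  have h := LinearMap.extendOfNorm_eq hdense ⟨C, hnorm⟩ ⟨f, hf⟩
  have h1 : e ⟨f, hf⟩ = hf.toLp f := rfl
  rw [← h1, h]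
  exact MemLp.coeFn_toLp (hT f hf).1

theorem MemLp_toLp_smul_sub {q : ℝ≥0∞} {f g : LpV n 2} {f' g' : LpV n q}
    (hf : f =ᵐ[volume] f') (hg : g =ᵐ[volume] g') (c : ℂ) :
    (c • (f - g) : LpV n 2) =ᵐ[volume] (c • (f' - g') : LpV n q) := by
  filter_upwards [hf, hg, Lp.coeFn_smul c (f - g), Lp.coeFn_sub f g, Lp.coeFn_smul c (f' - g'),
    Lp.coeFn_sub f' g'] with x h1 h2 h3 h4 h5 h6
  rw [h3, h5, Pi.smul_apply, Pi.smul_apply, h4, h6, Pi.sub_apply, Pi.sub_apply, h1, h2]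

/-- The extension of the `L²`-resolvent is a right inverse in `L^q`. -/
theorem exists_right_resolvent (hA : IsBoundedCoeff A) (hell : IsStronglyElliptic A) {τ : ℝ}
    (hτ : τ ≠ 0) {r C : ℝ} [Fact (1 ≤ ex r)] (hC : 0 ≤ C) (hT : OpBdd (res hA hell hτ) r C) :
    ∃ R : LpV n (ex r) →L[ℂ] LpV n (ex r), ‖R‖ ≤ C ∧
      (∀ (f : LpV n 2) (hf : MemLp f (ex r) volume), R (hf.toLp f) =ᵐ[volume] res hA hell hτ f) ∧
      ∀ f, (R f, (Complex.I * τ)⁻¹ • (f - R f)) ∈ diracBGraph A (ex r) := by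
  obtain ⟨R, hR1, hR2⟩ := exists_extension hC hT
  refine ⟨R, hR1, hR2, fun f => ?_⟩
  obtain ⟨s, hs, h⟩ := exists_tendsto_toLp (ex_ne_top r) f
  have hB := isBoundedCoeff_coeffB hA hell
  have hcont : Continuous fun f : LpV n (ex r) => (R f, (Complex.I * (τ : ℂ))⁻¹ • (f - R f)) := by
    fun_prop
  -- The resolvent equation holds for data in `L² ∩ L^q`, where it is the equation in `L²`, and
  -- passes to limits because the graph is closed.
  refine (isClosed_diracBGraph hB (ex r)).mem_of_tendsto ((hcont.tendsto f).comp h)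
    (Filter.Eventually.of_forall fun k => ?_)
  have h2 := (mem_diracBGraph_iff_res hA hell hτ (res hA hell hτ (s k)) (s k)).2 rfl
  refine (mem_diracBGraph_congr hB (hR2 (s k) (hs k)).symm ?_).1 h2
  exact MemLp_toLp_smul_sub (hs k).coeFn_toLp.symm (hR2 (s k) (hs k)).symm _

theorem isStronglyElliptic_one : IsStronglyElliptic (fun _ : Rn n =>
    (1 : Matrix (Fin (n + 1)) (Fin (n + 1)) ℂ)) := by
  refine ⟨1, one_pos, Filter.Eventually.of_forall fun x ξ => ?_⟩
  rw [act_one, one_mul]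
  exact (inner_self_eq_norm_sq (𝕜 := ℂ) ξ).ge

/-- For the identity matrix the Hodge projector is the orthogonal projection, which is bounded on
all `L^p` by the Riesz transforms. The unperturbed Dirac operator is thereby available in the whole
scale. -/
theorem hodge_one {τ : ℝ} (hτ : τ ≠ 0) (f : LpV n 2) :
    hodge (fun _ : Rn n => (1 : Matrix (Fin (n + 1)) (Fin (n + 1)) ℂ)) τ f = gradProj n hτ f := by
  refine (eq_hodge_of (IsBoundedCoeff.const 1) isStronglyElliptic_one hτ (gradProj_mem hτ f)
    ?_).symm
  have e : mulOp (IsBoundedCoeff.const (n := n) 1) 2 (gradProj n hτ f) = gradProj n hτ f := Lp.ext (by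
    filter_upwards [mulOp_ae (IsBoundedCoeff.const (n := n) 1) (gradProj n hτ f)] with x hx
    rw [hx, act_one])
  rw [e, gradProj_of_mem hτ (gradProj_mem hτ f)]

theorem coeffB_one : coeffB (fun _ : Rn n => (1 : Matrix (Fin (n + 1)) (Fin (n + 1)) ℂ))
    = fun _ => 1 := by
  have h1 : lowerPart (1 : Matrix (Fin (n + 1)) (Fin (n + 1)) ℂ) = 1 := by
    ext i j
    by_cases h : i = 0 <;> simp [lowerPart, h, Matrix.one_apply, eq_comm]
  have h2 : upperPart (1 : Matrix (Fin (n + 1)) (Fin (n + 1)) ℂ) = 1 := by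
    ext i j
    by_cases h : i = 0 <;> simp [upperPart, h, Matrix.one_apply]
  ext1 x
  simp [coeffB, h1, h2]

theorem mem_diracBGraph_one {p : ℝ≥0∞} {w : LpV n p × LpV n p} :
    w ∈ diracBGraph (fun _ : Rn n => (1 : Matrix (Fin (n + 1)) (Fin (n + 1)) ℂ)) p ↔
      w ∈ diracGraph n p := by
  constructor
  · rintro ⟨v, h1, h2⟩
    have : v = w.1 := Lp.ext (by
      filter_upwards [h1] with x hx
      rw [hx, coeffB_one, act_one])
    rw [this] at h2
    exact mem_graph_dirac.1 h2
  · intro h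
    exact ⟨w.1, Filter.Eventually.of_forall fun x => by simp only [coeffB_one, act_one],
      mem_graph_dirac.2 h⟩

/-- The functions in `L² ∩ L^q` form a core of the Dirac operator in `L^q`. -/
theorem exists_core {r : ℝ} (h0 : 0 < r) (h1 : r < 1) [Fact (1 ≤ ex r)] {v g : LpV n (ex r)}
    (h : (v, g) ∈ diracGraph n (ex r)) : ∃ (v' g' : ℕ → LpV n 2)
      (hv : ∀ k, MemLp (v' k) (ex r) volume) (hg : ∀ k, MemLp (g' k) (ex r) volume),
      (∀ k, (v' k, g' k) ∈ diracGraph n 2) ∧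
      Filter.Tendsto (fun k => (hv k).toLp (v' k)) Filter.atTop (nhds v) ∧
      Filter.Tendsto (fun k => (hg k).toLp (g' k)) Filter.atTop (nhds g) := by
  set t : ℝ := (2 * Real.pi)⁻¹ with ht
  have ht0 : t ≠ 0 := inv_ne_zero (by positivity)
  have hIt : Complex.I * (t : ℂ) ≠ 0 := mul_ne_zero Complex.I_ne_zero (by exact_mod_cast ht0)
  have hA := IsBoundedCoeff.const (n := n) 1
  have hell := isStronglyElliptic_one (n := n)
  obtain ⟨C0, hC0, hQ⟩ := gradProj_formBdd n h0 h1
  obtain ⟨C, hC, hres⟩ := res_opBdd_of_hodge hA hell h0 h1.le hC0 fun τ hτ => by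
    have := (hQ hτ).opBdd h0 h1 hC0
    rwa [show hodge (fun _ : Rn n => (1 : Matrix (Fin (n + 1)) (Fin (n + 1)) ℂ)) τ
      = gradProj n hτ from funext (hodge_one hτ)]
  obtain ⟨R, -, hR2, hR3⟩ := exists_right_resolvent hA hell ht0 hC (hres ht0)
  set f := v + (Complex.I * (t : ℂ)) • g with hf
  -- Both `R f` and `v` solve `(1 + itD) v = f` in `L^q`; injectivity of `1 + itD` at `t = 1/(2π)`
  -- identifies them. Approximating `f` in `L² ∩ L^q` then approximates `v` and `g` simultaneously.
  have hRf : R f = v := by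
    have h2 := (diracGraph n (ex r)).sub_mem h (mem_diracBGraph_one.1 (hR3 f))
    have e : (v, g) - (R f, (Complex.I * (t : ℂ))⁻¹ • (f - R f))
        = (v - R f, -(Complex.I * (t : ℂ))⁻¹ • (v - R f)) := by
      refine Prod.ext rfl ?_
      simp only [Prod.snd_sub]
      rw [hf, smul_sub, smul_add, inv_smul_smul₀ hIt, neg_smul, smul_sub]
      abel
    rw [e] at h2
    exact (sub_eq_zero.1 (eq_zero_of_mem_diracGraph _ h2)).symm
  have hg : (Complex.I * (t : ℂ))⁻¹ • (f - R f) = g := by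
    rw [hRf, hf, add_sub_cancel_left, inv_smul_smul₀ hIt]
  obtain ⟨s, hs, hlim⟩ := exists_tendsto_toLp (ex_ne_top r) f
  set T := res hA hell ht0 with hT
  have hTs : ∀ k, MemLp (T (s k)) (ex r) volume := fun k => (hres ht0 _ (hs k)).1
  have hTR : ∀ k, (hTs k).toLp (T (s k)) = R ((hs k).toLp (s k)) := fun k => Lp.ext
    ((hTs k).coeFn_toLp.trans (hR2 _ _).symm)
  have hgae : ∀ k, ((Complex.I * (t : ℂ))⁻¹ • (s k - T (s k)) : LpV n 2) =ᵐ[volume]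
      ((Complex.I * (t : ℂ))⁻¹ • ((hs k).toLp (s k) - R ((hs k).toLp (s k))) : LpV n (ex r)) :=
    fun k => MemLp_toLp_smul_sub (hs k).coeFn_toLp.symm (hR2 _ _).symm _
  have hgs : ∀ k, MemLp ((Complex.I * (t : ℂ))⁻¹ • (s k - T (s k)) : LpV n 2) (ex r) volume :=
    fun k => (Lp.memLp _).ae_eq (hgae k).symm
  refine ⟨fun k => T (s k), fun k => (Complex.I * (t : ℂ))⁻¹ • (s k - T (s k)), hTs, hgs,
    fun k => mem_diracBGraph_one.1 ((mem_diracBGraph_iff_res hA hell ht0 _ _).2 rfl), ?_, ?_⟩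
  · simp only [hTR]
    rw [← hRf]
    exact (R.continuous.tendsto f).comp hlim
  · have e : ∀ k, (hgs k).toLp _ =
        (Complex.I * (t : ℂ))⁻¹ • ((hs k).toLp (s k) - R ((hs k).toLp (s k))) := fun k =>
      Lp.ext ((hgs k).coeFn_toLp.trans (hgae k))
    simp only [e]
    rw [← hg]
    have hcont : Continuous fun f : LpV n (ex r) => (Complex.I * (t : ℂ))⁻¹ • (f - R f) := by
      fun_prop
    exact (hcont.tendsto f).comp hlim

theorem coeffBInv_mul (hA : IsBoundedCoeff A) (hell : IsStronglyElliptic A) :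
    ∀ᵐ x : Rn n, coeffBInv A x * coeffB A x = 1 := by
  filter_upwards [(isGoodCoeff_lowerPart hA hell).inv_mul, (isGoodCoeff_upperPart hA hell).mul_inv]
    with x h1 h2
  rw [coeffB, coeffBInv, Matrix.mul_assoc, ← Matrix.mul_assoc _ (lowerPart (A x)), h1,
    Matrix.one_mul, h2]

/-- The extension of the `L²`-resolvent is a left inverse in `L^q`. -/
theorem left_resolvent (hA : IsBoundedCoeff A) (hell : IsStronglyElliptic A) {τ : ℝ}
    (hτ : τ ≠ 0) {r : ℝ} (h0 : 0 < r) (h1 : r < 1) [Fact (1 ≤ ex r)]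
    {R : LpV n (ex r) →L[ℂ] LpV n (ex r)}
    (hR : ∀ (f : LpV n 2) (hf : MemLp f (ex r) volume), R (hf.toLp f) =ᵐ[volume] res hA hell hτ f)
    {u g : LpV n (ex r)} (h : (u, g) ∈ diracBGraph A (ex r)) :
    R (u + (Complex.I * (τ : ℂ)) • g) = u := by
  have hB := isBoundedCoeff_coeffB hA hell
  have hB' := isBoundedCoeff_coeffBInv hA hell
  have hIt : Complex.I * (τ : ℂ) ≠ 0 := mul_ne_zero Complex.I_ne_zero (by exact_mod_cast hτ)
  obtain ⟨v', g', hv, hg, hmem, hlv, hlg⟩ := exists_core h0 h1 ((mem_diracBGraph_iff hB u g).1 h)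
  -- The core belongs to `D`, so it approximates `B u`. The bounded inverse of `B` carries it back
  -- to functions in `L² ∩ L^q` that approximate `u`, and on these `R` agrees with the
  -- `L²`-resolvent.
  let u' : ℕ → LpV n 2 := fun k => mulOp hB' 2 (v' k)
  have hu'B : ∀ k, mulOp hB 2 (u' k) = v' k := fun k =>
    mulOp_mulOp_eq hB hB' (coeffB_mul_inv hA hell) _
  have hu'ae : ∀ k, u' k =ᵐ[volume] mulOp hB' (ex r) ((hv k).toLp (v' k)) := fun k => by
    filter_upwards [mulOp_ae hB' (v' k), mulOp_ae hB' ((hv k).toLp (v' k)), (hv k).coeFn_toLp]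
      with x a b c
    rw [a, b, c]
  let f' : ℕ → LpV n 2 := fun k => u' k + (Complex.I * (τ : ℂ)) • g' k
  let F : ℕ → LpV n (ex r) := fun k => mulOp hB' (ex r) ((hv k).toLp (v' k)) +
    (Complex.I * (τ : ℂ)) • (hg k).toLp (g' k)
  have hf'ae : ∀ k, f' k =ᵐ[volume] F k := fun k => by
    filter_upwards [hu'ae k, (hg k).coeFn_toLp, Lp.coeFn_add (u' k) ((Complex.I * (τ : ℂ)) • g' k),
      Lp.coeFn_smul (Complex.I * (τ : ℂ)) (g' k),
      Lp.coeFn_add (mulOp hB' (ex r) ((hv k).toLp (v' k)))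
        ((Complex.I * (τ : ℂ)) • (hg k).toLp (g' k)),
      Lp.coeFn_smul (Complex.I * (τ : ℂ)) ((hg k).toLp (g' k))] with x a b c d e f
    rw [c, e, Pi.add_apply, Pi.add_apply, d, f, Pi.smul_apply, Pi.smul_apply, a, b]
  have hf' : ∀ k, MemLp (f' k) (ex r) volume := fun k => (Lp.memLp _).ae_eq (hf'ae k).symm
  have hF : ∀ k, (hf' k).toLp (f' k) = F k := fun k =>
    Lp.ext ((hf' k).coeFn_toLp.trans (hf'ae k))
  have hres : ∀ k, u' k = res hA hell hτ (f' k) := fun k => by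
    rw [← mem_diracBGraph_iff_res hA hell hτ]
    simp only [f']
    rw [add_sub_cancel_left, inv_smul_smul₀ hIt, mem_diracBGraph_iff hB, hu'B]
    exact hmem k
  have hRF : ∀ k, R (F k) = mulOp hB' (ex r) ((hv k).toLp (v' k)) := fun k => by
    rw [← hF]
    refine Lp.ext ((hR _ _).trans ?_)
    rw [← hres]
    exact hu'ae k
  have hlim1 : Filter.Tendsto (fun k => mulOp hB' (ex r) ((hv k).toLp (v' k))) Filter.atTop
      (nhds u) := by
    have := ((mulOp hB' (ex r)).continuous.tendsto _).comp hlv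
    rwa [mulOp_mulOp_eq hB' hB (coeffBInv_mul hA hell)] at this
  have hlim2 : Filter.Tendsto F Filter.atTop (nhds (u + (Complex.I * (τ : ℂ)) • g)) :=
    hlim1.add (hlg.const_smul _)
  have hlim3 := (R.continuous.tendsto _).comp hlim2
  refine tendsto_nhds_unique hlim3 ?_
  simpa only [Function.comp_def, hRF] using hlim1

/-- Uniform bounds for the Hodge projectors imply bisectoriality. -/
theorem isBisectorial_of_hodge_opBdd (hA : IsBoundedCoeff A) (hell : IsStronglyElliptic A) {r M : ℝ}
    (h0 : 0 < r) (h1 : r < 1) (hM : 0 ≤ M) (h : ∀ τ : ℝ, τ ≠ 0 → OpBdd (hodge A τ) r M)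
    [Fact (1 ≤ ex r)] : IsBisectorial (diracB A (ex r)) := by
  obtain ⟨C, hC, hres⟩ := res_opBdd_of_hodge hA hell h0 h1.le hM h
  rw [isBisectorial_iff]
  refine ⟨C, fun τ hτ => ?_⟩
  obtain ⟨R, hR1, hR2, hR3⟩ := exists_right_resolvent hA hell hτ hC (hres hτ)
  have hIt : Complex.I * (τ : ℂ) ≠ 0 := mul_ne_zero Complex.I_ne_zero (by exact_mod_cast hτ)
  refine ⟨R, ?_, hR1⟩
  rw [isInverseOf_iff_graph hIt]
  simp only [one_smul, mem_graph_diracB]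
  exact ⟨hR3, fun u g hug => left_resolvent hA hell hτ h0 h1 hR2 hug⟩

end extension

/-! ### Weighted estimates and decay -/

section weight

variable {n : ℕ} {A : Coeff n}

theorem norm_le_sum_coord (η : Cn1 n) : ‖η‖ ≤ ∑ i, ‖η i‖ := by
  calc ‖η‖ = ‖∑ i, (EuclideanSpace.single i (η i) : Cn1 n)‖ := by
        congr 1
        ext k
        simp [Finset.sum_apply, Pi.single_apply]
    _ ≤ ∑ i, ‖η i‖ := norm_sum_le_of_le _ fun i _ => by simp

/-- Multiplication by a real function. -/
def scalar (om : Rn n → ℝ) : Coeff n := fun x => (om x : ℂ) • 1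

/-- The commutator of the Dirac operator and multiplication by a function. -/
def comm (om : Rn n → ℝ) : Coeff n := fun x => Matrix.of fun i j =>
  Fin.cases (Fin.cases 0 (fun l => (partialD l om x : ℂ)) j)
    (fun l => Fin.cases (-(partialD l om x : ℂ)) (fun _ => 0) j) i

theorem act_scalar (om : Rn n → ℝ) (x : Rn n) (ξ : Cn1 n) :
    act (scalar om x) ξ = (om x : ℂ) • ξ := by
  simp only [act, scalar, map_smul, map_one, smul_apply, one_apply_eq_self]

theorem act_comm_zero (om : Rn n → ℝ) (x : Rn n) (ξ : Cn1 n) :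
    act (comm om x) ξ 0 = ∑ i : Fin n, (partialD i om x : ℂ) * ξ i.succ := by
  rw [act_apply, Fin.sum_univ_succ]
  simp [comm]

theorem act_comm_succ (om : Rn n → ℝ) (x : Rn n) (ξ : Cn1 n) (i : Fin n) :
    act (comm om x) ξ i.succ = -(partialD i om x : ℂ) * ξ 0 := by
  rw [act_apply, Fin.sum_univ_succ]
  simp [comm]

theorem norm_act_comm_le {om : Rn n → ℝ} {x : Rn n} {ε : ℝ} (h : ∀ i, |partialD i om x| ≤ ε)
    (ξ : Cn1 n) : ‖act (comm om x) ξ‖ ≤ 2 * n * ε * ‖ξ‖ := by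
  refine (norm_le_sum_coord _).trans ?_
  rw [Fin.sum_univ_succ, act_comm_zero]
  simp only [act_comm_succ]
  have h1 : ∀ (i : Fin n) (z : ℂ), ‖z‖ ≤ ‖ξ‖ → ‖(partialD i om x : ℂ) * z‖ ≤ ε * ‖ξ‖ := by
    intro i z hz
    rw [norm_mul, Complex.norm_real]
    exact mul_le_mul (h i) hz (norm_nonneg _) ((abs_nonneg _).trans (h i))
  calc _ ≤ (∑ _i : Fin n, ε * ‖ξ‖) + ∑ _i : Fin n, ε * ‖ξ‖ := by
        refine add_le_add (norm_sum_le_of_le _ fun i _ => h1 i _ (PiLp.norm_apply_le _ _))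
          (Finset.sum_le_sum fun i _ => ?_)
        rw [neg_mul, norm_neg]
        exact h1 i _ (PiLp.norm_apply_le _ _)
    _ = _ := by simp; ring

/-- A smooth positive weight with slow relative growth. -/
structure IsWeight (om : Rn n → ℝ) (Λ ε : ℝ) : Prop where
  smooth : ContDiff ℝ ∞ om
  pos : ∀ x, 0 < om x
  le : ∀ x, om x ≤ Λ
  partial_le : ∀ i x, |partialD i om x| ≤ ε * om x

variable {om : Rn n → ℝ} {Λ ε : ℝ}

theorem IsWeight.scalar_bdd (h : IsWeight om Λ ε) : IsBoundedCoeff (scalar om) := by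
  refine IsBoundedCoeff.of_norm_act_le (K := Λ) (fun i j => ?_)
    (Filter.Eventually.of_forall fun x ξ => ?_)
  · simp only [scalar, Matrix.smul_apply, smul_eq_mul]
    exact ((Complex.continuous_ofReal.comp h.smooth.continuous).mul
      continuous_const).aestronglyMeasurable
  · rw [act_scalar, norm_smul, Complex.norm_real, Real.norm_of_nonneg (h.pos x).le]
    gcongr
    exact h.le x

theorem IsWeight.norm_act_comm_le (h : IsWeight om Λ ε) (x : Rn n) (ξ : Cn1 n) :
    ‖act (comm om x) ξ‖ ≤ 2 * n * ε * (om x * ‖ξ‖) :=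
  (DiracElliptic.norm_act_comm_le (fun i => h.partial_le i x) ξ).trans (le_of_eq (by ring))

theorem IsWeight.comm_bdd (h : IsWeight om Λ ε) (hε : 0 ≤ ε) : IsBoundedCoeff (comm om) := by
  refine IsBoundedCoeff.of_norm_act_le (K := 2 * n * ε * Λ) (fun i j => ?_)
    (Filter.Eventually.of_forall fun x ξ => (h.norm_act_comm_le x ξ).trans ?_)
  · have hc : ∀ l, Continuous fun x => (partialD l om x : ℂ) := fun l =>
      Complex.continuous_ofReal.comp (continuous_partialD h.smooth l)
    refine Continuous.aestronglyMeasurable ?_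
    refine Fin.cases ?_ (fun i => ?_) i <;> refine Fin.cases ?_ (fun j => ?_) j
    · simpa [comm] using continuous_const
    · simpa [comm] using hc j
    · exact (hc i).neg
    · simpa [comm] using continuous_const
  · rw [mul_assoc _ Λ]
    gcongr
    exact h.le x

/-- The product rule: the commutator of `D` with multiplication by `om` is multiplication by a
matrix built from the gradient of `om`, hence small relative to `om` itself. -/
theorem IsWeight.mem_diracGraph (h : IsWeight om Λ ε) (hε : 0 ≤ ε) {p : ℝ≥0∞} [Fact (1 ≤ p)]
    {v g : LpV n p} (hvg : (v, g) ∈ diracGraph n p) :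
    (mulOp h.scalar_bdd p v, mulOp h.scalar_bdd p g + mulOp (h.comm_bdd hε) p v)
      ∈ diracGraph n p := by
  rw [mem_diracGraph_iff] at hvg ⊢
  obtain ⟨h1, h2⟩ := hvg
  have hs : ∀ (w : LpV n p) j, (fun x => mulOp h.scalar_bdd p w x j) =ᵐ[volume]
      fun x => om x * w x j := fun w j => by
    filter_upwards [mulOp_ae h.scalar_bdd w] with x hx
    rw [hx, act_scalar]
    rfl
  have hsum : ∀ j, (fun x => (mulOp h.scalar_bdd p g + mulOp (h.comm_bdd hε) p v) x j) =ᵐ[volume]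
      fun x => om x * g x j + act (comm om x) (v x) j := fun j => by
    filter_upwards [LpV_add_coord (mulOp h.scalar_bdd p g) (mulOp (h.comm_bdd hε) p v) j, hs g j,
      mulOp_ae (h.comm_bdd hε) v] with x a b c
    rw [a, Pi.add_apply, b, c]
  have hpd : ∀ {φ : Rn n → ℝ}, IsTest φ → ∀ i x, partialD i φ x * om x =
      partialD i (fun y => om y * φ y) x - φ x * partialD i om x := fun hφ i x => by
    rw [partialD_mul (h.smooth.differentiable (by simp) x)
      (hφ.smooth.differentiable (by simp) x)]
    ring
  have hint1 : ∀ {φ : Rn n → ℝ}, IsTest φ → ∀ i (w : LpV n p) j,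
      Integrable fun x => partialD i (fun y => om y * φ y) x • w x j := fun hφ i w j =>
    (hφ.mul_left h.smooth).integrable_partialD i (LpV_locallyIntegrable_coord w j)
  have htest : ∀ {φ : Rn n → ℝ}, IsTest φ → ∀ i, IsTest fun x => partialD i om x * φ x :=
    fun hφ i => hφ.mul_left ((h.smooth.fderiv_right (m := ∞) (by simp)).clm_apply contDiff_const)
  have hint2 : ∀ {φ : Rn n → ℝ}, IsTest φ → ∀ i (w : LpV n p) j,
      Integrable fun x => (partialD i om x * φ x) • w x j := fun hφ i w j =>
    (htest hφ i).integrable (LpV_locallyIntegrable_coord w j)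
  have hint3 : ∀ {φ : Rn n → ℝ}, IsTest φ → ∀ (w : LpV n p) j,
      Integrable fun x => (om x * φ x) • w x j := fun hφ w j =>
    (hφ.mul_left h.smooth).integrable (LpV_locallyIntegrable_coord w j)
  have hprod : ∀ {φ : Rn n → ℝ}, IsTest φ → ∀ i j,
      ∫ x, partialD i φ x • mulOp h.scalar_bdd p v x j =
        (∫ x, partialD i (fun y => om y * φ y) x • v x j) -
          ∫ x, (partialD i om x * φ x) • v x j := fun {φ} hφ i j => by
    rw [← integral_sub (hint1 hφ i v j) (hint2 hφ i v j)]
    refine integral_congr_ae ?_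
    filter_upwards [hs v j] with x hx
    rw [hx, ← sub_smul, mul_comm (partialD i om x), ← hpd hφ, Complex.real_smul, Complex.real_smul]
    push_cast
    ring
  refine ⟨fun φ hφ => ?_, fun i φ hφ => ?_⟩
  · have e2 : ∫ x, φ x • (mulOp h.scalar_bdd p g + mulOp (h.comm_bdd hε) p v) x 0
        = (∫ x, (om x * φ x) • g x 0) + ∑ i : Fin n, ∫ x, (partialD i om x * φ x) • v x i.succ := by
      rw [← integral_finsetSum _ fun i _ => hint2 hφ i v i.succ,
        ← integral_add (hint3 hφ g 0) (integrable_finsetSum _ fun i _ => hint2 hφ i v i.succ)]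
      refine integral_congr_ae ?_
      filter_upwards [hsum 0] with x hx
      rw [hx, act_comm_zero, smul_add, Finset.smul_sum]
      simp only [Complex.real_smul]
      push_cast
      congr 1
      · ring
      · exact Finset.sum_congr rfl fun i _ => by ring
    simp only [hprod hφ]
    rw [Finset.sum_sub_distrib, h1 _ (hφ.mul_left h.smooth), e2]
    ring
  · have e2 : ∫ x, φ x • (mulOp h.scalar_bdd p g + mulOp (h.comm_bdd hε) p v) x i.succ
        = (∫ x, (om x * φ x) • g x i.succ) - ∫ x, (partialD i om x * φ x) • v x 0 := by
      rw [← integral_sub (hint3 hφ g _) (hint2 hφ i v _)]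
      refine integral_congr_ae ?_
      filter_upwards [hsum i.succ] with x hx
      rw [hx, act_comm_succ]
      simp only [Complex.real_smul]
      push_cast
      ring
    rw [hprod hφ, h2 i _ (hφ.mul_left h.smooth), e2]

/-- A priori estimates are stable under multiplication by weights of slow growth. -/
theorem IsWeight.norm_le (h : IsWeight om Λ ε) (hε : 0 ≤ ε) (hA : IsBoundedCoeff (coeffB A)) {K : ℝ}
    (hK : ∀ᵐ x : Rn n, ∀ ξ : Cn1 n, ‖act (coeffB A x) ξ‖ ≤ K * ‖ξ‖)
    {p : ℝ≥0∞} [Fact (1 ≤ p)] {z : ℂ} {C : ℝ} (hC : 0 ≤ C)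
    (hap : ∀ u g : LpV n p, (u, g) ∈ diracBGraph A p → ‖u‖ ≤ C * ‖u + z • g‖)
    (hsmall : C * (‖z‖ * (2 * n * ε * K)) ≤ 1 / 2) {u g : LpV n p}
    (hug : (u, g) ∈ diracBGraph A p) :
    ‖mulOp h.scalar_bdd p u‖ ≤ 2 * C * ‖mulOp h.scalar_bdd p (u + z • g)‖ := by
  set S := mulOp h.scalar_bdd p with hS
  set N := mulOp (h.comm_bdd hε) p (mulOp hA p u) with hN
  -- Scalar weights commute with `B`, so only `D` produces a commutator.
  have hcomm : mulOp hA p (S u) = S (mulOp hA p u) := Lp.ext (by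
    filter_upwards [mulOp_ae hA (S u), mulOp_ae h.scalar_bdd u, mulOp_ae hA u,
      mulOp_ae h.scalar_bdd (mulOp hA p u)] with x a b c d
    rw [a, hS, b, d, c, act_scalar, act_scalar]
    exact (Matrix.toEuclideanCLM (𝕜 := ℂ) (coeffB A x)).map_smul _ _)
  have hmem : (S u, S g + N) ∈ diracBGraph A p := by
    rw [mem_diracBGraph_iff hA, hcomm]
    exact h.mem_diracGraph hε ((mem_diracBGraph_iff hA u g).1 hug)
  -- The commutator is bounded by the weighted norm of `u`, because the gradient of a weight is at
  -- most `ε` times the weight. It can then be absorbed on the left.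
  have hNle : ‖N‖ ≤ 2 * n * ε * K * ‖S u‖ := by
    refine Lp.norm_le_mul_norm_of_ae_le_mul ?_
    filter_upwards [mulOp_ae (h.comm_bdd hε) (mulOp hA p u), mulOp_ae hA u,
      mulOp_ae h.scalar_bdd u, hK] with x a b c d
    rw [hN, a, b, hS, c, act_scalar, norm_smul, Complex.norm_real, Real.norm_of_nonneg (h.pos x).le]
    refine (h.norm_act_comm_le x _).trans ?_
    rw [mul_assoc _ K, mul_left_comm K]
    have := h.pos x
    gcongr
    exact d _
  have h1 := hap _ _ hmem
  have e : S u + z • (S g + N) = S (u + z • g) + z • N := by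
    rw [map_add, map_smul, smul_add, add_assoc]
  rw [e] at h1
  have h2 : ‖S u‖ ≤ C * ‖S (u + z • g)‖ + 1 / 2 * ‖S u‖ := by
    calc ‖S u‖ ≤ C * (‖S (u + z • g)‖ + ‖z‖ * (2 * n * ε * K * ‖S u‖)) := by
          refine h1.trans ?_
          gcongr
          refine (norm_add_le _ _).trans ?_
          rw [norm_smul]
          gcongr
      _ = C * ‖S (u + z • g)‖ + C * (‖z‖ * (2 * n * ε * K)) * ‖S u‖ := by ring
      _ ≤ _ := by gcongr
  linarith

/-- The weights `((1 + a|x|²) / (1 + b|x|²))^k`. -/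
def wt (n k : ℕ) (a b : ℝ) (x : Rn n) : ℝ := ((1 + a * ‖x‖ ^ 2) / (1 + b * ‖x‖ ^ 2)) ^ k

/-- By the inequality of means, `2 √a ‖x‖ ≤ 1 + a ‖x‖²`. -/
theorem wt_partial_aux {a : ℝ} (ha : 0 ≤ a) (x : Rn n) (i : Fin n) :
    |2 * a * x i / (1 + a * ‖x‖ ^ 2)| ≤ Real.sqrt a := by
  have hx : |x i| ≤ ‖x‖ := PiLp.norm_apply_le x i
  have hpos : 0 < 1 + a * ‖x‖ ^ 2 := by positivity
  rw [abs_div, abs_of_pos hpos, div_le_iff₀ hpos, abs_mul, abs_mul, abs_of_nonneg ha, abs_two]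
  have hs := Real.sq_sqrt ha
  have hs0 := Real.sqrt_nonneg a
  set s := Real.sqrt a
  rw [← hs]
  have : 2 * s ^ 2 * |x i| ≤ 2 * s ^ 2 * ‖x‖ := by gcongr
  nlinarith [mul_nonneg hs0 (sq_nonneg (s * ‖x‖ - 1))]

/-- The logarithmic derivative of the weight is `k` times the difference of two terms as in
`wt_partial_aux`, bounded by `√a` and by `√b ≤ √a`. The constant for the relative growth does not
depend on `b`. The positive `b` only makes the weight bounded, and it tends to zero later. -/
theorem isWeight_wt (n k : ℕ) {a b : ℝ} (hb : 0 < b) (hba : b ≤ a) :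
    IsWeight (wt n k a b) ((a / b) ^ k) (2 * k * Real.sqrt a) := by
  have ha : 0 < a := hb.trans_le hba
  have hpos : ∀ {c : ℝ}, 0 < c → ∀ x : Rn n, 0 < 1 + c * ‖x‖ ^ 2 := fun hc x => by positivity
  have hsm : ∀ c : ℝ, ContDiff ℝ ∞ fun x : Rn n => 1 + c * ‖x‖ ^ 2 := fun c =>
    contDiff_const.add (contDiff_const.mul (contDiff_norm_sq ℝ))
  refine ⟨((hsm a).div (hsm b) fun x => (hpos hb x).ne').pow k, fun x => ?_, fun x => ?_,
    fun i x => ?_⟩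
  · have := hpos ha x
    have := hpos hb x
    rw [wt]
    positivity
  · have h1 := hpos ha x
    have h2 := hpos hb x
    refine pow_le_pow_left₀ (by positivity) ?_ k
    rw [div_le_div_iff₀ h2 hb]
    nlinarith
  · have h1 := hpos ha x
    have h2 := hpos hb x
    have hline : HasDerivAt (fun t : ℝ => x + t • (EuclideanSpace.single i (1 : ℝ) : Rn n))
        (EuclideanSpace.single i 1) 0 := by
      simpa using ((hasDerivAt_id (0 : ℝ)).smul_const (EuclideanSpace.single i (1 : ℝ) : Rn n)).const_add x
    have hd : ∀ c : ℝ, HasDerivAt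
        (fun t : ℝ => 1 + c * ‖x + t • (EuclideanSpace.single i (1 : ℝ) : Rn n)‖ ^ 2)
        (2 * c * x i) 0 := fun c => by
      have := (hline.norm_sq.const_mul c).const_add 1
      simp only [zero_smul, add_zero, EuclideanSpace.inner_single_right, conj_trivial, one_mul]
        at this
      exact this.congr_deriv (by ring)
    have hne : ∀ c : ℝ, 1 + c * ‖x + (0 : ℝ) • (EuclideanSpace.single i (1 : ℝ) : Rn n)‖ ^ 2
        = 1 + c * ‖x‖ ^ 2 := fun c => by simp
    have hdw := ((hd a).div (hd b) (by rw [hne]; exact h2.ne')).pow k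
    have hsmw : ContDiff ℝ ∞ (wt n k a b) := ((hsm a).div (hsm b) fun x => (hpos hb x).ne').pow k
    have e : partialD i (wt n k a b) x = k * wt n k a b x *
        (2 * a * x i / (1 + a * ‖x‖ ^ 2) - 2 * b * x i / (1 + b * ‖x‖ ^ 2)) := by
      have h3 := (hsmw.differentiable (by simp) x).lineDeriv_eq_fderiv
        (v := (EuclideanSpace.single i (1 : ℝ) : Rn n))
      rw [partialD, ← h3, lineDeriv]
      refine hdw.deriv.trans ?_
      simp only [Pi.div_apply, hne, wt]
      rcases Nat.eq_zero_or_pos k with rfl | hk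
      · simp
      · obtain ⟨m, rfl⟩ := Nat.exists_eq_succ_of_ne_zero hk.ne'
        simp only [Nat.succ_eq_add_one, Nat.add_sub_cancel]
        rw [pow_succ _ m]
        set q : ℝ := (1 + a * ‖x‖ ^ 2) / (1 + b * ‖x‖ ^ 2) with hq
        have hX : 1 + a * ‖x‖ ^ 2 = q * (1 + b * ‖x‖ ^ 2) := by rw [hq]; field_simp
        have hq0 : q ≠ 0 := by rw [hq]; positivity
        rw [hX]
        generalize 1 + b * ‖x‖ ^ 2 = Y at h2
        field_simp
    rw [e, abs_mul, abs_of_nonneg (by rw [wt]; positivity)]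
    have h3 : |2 * a * x i / (1 + a * ‖x‖ ^ 2) - 2 * b * x i / (1 + b * ‖x‖ ^ 2)|
        ≤ 2 * Real.sqrt a := by
      refine (abs_sub _ _).trans ?_
      have := wt_partial_aux hb.le x i
      have := Real.sqrt_le_sqrt hba
      linarith [wt_partial_aux ha.le x i]
    calc _ ≤ k * wt n k a b x * (2 * Real.sqrt a) := by
          have : 0 ≤ k * wt n k a b x := by rw [wt]; positivity
          gcongr
      _ = _ := by ring

end weight

/-! ### Polynomial decay of solutions with data of bounded support -/

section decay

variable {n : ℕ} {A : Coeff n}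

/-- The power `n + 1` gives decay of order `‖x‖^(-2(n + 1))`, which is integrable in dimension `n`.
Being at most one, the function then lies in all `L^{1/s}`. -/
theorem memLp_inv_weight (n : ℕ) {a : ℝ} (ha : 0 < a) {s : ℝ} (h0 : 0 < s) (h1 : s ≤ 1) :
    MemLp (fun x : Rn n => ((((1 + a * ‖x‖ ^ 2) ^ (n + 1))⁻¹ : ℝ) : ℂ)) (ex s) volume := by
  have hc : Continuous fun x : Rn n => ((1 + a * ‖x‖ ^ 2) ^ (n + 1))⁻¹ := by
    refine Continuous.inv₀ (by fun_prop) fun x => ?_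
    positivity
  set m := min a 1 with hm
  have hm0 : 0 < m := lt_min ha one_pos
  have hint : Integrable (fun x : Rn n => (1 + ‖x‖ ^ 2) ^ (-(2 * (n + 1) : ℝ) / 2)) volume :=
    integrable_rpow_neg_one_add_norm_sq (by
      rw [finrank_euclideanSpace_fin]
      have : (0 : ℝ) ≤ n := n.cast_nonneg
      linarith)
  have h2 : MemLp (fun x : Rn n => ((((1 + a * ‖x‖ ^ 2) ^ (n + 1))⁻¹ : ℝ) : ℂ)) 1 volume := by
    suffices h6 : Integrable (fun x : Rn n => ((1 + a * ‖x‖ ^ 2) ^ (n + 1))⁻¹) volume from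
      memLp_one_iff_integrable.2 h6.ofReal
    refine ((hint.const_mul ((m ^ (n + 1))⁻¹)).mono' hc.aestronglyMeasurable
      (Filter.Eventually.of_forall fun x => ?_))
    have h3 : m * (1 + ‖x‖ ^ 2) ≤ 1 + a * ‖x‖ ^ 2 := by
      have h4 : m * ‖x‖ ^ 2 ≤ a * ‖x‖ ^ 2 := by gcongr; exact min_le_left _ _
      linarith [min_le_right a 1]
    have h5 : (1 + ‖x‖ ^ 2) ^ (-(2 * (n + 1) : ℝ) / 2) = ((1 + ‖x‖ ^ 2) ^ (n + 1))⁻¹ := by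
      rw [show -(2 * (n + 1) : ℝ) / 2 = -((n + 1 : ℕ) : ℝ) by push_cast; ring,
        Real.rpow_neg (by positivity), Real.rpow_natCast]
    rw [Real.norm_of_nonneg (by positivity), h5, ← mul_inv, ← mul_pow]
    gcongr
  refine memLp_of_ae_bound one_ne_zero (one_le_ex h0 h1) (ex_ne_top s) h2 (K := 1)
    (Filter.Eventually.of_forall fun x => ?_)
  rw [Complex.norm_real, Real.norm_of_nonneg (by positivity)]
  refine inv_le_one_of_one_le₀ (one_le_pow₀ ?_)
  have : 0 ≤ a * ‖x‖ ^ 2 := by positivity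
  linarith

theorem holderTriple_ex {r r' : ℝ} (h0 : 0 < r) (h : r < r') :
    ENNReal.HolderTriple (ex (r' - r)) (ex r) (ex r') := by
  refine ⟨?_⟩
  rw [ex, ex, ex, ← ENNReal.ofReal_inv_of_pos (by have := sub_pos.2 h; positivity),
    ← ENNReal.ofReal_inv_of_pos (by positivity),
    ← ENNReal.ofReal_inv_of_pos (by have := h0.trans h; positivity), inv_inv, inv_inv, inv_inv,
    ← ENNReal.ofReal_add (sub_pos.2 h).le h0.le, sub_add_cancel]

/-- Hölder's inequality: the reciprocal weight lies in `L^{1/(r' - r)}`, which turns weighted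
integrability into plain integrability with the smaller exponent `1 / r'`. -/
theorem memLp_of_weighted {r r' : ℝ} (h0 : 0 < r) (h : r ≤ r') (h1 : r' ≤ 1) {a : ℝ} (ha : 0 < a)
    {u : Rn n → Cn1 n}
    (hu : MemLp (fun x => (((1 + a * ‖x‖ ^ 2) ^ (n + 1) : ℝ) : ℂ) • u x) (ex r) volume) :
    MemLp u (ex r') volume := by
  have e : u = (fun x : Rn n => ((((1 + a * ‖x‖ ^ 2) ^ (n + 1))⁻¹ : ℝ) : ℂ)) •
      fun x => (((1 + a * ‖x‖ ^ 2) ^ (n + 1) : ℝ) : ℂ) • u x := by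
    funext x
    have : (1 + a * ‖x‖ ^ 2) ^ (n + 1) ≠ 0 := by positivity
    rw [Pi.smul_apply', smul_smul, ← Complex.ofReal_mul, inv_mul_cancel₀ this, Complex.ofReal_one,
      one_smul]
  rcases h.eq_or_lt with rfl | h
  · have hc : Continuous fun x : Rn n => ((((1 + a * ‖x‖ ^ 2) ^ (n + 1))⁻¹ : ℝ) : ℂ) := by
      refine Complex.continuous_ofReal.comp (Continuous.inv₀ (by fun_prop) fun x => ?_)
      positivity
    have hm : AEStronglyMeasurable u volume := by
      rw [e]; exact hc.aestronglyMeasurable.smul hu.1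
    refine hu.mono hm (Filter.Eventually.of_forall fun x => ?_)
    rw [norm_smul, Complex.norm_real, Real.norm_of_nonneg (by positivity)]
    refine le_mul_of_one_le_left (norm_nonneg _) (one_le_pow₀ ?_)
    have : 0 ≤ a * ‖x‖ ^ 2 := by positivity
    linarith
  · have := holderTriple_ex h0 h
    rw [e]
    exact MemLp.smul hu (memLp_inv_weight n ha (sub_pos.2 h) (by linarith))

/-- Solutions of `u + z D B u = f` with `f` of bounded support are polynomially decaying. -/
theorem memLp_of_mem_diracBGraph (hA : IsBoundedCoeff (coeffB A)) {r r' : ℝ} (h0 : 0 < r)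
    (hrr : r ≤ r') (h1 : r' ≤ 1) {p : ℝ≥0∞} [Fact (1 ≤ p)] (hp : p = ex r) {z : ℂ} {C : ℝ}
    (hC : 0 ≤ C) (hap : ∀ u g : LpV n p, (u, g) ∈ diracBGraph A p → ‖u‖ ≤ C * ‖u + z • g‖)
    {u g : LpV n p} (hug : (u, g) ∈ diracBGraph A p) {ρ : ℝ}
    (hf : ∀ᵐ x, ρ < ‖x‖ → (u + z • g) x = 0) : MemLp u (ex r') volume := by
  subst hp
  obtain ⟨K, hK0, hK⟩ := hA.exists_norm_act_le
  -- With the growth constant `2 (n + 1) √a` of the weight, the smallness condition for absorption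
  -- reads `Q √a ≤ 1 / 2`. This dictates `√a = s`; the summand `1` covers `Q = 0`.
  set Q : ℝ := C * (‖z‖ * (2 * n * (2 * (n + 1 : ℕ)) * K)) with hQ
  have hQ0 : 0 ≤ Q := by positivity
  set s : ℝ := (2 * (Q + 1))⁻¹ with hs
  have hs0 : 0 < s := by positivity
  set a : ℝ := s ^ 2 with ha
  have ha0 : 0 < a := by positivity
  have hsa : Real.sqrt a = s := Real.sqrt_sq hs0.le
  have hsmall : C * (‖z‖ * (2 * n * (2 * (n + 1 : ℕ) * Real.sqrt a) * K)) ≤ 1 / 2 := by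
    rw [hsa, show C * (‖z‖ * (2 * n * (2 * (n + 1 : ℕ) * s) * K)) = Q * s by rw [hQ]; ring, hs,
      ← div_eq_mul_inv, div_le_div_iff₀ (by positivity) (by positivity)]
    linarith
  set f := u + z • g with hfdef
  -- A bound for all the weights on the support of `f`. The absolute value allows for negative `ρ`.
  set L : ℝ := (1 + a * |ρ| ^ 2) ^ (n + 1) with hL
  have hL0 : 0 ≤ L := by positivity
  -- The parameters `b = a / (N + 1)` give bounded weights that tend to `(1 + a ‖x‖²)^(n + 1)`, all
  -- with the same growth constant.
  have hb : ∀ N : ℕ, 0 < a / (N + 1) ∧ a / (N + 1) ≤ a := fun N =>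
    ⟨by positivity, div_le_self ha0.le (by linarith [N.cast_nonneg (α := ℝ)])⟩
  have hest : ∀ N : ℕ, ‖mulOp (isWeight_wt n (n + 1) (hb N).1 (hb N).2).scalar_bdd (ex r) u‖
      ≤ 2 * C * (L * ‖f‖) := fun N => by
    refine ((isWeight_wt n (n + 1) (hb N).1 (hb N).2).norm_le (by positivity) hA hK hC hap
      hsmall hug).trans ?_
    gcongr
    refine Lp.norm_le_mul_norm_of_ae_le_mul ?_
    filter_upwards [mulOp_ae (isWeight_wt n (n + 1) (hb N).1 (hb N).2).scalar_bdd f, hf]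
      with x e1 e2
    rw [e1, act_scalar, norm_smul]
    by_cases hx : ρ < ‖x‖
    · rw [e2 hx]; simp
    · gcongr
      have hx' : ‖x‖ ≤ |ρ| := (not_lt.1 hx).trans (le_abs_self ρ)
      rw [Complex.norm_real, wt, Real.norm_of_nonneg (by have := (hb N).1; positivity), hL]
      have := (hb N).1
      gcongr
      refine (div_le_self (by positivity) ?_).trans (by gcongr)
      have : 0 ≤ a / (N + 1) * ‖x‖ ^ 2 := by positivity
      linarith
  refine memLp_of_weighted h0 hrr h1 ha0 ⟨?_, ?_⟩
  · have hc : Continuous fun x : Rn n => (((1 + a * ‖x‖ ^ 2) ^ (n + 1) : ℝ) : ℂ) := by fun_prop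
    exact hc.aestronglyMeasurable.smul (Lp.memLp u).1
  -- By Fatou's lemma the estimate, uniform in `N`, survives the removal of the cutoff in the
  -- weight.
  · refine lt_of_le_of_lt (Lp.eLpNorm_le_of_ae_tendsto (u := Filter.atTop)
      (f := fun N : ℕ => mulOp (isWeight_wt n (n + 1) (hb N).1 (hb N).2).scalar_bdd (ex r) u)
      (C := ENNReal.ofReal (2 * C * (L * ‖f‖)))
      (Filter.Eventually.of_forall fun N => ?_) (fun N => (Lp.memLp _).1) ?_) ENNReal.ofReal_lt_top
    · rw [← Lp.enorm_def, ← ofReal_norm]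
      exact ENNReal.ofReal_le_ofReal (hest N)
    · filter_upwards [ae_all_iff.2 fun N =>
        mulOp_ae (isWeight_wt n (n + 1) (hb N).1 (hb N).2).scalar_bdd u] with x hx
      simp only [hx, act_scalar, wt]
      refine Filter.Tendsto.smul_const ?_ _
      refine (Complex.continuous_ofReal.tendsto _).comp (Filter.Tendsto.pow ?_ _)
      have h3 : Filter.Tendsto (fun N : ℕ => a / ((N : ℝ) + 1)) Filter.atTop (nhds 0) :=
        by simpa [div_eq_mul_inv] using (tendsto_one_div_add_atTop_nhds_zero_nat (𝕜 := ℝ)).const_mul a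
      have h4 := ((h3.mul_const (‖x‖ ^ 2)).const_add 1)
      rw [zero_mul, add_zero] at h4
      have h5 := (tendsto_const_nhds (x := 1 + a * ‖x‖ ^ 2)).div h4 one_ne_zero
      rwa [div_one] at h5

end decay

/-! ### Reduction to bounded functions with bounded support -/

section nice

variable {n : ℕ} {A : Coeff n}

/-- Bounded measurable functions with bounded support. -/
structure IsNice (f : Rn n → Cn1 n) : Prop where
  aesm : AEStronglyMeasurable f volume
  bdd : ∃ K : ℝ, ∀ᵐ x, ‖f x‖ ≤ K
  supp : ∃ ρ : ℝ, ∀ᵐ x, ρ < ‖x‖ → f x = 0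

theorem IsNice.memLp {f : Rn n → Cn1 n} (hf : IsNice f) (p : ℝ≥0∞) : MemLp f p volume := by
  obtain ⟨K, hK⟩ := hf.bdd
  obtain ⟨ρ, hρ⟩ := hf.supp
  have h1 : MemLp ((Metric.closedBall (0 : Rn n) ρ).indicator fun _ => K) p volume :=
    memLp_indicator_const p Metric.isClosed_closedBall.measurableSet K
      (Or.inr (isCompact_closedBall _ _).measure_lt_top.ne)
  refine h1.mono hf.aesm ?_
  filter_upwards [hK, hρ] with x h2 h3
  by_cases hx : ρ < ‖x‖
  · rw [h3 hx]; simp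
  · rw [Set.indicator_of_mem (by simpa using hx)]
    exact h2.trans (le_abs_self K)

theorem IsNice.act {f : Rn n → Cn1 n} (hf : IsNice f) {M : Coeff n} (hM : IsBoundedCoeff M) :
    IsNice fun x => act (M x) (f x) := by
  obtain ⟨K, hK⟩ := hf.bdd
  obtain ⟨ρ, hρ⟩ := hf.supp
  obtain ⟨L, hL0, hL⟩ := hM.exists_norm_act_le
  refine ⟨hM.aestronglyMeasurable_act hf.aesm, ⟨L * K, ?_⟩, ⟨ρ, ?_⟩⟩
  · filter_upwards [hK, hL] with x h1 h2
    exact (h2 _).trans (by gcongr)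
  · filter_upwards [hρ] with x hx h
    rw [hx h]
    simp

theorem IsNice.congr {f g : Rn n → Cn1 n} (hf : IsNice f) (h : f =ᵐ[volume] g) : IsNice g := by
  obtain ⟨K, hK⟩ := hf.bdd
  obtain ⟨ρ, hρ⟩ := hf.supp
  refine ⟨hf.aesm.congr h, ⟨K, ?_⟩, ⟨ρ, ?_⟩⟩
  · filter_upwards [hK, h] with x h1 h2
    rwa [← h2]
  · filter_upwards [hρ, h] with x h1 h2
    rwa [← h2]

/-- Truncation of a function in range and domain. -/
def trunc (f : Rn n → Cn1 n) (k : ℕ) : Rn n → Cn1 n :=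
  {x | ‖x‖ ≤ k ∧ ‖f x‖ ≤ k}.indicator f

theorem norm_trunc_le (f : Rn n → Cn1 n) (k : ℕ) (x : Rn n) : ‖trunc f k x‖ ≤ ‖f x‖ :=
  norm_indicator_le_norm_self _ _

theorem isNice_trunc {f : Rn n → Cn1 n} (hf : StronglyMeasurable f) (k : ℕ) :
    IsNice (trunc f k) := by
  refine ⟨(hf.indicator ?_).aestronglyMeasurable, ⟨k, Filter.Eventually.of_forall fun x => ?_⟩,
    ⟨k, Filter.Eventually.of_forall fun x hx => ?_⟩⟩
  · exact (measurableSet_le measurable_norm measurable_const).inter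
      (measurableSet_le hf.measurable.norm measurable_const)
  · rw [trunc]
    by_cases hx : x ∈ {x | ‖x‖ ≤ (k : ℝ) ∧ ‖f x‖ ≤ k}
    · rw [Set.indicator_of_mem hx]; exact hx.2
    · rw [Set.indicator_of_notMem hx]; simp
  · exact Set.indicator_of_notMem (fun h => absurd h.1 (not_le.2 hx)) _

theorem trunc_eventually_eq (f : Rn n → Cn1 n) (x : Rn n) :
    ∀ᶠ k : ℕ in Filter.atTop, trunc f k x = f x := by
  obtain ⟨N, hN⟩ := exists_nat_ge (max ‖x‖ ‖f x‖)
  filter_upwards [Filter.eventually_ge_atTop N] with k hk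
  have hk' : (N : ℝ) ≤ k := by exact_mod_cast hk
  have hx : x ∈ {x | ‖x‖ ≤ (k : ℝ) ∧ ‖f x‖ ≤ k} :=
    ⟨(le_max_left _ _).trans (hN.trans hk'), (le_max_right _ _).trans (hN.trans hk')⟩
  exact Set.indicator_of_mem hx _

theorem tendsto_trunc (f : LpV n 2) :
    Filter.Tendsto (fun k => ((isNice_trunc (Lp.stronglyMeasurable f) k).memLp 2).toLp _)
      Filter.atTop (nhds f) := by
  refine tendsto_toLp_of_eLpNorm f
    (fun k => (isNice_trunc (Lp.stronglyMeasurable f) k).memLp 2) ?_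
  have h1 : ∀ g : Rn n → Cn1 n, eLpNorm g 2 volume =
      (∫⁻ x, ‖g x‖ₑ ^ (1 / 2 : ℝ)⁻¹) ^ (1 / 2 : ℝ) := fun g =>
    (congrArg (eLpNorm g · volume) ex_half).symm.trans (eLpNorm_ex (by norm_num) g)
  have h2 : Filter.Tendsto (fun k => ∫⁻ x, ‖trunc f k x - f x‖ₑ ^ (1 / 2 : ℝ)⁻¹) Filter.atTop
      (nhds (∫⁻ _ : Rn n, 0)) := by
    refine tendsto_lintegral_of_dominated_convergence' (fun x => ‖f x‖ₑ ^ (1 / 2 : ℝ)⁻¹)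
      (fun k => ?_) (fun k => Filter.Eventually.of_forall fun x => ?_) ?_
      (Filter.Eventually.of_forall fun x => ?_)
    · exact ((((isNice_trunc (Lp.stronglyMeasurable f) k).aesm).sub (Lp.memLp f).1).enorm).pow_const _
    · refine ENNReal.rpow_le_rpow ?_ (by norm_num)
      rw [trunc]
      by_cases hx : x ∈ {x | ‖x‖ ≤ (k : ℝ) ∧ ‖f x‖ ≤ k}
      · rw [Set.indicator_of_mem hx]; simp
      · rw [Set.indicator_of_notMem hx]; simp
    · have := (Lp.memLp f).2
      rw [h1] at this
      exact ((ENNReal.rpow_lt_top_iff_of_pos (by norm_num)).1 this).ne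
    · refine tendsto_const_nhds.congr' ?_
      filter_upwards [trunc_eventually_eq f x] with k hk
      rw [hk]
      norm_num
  have h3 := (ENNReal.continuous_rpow_const (y := (1 / 2 : ℝ))).tendsto _ |>.comp h2
  rw [lintegral_zero, ENNReal.zero_rpow_of_pos (by norm_num)] at h3
  exact h3.congr fun k => (h1 _).symm

/-- Boundedness on `L^{1/r}` can be checked on bounded functions with bounded support. -/
theorem opBdd_of_nice {T : LpV n 2 → LpV n 2} (hT : Continuous T) {r M : ℝ} (hM : 0 ≤ M)
    (h : ∀ f : LpV n 2, IsNice f → MemLp (T f) (ex r) volume ∧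
      (eLpNorm (T f) (ex r) volume).toReal ≤ M * (eLpNorm f (ex r) volume).toReal) :
    OpBdd T r M := by
  intro f hf
  set s : ℕ → LpV n 2 := fun k => ((isNice_trunc (Lp.stronglyMeasurable f) k).memLp 2).toLp _
    with hs
  have hs1 : ∀ k, s k =ᵐ[volume] trunc f k := fun k => MemLp.coeFn_toLp _
  have hs2 : ∀ k, IsNice (s k) := fun k =>
    (isNice_trunc (Lp.stronglyMeasurable f) k).congr (hs1 k).symm
  have hlim : Filter.Tendsto (fun k => T (s k)) Filter.atTop (nhds (T f)) :=
    (hT.tendsto _).comp (tendsto_trunc f)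
  -- Convergence of the images is only known in `L²`. A subsequence converges almost everywhere, and
  -- Fatou's lemma transfers the bound in `L^{1/r}`.
  obtain ⟨φ, -, hφ⟩ := (tendstoInMeasure_of_tendsto_Lp hlim).exists_seq_tendsto_ae
  have hle : eLpNorm (T f) (ex r) volume ≤
      ENNReal.ofReal (M * (eLpNorm f (ex r) volume).toReal) := by
    refine Lp.eLpNorm_le_of_ae_tendsto (u := Filter.atTop) (f := fun k => T (s (φ k)))
      (Filter.Eventually.of_forall fun k => ?_) (fun k => (Lp.memLp _).1) hφ
    obtain ⟨h1, h2⟩ := h _ (hs2 (φ k))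
    refine (ENNReal.le_ofReal_iff_toReal_le h1.2.ne (by positivity)).2 (h2.trans ?_)
    gcongr
    · exact hf.2.ne
    · refine eLpNorm_mono_ae ?_
      filter_upwards [hs1 (φ k)] with x hx
      rw [hx]
      exact norm_trunc_le _ _ _
  refine ⟨⟨(Lp.memLp _).1, hle.trans_lt ENNReal.ofReal_lt_top⟩, ?_⟩
  exact ENNReal.toReal_le_of_le_ofReal (by positivity) hle

end nice

/-! ### Resolvents for different exponents agree -/

section consistency

variable {n : ℕ} {A : Coeff n}

theorem I_mul_ne_zero {τ : ℝ} (hτ : τ ≠ 0) : Complex.I * (τ : ℂ) ≠ 0 :=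
  mul_ne_zero Complex.I_ne_zero (by exact_mod_cast hτ)

theorem add_smul_resolvent {V : Type*} [AddCommGroup V] [Module ℂ V] {τ : ℝ} (hτ : τ ≠ 0)
    (u f : V) : u + (Complex.I * (τ : ℂ)) • (Complex.I * (τ : ℂ))⁻¹ • (f - u) = f := by
  rw [smul_inv_smul₀ (I_mul_ne_zero hτ), add_sub_cancel]

theorem eq_res_of_mem (hA : IsBoundedCoeff A) (hell : IsStronglyElliptic A) {τ : ℝ} (hτ : τ ≠ 0)
    {u g : LpV n 2} (h : (u, g) ∈ diracBGraph A 2) :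
    u = res hA hell hτ (u + (Complex.I * (τ : ℂ)) • g) := by
  rw [← mem_diracBGraph_iff_res, add_sub_cancel_left, inv_smul_smul₀ (I_mul_ne_zero hτ)]
  exact h

/-- The resolvents in `L²` map bounded functions with bounded support to `L^q` for `q ≤ 2`. -/
theorem memLp_res_of_nice (hA : IsBoundedCoeff A) (hell : IsStronglyElliptic A) {τ : ℝ}
    (hτ : τ ≠ 0) {r : ℝ} (hr : 1 / 2 ≤ r) (h1 : r ≤ 1) {f : LpV n 2} (hf : IsNice f) :
    MemLp (res hA hell hτ f) (ex r) volume := by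
  have hmem := (mem_diracBGraph_iff_res hA hell hτ (res hA hell hτ f) f).2 rfl
  obtain ⟨ρ, hρ⟩ := hf.supp
  refine memLp_of_mem_diracBGraph (isBoundedCoeff_coeffB hA hell) (by norm_num) hr h1 ex_half.symm
    (z := Complex.I * (τ : ℂ)) (norm_nonneg (res hA hell hτ)) (fun u g hug => ?_) hmem (ρ := ρ) ?_
  · conv_lhs => rw [eq_res_of_mem hA hell hτ hug]
    exact ContinuousLinearMap.le_opNorm _ _
  · rw [add_smul_resolvent hτ]
    exact hρ

/-- An `L^q`-resolvent maps bounded functions with bounded support to `L^{q'}` for `q' ≤ q`. -/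
theorem memLp_of_resolvent (hA : IsBoundedCoeff A) (hell : IsStronglyElliptic A) {τ : ℝ}
    (hτ : τ ≠ 0) {r r' : ℝ} (h0 : 0 < r) (hr : r ≤ r') (h1 : r' ≤ 1) [Fact (1 ≤ ex r)]
    {R : LpV n (ex r) →L[ℂ] LpV n (ex r)}
    (hR1 : ∀ f, (R f, (Complex.I * (τ : ℂ))⁻¹ • (f - R f)) ∈ diracBGraph A (ex r))
    (hR2 : ∀ u g, (u, g) ∈ diracBGraph A (ex r) → R (u + (Complex.I * (τ : ℂ)) • g) = u)
    {f : LpV n (ex r)} (hf : IsNice f) : MemLp (R f) (ex r') volume := by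
  obtain ⟨ρ, hρ⟩ := hf.supp
  refine memLp_of_mem_diracBGraph (isBoundedCoeff_coeffB hA hell) h0 hr h1 rfl
    (z := Complex.I * (τ : ℂ)) (norm_nonneg R) (fun u g hug => ?_) (hR1 f) (ρ := ρ) ?_
  · conv_lhs => rw [← hR2 u g hug]
    exact ContinuousLinearMap.le_opNorm _ _
  · rw [add_smul_resolvent hτ]
    exact hρ

/-- The resolvents in `L²` and `L^q` agree on bounded functions with bounded support. -/
theorem resolvent_ae_eq_res (hA : IsBoundedCoeff A) (hell : IsStronglyElliptic A) {τ : ℝ}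
    (hτ : τ ≠ 0) {r : ℝ} (h0 : 0 < r) (h1 : r ≤ 1) [Fact (1 ≤ ex r)]
    {R : LpV n (ex r) →L[ℂ] LpV n (ex r)}
    (hR1 : ∀ f, (R f, (Complex.I * (τ : ℂ))⁻¹ • (f - R f)) ∈ diracBGraph A (ex r))
    (hR2 : ∀ u g, (u, g) ∈ diracBGraph A (ex r) → R (u + (Complex.I * (τ : ℂ)) • g) = u)
    {f : LpV n 2} (hf : IsNice f) :
    R ((hf.memLp (ex r)).toLp f) =ᵐ[volume] res hA hell hτ f := by
  have hB := isBoundedCoeff_coeffB hA hell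
  set f' := (hf.memLp (ex r)).toLp f with hf'
  have hff : f =ᵐ[volume] f' := (MemLp.coeFn_toLp _).symm
  -- Decay only lowers the exponent. For `1/r ≥ 2` the `L^{1/r}`-solution falls into `L²`, and for
  -- `1/r ≤ 2` the `L²`-solution falls into `L^{1/r}`. Uniqueness is then applied in the space of
  -- smaller exponent.
  rcases le_total r (1 / 2) with hr | hr
  · have hu : MemLp (R f') 2 volume := by
      have := memLp_of_resolvent hA hell hτ h0 hr (by norm_num) hR1 hR2 (hf.congr hff)
      rwa [ex_half] at this
    have huu : hu.toLp _ =ᵐ[volume] R f' := MemLp.coeFn_toLp _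
    have hm : (hu.toLp _, (Complex.I * (τ : ℂ))⁻¹ • (f - hu.toLp _)) ∈ diracBGraph A 2 :=
      (mem_diracBGraph_congr hB huu (MemLp_toLp_smul_sub hff huu _)).2 (hR1 f')
    rw [mem_diracBGraph_iff_res hA hell hτ] at hm
    rw [← hm]
    exact huu.symm
  · have hu := memLp_res_of_nice hA hell hτ hr h1 hf
    have huu : res hA hell hτ f =ᵐ[volume] hu.toLp _ := (MemLp.coeFn_toLp _).symm
    have hm : (hu.toLp _, (Complex.I * (τ : ℂ))⁻¹ • (f' - hu.toLp _)) ∈ diracBGraph A (ex r) :=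
      (mem_diracBGraph_congr hB huu (MemLp_toLp_smul_sub hff huu _)).1
        ((mem_diracBGraph_iff_res hA hell hτ _ f).2 rfl)
    have := hR2 _ _ hm
    rw [add_smul_resolvent hτ] at this
    rw [this]
    exact huu.symm

/-- Bisectoriality implies uniform bounds for the Hodge projectors. -/
theorem hodge_opBdd_of_isBisectorial (hA : IsBoundedCoeff A) (hell : IsStronglyElliptic A) {r : ℝ}
    (h0 : 0 < r) (h1 : r ≤ 1) [Fact (1 ≤ ex r)] (h : IsBisectorial (diracB A (ex r))) :
    ∃ M : ℝ, 0 ≤ M ∧ ∀ τ : ℝ, τ ≠ 0 → OpBdd (hodge A τ) r M := by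
  obtain ⟨C, hC⟩ := isBisectorial_iff.1 h
  have hC0 : 0 ≤ C := by
    obtain ⟨R, -, hR⟩ := hC 1 one_ne_zero
    exact (norm_nonneg R).trans hR
  refine hodge_opBdd_of_res hA hell h0 h1 hC0 fun {τ} hτ => ?_
  obtain ⟨R, hR, hRC⟩ := hC τ hτ
  rw [isInverseOf_iff_graph (I_mul_ne_zero hτ)] at hR
  simp only [one_smul, mem_graph_diracB] at hR
  refine opBdd_of_nice (res hA hell hτ).continuous hC0 fun f hf => ?_
  have e := resolvent_ae_eq_res hA hell hτ h0 h1 hR.1 hR.2 hf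
  refine ⟨(Lp.memLp _).ae_eq e, ?_⟩
  rw [← eLpNorm_congr_ae e, ← eLpNorm_congr_ae (MemLp.coeFn_toLp (hf.memLp (ex r))), ← Lp.norm_def,
    ← Lp.norm_def]
  exact R.le_of_opNorm_le hRC _

/-- Uniform bounds for the Hodge projectors persist for slightly smaller integrability exponents. -/
theorem exists_hodge_opBdd_right (hA : IsBoundedCoeff A) (hell : IsStronglyElliptic A) {r M : ℝ}
    (h0 : 0 < r) (h1 : r < 1) (hM : 0 ≤ M) (h : ∀ τ : ℝ, τ ≠ 0 → OpBdd (hodge A τ) r M) :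
    ∃ δ > 0, ∀ r', r ≤ r' → r' < r + δ → r' ≤ 1 →
      ∃ M' : ℝ, 0 ≤ M' ∧ ∀ τ : ℝ, τ ≠ 0 → OpBdd (hodge A τ) r' M' := by
  obtain ⟨δ, hδ, hap⟩ := exists_apriori_hodge hA hell h0 h1 hM h
  obtain ⟨C, hC, hres⟩ := res_opBdd_of_hodge hA hell h0 h1.le hM h
  have : Fact (1 ≤ ex r) := ⟨one_le_ex h0 h1.le⟩
  refine ⟨δ, hδ, fun r' hr hr' hr1 => ?_⟩
  obtain ⟨C', hC', hap'⟩ := hap r' (by rw [abs_of_nonneg (sub_nonneg.2 hr)]; linarith)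
  refine ⟨C', hC', fun σ hσ => opBdd_of_nice (hodgeL hA hell hσ).continuous hC' fun f hf => ?_⟩
  -- The a priori estimate lacks only that `hodge A σ f` belongs to `L^{1/r'}`. For data of bounded
  -- support this follows from decay, as `1/r' ≤ 1/r`. No quantitative information is taken from the
  -- decay.
  suffices hm : MemLp (hodge A σ f) (ex r') volume from ⟨hm, hap' σ hσ f (hf.memLp _) hm⟩
  have hτ : -σ⁻¹ ≠ 0 := neg_ne_zero.2 (inv_ne_zero hσ)
  have e := hodge_eq_res hA hell hτ f
  rw [inv_neg, inv_inv, neg_neg] at e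
  rw [e]
  have hU := (isGoodCoeff_upperPart hA hell).inv_bdd
  have hI := (isGoodCoeff_e0_sub_mul_e1 hA hell).inv_bdd
  set g := mulOp hI 2 f with hg
  have hgn : IsNice g := (hf.act hI).congr (mulOp_ae hI f).symm
  obtain ⟨R, -, hR1, hR2⟩ := exists_right_resolvent hA hell hτ hC (hres hτ)
  have hRm := memLp_of_resolvent hA hell hτ h0 hr hr1 hR2
    (fun u v huv => left_resolvent hA hell hτ h0 h1 hR1 huv)
    (hgn.congr (MemLp.coeFn_toLp (hgn.memLp (ex r))).symm)
  have hRm' : MemLp (res hA hell hτ g) (ex r') volume := hRm.ae_eq (hR1 g _)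
  have hm1 : MemLp (mulOp hU 2 (res hA hell hτ g)) (ex r') volume :=
    (hU.memLp_act hRm').ae_eq (mulOp_ae hU _).symm
  have hm2 : MemLp (opE1 n 2 g) (ex r') volume :=
    ((IsBoundedCoeff.const (n := n) (e1 n)).memLp_act (hgn.memLp _)).ae_eq (mulOp_ae _ _).symm
  exact (hm1.sub hm2).ae_eq (Lp.coeFn_sub _ _).symm

end consistency

/-! ### The interval of admissible exponents -/

section range

variable {n : ℕ} {A : Coeff n}

/-- The reciprocals `r = 1 / p` of the exponents for which the Hodge projectors are
`L^p`-bounded. -/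
def hodgeSet (A : Coeff n) : Set ℝ :=
  {r | r ∈ Set.Ioo 0 1 ∧ ∃ M : ℝ, 0 ≤ M ∧ ∀ τ : ℝ, τ ≠ 0 → OpBdd (hodge A τ) r M}

theorem half_mem_hodgeSet (hA : IsBoundedCoeff A) (hell : IsStronglyElliptic A) :
    (1 / 2 : ℝ) ∈ hodgeSet A := by
  obtain ⟨C, hC, h⟩ := exists_norm_hodge_le hA hell
  refine ⟨by norm_num, C, hC, fun τ hτ f _ => ?_⟩
  rw [ex_half]
  refine ⟨Lp.memLp _, ?_⟩
  have := h τ hτ f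
  rwa [Lp.norm_def, Lp.norm_def] at this

theorem one_sub_mem_hodgeSet (hA : IsBoundedCoeff A) (hell : IsStronglyElliptic A) {r : ℝ}
    (hr : r ∈ hodgeSet A) : 1 - r ∈ hodgeSet fun x => (A x).conjTranspose := by
  obtain ⟨⟨h0, h1⟩, M, hM, h⟩ := hr
  refine ⟨⟨by linarith, by linarith⟩, M, hM, fun τ hτ => ?_⟩
  exact (hodge_formBdd_conjTranspose hA hell hτ ((h τ hτ).formBdd h0 h1)).opBdd (by linarith)
    (by linarith) hM

theorem exists_right_subset_hodgeSet (hA : IsBoundedCoeff A) (hell : IsStronglyElliptic A) {r : ℝ}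
    (hr : r ∈ hodgeSet A) : ∃ δ > 0, ∀ r', r ≤ r' → r' < r + δ → r' ∈ hodgeSet A := by
  obtain ⟨⟨h0, h1⟩, M, hM, h⟩ := hr
  obtain ⟨δ, hδ, h'⟩ := exists_hodge_opBdd_right hA hell h0 h1 hM h
  refine ⟨min δ (1 - r), lt_min hδ (by linarith), fun r' hr hr' => ?_⟩
  have h2 := min_le_left δ (1 - r)
  have h3 := min_le_right δ (1 - r)
  exact ⟨⟨by linarith, by linarith⟩, h' r' hr (by linarith) (by linarith)⟩

/-- A priori estimates combined with decay give a neighbourhood to the right of `r`, that is,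
slightly smaller exponents. The left side is the right side of `1 - r` for the adjoint coefficients.
-/
theorem isOpen_hodgeSet (hA : IsBoundedCoeff A) (hell : IsStronglyElliptic A) :
    IsOpen (hodgeSet A) := by
  rw [Metric.isOpen_iff]
  intro r hr
  obtain ⟨δ, hδ, h⟩ := exists_right_subset_hodgeSet hA hell hr
  have hA' := hA.conjTranspose
  have hell' := isStronglyElliptic_conjTranspose hell
  obtain ⟨δ', hδ', h'⟩ := exists_right_subset_hodgeSet hA' hell' (one_sub_mem_hodgeSet hA hell hr)
  refine ⟨min δ δ', lt_min hδ hδ', fun r' hr' => ?_⟩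
  rw [Metric.mem_ball, Real.dist_eq] at hr'
  have h1 := (abs_lt.1 hr').1
  have h2 := (abs_lt.1 hr').2
  have h3 := min_le_left δ δ'
  have h4 := min_le_right δ δ'
  rcases le_total r r' with h5 | h5
  · exact h r' h5 (by linarith)
  · have := one_sub_mem_hodgeSet hA' hell' (h' (1 - r') (by linarith) (by linarith))
    simpa using this

/-- Riesz–Thorin interpolation for each fixed `τ`, with a bound uniform in `τ`. -/
theorem ordConnected_hodgeSet (hA : IsBoundedCoeff A) (hell : IsStronglyElliptic A) :
    (hodgeSet A).OrdConnected := by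
  refine ⟨fun x hx y hy r hr => ?_⟩
  obtain ⟨⟨hx0, hx1⟩, M, hM, h⟩ := hx
  obtain ⟨⟨hy0, hy1⟩, M', hM', h'⟩ := hy
  have h0 : 0 < r := hx0.trans_le hr.1
  have h1 : r < 1 := hr.2.trans_lt hy1
  have hMM : 0 ≤ max M M' := hM.trans (le_max_left _ _)
  refine ⟨⟨h0, h1⟩, max M M', hMM, fun τ hτ => ?_⟩
  exact (FormBdd.interpolate (T := hodgeL hA hell hτ) hx0 hy1 hMM
    (((h τ hτ).mono (le_max_left _ _)).formBdd hx0 hx1)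
    (((h' τ hτ).mono (le_max_right _ _)).formBdd hy0 hy1) hr.1 hr.2).opBdd h0 h1 hMM

theorem lpBounded_iff {T : ℝ → LpV n 2 → LpV n 2} {I : Set ℝ} {r : ℝ} :
    LpBounded I T (ex r) ↔ ∃ M : ℝ, 0 ≤ M ∧ ∀ τ ∈ I, OpBdd (T τ) r M := by
  constructor
  · rintro ⟨C, hC⟩
    refine ⟨C, C.2, fun τ hτ f hf => ?_⟩
    have h := hC τ hτ f hf
    have hfin : (C : ℝ≥0∞) * eLpNorm f (ex r) volume < ⊤ := ENNReal.mul_lt_top ENNReal.coe_lt_top hf.2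
    refine ⟨⟨(Lp.memLp _).1, h.trans_lt hfin⟩, ?_⟩
    simpa using ENNReal.toReal_mono hfin.ne h
  · rintro ⟨M, hM, h⟩
    lift M to ℝ≥0 using hM
    refine ⟨M, fun τ hτ f hf => ?_⟩
    obtain ⟨h1, h2⟩ := h τ hτ f hf
    rw [← ENNReal.toReal_le_toReal h1.2.ne (ENNReal.mul_lt_top ENNReal.coe_lt_top hf.2).ne,
      ENNReal.toReal_mul]
    exact h2

theorem ex_inv_toReal {p : ℝ≥0∞} (hp : p < ⊤) : ex p.toReal⁻¹ = p := by
  rw [ex, inv_inv, ENNReal.ofReal_toReal hp.ne]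

/-- The exponents for which the Hodge projectors are `L^p`-bounded. -/
def hodgeRange (A : Coeff n) : Set ℝ≥0∞ :=
  {p | 1 < p ∧ p < ⊤ ∧ LpBounded {τ : ℝ | τ ≠ 0} (hodge A) p}

theorem mem_hodgeRange_iff {p : ℝ≥0∞} :
    p ∈ hodgeRange A ↔ p ∈ Set.Ioo 1 ⊤ ∧ p.toReal⁻¹ ∈ hodgeSet A := by
  rw [hodgeRange, Set.mem_ofPred_eq, ← and_assoc]
  refine and_congr_right fun hp => ?_
  have h1 : 1 < p.toReal := by
    have := (ENNReal.toReal_lt_toReal ENNReal.one_ne_top hp.2.ne).2 hp.1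
    simpa using this
  conv_lhs => rw [← ex_inv_toReal hp.2, lpBounded_iff]
  exact ⟨fun h => ⟨⟨by positivity, inv_lt_one_of_one_lt₀ h1⟩, h⟩, fun h => h.2⟩

theorem two_mem_hodgeRange (hA : IsBoundedCoeff A) (hell : IsStronglyElliptic A) :
    2 ∈ hodgeRange A := by
  rw [mem_hodgeRange_iff]
  exact ⟨⟨by norm_num, by norm_num⟩, by simpa using half_mem_hodgeSet hA hell⟩

theorem isOpen_hodgeRange (hA : IsBoundedCoeff A) (hell : IsStronglyElliptic A) :
    IsOpen (hodgeRange A) := by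
  have e : hodgeRange A = Set.Ioo 1 ⊤ ∩ (fun p : ℝ≥0∞ => p.toReal⁻¹) ⁻¹' hodgeSet A :=
    Set.ext fun p => mem_hodgeRange_iff
  rw [e]
  refine ContinuousOn.isOpen_inter_preimage ?_ isOpen_Ioo (isOpen_hodgeSet hA hell)
  refine (ENNReal.continuousOn_toReal.mono fun p hp => hp.2.ne).inv₀ fun p hp => ?_
  exact (ENNReal.toReal_pos (zero_lt_one.trans hp.1).ne' hp.2.ne).ne'

theorem ordConnected_hodgeRange (hA : IsBoundedCoeff A) (hell : IsStronglyElliptic A) :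
    (hodgeRange A).OrdConnected := by
  refine ⟨fun p hp q hq s hs => ?_⟩
  rw [mem_hodgeRange_iff] at *
  have h1 : 1 < s := hp.1.1.trans_le hs.1
  have h2 : s < ⊤ := hs.2.trans_lt hq.1.2
  refine ⟨⟨h1, h2⟩, (ordConnected_hodgeSet hA hell).out hq.2 hp.2 ⟨?_, ?_⟩⟩
  · exact inv_anti₀ (ENNReal.toReal_pos (zero_lt_one.trans h1).ne' h2.ne)
      (ENNReal.toReal_mono hq.1.2.ne hs.2)
  · exact inv_anti₀ (ENNReal.toReal_pos (zero_lt_one.trans hp.1.1).ne' hp.1.2.ne)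
      (ENNReal.toReal_mono h2.ne hs.1)

/-- An open order-connected subset of `(1, ⊤)` is an open interval: openness excludes the two
endpoints, and order-connectedness fills the interior. -/
theorem hodgeRange_eq_Ioo (hA : IsBoundedCoeff A) (hell : IsStronglyElliptic A) :
    hodgeRange A = Set.Ioo (sInf (hodgeRange A)) (sSup (hodgeRange A)) := by
  refine Set.Subset.antisymm (fun p hp => ?_) fun p hp => ?_
  · have hn := (isOpen_hodgeRange hA hell).mem_nhds hp
    obtain ⟨l, hl, hl'⟩ := exists_Ioc_subset_of_mem_nhds hn ⟨1, hp.1⟩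
    obtain ⟨u, hu, hu'⟩ := exists_Ico_subset_of_mem_nhds hn ⟨⊤, hp.2.1⟩
    obtain ⟨a, ha, ha'⟩ := exists_between hl
    obtain ⟨b, hb, hb'⟩ := exists_between hu
    exact ⟨(sInf_le (hl' ⟨ha, ha'.le⟩)).trans_lt ha', hb.trans_le (le_sSup (hu' ⟨hb.le, hb'⟩))⟩
  · obtain ⟨a, ha, ha'⟩ := sInf_lt_iff.1 hp.1
    obtain ⟨b, hb, hb'⟩ := lt_sSup_iff.1 hp.2
    exact (ordConnected_hodgeRange hA hell).out ha hb ⟨ha'.le, hb'.le⟩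

/-- The equivalence at a single exponent, without reference to an interval around `2`. One direction
needs consistency of the resolvents, the other the extension of the `L²`-resolvent. -/
theorem isBisectorial_iff_mem_hodgeRange (hA : IsBoundedCoeff A) (hell : IsStronglyElliptic A)
    {p : ℝ≥0∞} (h1 : 1 < p) (h2 : p < ⊤) :
    (∀ _ : Fact (1 ≤ p), IsBisectorial (diracB A p)) ↔ p ∈ hodgeRange A := by
  obtain ⟨r, rfl⟩ : ∃ r, ex r = p := ⟨_, ex_inv_toReal h2⟩
  have h0 : 0 < r := by
    by_contra h
    rw [ex, ENNReal.ofReal_of_nonpos (inv_nonpos.2 (not_lt.1 h))] at h1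
    exact not_lt_zero h1
  have hr1 : r < 1 := by
    by_contra h
    refine absurd h1 (not_lt.2 ?_)
    rw [ex, ← ENNReal.ofReal_one]
    exact ENNReal.ofReal_le_ofReal (inv_le_one_of_one_le₀ (not_lt.1 h))
  rw [hodgeRange, Set.mem_ofPred_eq, and_iff_right h1, and_iff_right h2, lpBounded_iff]
  constructor
  · intro h
    have : Fact (1 ≤ ex r) := ⟨h1.le⟩
    exact hodge_opBdd_of_isBisectorial hA hell h0 hr1.le (h this)
  · rintro ⟨M, hM, h⟩ _
    exact isBisectorial_of_hodge_opBdd hA hell h0 hr1 hM h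

/-- Every interval competing in the definition of `intervalDB` consists of exponents with bounded
Hodge projectors. Conversely, the set of these exponents is itself an open interval containing `2`,
hence one of the competitors and the largest of them. -/
theorem intervalDB_eq (hA : IsBoundedCoeff A) (hell : IsStronglyElliptic A) :
    intervalDB A = hodgeRange A := by
  refine Set.Subset.antisymm ?_ fun p hp => ?_
  · rintro p ⟨a, b, ha, -, hp, h⟩
    exact (isBisectorial_iff_mem_hodgeRange hA hell (ha.trans_lt hp.1) (hp.2.trans_le le_top)).1
      (h p hp)
  · have e := hodgeRange_eq_Ioo hA hell
    have h1 : 1 ≤ sInf (hodgeRange A) := le_sInf fun q hq => hq.1.le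
    refine ⟨sInf (hodgeRange A), sSup (hodgeRange A), h1, ?_, ?_, fun q hq => ?_⟩
    · rw [← e]; exact two_mem_hodgeRange hA hell
    · rwa [← e]
    · refine (isBisectorial_iff_mem_hodgeRange hA hell (h1.trans_lt hq.1)
        (hq.2.trans_le le_top)).2 ?_
      rwa [e]

end range

end DiracElliptic

end

theorem mainTheorem6 (n : ℕ) (hn : 1 ≤ n) (A : DiracElliptic.Coeff n)
    (hA : DiracElliptic.IsBoundedCoeff A) (hell : DiracElliptic.IsStronglyElliptic A) :
    (∀ p : ℝ≥0∞, 1 < p → p < ⊤ →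
      (p ∈ DiracElliptic.intervalDB A ↔
        DiracElliptic.LpBounded {τ : ℝ | τ ≠ 0} (DiracElliptic.hodge A) p)) ∧
    ∃ pMinus : ℝ≥0∞, 1 ≤ pMinus ∧ pMinus < 2 ∧ 2 < DiracElliptic.pPlus A ∧
      {p : ℝ≥0∞ | 1 < p ∧ p < ⊤ ∧
        DiracElliptic.LpBounded {τ : ℝ | τ ≠ 0} (DiracElliptic.hodge A) p} =
        Set.Ioo pMinus (DiracElliptic.pPlus A) := by
  have e := DiracElliptic.hodgeRange_eq_Ioo hA hell
  have h2 := DiracElliptic.two_mem_hodgeRange hA hell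
  rw [DiracElliptic.pPlus, DiracElliptic.intervalDB_eq hA hell]
  refine ⟨fun p h1 hp => ⟨fun h => h.2.2, fun h => ⟨h1, hp, h⟩⟩,
    sInf (DiracElliptic.hodgeRange A), le_sInf fun q hq => hq.1.le, ?_, ?_, e⟩
  · rw [e] at h2; exact h2.1
  · rw [e] at h2; exact h2.2
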